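/- **Setting.** Let $P,V,Q$ be $n\times n$ complex matrix functions on $[0,\infty)$, self-adjoint a.e., with $P\in AC_{\rm loc}([0,\infty))$ and $V,Q\in L^1_{\rm loc}([0,\infty))$, such that for some $\theta_P,\theta_Q>0$, $C_V\ge 0$ and a.e. $x$, all $v\in\mathbb C^n$ satisfy $(P(x)v,v)\ge\theta_P|v|^2$, $(Q(x)v,v)\ge\theta_Q|v|^2$, $|(V(x)v,v)|\le C_V|v|^2$ **(A1)**. Assume there are self-adjoint matrices $P_+,V_+,Q_+$, with $P_+,Q_+$ positive definite, and $C,\eta>0$ such that $|P(x)-P_+|$, $|V(x)-V_+|$, $|Q(x)-Q_+|$ and $|P'(x)|$ are at most $Ce^{-\eta x}$ for a.e. $x>0$ **(A2)**. Let $\alpha_1,\alpha_2\in\mathbb C^{n\times n}$, $\alpha=(\alpha_1\ \alpha_2)$, $J=\begin{pmatrix}0&-I_n\\ I_n&0\end{pmatrix}$, with $\operatorname{rank}\alpha=n$ and $\alpha J\alpha^*=0$ **(A3)**. Let $\mathcal L\phi=Q^{-1}\{-(P\phi')'+V\phi\}$ in $L^2((0,\infty),\mathbb C^n)$, with domain all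 $\phi\in L^2$ with $\phi,\phi'\in AC_{\rm loc}([0,\infty))$, $\mathcal L\phi\in L^2$ and $\alpha_1\phi(0)+\alpha_2P(0)\phi'(0)=0$. Let $\operatorname{Mor}(\mathcal L;\lambda_0)$ be the number of eigenvalues of $\mathcal L$ in $(-\infty,\lambda_0)$, counted with multiplicity. Put $\kappa=\inf_{r\ne0}(V_+r,r)/(Q_+r,r)$. Write $\mathcal L\phi=\lambda\phi$ as $Jy'=\mathbb B(x;\lambda)y$ for $y=(\phi,P\phi')$, where $\mathbb B=\operatorname{diag}(\lambda Q-V,\,P^{-1})$. Let $\ell_1(x;\lambda)\subset\mathbb C^{2n}$ be the space of values $y(x)$ of the solutions $y$ with $y(0)$ in the column space of $J\alpha^*$ (that is, the solutions satisfying the boundary condition at $0$), let $\ell_2(x;\lambda)$ be the space of values $y(x)$ of the solutions $y\in L^2((0,\infty),\mathbb C^{2n})$, and let $\ell_2^+(\lambda)=\lim_{x\to\infty}\ell_2(x;\lambda)$. Limits and continuity of subspaces are taken in the Lagrangian Grassmannian $\Lambda(n)$, the set of $n$-dimensional $\ell\subset\mathbb C^{2n}$ with $(Ju,v)=0$ for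 all $u,v\in\ell$, with the distance given by the norm of the difference of the orthogonal projections. Call $\lambda_\infty$ *boundary inconjugate* if $\ell_1(0;-\lambda_\infty)\cap\ell_2^+(-\lambda_\infty)=\{0\}$. For continuous paths $\ell_1(\cdot),\ell_2(\cdot)$ in $\Lambda(n)$ on $[a,b]$, let $X_i,Y_i$ be $n\times n$ matrices such that the columns of $\binom{X_i(t)}{Y_i(t)}$ are a basis of $\ell_i(t)$, and let $\tilde W=-(X_1+iY_1)(X_1-iY_1)^{-1}(X_2-iY_2)(X_2+iY_2)^{-1}$, a unitary matrix that does not depend on the bases. Then $\operatorname{Mas}(\ell_1,\ell_2;[a,b])$ is the spectral flow of $\tilde W$ through $-1$, counterclockwise counted positively: choose $a=t_0<\dots<t_N=b$ and $\varepsilon_j\in(0,\pi)$ such that $e^{i(\pi\pm\varepsilon_j)}\notin\sigma(\tilde W(t))$ for $t\in[t_{j},t_{j+1}]$, let $k(t,\varepsilon)=\sum_{0\le\theta<\varepsilon}\dim\ker(\tilde W(t)-e^{i(\pi+\theta)}I)$, and take $\sum_{j=0}^{N-1}\big(k(t_{j+1},\varepsilon_j)-k(t_{j},\varepsilon_j)\big)$.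 On $[0,\infty)$ the index is that of the paths extended to $[0,\infty]$ by their limits at $\infty$. **Theorem 1.3 (target at $+\infty$).** Assume (A1), (A2), (A3) and let $\lambda_0<\kappa$. Then $x\mapsto\ell_1(x;\lambda_0)$ extends by its limit at $\infty$ to a continuous path $[0,\infty]\to\Lambda(n)$, the space $\ell_2^+(\lambda)$ exists for every $\lambda<\kappa$, and $\ell_2^+:(-\infty,\kappa)\to\Lambda(n)$ is continuous. Moreover there is $\Lambda_\infty\in\mathbb R$ such that for every boundary inconjugate $\lambda_\infty>\Lambda_\infty$, the number $\operatorname{Mor}(\mathcal L;\lambda_0)$ is finite and $$\operatorname{Mor}(\mathcal L;\lambda_0)=-\operatorname{Mas}\big(\ell_1(\cdot;\lambda_0),\ell_2^+(\lambda_0);[0,\infty)\big)-\operatorname{Mas}\big(\ell_1(0;\cdot),\ell_2^+(\cdot);[-\lambda_\infty,\lambda_0]\big).$$ -/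

import Mathlib

open MeasureTheory Filter Topology
open scoped ComplexOrder

/-! ### Lagrangian subspaces of `ℂ^{2n}` -/

section Lagrangian

variable {n : ℕ}

/-- `ℓ ⊆ ℂ^{2n}` is Lagrangian: `dim ℓ = n` and `(J u, v) = 0` for all `u, v ∈ ℓ`, where
`J = [[0, -I], [I, 0]]`. Vectors of `ℂ^{2n}` are indexed by `Fin n ⊕ Fin n`. -/
def IsLagrangian (L : Submodule ℂ (Fin n ⊕ Fin n → ℂ)) : Prop :=
  Module.finrank ℂ L = n ∧
    ∀ u ∈ L, ∀ v ∈ L, star v ⬝ᵥ Matrix.mulVec (Matrix.J (Fin n) ℂ) u = 0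

/-- The columns of the `2n × n` matrix `X` form a basis of `L`. -/
def IsFrame (X : Matrix (Fin n ⊕ Fin n) (Fin n) ℂ)
    (L : Submodule ℂ (Fin n ⊕ Fin n → ℂ)) : Prop :=
  LinearIndependent ℂ X.col ∧ Submodule.span ℂ (Set.range X.col) = L

open Classical in
/-- A frame for an `n`-dimensional subspace. The constructions below do not depend on
which frame is chosen. -/
noncomputable def frameOf (L : Submodule ℂ (Fin n ⊕ Fin n → ℂ)) :
    Matrix (Fin n ⊕ Fin n) (Fin n) ℂ :=
  if h : ∃ X, IsFrame X L then h.choose else 0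

/-- The orthogonal projection matrix `X (X* X)⁻¹ X*` onto `L`. The metric of the Lagrangian
Grassmannian is the distance of these matrices in any matrix norm, so that convergence and
continuity in it are convergence and continuity of `projMatrix`. -/
noncomputable def projMatrix (L : Submodule ℂ (Fin n ⊕ Fin n → ℂ)) :
    Matrix (Fin n ⊕ Fin n) (Fin n ⊕ Fin n) ℂ :=
  frameOf L * ((frameOf L).conjTranspose * frameOf L)⁻¹ * (frameOf L).conjTranspose

/-- `L` is a continuous path of Lagrangian subspaces on `s`. -/
def IsLagrangianPath {ι : Type*} [TopologicalSpace ι]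
    (L : ι → Submodule ℂ (Fin n ⊕ Fin n → ℂ)) (s : Set ι) : Prop :=
  (∀ t ∈ s, IsLagrangian (L t)) ∧ ContinuousOn (fun t => projMatrix (L t)) s

/-- `M` is the limit of `L x` as `x → ∞` in the Lagrangian Grassmannian. -/
def IsLagrangianLimit (L : ℝ → Submodule ℂ (Fin n ⊕ Fin n → ℂ))
    (M : Submodule ℂ (Fin n ⊕ Fin n → ℂ)) : Prop :=
  IsLagrangian M ∧ Tendsto (fun x => projMatrix (L x)) atTop (𝓝 (projMatrix M))

open Classical in
/-- `lim_{x → ∞} L x` in the Lagrangian Grassmannian (`⊥`, which is not Lagrangian for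
`n ≥ 1`, if there is no limit). -/
noncomputable def lagrangianLimit (L : ℝ → Submodule ℂ (Fin n ⊕ Fin n → ℂ)) :
    Submodule ℂ (Fin n ⊕ Fin n → ℂ) :=
  if h : ∃ M, IsLagrangianLimit L M then h.choose else ⊥

open Classical in
/-- The path `L` on `[0, ∞)` extended to `[0, ∞]` by its limit at `∞`. -/
noncomputable def compactifiedPath (L : ℝ → Submodule ℂ (Fin n ⊕ Fin n → ℂ)) :
    ENNReal → Submodule ℂ (Fin n ⊕ Fin n → ℂ) :=
  fun x => if x = ⊤ then lagrangianLimit L else L x.toReal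

/-! ### The Maslov index -/

/-- The unitary matrix
`-(X₁ + iY₁)(X₁ - iY₁)⁻¹(X₂ - iY₂)(X₂ + iY₂)⁻¹` of two Lagrangian subspaces with frames
`(X₁; Y₁)` and `(X₂; Y₂)`. -/
noncomputable def souriauMatrix (L₁ L₂ : Submodule ℂ (Fin n ⊕ Fin n → ℂ)) :
    Matrix (Fin n) (Fin n) ℂ :=
  let X₁ := (frameOf L₁).toRows₁
  let Y₁ := (frameOf L₁).toRows₂
  let X₂ := (frameOf L₂).toRows₁
  let Y₂ := (frameOf L₂).toRows₂;
  -((X₁ + Complex.I • Y₁) * (X₁ - Complex.I • Y₁)⁻¹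
    * (X₂ - Complex.I • Y₂) * (X₂ + Complex.I • Y₂)⁻¹)

/-- The point `e^{i(π + θ)}` of the unit circle. -/
noncomputable def circlePoint (θ : ℝ) : ℂ :=
  Complex.exp (((Real.pi + θ : ℝ) : ℂ) * Complex.I)

/-- The number of eigenvalues of `W`, with multiplicity, of the form `e^{i(π + θ)}` with
`0 ≤ θ < ε`. -/
noncomputable def arcCount (W : Matrix (Fin n) (Fin n) ℂ) (ε : ℝ) : ℕ :=
  ∑ᶠ (θ : ℝ) (_ : θ ∈ Set.Ico 0 ε),
    Module.finrank ℂ (Module.End.eigenspace (Matrix.toLin' W) (circlePoint θ))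

/-- `m` is the spectral flow through `-1` (counterclockwise positive) of the path `W` on
`[a, b]`, computed from some subdivision `a = t₀ < ... < t_N = b` and some `ε_j ∈ (0, π)` such
that `e^{i(π ± ε_j)}` is not an eigenvalue of `W s` for `s ∈ [t_j, t_{j+1}]`. -/
def IsSpectralFlow {ι : Type*} [Preorder ι] (W : ι → Matrix (Fin n) (Fin n) ℂ)
    (a b : ι) (m : ℤ) : Prop :=
  ∃ (N : ℕ) (t : ℕ → ι) (ε : ℕ → ℝ),
    t 0 = a ∧ t N = b ∧
    (∀ j < N, t j < t (j + 1) ∧ 0 < ε j ∧ ε j < Real.pi ∧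
      ∀ s ∈ Set.Icc (t j) (t (j + 1)),
        circlePoint (ε j) ∉ spectrum ℂ (W s) ∧ circlePoint (-ε j) ∉ spectrum ℂ (W s)) ∧
    m = ∑ j ∈ Finset.range N,
      ((arcCount (W (t (j + 1))) (ε j) : ℤ) - (arcCount (W (t j)) (ε j) : ℤ))

open Classical in
/-- The Maslov index `Mas(L₁, L₂; [a, b])` of two continuous paths of Lagrangian subspaces. -/
noncomputable def maslovIndex {ι : Type*} [Preorder ι]
    (L₁ L₂ : ι → Submodule ℂ (Fin n ⊕ Fin n → ℂ)) (a b : ι) : ℤ :=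
  if h : ∃ m, IsSpectralFlow (fun t => souriauMatrix (L₁ t) (L₂ t)) a b m then h.choose else 0

/-- The Maslov index `Mas(L₁, L₂; [0, ∞))`, where `[0, ∞)` is compactified to `[0, ∞]`. -/
noncomputable def maslovIndexHalfLine
    (L₁ L₂ : ℝ → Submodule ℂ (Fin n ⊕ Fin n → ℂ)) : ℤ :=
  maslovIndex (compactifiedPath L₁) (compactifiedPath L₂) 0 ⊤

end Lagrangian

/-! ### Sturm-Liouville systems on the half-line -/

/-- Local absolute continuity on `[0, ∞)`. -/
def ACLoc {E : Type*} [PseudoMetricSpace E] (f : ℝ → E) : Prop :=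
  ∀ b : ℝ, 0 < b → AbsolutelyContinuousOnInterval f 0 b

/-- Lebesgue measure on `(0, ∞)`. -/
noncomputable abbrev halfLine : Measure ℝ := volume.restrict (Set.Ioi 0)

/-- `L²((0, ∞), ℂⁿ)`. -/
abbrev HalfLineL2 (n : ℕ) : Type :=
  Lp (EuclideanSpace ℂ (Fin n)) 2 halfLine

/-- The data of `-(P φ')' + V φ = λ Q φ` on `(0, ∞)`, `α₁ φ(0) + α₂ P(0) φ'(0) = 0`. -/
structure SturmLiouville (n : ℕ) where
  /-- leading coefficient -/
  P : ℝ → Matrix (Fin n) (Fin n) ℂ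
  /-- potential -/
  V : ℝ → Matrix (Fin n) (Fin n) ℂ
  /-- weight -/
  Q : ℝ → Matrix (Fin n) (Fin n) ℂ
  /-- first boundary matrix -/
  α₁ : Matrix (Fin n) (Fin n) ℂ
  /-- second boundary matrix -/
  α₂ : Matrix (Fin n) (Fin n) ℂ

/-- `κ = inf_{r ≠ 0} (V₊ r, r) / (Q₊ r, r)`. -/
noncomputable def kappa {n : ℕ} (Vp Qp : Matrix (Fin n) (Fin n) ℂ) : ℝ :=
  ⨅ r : {r : Fin n → ℂ // r ≠ 0},
    (star r.1 ⬝ᵥ Vp.mulVec r.1).re / (star r.1 ⬝ᵥ Qp.mulVec r.1).re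

namespace SturmLiouville

variable {n : ℕ} (S : SturmLiouville n)

/-- Self-adjointness, regularity and uniform bounds of the coefficients. -/
structure RegularCoefficients : Prop where
  hermitian : ∀ᵐ x ∂halfLine, (S.P x).IsHermitian ∧ (S.V x).IsHermitian ∧ (S.Q x).IsHermitian
  P_ac : ∀ i j, ACLoc (fun x => S.P x i j)
  V_int : ∀ i j, LocallyIntegrableOn (fun x => S.V x i j) (Set.Ici 0)
  Q_int : ∀ i j, LocallyIntegrableOn (fun x => S.Q x i j) (Set.Ici 0)
  P_lower : ∃ θ > 0, ∀ᵐ x ∂halfLine, ∀ v : Fin n → ℂ,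
    θ * (star v ⬝ᵥ v).re ≤ (star v ⬝ᵥ (S.P x).mulVec v).re
  Q_lower : ∃ θ > 0, ∀ᵐ x ∂halfLine, ∀ v : Fin n → ℂ,
    θ * (star v ⬝ᵥ v).re ≤ (star v ⬝ᵥ (S.Q x).mulVec v).re
  V_bound : ∃ C ≥ 0, ∀ᵐ x ∂halfLine, ∀ v : Fin n → ℂ,
    ‖star v ⬝ᵥ (S.V x).mulVec v‖ ≤ C * (star v ⬝ᵥ v).re

/-- `P`, `V`, `Q` approach the endstates `P₊`, `V₊`, `Q₊` at an exponential rate. -/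
structure HasEndstates (Pp Vp Qp : Matrix (Fin n) (Fin n) ℂ) : Prop where
  P_posDef : Pp.PosDef
  V_hermitian : Vp.IsHermitian
  Q_posDef : Qp.PosDef
  decay : ∃ C η : ℝ, 0 < C ∧ 0 < η ∧ ∀ᵐ x ∂halfLine, ∀ i j,
    ‖S.P x i j - Pp i j‖ ≤ C * Real.exp (-η * x) ∧
    ‖S.V x i j - Vp i j‖ ≤ C * Real.exp (-η * x) ∧
    ‖S.Q x i j - Qp i j‖ ≤ C * Real.exp (-η * x) ∧
    ‖deriv (fun s => S.P s i j) x‖ ≤ C * Real.exp (-η * x)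

/-- The `n × 2n` matrix `α = (α₁ α₂)`. -/
def α : Matrix (Fin n) (Fin n ⊕ Fin n) ℂ := Matrix.fromCols S.α₁ S.α₂

/-- `rank α = n` and `α J α* = 0`. -/
structure SelfAdjointBoundary : Prop where
  rank_eq : S.α.rank = n
  isotropic : S.α * Matrix.J (Fin n) ℂ * S.α.conjTranspose = 0

/-! #### The operator and its Morse index -/

/-- The graph of the operator `φ ↦ Q⁻¹(-(P φ')' + V φ)` in `L² × L²`, with domain
`φ ∈ L²`, `φ, φ' ∈ AC_loc`, image in `L²`, and `α₁ φ(0) + α₂ P(0) φ'(0) = 0`. Here `f` is the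
continuous representative of `φ`, `f'` its derivative on `[0, ∞)` (one-sided at `0`), and `w`
the almost everywhere derivative of `P f'`. -/
def operatorGraph : Submodule ℂ (HalfLineL2 n × HalfLineL2 n) where
  carrier := {p | ∃ f f' w : ℝ → Fin n → ℂ,
    (∀ᵐ x ∂halfLine, (p.1 x).ofLp = f x) ∧
    ACLoc f ∧ ACLoc f' ∧
    (∀ x ∈ Set.Ici (0 : ℝ), HasDerivWithinAt f (f' x) (Set.Ici 0) x) ∧
    (∀ᵐ x ∂halfLine, HasDerivAt (fun s => (S.P s).mulVec (f' s)) (w x) x) ∧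
    (∀ᵐ x ∂halfLine, (p.2 x).ofLp = (S.Q x)⁻¹.mulVec (-w x + (S.V x).mulVec (f x))) ∧
    S.α₁.mulVec (f 0) + S.α₂.mulVec ((S.P 0).mulVec (f' 0)) = 0}
  zero_mem' := by
    refine ⟨0, 0, 0, ?_, ?_, ?_, ?_, ?_, ?_, ?_⟩
    · filter_upwards [Lp.coeFn_zero (EuclideanSpace ℂ (Fin n)) 2 halfLine] with x hx
      rw [Prod.fst_zero, hx]
      simp
    · intro b _
      simp [AbsolutelyContinuousOnInterval, tendsto_const_nhds]
    · intro b _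
      simp [AbsolutelyContinuousOnInterval, tendsto_const_nhds]
    · intro x _
      exact hasDerivWithinAt_const x _ (0 : Fin n → ℂ)
    · refine Eventually.of_forall fun x => ?_
      simpa using hasDerivAt_const x (0 : Fin n → ℂ)
    · filter_upwards [Lp.coeFn_zero (EuclideanSpace ℂ (Fin n)) 2 halfLine] with x hx
      rw [Prod.snd_zero, hx]
      simp
    · simp
  add_mem' := by
    rintro p q ⟨f, f', w, h1, h2, h3, h4, h5, h6, h7⟩ ⟨g, g', z, k1, k2, k3, k4, k5, k6, k7⟩
    refine ⟨f + g, f' + g', w + z, ?_, fun b hb => (h2 b hb).add (k2 b hb),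
      fun b hb => (h3 b hb).add (k3 b hb), fun x hx => (h4 x hx).add (k4 x hx), ?_, ?_, ?_⟩
    · filter_upwards [h1, k1, Lp.coeFn_add p.1 q.1] with x hx kx hpq
      rw [Prod.fst_add, hpq]
      simp [hx, kx]
    · filter_upwards [h5, k5] with x hx kx
      simpa [Matrix.mulVec_add] using! hx.add kx
    · filter_upwards [h6, k6, Lp.coeFn_add p.2 q.2] with x hx kx hpq
      rw [Prod.snd_add, hpq]
      simp only [Pi.add_apply, WithLp.ofLp_add, hx, kx, Matrix.mulVec_add, Matrix.mulVec_neg,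
        neg_add]
      abel
    · have := congrArg₂ (· + ·) h7 k7
      simp only [add_zero] at this
      rw [← this]
      simp only [Pi.add_apply, Matrix.mulVec_add]
      abel
  smul_mem' := by
    rintro c p ⟨f, f', w, h1, h2, h3, h4, h5, h6, h7⟩
    refine ⟨c • f, c • f', c • w, ?_, fun b hb => (h2 b hb).const_smul c,
      fun b hb => (h3 b hb).const_smul c, fun x hx => (h4 x hx).const_smul c, ?_, ?_, ?_⟩
    · filter_upwards [h1, Lp.coeFn_smul c p.1] with x hx hp
      rw [Prod.smul_fst, hp]
      simp [hx]
    · filter_upwards [h5] with x hx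
      simpa [Matrix.mulVec_smul] using! hx.const_smul c
    · filter_upwards [h6, Lp.coeFn_smul c p.2] with x hx hp
      rw [Prod.smul_snd, hp]
      simp only [Pi.smul_apply, WithLp.ofLp_smul, hx, Matrix.mulVec_smul]
      rw [← smul_neg, ← smul_add, Matrix.mulVec_smul]
    · simp only [Pi.smul_apply, Matrix.mulVec_smul]
      rw [← smul_add, h7, smul_zero]

/-- The space of `φ` in the domain of the operator `𝓛` with `𝓛 φ = lam φ`. -/
noncomputable def eigenspace (lam : ℝ) : Submodule ℂ (HalfLineL2 n) :=
  S.operatorGraph.comap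
    (LinearMap.prod LinearMap.id ((lam : ℂ) • (LinearMap.id : HalfLineL2 n →ₗ[ℂ] HalfLineL2 n)))

/-- `Mor(𝓛; lam0)`: the number of eigenvalues, with multiplicity, on `(-∞, lam0)`. -/
noncomputable def morseIndex (lam0 : ℝ) : ℕ∞ :=
  ⨆ F : Finset (Set.Iio lam0), ∑ lam ∈ F, Cardinal.toENat (Module.rank ℂ (S.eigenspace lam.1))

/-! #### The first order system and its Lagrangian subspaces -/

/-- The matrix `𝔹(x; lam) = diag(lam Q(x) - V(x), P(x)⁻¹)`. -/
noncomputable def hamiltonian (x lam : ℝ) : Matrix (Fin n ⊕ Fin n) (Fin n ⊕ Fin n) ℂ :=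
  Matrix.fromBlocks ((lam : ℂ) • S.Q x - S.V x) 0 0 (S.P x)⁻¹

/-- Solutions `y ∈ AC_loc([0, ∞), ℂ^{2n})` of `J y' = 𝔹(x; lam) y` almost everywhere on
`(0, ∞)`. Values at negative arguments play no role. -/
def solutions (lam : ℝ) : Submodule ℂ (ℝ → Fin n ⊕ Fin n → ℂ) where
  carrier := {y | ACLoc y ∧ ∀ᵐ x ∂halfLine, ∃ y' : Fin n ⊕ Fin n → ℂ,
    HasDerivAt y y' x ∧
      (Matrix.J (Fin n) ℂ).mulVec y' = (S.hamiltonian x lam).mulVec (y x)}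
  zero_mem' := by
    refine ⟨?_, Eventually.of_forall fun x => ⟨0, hasDerivAt_const x _, by simp⟩⟩
    intro b _
    simp [AbsolutelyContinuousOnInterval, tendsto_const_nhds]
  add_mem' := by
    rintro y z ⟨h1, h2⟩ ⟨k1, k2⟩
    refine ⟨fun b hb => (h1 b hb).add (k1 b hb), ?_⟩
    filter_upwards [h2, k2] with x ⟨y', hy, hy'⟩ ⟨z', hz, hz'⟩
    exact ⟨y' + z', hy.add hz, by simp [Matrix.mulVec_add, hy', hz']⟩
  smul_mem' := by
    rintro c y ⟨h1, h2⟩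
    refine ⟨fun b hb => (h1 b hb).const_smul c, ?_⟩
    filter_upwards [h2] with x ⟨y', hy, hy'⟩
    exact ⟨c • y', hy.const_smul c, by simp [Matrix.mulVec_smul, hy']⟩

/-- The solutions whose value at `0` is in the column space of `J α*`. -/
def boundarySolutions (lam : ℝ) : Submodule ℂ (ℝ → Fin n ⊕ Fin n → ℂ) :=
  S.solutions lam ⊓
    (LinearMap.range (Matrix.J (Fin n) ℂ * S.α.conjTranspose).mulVecLin).comap
      (LinearMap.proj 0)

/-- The solutions in `L²((0, ∞), ℂ^{2n})`. -/
def decayingSolutions (lam : ℝ) : Submodule ℂ (ℝ → Fin n ⊕ Fin n → ℂ) where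
  carrier := {y | y ∈ S.solutions lam ∧ ∀ i, MemLp (fun x => y x i) 2 halfLine}
  zero_mem' := ⟨zero_mem _, fun _ => MemLp.zero⟩
  add_mem' := by
    rintro y z ⟨h1, h2⟩ ⟨k1, k2⟩
    exact ⟨add_mem h1 k1, fun i => (h2 i).add (k2 i)⟩
  smul_mem' := by
    rintro c y ⟨h1, h2⟩
    exact ⟨Submodule.smul_mem _ c h1, fun i => (h2 i).const_smul c⟩

/-- `ℓ₁(x; lam)`: the values at `x ≥ 0` of the solutions satisfying the boundary condition,
i.e. the column space of the matrix solution `X₁` with `X₁(0; lam) = J α*`. -/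
def ell₁ (x lam : ℝ) : Submodule ℂ (Fin n ⊕ Fin n → ℂ) :=
  (S.boundarySolutions lam).map (LinearMap.proj x)

/-- `ℓ₂(x; lam)`: the values at `x ≥ 0` of the solutions in `L²((0, ∞), ℂ^{2n})`. -/
def ell₂ (x lam : ℝ) : Submodule ℂ (Fin n ⊕ Fin n → ℂ) :=
  (S.decayingSolutions lam).map (LinearMap.proj x)

/-- `ℓ₂⁺(lam) = lim_{x → ∞} ℓ₂(x; lam)`. -/
noncomputable def ell₂plus (lam : ℝ) : Submodule ℂ (Fin n ⊕ Fin n → ℂ) :=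
  lagrangianLimit (fun x => S.ell₂ x lam)

/-- `lamInf` is boundary inconjugate: `ℓ₁(0; -lamInf) ∩ ℓ₂⁺(-lamInf) = {0}`. -/
def BoundaryInconjugate (lamInf : ℝ) : Prop :=
  S.ell₁ 0 (-lamInf) ⊓ S.ell₂plus (-lamInf) = ⊥

end SturmLiouville

section UnitaryAngles

open Matrix

variable {n : ℕ}

theorem circlePoint_eq (θ : ℝ) : circlePoint θ = -Complex.exp (θ * Complex.I) := by
  unfold circlePoint
  push_cast
  rw [add_mul, Complex.exp_add, Complex.exp_pi_mul_I]
  ring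

theorem norm_circlePoint (θ : ℝ) : ‖circlePoint θ‖ = 1 := by
  rw [circlePoint_eq, norm_neg, Complex.norm_exp_ofReal_mul_I]

theorem circlePoint_add_two_pi (θ : ℝ) : circlePoint (θ + 2 * Real.pi) = circlePoint θ := by
  rw [circlePoint_eq, circlePoint_eq]
  push_cast
  rw [add_mul, Complex.exp_add, Complex.exp_two_pi_mul_I, mul_one]

theorem circlePoint_eq_iff {θ θ' : ℝ} :
    circlePoint θ = circlePoint θ' ↔ ∃ k : ℤ, θ = θ' + k * (2 * Real.pi) := by
  rw [circlePoint_eq, circlePoint_eq, neg_inj, Complex.exp_eq_exp_iff_exists_int]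
  refine exists_congr fun k => ?_
  have hI : (Complex.I : ℂ) ≠ 0 := Complex.I_ne_zero
  constructor
  · intro h
    have h' : ((θ : ℂ)) * Complex.I = ((θ' + k * (2 * Real.pi) : ℝ) : ℂ) * Complex.I := by
      rw [h]; push_cast; ring
    exact_mod_cast mul_right_cancel₀ hI h'
  · intro h
    rw [h]; push_cast; ring

theorem circlePoint_injOn {a θ θ' : ℝ} (h : θ ∈ Set.Ico a (a + 2 * Real.pi))
    (h' : θ' ∈ Set.Ico a (a + 2 * Real.pi)) (e : circlePoint θ = circlePoint θ') : θ = θ' := by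
  obtain ⟨k, hk⟩ := circlePoint_eq_iff.1 e
  have hpi := Real.pi_pos
  have h1 : (k : ℝ) < 1 := by
    by_contra hc
    push Not at hc
    nlinarith [h.1, h.2, h'.1, h'.2]
  have h2 : (-1 : ℝ) < k := by
    by_contra hc
    push Not at hc
    nlinarith [h.1, h.2, h'.1, h'.2]
  have h3 : k < 1 := by exact_mod_cast h1
  have h4 : -1 < k := by exact_mod_cast h2
  have : k = 0 := by omega
  simpa [this] using hk

theorem exists_circlePoint_eq {z : ℂ} (hz : ‖z‖ = 1) :
    ∃ θ ∈ Set.Ico 0 (2 * Real.pi), circlePoint θ = z := by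
  have hpi := Real.two_pi_pos
  refine ⟨toIcoMod hpi 0 (Complex.arg (-z)), by simpa using toIcoMod_mem_Ico hpi 0 _, ?_⟩
  have : circlePoint (Complex.arg (-z)) = z := by
    rw [circlePoint_eq]
    have := Complex.norm_mul_exp_arg_mul_I (-z)
    rw [norm_neg, hz] at this
    simp only [Complex.ofReal_one, one_mul] at this
    rw [this, neg_neg]
  conv_rhs => rw [← this]
  refine circlePoint_eq_iff.2 ⟨-toIcoDiv hpi 0 (Complex.arg (-z)), ?_⟩
  rw [toIcoMod, zsmul_eq_mul]
  push_cast
  ring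

/-- A unitary matrix is unitarily diagonalizable. -/
theorem exists_unitary_diagonalization (W : Matrix (Fin n) (Fin n) ℂ) (hW : Wᴴ * W = 1) :
    ∃ (V : Matrix (Fin n) (Fin n) ℂ) (φ : Fin n → ℝ), Vᴴ * V = 1 ∧
      (∀ i, φ i ∈ Set.Ico 0 (2 * Real.pi)) ∧
      W = V * diagonal (fun i => circlePoint (φ i)) * Vᴴ := by
  have hW' : W * Wᴴ = 1 := mul_eq_one_comm.1 hW
  obtain ⟨θ, hθ⟩ : ∃ θ : ℝ, circlePoint θ ∉ spectrum ℂ W := by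
    by_contra hc
    push Not at hc
    have hinf : (Set.range fun k : ℕ => circlePoint (1 / (k + 1 : ℝ))).Infinite := by
      refine Set.infinite_range_of_injective fun k l hkl => ?_
      have hp := Real.pi_gt_three
      have hb : ∀ k : ℕ, (1 / (k + 1 : ℝ)) ∈ Set.Ico 0 (0 + 2 * Real.pi) := fun k => by
        have : (1 / (k + 1 : ℝ)) ≤ 1 := by
          rw [div_le_one (by positivity)]; linarith [Nat.cast_nonneg (α := ℝ) k]
        exact ⟨by positivity, by linarith⟩
      have := circlePoint_injOn (hb k) (hb l) hkl
      rw [one_div, one_div, _root_.inv_inj] at this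
      exact_mod_cast add_right_cancel this
    exact hinf ((Matrix.finite_spectrum W).subset (by rintro _ ⟨k, rfl⟩; exact hc _))
  set p := circlePoint θ with hp
  have hpn : star p * p = 1 := by
    have := norm_circlePoint θ
    rw [← hp] at this
    rw [mul_comm]
    change p * (starRingEnd ℂ) p = 1
    rw [Complex.mul_conj, Complex.normSq_eq_norm_sq, this]; norm_num
  have hunit : IsUnit (p • (1 : Matrix (Fin n) (Fin n) ℂ) - W) := by
    have := spectrum.notMem_iff.1 hθ
    rwa [Algebra.algebraMap_eq_smul_one] at this
  set R := (p • (1 : Matrix (Fin n) (Fin n) ℂ) - W) with hR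
  have hRdet : IsUnit R.det := (Matrix.isUnit_iff_isUnit_det _).1 hunit
  have hRR : R * R⁻¹ = 1 := Matrix.mul_nonsing_inv _ hRdet
  have hRR' : R⁻¹ * R = 1 := Matrix.nonsing_inv_mul _ hRdet
  set T := (p • (1 : Matrix (Fin n) (Fin n) ℂ) + W) with hT
  have hTR : T * R = R * T := by
    simp only [hT, hR, add_mul, mul_sub, sub_mul, mul_add]
    simp
    abel
  set H := Complex.I • (T * R⁻¹) with hH
  have hTR' : T * R⁻¹ = R⁻¹ * T := by
    calc T * R⁻¹ = R⁻¹ * R * (T * R⁻¹) := by rw [hRR', one_mul]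
      _ = R⁻¹ * (R * T) * R⁻¹ := by simp only [mul_assoc]
      _ = R⁻¹ * (T * R) * R⁻¹ := by rw [hTR]
      _ = R⁻¹ * T := by rw [mul_assoc, mul_assoc, hRR, mul_one]
  have hRs : Rᴴ = -(star p • (R * Wᴴ)) := by
    rw [hR, conjTranspose_sub, conjTranspose_smul, conjTranspose_one, sub_mul, hW', smul_sub,
      smul_mul_assoc, smul_smul, hpn]
    simp
  have hTs : Tᴴ = star p • (T * Wᴴ) := by
    rw [hT, conjTranspose_add, conjTranspose_smul, conjTranspose_one, add_mul, hW', smul_add,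
      smul_mul_assoc, smul_smul, hpn]
    simp [add_comm]
  have hHerm : H.IsHermitian := by
    rw [Matrix.IsHermitian, hH, conjTranspose_smul, conjTranspose_mul, conjTranspose_nonsing_inv]
    have key : Rᴴ * (R⁻¹ * T) = -Tᴴ := by
      rw [hRs, hTs]
      have hc : Wᴴ * R⁻¹ = R⁻¹ * Wᴴ := by
        have hc0 : R * Wᴴ = Wᴴ * R := by
          rw [hR, sub_mul, mul_sub, hW, hW']; simp
        calc Wᴴ * R⁻¹ = R⁻¹ * (R * Wᴴ) * R⁻¹ := by rw [← mul_assoc, hRR', one_mul]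
          _ = R⁻¹ * Wᴴ := by rw [hc0, mul_assoc, mul_assoc, hRR, mul_one]
      have hc1 : Wᴴ * T = T * Wᴴ := by
        rw [hT, add_mul, mul_add, hW, hW']; simp
      rw [neg_mul, smul_mul_assoc, mul_assoc, ← mul_assoc Wᴴ, hc, mul_assoc R⁻¹, hc1,
        ← mul_assoc R, hRR, one_mul]
    have hRH : IsUnit (Rᴴ).det := by rw [det_conjTranspose]; exact hRdet.star
    have : (Rᴴ)⁻¹ * Tᴴ = -(T * R⁻¹) := by
      rw [hTR', ← neg_eq_iff_eq_neg, ← mul_neg, ← key, ← mul_assoc, Matrix.nonsing_inv_mul _ hRH,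
        one_mul]
    rw [this]
    simp
  have hHR : H * R = Complex.I • T := by rw [hH, smul_mul_assoc, mul_assoc, hRR', mul_one]
  have hspec := hHerm.spectral_theorem
  set V : Matrix (Fin n) (Fin n) ℂ := (hHerm.eigenvectorUnitary : Matrix (Fin n) (Fin n) ℂ)
    with hV
  have hVV : Vᴴ * V = 1 := by
    have := (Unitary.mem_iff.1 hHerm.eigenvectorUnitary.2).1
    exact this
  have hVV' : V * Vᴴ = 1 := mul_eq_one_comm.1 hVV
  set h := hHerm.eigenvalues with hh
  have hspec' : H = V * diagonal (fun i => (h i : ℂ)) * Vᴴ := by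
    rw [hspec, Unitary.conjStarAlgAut_apply]
    rfl
  have hne : ∀ i, (h i : ℂ) + Complex.I ≠ 0 := fun i hi => by
    have := congrArg Complex.im hi
    simp at this
  set d : Fin n → ℂ := fun i => p * ((h i : ℂ) - Complex.I) / ((h i : ℂ) + Complex.I) with hd
  have hdn : ∀ i, ‖d i‖ = 1 := fun i => by
    rw [hd]
    simp only [norm_div, norm_mul]
    rw [hp, norm_circlePoint, one_mul]
    have : (h i : ℂ) - Complex.I = (starRingEnd ℂ) ((h i : ℂ) + Complex.I) := by simp [sub_eq_add_neg]
    rw [this, Complex.norm_conj, div_self]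
    exact norm_ne_zero_iff.2 (hne i)
  choose φ hφ hφ' using fun i => exists_circlePoint_eq (hdn i)
  refine ⟨V, φ, hVV, hφ, ?_⟩
  have hdd : (fun i => circlePoint (φ i)) = d := funext hφ'
  rw [hdd]
  -- `(H + i) W = p (H - i)`
  have e1 : (H + Complex.I • 1) * W = p • (H - Complex.I • 1) := by
    have := hHR
    rw [hR, hT, mul_sub, smul_add] at this
    simp only [mul_smul_comm, mul_one] at this
    have e5 : (Complex.I • (1 : Matrix (Fin n) (Fin n) ℂ)) * W = Complex.I • W := by simp
    rw [add_mul, e5, smul_sub, eq_sub_iff_add_eq, sub_eq_iff_eq_add.1 this,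
      smul_comm p Complex.I]
    abel
  have e2 : H + Complex.I • 1 = V * diagonal (fun i => (h i : ℂ) + Complex.I) * Vᴴ := by
    have : diagonal (fun i => (h i : ℂ) + Complex.I)
        = diagonal (fun i => (h i : ℂ)) + Complex.I • (1 : Matrix (Fin n) (Fin n) ℂ) := by
      rw [smul_one_eq_diagonal, diagonal_add]
    rw [this, mul_add, add_mul, ← hspec']
    simp [hVV']
  have e3 : H - Complex.I • 1 = V * diagonal (fun i => (h i : ℂ) - Complex.I) * Vᴴ := by
    have : diagonal (fun i => (h i : ℂ) - Complex.I)
        = diagonal (fun i => (h i : ℂ)) - Complex.I • (1 : Matrix (Fin n) (Fin n) ℂ) := by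
      rw [smul_one_eq_diagonal, diagonal_sub]
    rw [this, mul_sub, sub_mul, ← hspec']
    simp [hVV']
  set G := V * diagonal (fun i => ((h i : ℂ) + Complex.I)⁻¹) * Vᴴ with hG
  have e4 : G * (H + Complex.I • 1) = 1 := by
    rw [e2, hG]
    calc V * diagonal (fun i => ((h i : ℂ) + Complex.I)⁻¹) * Vᴴ
          * (V * diagonal (fun i => (h i : ℂ) + Complex.I) * Vᴴ)
        = V * diagonal (fun i => ((h i : ℂ) + Complex.I)⁻¹) * (Vᴴ * V)
          * diagonal (fun i => (h i : ℂ) + Complex.I) * Vᴴ := by simp only [mul_assoc]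
      _ = V * (diagonal (fun i => ((h i : ℂ) + Complex.I)⁻¹)
          * diagonal (fun i => (h i : ℂ) + Complex.I)) * Vᴴ := by
          rw [hVV, mul_one]; simp only [mul_assoc]
      _ = 1 := by
          rw [diagonal_mul_diagonal]
          have : (fun i => ((h i : ℂ) + Complex.I)⁻¹ * ((h i : ℂ) + Complex.I)) = fun _ => 1 :=
            funext fun i => inv_mul_cancel₀ (hne i)
          rw [this, diagonal_one, mul_one, hVV']
  calc W = G * ((H + Complex.I • 1) * W) := by rw [← mul_assoc, e4, one_mul]
    _ = V * diagonal (fun i => ((h i : ℂ) + Complex.I)⁻¹) * (Vᴴ * V)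
          * (p • diagonal (fun i => (h i : ℂ) - Complex.I)) * Vᴴ := by
        rw [e1, e3, hG]
        simp only [mul_assoc, mul_smul_comm, smul_mul_assoc]
    _ = V * (diagonal (fun i => ((h i : ℂ) + Complex.I)⁻¹)
          * (p • diagonal (fun i => (h i : ℂ) - Complex.I))) * Vᴴ := by
        rw [hVV, mul_one]; simp only [mul_assoc]
    _ = V * diagonal d * Vᴴ := by
        congr 2
        rw [mul_smul_comm, diagonal_mul_diagonal, ← diagonal_smul]
        congr 1
        funext i
        simp only [hd, Pi.smul_apply, smul_eq_mul]
        field_simp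

open Classical in
/-- The angles `φ i ∈ [0, 2π)` such that the eigenvalues of the unitary matrix `W` are
`e^{i(π + φ i)}`. -/
noncomputable def angles (W : Matrix (Fin n) (Fin n) ℂ) : Fin n → ℝ :=
  if h : Wᴴ * W = 1 then (exists_unitary_diagonalization W h).choose_spec.choose else 0

theorem angles_spec {W : Matrix (Fin n) (Fin n) ℂ} (h : Wᴴ * W = 1) :
    ∃ V : Matrix (Fin n) (Fin n) ℂ, Vᴴ * V = 1 ∧
      (∀ i, angles W i ∈ Set.Ico 0 (2 * Real.pi)) ∧
      W = V * diagonal (fun i => circlePoint (angles W i)) * Vᴴ := by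
  rw [angles, dif_pos h]
  exact ⟨_, (exists_unitary_diagonalization W h).choose_spec.choose_spec⟩

theorem angles_mem {W : Matrix (Fin n) (Fin n) ℂ} (h : Wᴴ * W = 1) (i : Fin n) :
    angles W i ∈ Set.Ico 0 (2 * Real.pi) := (angles_spec h).choose_spec.2.1 i

theorem finrank_eigenspace_unitary {W : Matrix (Fin n) (Fin n) ℂ} (h : Wᴴ * W = 1) (z : ℂ) :
    Module.finrank ℂ (Module.End.eigenspace (Matrix.toLin' W) z)
      = (Finset.univ.filter fun i => circlePoint (angles W i) = z).card := by
  obtain ⟨V, hV, -, hWV⟩ := angles_spec h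
  have hV' : V * Vᴴ = 1 := mul_eq_one_comm.1 hV
  have hVd : IsUnit V.det := (Matrix.isUnit_iff_isUnit_det _).1 ⟨⟨V, Vᴴ, hV', hV⟩, rfl⟩
  have hVd' : IsUnit Vᴴ.det := (Matrix.isUnit_iff_isUnit_det _).1 ⟨⟨Vᴴ, V, hV, hV'⟩, rfl⟩
  have e1 : W - z • 1 = V * diagonal (fun i => circlePoint (angles W i) - z) * Vᴴ := by
    have : diagonal (fun i => circlePoint (angles W i) - z)
        = diagonal (fun i => circlePoint (angles W i)) - z • (1 : Matrix (Fin n) (Fin n) ℂ) := by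
      rw [smul_one_eq_diagonal, diagonal_sub]
    rw [this, mul_sub, sub_mul, ← hWV]
    simp [hV']
  have e2 : Module.End.eigenspace (Matrix.toLin' W) z
      = LinearMap.ker (Matrix.mulVecLin (W - z • 1)) := by
    rw [Module.End.eigenspace_def]
    congr 1
    ext v
    simp
  have e3 := LinearMap.finrank_range_add_finrank_ker (Matrix.mulVecLin (W - z • 1))
  have e4 : Module.finrank ℂ (LinearMap.range (Matrix.mulVecLin (W - z • 1)))
      = (Finset.univ.filter fun i => ¬ circlePoint (angles W i) = z).card := by
    change (W - z • 1).rank = _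
    rw [e1, Matrix.rank_mul_eq_left_of_isUnit_det _ _ hVd',
      Matrix.rank_mul_eq_right_of_isUnit_det _ _ hVd, Matrix.rank_diagonal, Fintype.card_subtype]
    simp only [ne_eq, sub_eq_zero]
  have e5 := Finset.card_filter_add_card_filter_not (s := (Finset.univ : Finset (Fin n)))
    (fun i => circlePoint (angles W i) = z)
  rw [e2]
  simp only [Module.finrank_fin_fun, Finset.card_univ, Fintype.card_fin] at e3 e5
  omega

theorem circlePoint_mem_spectrum_iff {W : Matrix (Fin n) (Fin n) ℂ} (h : Wᴴ * W = 1) (z : ℂ) :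
    z ∈ spectrum ℂ W ↔ ∃ i, circlePoint (angles W i) = z := by
  have := finrank_eigenspace_unitary h z
  rw [← Matrix.spectrum_toLin', ← Module.End.hasEigenvalue_iff_mem_spectrum,
    Module.End.hasEigenvalue_iff]
  rw [← not_iff_not]
  simp only [ne_eq, not_not, not_exists]
  rw [← Submodule.finrank_eq_zero (R := ℂ), this, Finset.card_eq_zero, Finset.filter_eq_empty_iff]
  simp

/-- The number of angles of `W` below `ε`. -/
noncomputable def angleCount (W : Matrix (Fin n) (Fin n) ℂ) (ε : ℝ) : ℕ :=
  (Finset.univ.filter fun i => angles W i < ε).card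

theorem arcCount_eq {W : Matrix (Fin n) (Fin n) ℂ} (h : Wᴴ * W = 1) {ε : ℝ}
    (hε : ε ≤ 2 * Real.pi) : arcCount W ε = angleCount W ε := by
  classical
  have key : ∀ θ ∈ Set.Ico 0 ε,
      Module.finrank ℂ (Module.End.eigenspace (Matrix.toLin' W) (circlePoint θ))
        = (Finset.univ.filter fun i => angles W i = θ).card := by
    intro θ hθ
    rw [finrank_eigenspace_unitary h]
    congr 1
    ext i
    simp only [Finset.mem_filter, Finset.mem_univ, true_and]
    refine ⟨fun e => ?_, fun e => by rw [e]⟩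
    have hm := angles_mem h i
    exact circlePoint_injOn (a := 0) (by simpa using hm) ⟨hθ.1, by linarith [hθ.2]⟩ e
  unfold arcCount angleCount
  have e1 : (∑ᶠ (θ : ℝ) (_ : θ ∈ Set.Ico 0 ε),
      Module.finrank ℂ (Module.End.eigenspace (Matrix.toLin' W) (circlePoint θ)))
      = ∑ᶠ (θ : ℝ) (_ : θ ∈ Set.Ico 0 ε), (Finset.univ.filter fun i => angles W i = θ).card :=
    finsum_congr fun θ => finsum_congr fun hθ => key θ hθ
  rw [e1]
  set s := Finset.univ.filter fun i => angles W i < ε with hs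
  rw [finsum_mem_eq_sum_of_inter_support_eq (t := s.image (angles W)) _ ?_]
  · rw [Finset.card_eq_sum_card_image (angles W) s]
    refine Finset.sum_congr rfl fun θ hθ => ?_
    congr 1
    ext i
    obtain ⟨j, hj, rfl⟩ := Finset.mem_image.1 hθ
    simp only [hs, Finset.mem_filter, Finset.mem_univ, true_and] at hj ⊢
    exact ⟨fun e => ⟨by rw [e]; exact hj, e⟩, fun e => e.2⟩
  · ext θ
    simp only [Set.mem_inter_iff, Set.mem_Ico, Function.mem_support, ne_eq, Finset.card_eq_zero,
      Finset.filter_eq_empty_iff, Finset.mem_univ, true_imp_iff, not_forall, not_not,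
      Finset.coe_image, Set.mem_image, SetLike.mem_coe, hs, Finset.mem_filter, true_and]
    constructor
    · rintro ⟨⟨-, h2⟩, i, rfl⟩
      exact ⟨⟨i, h2, rfl⟩, i, rfl⟩
    · rintro ⟨⟨i, hi, rfl⟩, -⟩
      exact ⟨⟨(angles_mem h i).1, hi⟩, i, rfl⟩

/-- The sum of the angles in `[0, 2π)`. -/
noncomputable def angleSum (W : Matrix (Fin n) (Fin n) ℂ) : ℝ := ∑ i, angles W i

theorem det_neg_unitary {W : Matrix (Fin n) (Fin n) ℂ} (h : Wᴴ * W = 1) :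
    (-W).det = Complex.exp (angleSum W * Complex.I) := by
  obtain ⟨V, hV, -, hWV⟩ := angles_spec h
  have e : -W = V * diagonal (fun i => Complex.exp (angles W i * Complex.I)) * Vᴴ := by
    conv_lhs => rw [hWV]
    rw [← neg_mul, ← mul_neg, diagonal_neg]
    congr 3
    funext i
    rw [circlePoint_eq, neg_neg]
  rw [e, det_mul, det_mul, mul_comm V.det, mul_assoc, ← det_mul, mul_eq_one_comm.1 hV, det_one,
    mul_one, det_diagonal, ← Complex.exp_sum, angleSum]
  push_cast
  rw [Finset.sum_mul]

end UnitaryAngles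

section SpectralFlow

open Matrix

variable {n : ℕ} {ι : Type*} [TopologicalSpace ι]

theorem trace_pow_neg_unitary {W : Matrix (Fin n) (Fin n) ℂ} (h : Wᴴ * W = 1) (k : ℕ) :
    ((-W) ^ k).trace = ∑ i, Complex.exp (angles W i * Complex.I) ^ k := by
  obtain ⟨V, hV, -, hWV⟩ := angles_spec h
  set d : Fin n → ℂ := fun i => Complex.exp (angles W i * Complex.I) with hd
  have e : -W = V * diagonal d * Vᴴ := by
    conv_lhs => rw [hWV]
    rw [← neg_mul, ← mul_neg, diagonal_neg]
    congr 3
    funext i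
    rw [circlePoint_eq, neg_neg]
  have e2 : (-W) ^ k = V * diagonal (d ^ k) * Vᴴ := by
    rw [e]
    induction k with
    | zero => simp [mul_eq_one_comm.1 hV]
    | succ k ih =>
      rw [pow_succ, ih]
      calc V * diagonal (d ^ k) * Vᴴ * (V * diagonal d * Vᴴ)
          = V * diagonal (d ^ k) * (Vᴴ * V) * diagonal d * Vᴴ := by simp only [mul_assoc]
        _ = V * (diagonal (d ^ k) * diagonal d) * Vᴴ := by
            rw [hV, mul_one]; simp only [mul_assoc]
        _ = V * diagonal (d ^ (k + 1)) * Vᴴ := by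
            rw [diagonal_mul_diagonal]
            congr 3
  rw [e2, trace_mul_comm, ← mul_assoc, hV, one_mul, trace_diagonal]
  rfl

instance two_pi_pos_fact : Fact (0 < 2 * Real.pi) := ⟨Real.two_pi_pos⟩

theorem fourier_two_pi_coe (k : ℤ) (x : ℝ) :
    (fourier k : C(AddCircle (2 * Real.pi), ℂ)) (x : AddCircle (2 * Real.pi))
      = Complex.exp (x * Complex.I) ^ k := by
  rw [fourier_coe_apply, ← Complex.exp_int_mul]
  congr 1
  have : (Real.pi : ℂ) ≠ 0 := by exact_mod_cast Real.pi_ne_zero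
  push_cast
  field_simp

/-- Symmetric functions of the eigenvalues depend continuously on a unitary matrix. -/
theorem continuousWithinAt_sum_angles {W : ι → Matrix (Fin n) (Fin n) ℂ} {s : Set ι} {t₀ : ι}
    (ht₀ : t₀ ∈ s) (hW : ContinuousWithinAt W s t₀) (hU : ∀ t ∈ s, (W t)ᴴ * W t = 1)
    (g : C(AddCircle (2 * Real.pi), ℂ)) :
    ContinuousWithinAt (fun t => ∑ i, g (angles (W t) i : AddCircle (2 * Real.pi))) s t₀ := by
  have hspan : ∀ q ∈ Submodule.span ℂ (Set.range (fourier (T := 2 * Real.pi))),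
      ContinuousWithinAt (fun t => ∑ i, q (angles (W t) i : AddCircle (2 * Real.pi))) s t₀ := by
    intro q hq
    induction hq using Submodule.span_induction with
    | zero => simpa using continuousWithinAt_const
    | add x y _ _ hx hy =>
      refine (hx.add hy).congr (fun t _ => ?_) ?_ <;> simp [Finset.sum_add_distrib]
    | smul c x _ hx =>
      refine (hx.const_smul c).congr (fun t _ => ?_) ?_ <;> simp [Finset.mul_sum]
    | mem x hx =>
      obtain ⟨k, rfl⟩ := hx
      have hnat : ∀ k : ℕ, ContinuousWithinAt
          (fun t => ∑ i, Complex.exp (angles (W t) i * Complex.I) ^ k) s t₀ := fun k => by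
        have h1 : ContinuousWithinAt (fun t => ((-W t) ^ k).trace) s t₀ := by
          have h2 : Continuous fun M : Matrix (Fin n) (Fin n) ℂ => ((-M) ^ k).trace :=
            (continuous_neg.pow k).matrix_trace
          exact h2.continuousAt.comp_continuousWithinAt hW
        exact h1.congr (fun t ht => (trace_pow_neg_unitary (hU t ht) k).symm)
          (trace_pow_neg_unitary (hU t₀ ht₀) k).symm
      simp only [fourier_two_pi_coe]
      obtain ⟨m, rfl | rfl⟩ := k.eq_nat_or_neg
      · simpa using hnat m
      · have := (Complex.continuous_conj.continuousAt.comp_continuousWithinAt (hnat m))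
        refine this.congr (fun t _ => ?_) ?_ <;>
        · simp only [Function.comp_apply, map_sum, map_pow, ← Complex.exp_conj, map_mul,
            Complex.conj_ofReal, Complex.conj_I, _root_.zpow_neg, zpow_natCast, ← inv_pow,
            ← Complex.exp_neg, mul_neg]
  refine continuousWithinAt_of_locally_uniform_approx_of_continuousWithinAt ht₀ fun u hu => ?_
  obtain ⟨ε, hε, hεu⟩ := Metric.mem_uniformity_dist.1 hu
  have hg : g ∈ (Submodule.span ℂ (Set.range (fourier (T := 2 * Real.pi)))).topologicalClosure := by
    rw [span_fourier_closure_eq_top]; trivial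
  obtain ⟨q, hq, hgq⟩ := Metric.mem_closure_iff.1 hg (ε / (n + 1)) (by positivity)
  refine ⟨s, self_mem_nhdsWithin, _, hspan q hq, fun t _ => hεu ?_⟩
  rw [dist_eq_norm, ← Finset.sum_sub_distrib]
  calc ‖∑ i, (g (angles (W t) i : AddCircle (2 * Real.pi))
          - q (angles (W t) i : AddCircle (2 * Real.pi)))‖
      ≤ ∑ i : Fin n, ε / (n + 1) := by
        refine (norm_sum_le _ _).trans (Finset.sum_le_sum fun i _ => ?_)
        rw [← dist_eq_norm]
        exact (ContinuousMap.dist_apply_le_dist _).trans hgq.le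
    _ = n * ε / (n + 1) := by simp; ring
    _ < ε := by
        rw [div_lt_iff₀ (by positivity)]
        nlinarith

theorem continuousWithinAt_sum_liftIco {W : ι → Matrix (Fin n) (Fin n) ℂ} {s : Set ι} {t₀ : ι}
    (ht₀ : t₀ ∈ s) (hW : ContinuousWithinAt W s t₀) (hU : ∀ t ∈ s, (W t)ᴴ * W t = 1)
    {a : ℝ} {f : ℝ → ℝ} (hf : Continuous f) (hfa : f a = f (a + 2 * Real.pi)) :
    ContinuousWithinAt (fun t => ∑ i, AddCircle.liftIco (2 * Real.pi) a f
      (angles (W t) i : AddCircle (2 * Real.pi))) s t₀ := by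
  have hc : Continuous (AddCircle.liftIco (2 * Real.pi) a f) :=
    AddCircle.liftIco_continuous hfa hf.continuousOn
  have := continuousWithinAt_sum_angles ht₀ hW hU
    ⟨fun x => ((AddCircle.liftIco (2 * Real.pi) a f x : ℝ) : ℂ), Complex.continuous_ofReal.comp hc⟩
  have := Complex.continuous_re.continuousAt.comp_continuousWithinAt this
  refine this.congr (fun t _ => ?_) ?_ <;> simp

/-- The branch of the angle with values in `[ε - 2π, ε)`. -/
noncomputable def angleBranch (ε φ : ℝ) : ℝ := if φ < ε then φ else φ - 2 * Real.pi

theorem angleBranch_coe (ε φ : ℝ) :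
    (φ : AddCircle (2 * Real.pi)) = (angleBranch ε φ : AddCircle (2 * Real.pi)) := by
  unfold angleBranch
  split_ifs
  · rfl
  · rw [AddCircle.coe_sub, AddCircle.coe_period, sub_zero]

theorem angleBranch_mem {ε φ : ℝ} (hε : 0 < ε) (hε' : ε < 2 * Real.pi)
    (hφ : φ ∈ Set.Ico 0 (2 * Real.pi)) :
    angleBranch ε φ ∈ Set.Ico (ε - 2 * Real.pi) (ε - 2 * Real.pi + 2 * Real.pi) := by
  unfold angleBranch
  split_ifs with h
  · exact ⟨by linarith [hφ.1], by linarith⟩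
  · exact ⟨by linarith, by linarith [hφ.2]⟩

theorem sum_angleBranch (W : Matrix (Fin n) (Fin n) ℂ) (ε : ℝ) :
    ∑ i, angleBranch ε (angles W i)
      = angleSum W + 2 * Real.pi * angleCount W ε - 2 * Real.pi * n := by
  have h1 : ∀ i, angleBranch ε (angles W i)
      = angles W i - 2 * Real.pi + 2 * Real.pi * (if angles W i < ε then 1 else 0) := fun i => by
    unfold angleBranch; split_ifs <;> ring
  simp only [h1, Finset.sum_add_distrib, Finset.sum_sub_distrib, ← Finset.mul_sum,
    Finset.sum_boole, angleSum, angleCount]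
  simp
  ring

/-- A continuous argument of `det (-W)` minus the branch sum of the angles is locally constant. -/
theorem lift_sub_angleSum_eventually_eq {W : ι → Matrix (Fin n) (Fin n) ℂ} {s : Set ι} {t₀ : ι}
    (ht₀ : t₀ ∈ s) (hW : ContinuousWithinAt W s t₀) (hU : ∀ t ∈ s, (W t)ᴴ * W t = 1)
    {α : ι → ℝ} (hα : ContinuousWithinAt α s t₀)
    (hαW : ∀ t ∈ s, Complex.exp (α t * Complex.I) = (-W t).det)
    {ε : ℝ} (hε : 0 < ε) (hε' : ε < 2 * Real.pi) (hsp : circlePoint ε ∉ spectrum ℂ (W t₀)) :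
    ∀ᶠ t in 𝓝[s] t₀, α t - angleSum (W t) - 2 * Real.pi * angleCount (W t) ε
      = α t₀ - angleSum (W t₀) - 2 * Real.pi * angleCount (W t₀) ε := by
  have hpi := Real.pi_pos
  set a := ε - 2 * Real.pi with ha
  have hne : ∀ i, angles (W t₀) i ≠ ε := fun i hi =>
    hsp ((circlePoint_mem_spectrum_iff (hU t₀ ht₀) _).2 ⟨i, by rw [hi]⟩)
  -- distance of the branch to the end points of `[ε - 2π, ε]`
  set m : ℝ → ℝ := fun x => min (x - a) (ε - x) with hm
  have hmc : Continuous m := by fun_prop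
  have hma : m a = 0 := by simp [hm, ha, hpi.le]
  have hmε : m (a + 2 * Real.pi) = 0 := by simp [hm, ha, hpi.le]
  have hmpos : ∀ i, 0 < m (angleBranch ε (angles (W t₀) i)) := fun i => by
    have h1 := angles_mem (hU t₀ ht₀) i
    have h2 := hne i
    simp only [hm, lt_min_iff, angleBranch, ha]
    split_ifs with h
    · exact ⟨by linarith [h1.1], by linarith⟩
    · have : ε < angles (W t₀) i := lt_of_le_of_ne (not_lt.1 h) h2.symm
      exact ⟨by linarith, by linarith [h1.2]⟩
  obtain ⟨δ, hδ, hδm⟩ : ∃ δ > 0, ∀ i, δ ≤ m (angleBranch ε (angles (W t₀) i)) := by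
    rcases isEmpty_or_nonempty (Fin n) with h | h
    · exact ⟨1, one_pos, fun i => h.elim i⟩
    · obtain ⟨i, hi⟩ := Finite.exists_min fun i => m (angleBranch ε (angles (W t₀) i))
      exact ⟨_, hmpos i, hi⟩
  -- a bump function detecting angles close to `ε`
  set b : ℝ → ℝ := fun x => 1 - min 1 (m x / δ) with hb
  have hbc : Continuous b := by fun_prop
  have hb0 : ∀ x, 0 ≤ b x := fun x => by simp [hb]
  set f : ℝ → ℝ := fun x => x * min 1 (2 * m x / δ) with hf
  have hfc : Continuous f := by fun_prop
  have H1 := continuousWithinAt_sum_liftIco ht₀ hW hU (a := a) hbc (by simp [hb, hma, hmε])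
  have H2 := continuousWithinAt_sum_liftIco ht₀ hW hU (a := a) hfc (by simp [hf, hma, hmε])
  have lift_eq : ∀ (h : ℝ → ℝ), ∀ t ∈ s, ∀ i,
      AddCircle.liftIco (2 * Real.pi) a h (angles (W t) i : AddCircle (2 * Real.pi))
        = h (angleBranch ε (angles (W t) i)) := fun h t ht i => by
    rw [angleBranch_coe ε, AddCircle.liftIco_coe_apply]
    exact angleBranch_mem hε hε' (angles_mem (hU t ht) i)
  have hb_t₀ : ∑ i, AddCircle.liftIco (2 * Real.pi) a b
      (angles (W t₀) i : AddCircle (2 * Real.pi)) = 0 := by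
    refine Finset.sum_eq_zero fun i _ => ?_
    rw [lift_eq b t₀ ht₀, hb]
    have : 1 ≤ m (angleBranch ε (angles (W t₀) i)) / δ := (one_le_div hδ).2 (hδm i)
    simp [this]
  have E1 : ∀ᶠ t in 𝓝[s] t₀, ∑ i, AddCircle.liftIco (2 * Real.pi) a b
      (angles (W t) i : AddCircle (2 * Real.pi)) < 1 / 2 := by
    refine H1.eventually (gt_mem_nhds ?_)
    simp only [hb_t₀]; norm_num
  have hfsum : ∀ t ∈ s, ∑ i, AddCircle.liftIco (2 * Real.pi) a b
      (angles (W t) i : AddCircle (2 * Real.pi)) < 1 / 2 →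
      ∑ i, AddCircle.liftIco (2 * Real.pi) a f (angles (W t) i : AddCircle (2 * Real.pi))
        = ∑ i, angleBranch ε (angles (W t) i) := by
    intro t ht hlt
    refine Finset.sum_congr rfl fun i _ => ?_
    rw [lift_eq f t ht]
    have h1 : b (angleBranch ε (angles (W t) i)) < 1 / 2 := by
      refine lt_of_le_of_lt ?_ hlt
      simp only [lift_eq b t ht]
      exact Finset.single_le_sum (f := fun i => b (angleBranch ε (angles (W t) i)))
        (fun i _ => hb0 _) (Finset.mem_univ i)
    have h2 : 1 ≤ 2 * m (angleBranch ε (angles (W t) i)) / δ := by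
      by_contra hc
      push Not at hc
      have h3 : m (angleBranch ε (angles (W t) i)) / δ < 1 / 2 := by
        rw [mul_div_assoc] at hc; linarith
      have h4 : min 1 (m (angleBranch ε (angles (W t) i)) / δ) < 1 / 2 :=
        lt_of_le_of_lt (min_le_right _ _) h3
      simp only [hb] at h1
      linarith
    simp [hf, h2]
  have E2 : ∀ᶠ t in 𝓝[s] t₀, |(α t - ∑ i, AddCircle.liftIco (2 * Real.pi) a f
      (angles (W t) i : AddCircle (2 * Real.pi))) - (α t₀ - ∑ i, AddCircle.liftIco (2 * Real.pi) a f
      (angles (W t₀) i : AddCircle (2 * Real.pi)))| < 1 := by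
    have := (hα.sub H2)
    exact (Metric.tendsto_nhds.1 this 1 one_pos)
  have hval : ∀ t ∈ s, ∃ k : ℤ, α t - ∑ i, angleBranch ε (angles (W t) i) = k * (2 * Real.pi) := by
    intro t ht
    have h1 := hαW t ht
    rw [det_neg_unitary (hU t ht), Complex.exp_eq_exp_iff_exists_int] at h1
    obtain ⟨k, hk⟩ := h1
    refine ⟨k + n - angleCount (W t) ε, ?_⟩
    have h2 : ((α t : ℝ) : ℂ) * Complex.I
        = ((angleSum (W t) + k * (2 * Real.pi) : ℝ) : ℂ) * Complex.I := by
      rw [hk]; push_cast; ring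
    have h3 : α t = angleSum (W t) + k * (2 * Real.pi) := by
      exact_mod_cast mul_right_cancel₀ Complex.I_ne_zero h2
    rw [sum_angleBranch, h3]
    push_cast
    ring
  filter_upwards [E1, E2, self_mem_nhdsWithin] with t h1 h2 ht
  rw [hfsum t ht h1, hfsum t₀ ht₀ (by rw [hb_t₀]; norm_num)] at h2
  obtain ⟨k, hk⟩ := hval t ht
  obtain ⟨k₀, hk₀⟩ := hval t₀ ht₀
  have hkk : k = k₀ := by
    rw [hk, hk₀, ← sub_mul, abs_mul, abs_of_pos Real.two_pi_pos] at h2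
    have h3 : |(k : ℝ) - k₀| < 1 := by
      have := Real.pi_gt_three
      nlinarith [abs_nonneg ((k : ℝ) - k₀)]
    have h4 : |k - k₀| < 1 := by exact_mod_cast h3
    have := Int.abs_lt_one_iff.1 h4
    omega
  rw [sum_angleBranch] at hk hk₀
  rw [hkk] at hk
  linarith

theorem eventually_notMem_spectrum {W : ι → Matrix (Fin n) (Fin n) ℂ} {s : Set ι} {t₀ : ι}
    (hW : ContinuousWithinAt W s t₀) {z : ℂ} (hz : z ∉ spectrum ℂ (W t₀)) :
    ∀ᶠ t in 𝓝[s] t₀, z ∉ spectrum ℂ (W t) := by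
  have key : ∀ t, z ∉ spectrum ℂ (W t) ↔ (algebraMap ℂ _ z - W t).det ≠ 0 := fun t => by
    rw [spectrum.notMem_iff, Matrix.isUnit_iff_isUnit_det, isUnit_iff_ne_zero]
  simp only [key] at hz ⊢
  have h1 : Continuous fun M : Matrix (Fin n) (Fin n) ℂ => (algebraMap ℂ _ z - M).det := by
    fun_prop
  exact (h1.continuousAt.comp_continuousWithinAt hW).eventually_ne hz

/-- The multiplicity of the eigenvalue `-1`. -/
noncomputable def zeroCount (W : Matrix (Fin n) (Fin n) ℂ) : ℕ :=
  (Finset.univ.filter fun i => angles W i = 0).card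

theorem finrank_eigenspace_neg_one {W : Matrix (Fin n) (Fin n) ℂ} (h : Wᴴ * W = 1) :
    Module.finrank ℂ (Module.End.eigenspace (Matrix.toLin' W) (-1)) = zeroCount W := by
  rw [finrank_eigenspace_unitary h, zeroCount]
  congr 1
  ext i
  have h0 : circlePoint 0 = -1 := by rw [circlePoint_eq]; simp
  simp only [Finset.mem_filter, Finset.mem_univ, true_and, ← h0]
  refine ⟨fun e => ?_, fun e => by rw [e]⟩
  exact circlePoint_injOn (a := 0) (by simpa using angles_mem h i)
    ⟨le_rfl, by linarith [Real.two_pi_pos]⟩ e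

/-- Near `t₀`, all angles but those close to `0` stay away from `0`. -/
theorem exists_gap {W : Matrix (Fin n) (Fin n) ℂ} (h : Wᴴ * W = 1) {ε₀ : ℝ} (hε₀ : 0 < ε₀) :
    ∃ ε : ℝ, 0 < ε ∧ ε < ε₀ ∧ ε < Real.pi ∧
      ∀ i, angles W i = 0 ∨ (ε < angles W i ∧ angles W i < 2 * Real.pi - ε) := by
  have hpi := Real.pi_pos
  have : ∀ i, ∃ δ > 0, angles W i = 0 ∨ (δ < angles W i ∧ angles W i < 2 * Real.pi - δ) :=
    fun i => by
    have hi := angles_mem h i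
    rcases hi.1.eq_or_lt with h0 | h0
    · exact ⟨1, one_pos, Or.inl h0.symm⟩
    · refine ⟨min (angles W i) (2 * Real.pi - angles W i) / 2, ?_, Or.inr ⟨?_, ?_⟩⟩
      · have : 0 < min (angles W i) (2 * Real.pi - angles W i) :=
          lt_min h0 (by linarith [hi.2])
        linarith
      · linarith [min_le_left (angles W i) (2 * Real.pi - angles W i)]
      · linarith [min_le_right (angles W i) (2 * Real.pi - angles W i), hi.2]
  choose δ hδ hδ' using this
  obtain ⟨δ₀, hδ₀, hδ₀'⟩ : ∃ δ₀ > 0, ∀ i, δ₀ ≤ δ i := by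
    rcases isEmpty_or_nonempty (Fin n) with h | h
    · exact ⟨1, one_pos, fun i => h.elim i⟩
    · obtain ⟨i, hi⟩ := Finite.exists_min δ
      exact ⟨_, hδ i, hi⟩
  refine ⟨min δ₀ (min ε₀ Real.pi) / 2, by positivity, ?_, ?_, fun i => ?_⟩
  · have := min_le_right δ₀ (min ε₀ Real.pi)
    have := min_le_left ε₀ Real.pi
    linarith
  · have := min_le_right δ₀ (min ε₀ Real.pi)
    have := min_le_right ε₀ Real.pi
    linarith
  · refine (hδ' i).imp_right fun ⟨h1, h2⟩ => ?_
    have := min_le_left δ₀ (min ε₀ Real.pi)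
    have := hδ₀' i
    exact ⟨by linarith, by linarith⟩

theorem circlePoint_notMem_of_gap {W : Matrix (Fin n) (Fin n) ℂ} (h : Wᴴ * W = 1) {ε : ℝ}
    (hε : 0 < ε) (hε' : ε < Real.pi)
    (hg : ∀ i, angles W i = 0 ∨ (ε < angles W i ∧ angles W i < 2 * Real.pi - ε)) :
    circlePoint ε ∉ spectrum ℂ W ∧ circlePoint (2 * Real.pi - ε) ∉ spectrum ℂ W := by
  have hpi := Real.pi_pos
  constructor
  · rw [circlePoint_mem_spectrum_iff h]
    rintro ⟨i, hi⟩
    have := circlePoint_injOn (a := 0) (by simpa using angles_mem h i)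
      ⟨hε.le, by linarith⟩ hi
    rcases hg i with h1 | h1
    · linarith
    · linarith [h1.1]
  · rw [circlePoint_mem_spectrum_iff h]
    rintro ⟨i, hi⟩
    have := circlePoint_injOn (a := 0) (by simpa using angles_mem h i)
      ⟨by linarith, by linarith⟩ hi
    rcases hg i with h1 | h1
    · linarith
    · linarith [h1.2]

theorem angleCount_of_gap {W : Matrix (Fin n) (Fin n) ℂ} {ε : ℝ} (hε : 0 < ε)
    (hε' : ε < Real.pi)
    (hg : ∀ i, angles W i = 0 ∨ (ε < angles W i ∧ angles W i < 2 * Real.pi - ε)) :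
    angleCount W ε = zeroCount W ∧ angleCount W (2 * Real.pi - ε) = n := by
  constructor
  · unfold angleCount zeroCount
    congr 1
    ext i
    simp only [Finset.mem_filter, Finset.mem_univ, true_and]
    rcases hg i with h1 | h1
    · simp [h1, hε]
    · exact ⟨fun h => by linarith [h1.1], fun h => by linarith [h1.1]⟩
  · unfold angleCount
    rw [Finset.filter_true_of_mem]
    · simp
    · intro i _
      rcases hg i with h1 | h1
      · rw [h1]; linarith
      · exact h1.2

theorem zeroCount_le_angleCount (W : Matrix (Fin n) (Fin n) ℂ) {ε : ℝ} (hε : 0 < ε) :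
    zeroCount W ≤ angleCount W ε := by
  refine Finset.card_le_card fun i hi => ?_
  simp only [Finset.mem_filter, Finset.mem_univ, true_and] at hi ⊢
  rw [hi]; exact hε

/-- The local behaviour of the argument function near any point: in terms of the number of
angles in `[0, ε)` and in `[2π - ε, 2π)`. -/
theorem eventually_lift_sub_angleSum {W : ι → Matrix (Fin n) (Fin n) ℂ} {s : Set ι} {t₀ : ι}
    (ht₀ : t₀ ∈ s) (hW : ContinuousWithinAt W s t₀) (hU : ∀ t ∈ s, (W t)ᴴ * W t = 1)
    {α : ι → ℝ} (hα : ContinuousWithinAt α s t₀)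
    (hαW : ∀ t ∈ s, Complex.exp (α t * Complex.I) = (-W t).det) {ε₀ : ℝ} (hε₀ : 0 < ε₀) :
    ∃ ε, 0 < ε ∧ ε < ε₀ ∧ ε < Real.pi ∧ ∀ᶠ t in 𝓝[s] t₀,
      α t - angleSum (W t) - 2 * Real.pi * angleCount (W t) ε
        = α t₀ - angleSum (W t₀) - 2 * Real.pi * zeroCount (W t₀) ∧
      angleCount (W t) ε + (n - angleCount (W t) (2 * Real.pi - ε)) = zeroCount (W t₀) := by
  obtain ⟨ε, h1, h2, h3, h4⟩ := exists_gap (hU t₀ ht₀) hε₀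
  have hpi := Real.pi_pos
  obtain ⟨h5, h6⟩ := circlePoint_notMem_of_gap (hU t₀ ht₀) h1 h3 h4
  obtain ⟨h7, h8⟩ := angleCount_of_gap h1 h3 h4
  refine ⟨ε, h1, h2, h3, ?_⟩
  filter_upwards [lift_sub_angleSum_eventually_eq ht₀ hW hU hα hαW h1 (by linarith) h5,
    lift_sub_angleSum_eventually_eq ht₀ hW hU hα hαW (by linarith : 0 < 2 * Real.pi - ε)
      (by linarith) h6] with t e1 e2
  rw [h7] at e1
  refine ⟨e1, ?_⟩
  rw [h8] at e2
  have e3 : 2 * Real.pi * ((angleCount (W t) (2 * Real.pi - ε) : ℝ) + zeroCount (W t₀))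
      = 2 * Real.pi * (angleCount (W t) ε + n) := by linarith
  have e4 := mul_left_cancel₀ Real.two_pi_pos.ne' e3
  have e5 : angleCount (W t) (2 * Real.pi - ε) + zeroCount (W t₀) = angleCount (W t) ε + n := by
    exact_mod_cast e4
  have e6 : angleCount (W t) (2 * Real.pi - ε) ≤ n := by
    unfold angleCount
    refine (Finset.card_le_univ _).trans (by simp)
  omega

theorem IsPreconnected.eq_of_eventually_eq {β : Type*} {s : Set ι} (hs : IsPreconnected s)
    {f : ι → β} (h : ∀ t ∈ s, ∀ᶠ u in 𝓝[s] t, f u = f t) {a b : ι} (ha : a ∈ s) (hb : b ∈ s) :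
    f a = f b :=
  hs.induction₂ (fun x y => f x = f y) (fun x hx => (h x hx).mono fun _ hy => hy.symm)
    (fun _ _ _ _ _ _ => Eq.trans) (fun _ _ _ _ => Eq.symm) ha hb

/-- If the multiplicity of `-1` does not drop near any point, there is no flow through `-1`. -/
theorem lift_sub_angleSum_eq_of_zeroCount {W : ι → Matrix (Fin n) (Fin n) ℂ} {s : Set ι}
    (hs : IsPreconnected s) (hW : ContinuousOn W s) (hU : ∀ t ∈ s, (W t)ᴴ * W t = 1)
    {α : ι → ℝ} (hα : ContinuousOn α s)
    (hαW : ∀ t ∈ s, Complex.exp (α t * Complex.I) = (-W t).det)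
    (hz : ∀ t ∈ s, ∀ᶠ u in 𝓝[s] t, zeroCount (W t) ≤ zeroCount (W u)) {a b : ι}
    (ha : a ∈ s) (hb : b ∈ s) : α a - angleSum (W a) = α b - angleSum (W b) := by
  refine IsPreconnected.eq_of_eventually_eq hs (f := fun t => α t - angleSum (W t))
    (fun t ht => ?_) ha hb
  obtain ⟨ε, h1, -, -, h2⟩ :=
    eventually_lift_sub_angleSum ht (hW t ht) hU (hα t ht) hαW one_pos
  filter_upwards [h2, hz t ht] with u hu hu'
  have h3 := zeroCount_le_angleCount (W u) h1
  have h4 : angleCount (W u) ε = zeroCount (W t) := by omega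
  have h5 := hu.1
  rw [h4] at h5
  linarith

/-- The change of the argument function at a point where all eigenvalues at `-1` leave
clockwise. -/
theorem lift_sub_angleSum_crossing {W : ℝ → Matrix (Fin n) (Fin n) ℂ} {s : Set ℝ} {t₀ : ℝ}
    (ht₀ : t₀ ∈ s) (hW : ContinuousWithinAt W s t₀) (hU : ∀ t ∈ s, (W t)ᴴ * W t = 1)
    {α : ℝ → ℝ} (hα : ContinuousWithinAt α s t₀)
    (hαW : ∀ t ∈ s, Complex.exp (α t * Complex.I) = (-W t).det)
    (hcr : ∃ ε > 0, ∀ᶠ t in 𝓝[s \ {t₀}] t₀, ∀ θ : ℝ, |θ| ≤ ε → 0 ≤ θ * (t - t₀) →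
      circlePoint θ ∉ spectrum ℂ (W t)) :
    ∀ᶠ t in 𝓝[s] t₀, α t - angleSum (W t)
      = α t₀ - angleSum (W t₀) - (if t₀ < t then 2 * Real.pi * zeroCount (W t₀) else 0) ∧
      (t ≠ t₀ → zeroCount (W t) = 0) := by
  obtain ⟨ε₀, hε₀, hcr⟩ := hcr
  obtain ⟨ε, h1, h2, h3, h4⟩ :=
    eventually_lift_sub_angleSum ht₀ hW hU hα hαW hε₀
  have hcr' : ∀ᶠ t in 𝓝[s] t₀, t ≠ t₀ → ∀ θ : ℝ, |θ| ≤ ε₀ → 0 ≤ θ * (t - t₀) →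
      circlePoint θ ∉ spectrum ℂ (W t) := by
    rw [eventually_nhdsWithin_iff] at hcr ⊢
    filter_upwards [hcr] with t ht hts hne
    exact ht ⟨hts, hne⟩
  filter_upwards [h4, hcr', self_mem_nhdsWithin] with t ht ht' hts
  by_cases hne : t = t₀
  · subst hne; simp
  have hc := ht' hne
  have hnot : ∀ i, ∀ θ : ℝ, |θ| ≤ ε₀ → 0 ≤ θ * (t - t₀) → circlePoint (angles (W t) i)
      ≠ circlePoint θ := fun i θ h h' e =>
    hc θ h h' ((circlePoint_mem_spectrum_iff (hU t hts) _).2 ⟨i, e⟩)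
  have hz : zeroCount (W t) = 0 := by
    rw [zeroCount, Finset.card_eq_zero, Finset.filter_eq_empty_iff]
    intro i _ hi
    exact hnot i 0 (by simp [hε₀.le]) (by simp) (by rw [hi])
  refine ⟨?_, fun _ => hz⟩
  rcases lt_or_gt_of_ne hne with hlt | hgt
  · rw [if_neg (not_lt.2 hlt.le)]
    have h5 : angleCount (W t) (2 * Real.pi - ε) = n := by
      unfold angleCount
      rw [Finset.filter_true_of_mem]
      · simp
      · intro i _
        by_contra hcon
        push Not at hcon
        have hi := (angles_mem (hU t hts) i).2
        refine hnot i (angles (W t) i - 2 * Real.pi) ?_ ?_ ?_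
        · rw [abs_le]; constructor <;> linarith
        · exact mul_nonneg_of_nonpos_of_nonpos (by linarith) (by linarith)
        · rw [← circlePoint_add_two_pi (angles (W t) i - 2 * Real.pi)]
          congr 1; ring
    have h6 : angleCount (W t) ε = zeroCount (W t₀) := by omega
    have h7 := ht.1
    rw [h6] at h7
    linarith
  · rw [if_pos hgt]
    have h5 : angleCount (W t) ε = 0 := by
      rw [angleCount, Finset.card_eq_zero, Finset.filter_eq_empty_iff]
      intro i _ hi
      have hi0 := (angles_mem (hU t hts) i).1
      refine hnot i (angles (W t) i) ?_ ?_ rfl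
      · rw [abs_le]; constructor <;> linarith
      · exact mul_nonneg hi0 (by linarith)
    have h7 := ht.1
    rw [h5] at h7
    push_cast at h7
    linarith

end SpectralFlow

section Concat

variable {n : ℕ}

theorem IsSpectralFlow.refl {ι : Type*} [Preorder ι]
    (W : ι → Matrix (Fin n) (Fin n) ℂ) (a : ι) :
    IsSpectralFlow W a a 0 :=
  ⟨0, fun _ => a, fun _ => 1, rfl, rfl, by simp, by simp⟩

theorem IsSpectralFlow.concat {ι : Type*} [PartialOrder ι]
    {W : ι → Matrix (Fin n) (Fin n) ℂ} {a b c : ι} {m : ℤ}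
    (h : IsSpectralFlow W a b m) (hbc : b ≤ c) {ε : ℝ} (hε : 0 < ε) (hε' : ε < Real.pi)
    (hs : ∀ s ∈ Set.Icc b c, circlePoint ε ∉ spectrum ℂ (W s) ∧
      circlePoint (-ε) ∉ spectrum ℂ (W s)) : ∃ m', IsSpectralFlow W a c m' := by
  rcases hbc.eq_or_lt with rfl | hbc
  · exact ⟨m, h⟩
  obtain ⟨N, t, e, h0, hN, hj, -⟩ := h
  refine ⟨_, N + 1, fun j => if j ≤ N then t j else c, fun j => if j < N then e j else ε,
    by simp [h0], by simp, fun j hjN => ?_, rfl⟩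
  rcases (Nat.lt_succ_iff.1 hjN).eq_or_lt with rfl | hlt
  · simpa [hN, hε, hε', hbc] using hs
  · have h1 : j ≤ N := hlt.le
    have h2 : j + 1 ≤ N := hlt
    simpa [h1, h2, hlt] using hj j hlt

end Concat

section Partition

open Matrix

variable {n : ℕ} {ι : Type*} [ConditionallyCompleteLinearOrder ι] [TopologicalSpace ι]
  [OrderTopology ι] [DenselyOrdered ι]

theorem exists_isSpectralFlow {W : ι → Matrix (Fin n) (Fin n) ℂ} {a b : ι} (hab : a ≤ b)
    (hW : ContinuousOn W (Set.Icc a b)) (hU : ∀ t ∈ Set.Icc a b, (W t)ᴴ * W t = 1) :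
    ∃ m, IsSpectralFlow W a b m := by
  have hgap : ∀ t ∈ Set.Icc a b, ∃ ε, 0 < ε ∧ ε < Real.pi ∧ ∀ᶠ s in 𝓝[Set.Icc a b] t,
      circlePoint ε ∉ spectrum ℂ (W s) ∧ circlePoint (-ε) ∉ spectrum ℂ (W s) := by
    intro t ht
    obtain ⟨ε, h1, -, h3, h4⟩ := exists_gap (hU t ht) one_pos
    obtain ⟨h5, h6⟩ := circlePoint_notMem_of_gap (hU t ht) h1 h3 h4
    refine ⟨ε, h1, h3, ?_⟩
    have h7 : circlePoint (-ε) ∉ spectrum ℂ (W t) := by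
      rw [← circlePoint_add_two_pi, neg_add_eq_sub]; exact h6
    exact (eventually_notMem_spectrum (hW t ht) h5).and (eventually_notMem_spectrum (hW t ht) h7)
  set S : Set ι := {x | ∀ y ∈ Set.Icc a x, ∃ m, IsSpectralFlow W a y m} with hS
  -- points near a point of `S`, inside a window without spectrum at `±ε`
  have hwin : ∀ t ∈ Set.Icc a b, ∃ ε, 0 < ε ∧ ε < Real.pi ∧ ∀ᶠ x in 𝓝[Set.Icc a b] t,
      ∀ s ∈ Set.uIcc t x, circlePoint ε ∉ spectrum ℂ (W s) ∧
        circlePoint (-ε) ∉ spectrum ℂ (W s) := by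
    intro t ht
    obtain ⟨ε, h1, h2, h3⟩ := hgap t ht
    refine ⟨ε, h1, h2, ?_⟩
    rw [eventually_nhdsWithin_iff] at h3 ⊢
    have h4 : ∀ᶠ x in 𝓝 t, ∀ s ∈ Set.uIcc t x, s ∈ Set.Icc a b →
        circlePoint ε ∉ spectrum ℂ (W s) ∧ circlePoint (-ε) ∉ spectrum ℂ (W s) := by
      have h5 : Tendsto (fun x => Set.uIcc t x) (𝓝 t) (𝓝 t).smallSets :=
        tendsto_const_nhds.uIcc tendsto_id
      exact h5.eventually (eventually_smallSets_forall.2 h3)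
    filter_upwards [h4] with x hx hxab s hs
    exact hx s hs (Set.uIcc_subset_Icc ht hxab hs)
  have hstep : ∀ p ∈ S, a ≤ p → ∀ q, p ≤ q → (∃ ε, 0 < ε ∧ ε < Real.pi ∧ ∀ s ∈ Set.Icc p q,
      circlePoint ε ∉ spectrum ℂ (W s) ∧ circlePoint (-ε) ∉ spectrum ℂ (W s)) → q ∈ S := by
    rintro p hp hap q hpq ⟨ε, h1, h2, h3⟩ y hy
    rcases le_total y p with hyp | hyp
    · exact hp y ⟨hy.1, hyp⟩
    · obtain ⟨m, hm⟩ := hp p ⟨hap, le_rfl⟩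
      exact hm.concat hyp h1 h2 fun s hs => h3 s ⟨hs.1, hs.2.trans hy.2⟩
  have key : Set.Icc a b ⊆ S := by
    refine IsClosed.Icc_subset_of_forall_mem_nhdsWithin ?_ ?_ ?_
    · refine isClosed_of_closure_subset fun x hx => ?_
      have hxab : x ∈ Set.Icc a b :=
        isClosed_Icc.closure_subset_iff.2 Set.inter_subset_right hx
      refine ⟨?_, hxab⟩
      obtain ⟨ε, h1, h2, h3⟩ := hwin x hxab
      rw [eventually_nhdsWithin_iff] at h3
      obtain ⟨x', hx', hx'S⟩ := (mem_closure_iff_frequently.1 hx).and_eventually h3 |>.exists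
      rcases le_total x x' with h | h
      · exact fun y hy => hx'.1 y ⟨hy.1, hy.2.trans h⟩
      · refine hstep x' hx'.1 hx'.2.1 x h ⟨ε, h1, h2, fun s hs => hx'S hx'.2 s ?_⟩
        rw [Set.uIcc_of_ge h]; exact hs
    · intro y hy
      have : y = a := le_antisymm hy.2 hy.1
      exact ⟨0, this ▸ IsSpectralFlow.refl W a⟩
    · rintro x ⟨hxS, hx⟩
      obtain ⟨ε, h1, h2, h3⟩ := hwin x ⟨hx.1, hx.2.le⟩
      have h4 : 𝓝[>] x ≤ 𝓝[Set.Icc a b] x :=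
        nhdsWithin_le_of_mem (mem_of_superset (Ioc_mem_nhdsGT hx.2)
          fun y hy => ⟨hx.1.trans hy.1.le, hy.2⟩)
      filter_upwards [h4 h3, self_mem_nhdsWithin] with y hy hxy
      refine hstep x hxS hx.1 y (le_of_lt hxy) ⟨ε, h1, h2, fun s hs => hy s ?_⟩
      rw [Set.uIcc_of_le (le_of_lt hxy)]; exact hs
  exact key (Set.right_mem_Icc.2 hab) b ⟨hab, le_rfl⟩

/-- The spectral flow in terms of a continuous argument of `det (-W)`. -/
theorem IsSpectralFlow.eq_lift {W : ι → Matrix (Fin n) (Fin n) ℂ} {a b : ι} {m : ℤ}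
    (h : IsSpectralFlow W a b m)
    (hW : ContinuousOn W (Set.Icc a b)) (hU : ∀ t ∈ Set.Icc a b, (W t)ᴴ * W t = 1)
    {α : ι → ℝ} (hα : ContinuousOn α (Set.Icc a b))
    (hαW : ∀ t ∈ Set.Icc a b, Complex.exp (α t * Complex.I) = (-W t).det) :
    2 * Real.pi * m = (α b - angleSum (W b)) - (α a - angleSum (W a)) := by
  obtain ⟨N, t, ε, rfl, rfl, hj, rfl⟩ := h
  have hpi := Real.pi_pos
  have hmono : ∀ i j, i ≤ j → j ≤ N → t i ≤ t j := by
    intro i j hij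
    induction j, hij using Nat.le_induction with
    | base => exact fun _ => le_rfl
    | succ j _ ih => exact fun h => (ih (by omega)).trans (hj j h).1.le
  have hseg : ∀ j < N, 2 * Real.pi * ((arcCount (W (t (j + 1))) (ε j) : ℝ)
      - arcCount (W (t j)) (ε j)) = (α (t (j + 1)) - angleSum (W (t (j + 1))))
        - (α (t j) - angleSum (W (t j))) := by
    intro j hjN
    obtain ⟨h1, h2, h3, h4⟩ := hj j hjN
    have hsub : Set.Icc (t j) (t (j + 1)) ⊆ Set.Icc (t 0) (t N) :=
      Set.Icc_subset_Icc (hmono 0 j (by omega) hjN.le) (hmono (j + 1) N hjN le_rfl)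
    have h5 := IsPreconnected.eq_of_eventually_eq (s := Set.Icc (t j) (t (j + 1)))
      isPreconnected_Icc
      (f := fun s => α s - angleSum (W s) - 2 * Real.pi * angleCount (W s) (ε j))
      (fun s hs => lift_sub_angleSum_eventually_eq hs ((hW s (hsub hs)).mono hsub)
        (fun u hu => hU u (hsub hu)) ((hα s (hsub hs)).mono hsub)
        (fun u hu => hαW u (hsub hu)) h2 (by linarith) (h4 s hs).1)
      (Set.right_mem_Icc.2 h1.le) (Set.left_mem_Icc.2 h1.le)
    rw [arcCount_eq (hU _ (hsub (Set.right_mem_Icc.2 h1.le))) (by linarith),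
      arcCount_eq (hU _ (hsub (Set.left_mem_Icc.2 h1.le))) (by linarith)]
    linarith
  push_cast
  rw [Finset.mul_sum, Finset.sum_congr rfl fun j hj => hseg j (Finset.mem_range.1 hj)]
  exact Finset.sum_range_sub (fun j => α (t j) - angleSum (W (t j))) N

theorem two_pi_mul_maslovIndex {L₁ L₂ : ι → Submodule ℂ (Fin n ⊕ Fin n → ℂ)} {a b : ι}
    (hab : a ≤ b) (hW : ContinuousOn (fun t => souriauMatrix (L₁ t) (L₂ t)) (Set.Icc a b))
    (hU : ∀ t ∈ Set.Icc a b,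
      (souriauMatrix (L₁ t) (L₂ t))ᴴ * souriauMatrix (L₁ t) (L₂ t) = 1)
    {α : ι → ℝ} (hα : ContinuousOn α (Set.Icc a b))
    (hαW : ∀ t ∈ Set.Icc a b,
      Complex.exp (α t * Complex.I) = (-souriauMatrix (L₁ t) (L₂ t)).det) :
    2 * Real.pi * maslovIndex L₁ L₂ a b = (α b - angleSum (souriauMatrix (L₁ b) (L₂ b)))
      - (α a - angleSum (souriauMatrix (L₁ a) (L₂ a))) := by
  have h := exists_isSpectralFlow hab hW hU
  rw [maslovIndex, dif_pos h]
  exact h.choose_spec.eq_lift hW hU hα hαW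

end Partition

section LagrangianGeometry

open Matrix

variable {n : ℕ}

theorem IsFrame.mem_iff {X : Matrix (Fin n ⊕ Fin n) (Fin n) ℂ}
    {L : Submodule ℂ (Fin n ⊕ Fin n → ℂ)} (h : IsFrame X L) (v : Fin n ⊕ Fin n → ℂ) :
    v ∈ L ↔ ∃ c, X *ᵥ c = v := by
  rw [← h.2, ← Matrix.range_mulVecLin]
  rfl

theorem IsFrame.mulVec_injective {X : Matrix (Fin n ⊕ Fin n) (Fin n) ℂ}
    {L : Submodule ℂ (Fin n ⊕ Fin n → ℂ)} (h : IsFrame X L) :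
    Function.Injective X.mulVec := Matrix.mulVec_injective_iff.2 h.1

theorem exists_isFrame {L : Submodule ℂ (Fin n ⊕ Fin n → ℂ)} (h : Module.finrank ℂ L = n) :
    ∃ X, IsFrame X L := by
  let b := Module.finBasisOfFinrankEq ℂ L h
  refine ⟨Matrix.of fun i j => (b j : Fin n ⊕ Fin n → ℂ) i, ?_, ?_⟩
  · exact b.linearIndependent.map' L.subtype (Submodule.ker_subtype L)
  · have : Set.range (Matrix.of fun i j => (b j : Fin n ⊕ Fin n → ℂ) i).col
        = L.subtype '' Set.range b := by
      rw [← Set.range_comp]; rfl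
    rw [this, Submodule.span_image, b.span_eq, Submodule.map_subtype_top]

theorem frameOf_spec {L : Submodule ℂ (Fin n ⊕ Fin n → ℂ)} (h : Module.finrank ℂ L = n) :
    IsFrame (frameOf L) L := by
  have := exists_isFrame h
  rw [frameOf, dif_pos this]
  exact this.choose_spec

theorem IsFrame.isUnit_gram {X : Matrix (Fin n ⊕ Fin n) (Fin n) ℂ}
    {L : Submodule ℂ (Fin n ⊕ Fin n → ℂ)} (h : IsFrame X L) : IsUnit (Xᴴ * X).det := by
  rw [← Matrix.isUnit_iff_isUnit_det, ← Matrix.mulVec_injective_iff_isUnit]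
  refine (injective_iff_map_eq_zero (Matrix.mulVecLin (Xᴴ * X))).2 fun v hv => ?_
  have := (Matrix.conjTranspose_mul_self_mulVec_eq_zero X v).1 hv
  exact h.mulVec_injective (by simpa using this)

/-- `Q` is the matrix of the orthogonal projection onto `L`. -/
structure IsOrthProj (Q : Matrix (Fin n ⊕ Fin n) (Fin n ⊕ Fin n) ℂ)
    (L : Submodule ℂ (Fin n ⊕ Fin n → ℂ)) : Prop where
  hermitian : Qᴴ = Q
  map_id : ∀ v ∈ L, Q *ᵥ v = v
  map_mem : ∀ v, Q *ᵥ v ∈ L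

theorem IsOrthProj.unique {Q Q' : Matrix (Fin n ⊕ Fin n) (Fin n ⊕ Fin n) ℂ}
    {L : Submodule ℂ (Fin n ⊕ Fin n → ℂ)} (h : IsOrthProj Q L) (h' : IsOrthProj Q' L) :
    Q = Q' := by
  have e : ∀ {A B : Matrix (Fin n ⊕ Fin n) (Fin n ⊕ Fin n) ℂ}, IsOrthProj A L →
      IsOrthProj B L → A * B = B := fun {A B} hA hB => by
    refine Matrix.ext_of_mulVec_single fun i => ?_
    rw [← Matrix.mulVec_mulVec]
    exact hA.map_id _ (hB.map_mem _)
  calc Q = Qᴴ := h.hermitian.symm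
    _ = (Q' * Q)ᴴ := by rw [e h' h]
    _ = Q * Q' := by rw [conjTranspose_mul, h.hermitian, h'.hermitian]
    _ = Q' := e h h'

theorem IsFrame.isOrthProj {X : Matrix (Fin n ⊕ Fin n) (Fin n) ℂ}
    {L : Submodule ℂ (Fin n ⊕ Fin n → ℂ)} (h : IsFrame X L) :
    IsOrthProj (X * (Xᴴ * X)⁻¹ * Xᴴ) L := by
  have hG := h.isUnit_gram
  refine ⟨?_, fun v hv => ?_, fun v => ?_⟩
  · rw [conjTranspose_mul, conjTranspose_mul, conjTranspose_nonsing_inv, conjTranspose_mul,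
      conjTranspose_conjTranspose, Matrix.mul_assoc]
  · obtain ⟨c, rfl⟩ := (h.mem_iff v).1 hv
    rw [mulVec_mulVec, Matrix.mul_assoc, Matrix.mul_assoc, Matrix.nonsing_inv_mul _ hG,
      Matrix.mul_one]
  · rw [h.mem_iff]
    exact ⟨((Xᴴ * X)⁻¹ * Xᴴ) *ᵥ v, by rw [mulVec_mulVec, Matrix.mul_assoc]⟩

theorem isOrthProj_projMatrix {L : Submodule ℂ (Fin n ⊕ Fin n → ℂ)}
    (h : Module.finrank ℂ L = n) : IsOrthProj (projMatrix L) L :=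
  (frameOf_spec h).isOrthProj

theorem projMatrix_injective {L M : Submodule ℂ (Fin n ⊕ Fin n → ℂ)}
    (hL : Module.finrank ℂ L = n) (hM : Module.finrank ℂ M = n)
    (h : projMatrix L = projMatrix M) : L = M := by
  have h1 := isOrthProj_projMatrix hL
  have h2 := isOrthProj_projMatrix hM
  refine le_antisymm (fun v hv => ?_) (fun v hv => ?_)
  · rw [← h1.map_id v hv, h]; exact h2.map_mem v
  · rw [← h2.map_id v hv, ← h]; exact h1.map_mem v

theorem IsOrthProj.norm_apply_le {Q : Matrix (Fin n ⊕ Fin n) (Fin n ⊕ Fin n) ℂ}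
    {L : Submodule ℂ (Fin n ⊕ Fin n → ℂ)} (h : IsOrthProj Q L) (i j : Fin n ⊕ Fin n) :
    ‖Q i j‖ ≤ 1 := by
  have e : Q * Q = Q := by
    refine Matrix.ext_of_mulVec_single fun i => ?_
    rw [← Matrix.mulVec_mulVec]
    exact h.map_id _ (h.map_mem _)
  have hs : ∑ k, ‖Q i k‖ ^ 2 = (Q i i).re := by
    have h1 : (Q * Qᴴ) i i = Q i i := by rw [h.hermitian, e]
    rw [Matrix.mul_apply] at h1
    have h2 := congrArg Complex.re h1
    rw [← h2, Complex.re_sum]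
    refine Finset.sum_congr rfl fun k _ => ?_
    rw [conjTranspose_apply, Complex.star_def, Complex.mul_conj, Complex.normSq_eq_norm_sq,
      Complex.ofReal_re]
  have h1 : ∀ k, ‖Q i k‖ ^ 2 ≤ (Q i i).re := fun k => by
    rw [← hs]
    exact Finset.single_le_sum (f := fun k => ‖Q i k‖ ^ 2) (fun _ _ => sq_nonneg _)
      (Finset.mem_univ k)
  have h2 : (Q i i).re ≤ ‖Q i i‖ := Complex.re_le_norm _
  have h3 := h1 i
  have h4 : ‖Q i i‖ ≤ 1 := by
    by_contra hc
    push Not at hc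
    nlinarith
  have h5 := h1 j
  by_contra hc
  push Not at hc
  nlinarith

theorem IsOrthProj.trace_eq {Q : Matrix (Fin n ⊕ Fin n) (Fin n ⊕ Fin n) ℂ}
    {L : Submodule ℂ (Fin n ⊕ Fin n → ℂ)} (h : IsOrthProj Q L) :
    Q.trace = Module.finrank ℂ L := by
  have : LinearMap.IsProj L (Matrix.toLin' Q) :=
    ⟨fun v => by simpa using h.map_mem v, fun v hv => by simpa using h.map_id v hv⟩
  rw [← this.trace, Matrix.trace_toLin'_eq]

/-- Convergence in the Lagrangian Grassmannian from a closed graph property. -/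
theorem tendsto_projMatrix_of_closed {T : Type*} {l : Filter T}
    {L : T → Submodule ℂ (Fin n ⊕ Fin n → ℂ)} {M : Submodule ℂ (Fin n ⊕ Fin n → ℂ)}
    (hL : ∀ᶠ t in l, Module.finrank ℂ (L t) = n) (hM : Module.finrank ℂ M ≤ n)
    (hcl : ∀ g : Ultrafilter T, ↑g ≤ l → ∀ (u : T → Fin n ⊕ Fin n → ℂ)
      (w : Fin n ⊕ Fin n → ℂ), (∀ᶠ t in (g : Filter T), u t ∈ L t) →
      Tendsto u g (𝓝 w) → w ∈ M) :
    Tendsto (fun t => projMatrix (L t)) l (𝓝 (projMatrix M)) := by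
  rw [tendsto_iff_ultrafilter]
  intro g hg
  have hgL : ∀ᶠ t in (g : Filter T), IsOrthProj (projMatrix (L t)) (L t) :=
    (hL.filter_mono hg).mono fun t ht => isOrthProj_projMatrix ht
  have hcomp : IsCompact {Q : Matrix (Fin n ⊕ Fin n) (Fin n ⊕ Fin n) ℂ | ∀ i j, ‖Q i j‖ ≤ 1} := by
    have : {Q : Matrix (Fin n ⊕ Fin n) (Fin n ⊕ Fin n) ℂ | ∀ i j, ‖Q i j‖ ≤ 1}
        = Set.univ.pi fun _ => Set.univ.pi fun _ => Metric.closedBall (0 : ℂ) 1 := by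
      ext Q
      constructor
      · exact fun h i _ j _ => mem_closedBall_zero_iff.2 (h i j)
      · exact fun h i j => mem_closedBall_zero_iff.1 (h i trivial j trivial)
    rw [this]
    exact isCompact_univ_pi fun _ => isCompact_univ_pi fun _ => isCompact_closedBall _ _
  obtain ⟨Q, -, hQ⟩ := isCompact_iff_ultrafilter_le_nhds.1 hcomp
    (g.map fun t => projMatrix (L t)) (by
      rw [le_principal_iff]
      exact hgL.mono fun t ht i j => ht.norm_apply_le i j)
  have hQ : Tendsto (fun t => projMatrix (L t)) g (𝓝 Q) := hQ
  have hmul : Q * Q = Q := by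
    refine tendsto_nhds_unique (hQ.mul hQ) (hQ.congr' ?_)
    filter_upwards [hgL] with t ht
    symm
    refine Matrix.ext_of_mulVec_single fun i => ?_
    rw [← Matrix.mulVec_mulVec]
    exact ht.map_id _ (ht.map_mem _)
  have hherm : Qᴴ = Q := by
    refine tendsto_nhds_unique ((continuous_id.matrix_conjTranspose.tendsto Q).comp hQ)
      (hQ.congr' ?_)
    filter_upwards [hgL] with t ht
    exact ht.hermitian.symm
  have htr : Q.trace = n := by
    refine tendsto_nhds_unique ((continuous_id.matrix_trace.tendsto Q).comp hQ)
      (tendsto_const_nhds.congr' ?_)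
    filter_upwards [hgL, hL.filter_mono hg] with t ht ht'
    simp only [Function.comp_apply, id]
    rw [ht.trace_eq, ht']
  have hmem : ∀ v, Q *ᵥ v ∈ M := fun v => by
    refine hcl g hg (fun t => projMatrix (L t) *ᵥ v) _ (hgL.mono fun t ht => ht.map_mem v) ?_
    have : Continuous fun P : Matrix (Fin n ⊕ Fin n) (Fin n ⊕ Fin n) ℂ => P *ᵥ v := by fun_prop
    exact (this.tendsto Q).comp hQ
  set R := LinearMap.range (Matrix.mulVecLin Q) with hR
  have hQR : IsOrthProj Q R := by
    refine ⟨hherm, ?_, fun v => ⟨v, rfl⟩⟩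
    rintro _ ⟨v, rfl⟩
    rw [mulVecLin_apply, mulVec_mulVec, hmul]
  have hRM : R = M := by
    have h1 : R ≤ M := by rintro _ ⟨v, rfl⟩; exact hmem v
    refine Submodule.eq_of_le_of_finrank_le h1 ?_
    have h2 := hQR.trace_eq
    rw [htr] at h2
    have h3 : n = Module.finrank ℂ R := by exact_mod_cast h2
    omega
  have hfr : Module.finrank ℂ M = n := by
    have h2 := hQR.trace_eq
    rw [htr, hRM] at h2
    exact_mod_cast h2.symm
  rw [hRM] at hQR
  rw [← hQR.unique (isOrthProj_projMatrix hfr)]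
  exact hQ

/-- The symplectic form in coordinates. -/
theorem star_dotProduct_J_mulVec (v u : Fin n ⊕ Fin n → ℂ) :
    star v ⬝ᵥ Matrix.J (Fin n) ℂ *ᵥ u
      = ∑ i, (star (v (Sum.inr i)) * u (Sum.inl i) - star (v (Sum.inl i)) * u (Sum.inr i)) := by
  simp only [Matrix.J, dotProduct, Matrix.fromBlocks_mulVec, Fintype.sum_sum_type,
    Finset.sum_sub_distrib, Sum.elim_inl, Sum.elim_inr, Pi.star_apply, zero_mulVec, one_mulVec,
    neg_mulVec, zero_add, add_zero, Pi.neg_apply, Function.comp_apply, mul_neg,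
    Finset.sum_neg_distrib]
  ring

/-- `u` is isotropic for the symplectic form. -/
def IsIsotropic (L : Submodule ℂ (Fin n ⊕ Fin n → ℂ)) : Prop :=
  ∀ u ∈ L, ∀ v ∈ L, star v ⬝ᵥ Matrix.J (Fin n) ℂ *ᵥ u = 0

theorem IsIsotropic.finrank_le {L : Submodule ℂ (Fin n ⊕ Fin n → ℂ)} (h : IsIsotropic L) :
    Module.finrank ℂ L ≤ n := by
  have hJJ : Matrix.J (Fin n) ℂ * Matrix.J (Fin n) ℂ = -1 := Matrix.J_squared _ _
  have hinj : Function.Injective (Matrix.mulVecLin (Matrix.J (Fin n) ℂ)) := by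
    refine (injective_iff_map_eq_zero _).2 fun v hv => ?_
    have : (Matrix.J (Fin n) ℂ * Matrix.J (Fin n) ℂ) *ᵥ v = 0 := by
      rw [← mulVec_mulVec]
      rw [mulVecLin_apply] at hv
      rw [hv, mulVec_zero]
    rw [hJJ, neg_mulVec, one_mulVec] at this
    exact neg_eq_zero.1 this
  have hdisj : Disjoint L (L.map (Matrix.mulVecLin (Matrix.J (Fin n) ℂ))) := by
    rw [Submodule.disjoint_def]
    rintro v hv ⟨u, hu, rfl⟩
    have := h u hu _ hv
    rw [mulVecLin_apply] at this ⊢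
    exact dotProduct_star_self_eq_zero.1 (by rw [dotProduct_comm] at this; simpa [dotProduct_comm] using this)
  have h1 := Submodule.finrank_add_finrank_le_of_disjoint hdisj
  rw [← (Submodule.equivMapOfInjective _ hinj L).finrank_eq] at h1
  simp only [Module.finrank_fintype_fun_eq_card, Fintype.card_sum, Fintype.card_fin] at h1
  omega

theorem IsIsotropic.isLagrangian {L : Submodule ℂ (Fin n ⊕ Fin n → ℂ)} (h : IsIsotropic L)
    (hd : n ≤ Module.finrank ℂ L) : IsLagrangian L := ⟨le_antisymm h.finrank_le hd, h⟩

/-- The combination `x + i y` of the halves of `v = (x, y)`. -/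
def plusPart (v : Fin n ⊕ Fin n → ℂ) : Fin n → ℂ :=
  fun i => v (Sum.inl i) + Complex.I * v (Sum.inr i)

/-- The combination `x - i y` of the halves of `v = (x, y)`. -/
def minusPart (v : Fin n ⊕ Fin n → ℂ) : Fin n → ℂ :=
  fun i => v (Sum.inl i) - Complex.I * v (Sum.inr i)

theorem star_dotProduct_J_mulVec_eq (v u : Fin n ⊕ Fin n → ℂ) :
    star v ⬝ᵥ Matrix.J (Fin n) ℂ *ᵥ u
      = Complex.I / 2 * (star (plusPart v) ⬝ᵥ plusPart u - star (minusPart v) ⬝ᵥ minusPart u) := by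
  rw [star_dotProduct_J_mulVec]
  simp only [dotProduct, ← Finset.sum_sub_distrib, Finset.mul_sum]
  refine Finset.sum_congr rfl fun i _ => ?_
  simp only [Pi.star_apply, plusPart, minusPart, star_add, star_sub, star_mul', Complex.star_def, Complex.conj_I]
  linear_combination (-(starRingEnd ℂ) (v (Sum.inl i)) * u (Sum.inr i)
    + (starRingEnd ℂ) (v (Sum.inr i)) * u (Sum.inl i)) * Complex.I_sq

/-- The vector with prescribed `x + i y` and `x - i y`. -/
noncomputable def ofParts (p q : Fin n → ℂ) : Fin n ⊕ Fin n → ℂ :=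
  Sum.elim (fun i => (p i + q i) / 2) (fun i => (p i - q i) / (2 * Complex.I))

@[simp] theorem plusPart_ofParts (p q : Fin n → ℂ) : plusPart (ofParts p q) = p := by
  funext i
  simp only [plusPart, ofParts, Sum.elim_inl, Sum.elim_inr]
  field_simp
  ring

@[simp] theorem minusPart_ofParts (p q : Fin n → ℂ) : minusPart (ofParts p q) = q := by
  funext i
  simp only [minusPart, ofParts, Sum.elim_inl, Sum.elim_inr]
  field_simp
  ring

theorem ext_parts {u v : Fin n ⊕ Fin n → ℂ} (h : plusPart u = plusPart v)
    (h' : minusPart u = minusPart v) : u = v := by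
  have h1 : ∀ i, u (Sum.inl i) = v (Sum.inl i) ∧ u (Sum.inr i) = v (Sum.inr i) := fun i => by
    have e1 := congrFun h i
    have e2 := congrFun h' i
    simp only [plusPart, minusPart] at e1 e2
    constructor
    · linear_combination (e1 + e2) / 2
    · have : Complex.I * u (Sum.inr i) = Complex.I * v (Sum.inr i) := by
        linear_combination (e1 - e2) / 2
      exact mul_left_cancel₀ Complex.I_ne_zero this
  funext i
  rcases i with i | i
  · exact (h1 i).1
  · exact (h1 i).2

/-- The unitary matrix `(X + iY)(X - iY)⁻¹` of a Lagrangian subspace with frame `(X; Y)`. -/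
noncomputable def lagUnitary (L : Submodule ℂ (Fin n ⊕ Fin n → ℂ)) : Matrix (Fin n) (Fin n) ℂ :=
  ((frameOf L).toRows₁ + Complex.I • (frameOf L).toRows₂)
    * ((frameOf L).toRows₁ - Complex.I • (frameOf L).toRows₂)⁻¹

theorem plusPart_mulVec (Z : Matrix (Fin n ⊕ Fin n) (Fin n) ℂ) (c : Fin n → ℂ) :
    plusPart (Z *ᵥ c) = (Z.toRows₁ + Complex.I • Z.toRows₂) *ᵥ c := by
  funext i
  rw [add_mulVec, smul_mulVec]
  rfl

theorem minusPart_mulVec (Z : Matrix (Fin n ⊕ Fin n) (Fin n) ℂ) (c : Fin n → ℂ) :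
    minusPart (Z *ᵥ c) = (Z.toRows₁ - Complex.I • Z.toRows₂) *ᵥ c := by
  funext i
  rw [sub_mulVec, smul_mulVec]
  rfl

/-- For a frame of a Lagrangian subspace, `(X ± iY)ᴴ (X ± iY)` is the Gram matrix. -/
theorem IsFrame.gram_eq {Z : Matrix (Fin n ⊕ Fin n) (Fin n) ℂ}
    {L : Submodule ℂ (Fin n ⊕ Fin n → ℂ)} (h : IsFrame Z L) (hL : IsLagrangian L) :
    (Z.toRows₁ - Complex.I • Z.toRows₂)ᴴ * (Z.toRows₁ - Complex.I • Z.toRows₂) = Zᴴ * Z ∧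
    (Z.toRows₁ + Complex.I • Z.toRows₂)ᴴ * (Z.toRows₁ + Complex.I • Z.toRows₂) = Zᴴ * Z := by
  set A := Z.toRows₁ with hA
  set B := Z.toRows₂ with hB
  have hG : Zᴴ * Z = Aᴴ * A + Bᴴ * B := by
    conv_lhs => rw [← Matrix.fromRows_toRows Z]
    rw [conjTranspose_fromRows_eq_fromCols_conjTranspose, fromCols_mul_fromRows]
  have hJ : Bᴴ * A = Aᴴ * B := by
    ext i j
    have h1 : Z *ᵥ Pi.single i 1 ∈ L := (h.mem_iff _).2 ⟨_, rfl⟩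
    have h2 : Z *ᵥ Pi.single j 1 ∈ L := (h.mem_iff _).2 ⟨_, rfl⟩
    have h3 := hL.2 _ h2 _ h1
    rw [star_dotProduct_J_mulVec, Finset.sum_sub_distrib, sub_eq_zero] at h3
    simpa [Matrix.mul_apply, hA, hB, toRows₁, toRows₂] using h3
  constructor
  · rw [conjTranspose_sub, conjTranspose_smul, sub_mul, mul_sub, mul_sub, smul_mul_assoc,
      smul_mul_assoc, mul_smul_comm, mul_smul_comm, smul_smul, hJ, hG]
    simp
    abel
  · rw [conjTranspose_add, conjTranspose_smul, add_mul, mul_add, mul_add, smul_mul_assoc,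
      smul_mul_assoc, mul_smul_comm, mul_smul_comm, smul_smul, hJ, hG]
    simp

theorem IsFrame.isUnit_minus {Z : Matrix (Fin n ⊕ Fin n) (Fin n) ℂ}
    {L : Submodule ℂ (Fin n ⊕ Fin n → ℂ)} (h : IsFrame Z L) (hL : IsLagrangian L) :
    IsUnit (Z.toRows₁ - Complex.I • Z.toRows₂).det := by
  have h1 := h.isUnit_gram
  rw [← (h.gram_eq hL).1, det_mul] at h1
  exact isUnit_of_mul_isUnit_right h1

theorem IsFrame.isUnit_plus {Z : Matrix (Fin n ⊕ Fin n) (Fin n) ℂ}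
    {L : Submodule ℂ (Fin n ⊕ Fin n → ℂ)} (h : IsFrame Z L) (hL : IsLagrangian L) :
    IsUnit (Z.toRows₁ + Complex.I • Z.toRows₂).det := by
  have h1 := h.isUnit_gram
  rw [← (h.gram_eq hL).2, det_mul] at h1
  exact isUnit_of_mul_isUnit_right h1

theorem IsLagrangian.mem_iff {L : Submodule ℂ (Fin n ⊕ Fin n → ℂ)} (hL : IsLagrangian L)
    (v : Fin n ⊕ Fin n → ℂ) : v ∈ L ↔ plusPart v = lagUnitary L *ᵥ minusPart v := by
  have h := frameOf_spec hL.1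
  have hu := h.isUnit_minus hL
  rw [h.mem_iff, lagUnitary]
  constructor
  · rintro ⟨c, rfl⟩
    rw [plusPart_mulVec, minusPart_mulVec, mulVec_mulVec, Matrix.mul_assoc, nonsing_inv_mul _ hu,
      Matrix.mul_one]
  · intro e
    refine ⟨((frameOf L).toRows₁ - Complex.I • (frameOf L).toRows₂)⁻¹ *ᵥ minusPart v,
      ext_parts ?_ ?_⟩
    · rw [plusPart_mulVec, mulVec_mulVec, e]
    · rw [minusPart_mulVec, mulVec_mulVec, mul_nonsing_inv _ hu, one_mulVec]

theorem lagUnitary_unitary {L : Submodule ℂ (Fin n ⊕ Fin n → ℂ)} (hL : IsLagrangian L) :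
    (lagUnitary L)ᴴ * lagUnitary L = 1 := by
  have h := frameOf_spec hL.1
  have hu := h.isUnit_minus hL
  obtain ⟨h1, h2⟩ := h.gram_eq hL
  have hu' : IsUnit (((frameOf L).toRows₁ - Complex.I • (frameOf L).toRows₂)ᴴ).det := by
    rw [det_conjTranspose]; exact hu.star
  rw [lagUnitary, conjTranspose_mul, conjTranspose_nonsing_inv, Matrix.mul_assoc,
    ← Matrix.mul_assoc _ _ (((frameOf L).toRows₁ - Complex.I • (frameOf L).toRows₂)⁻¹), h2, ← h1,
    Matrix.mul_assoc, mul_nonsing_inv _ hu, Matrix.mul_one, nonsing_inv_mul _ hu']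

theorem lagUnitary_unitary' {L : Submodule ℂ (Fin n ⊕ Fin n → ℂ)} (hL : IsLagrangian L) :
    lagUnitary L * (lagUnitary L)ᴴ = 1 := mul_eq_one_comm.1 (lagUnitary_unitary hL)

theorem lagUnitary_eq {L : Submodule ℂ (Fin n ⊕ Fin n → ℂ)} (hL : IsLagrangian L) :
    lagUnitary L = (projMatrix L).toBlocks₁₁ - (projMatrix L).toBlocks₂₂
      + Complex.I • ((projMatrix L).toBlocks₁₂ + (projMatrix L).toBlocks₂₁) := by
  have h := frameOf_spec hL.1
  have hu := h.isUnit_minus hL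
  obtain ⟨h1, -⟩ := h.gram_eq hL
  have hu' : IsUnit (((frameOf L).toRows₁ - Complex.I • (frameOf L).toRows₂)ᴴ).det := by
    rw [det_conjTranspose]; exact hu.star
  rw [lagUnitary, projMatrix]
  set Z := frameOf L
  set A := Z.toRows₁ with hA
  set B := Z.toRows₂ with hB
  set G := (Zᴴ * Z)⁻¹ with hG
  have hinv : (A - Complex.I • B)⁻¹ = G * (Aᴴ + Complex.I • Bᴴ) := by
    have : Aᴴ + Complex.I • Bᴴ = (A - Complex.I • B)ᴴ := by
      rw [conjTranspose_sub, conjTranspose_smul]; simp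
    rw [this, hG, ← h1, Matrix.mul_inv_rev, Matrix.mul_assoc, nonsing_inv_mul _ hu', Matrix.mul_one]
  have hP : Z * G * Zᴴ = fromBlocks (A * G * Aᴴ) (A * G * Bᴴ) (B * G * Aᴴ) (B * G * Bᴴ) := by
    conv_lhs => rw [← Matrix.fromRows_toRows Z]
    rw [conjTranspose_fromRows_eq_fromCols_conjTranspose, fromRows_mul, fromRows_mul_fromCols]
  rw [hinv, hP, toBlocks_fromBlocks₁₁, toBlocks_fromBlocks₁₂, toBlocks_fromBlocks₂₁,
    toBlocks_fromBlocks₂₂]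
  simp only [mul_add, add_mul, smul_mul_assoc, mul_smul_comm, smul_add, smul_smul,
    Complex.I_mul_I, Matrix.mul_assoc]
  simp only [neg_smul, one_smul]
  abel

theorem souriauMatrix_eq {L₁ L₂ : Submodule ℂ (Fin n ⊕ Fin n → ℂ)} (h₂ : IsLagrangian L₂) :
    souriauMatrix L₁ L₂ = -(lagUnitary L₁ * (lagUnitary L₂)ᴴ) := by
  have h := frameOf_spec h₂.1
  have hu := h.isUnit_minus h₂
  have hu' := h.isUnit_plus h₂
  set D := (frameOf L₂).toRows₁ - Complex.I • (frameOf L₂).toRows₂ with hD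
  set E := (frameOf L₂).toRows₁ + Complex.I • (frameOf L₂).toRows₂ with hE
  have h3 : (lagUnitary L₂)ᴴ = D * E⁻¹ := by
    have h4 : lagUnitary L₂ * (D * E⁻¹) = 1 := by
      rw [lagUnitary, ← hD, ← hE, Matrix.mul_assoc, ← Matrix.mul_assoc D⁻¹,
        nonsing_inv_mul _ hu, Matrix.one_mul, mul_nonsing_inv _ hu']
    calc (lagUnitary L₂)ᴴ = (lagUnitary L₂)ᴴ * (lagUnitary L₂ * (D * E⁻¹)) := by
          rw [h4, Matrix.mul_one]
      _ = D * E⁻¹ := by rw [← Matrix.mul_assoc, lagUnitary_unitary h₂, Matrix.one_mul]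
  rw [h3, lagUnitary]
  simp only [souriauMatrix, ← hD, ← hE, Matrix.mul_assoc]

theorem souriauMatrix_unitary {L₁ L₂ : Submodule ℂ (Fin n ⊕ Fin n → ℂ)} (h₁ : IsLagrangian L₁)
    (h₂ : IsLagrangian L₂) : (souriauMatrix L₁ L₂)ᴴ * souriauMatrix L₁ L₂ = 1 := by
  rw [souriauMatrix_eq h₂, conjTranspose_neg, neg_mul_neg, conjTranspose_mul,
    conjTranspose_conjTranspose, Matrix.mul_assoc, ← Matrix.mul_assoc _ (lagUnitary L₁),
    lagUnitary_unitary h₁, Matrix.one_mul, lagUnitary_unitary' h₂]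

theorem det_neg_souriauMatrix {L₁ L₂ : Submodule ℂ (Fin n ⊕ Fin n → ℂ)}
    (h₂ : IsLagrangian L₂) :
    (-souriauMatrix L₁ L₂).det = (lagUnitary L₁).det * star (lagUnitary L₂).det := by
  rw [souriauMatrix_eq h₂, neg_neg, det_mul, det_conjTranspose]

theorem continuousWithinAt_lagUnitary {ι : Type*} [TopologicalSpace ι]
    {L : ι → Submodule ℂ (Fin n ⊕ Fin n → ℂ)} {s : Set ι} (h : IsLagrangianPath L s) :
    ContinuousOn (fun t => lagUnitary (L t)) s := by
  have h1 : Continuous fun P : Matrix (Fin n ⊕ Fin n) (Fin n ⊕ Fin n) ℂ =>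
      P.toBlocks₁₁ - P.toBlocks₂₂ + Complex.I • (P.toBlocks₁₂ + P.toBlocks₂₁) := by
    simp only [toBlocks₁₁, toBlocks₂₂, toBlocks₁₂, toBlocks₂₁]
    fun_prop
  exact (h1.comp_continuousOn h.2).congr fun t ht => lagUnitary_eq (h.1 t ht)

theorem continuousOn_souriauMatrix {ι : Type*} [TopologicalSpace ι]
    {L₁ L₂ : ι → Submodule ℂ (Fin n ⊕ Fin n → ℂ)} {s : Set ι} (h₁ : IsLagrangianPath L₁ s)
    (h₂ : IsLagrangianPath L₂ s) :
    ContinuousOn (fun t => souriauMatrix (L₁ t) (L₂ t)) s :=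
  (((continuousWithinAt_lagUnitary h₁).mul
    (continuous_id.matrix_conjTranspose.comp_continuousOn
      (continuousWithinAt_lagUnitary h₂))).neg).congr fun t ht => souriauMatrix_eq (h₂.1 t ht)

/-- The multiplicity of `-1` is the dimension of the intersection. -/
theorem zeroCount_souriauMatrix {L₁ L₂ : Submodule ℂ (Fin n ⊕ Fin n → ℂ)} (h₁ : IsLagrangian L₁)
    (h₂ : IsLagrangian L₂) :
    zeroCount (souriauMatrix L₁ L₂) = Module.finrank ℂ (L₁ ⊓ L₂ : Submodule ℂ _) := by
  rw [← finrank_eigenspace_neg_one (souriauMatrix_unitary h₁ h₂)]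
  have hE : ∀ p, p ∈ Module.End.eigenspace (Matrix.toLin' (souriauMatrix L₁ L₂)) (-1)
      ↔ (lagUnitary L₂)ᴴ *ᵥ p = (lagUnitary L₁)ᴴ *ᵥ p := fun p => by
    rw [Module.End.mem_eigenspace_iff, Matrix.toLin'_apply, souriauMatrix_eq h₂, neg_mulVec,
      neg_smul, one_smul, neg_inj, ← mulVec_mulVec]
    constructor
    · intro e
      conv_rhs => rw [← e, mulVec_mulVec, lagUnitary_unitary h₁, one_mulVec]
    · intro e
      rw [e, mulVec_mulVec, lagUnitary_unitary' h₁, one_mulVec]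
  have hmem : ∀ {L : Submodule ℂ (Fin n ⊕ Fin n → ℂ)}, IsLagrangian L → ∀ v,
      v ∈ L ↔ minusPart v = (lagUnitary L)ᴴ *ᵥ plusPart v := fun {L} hL v => by
    rw [hL.mem_iff]
    constructor
    · intro e; rw [e, mulVec_mulVec, lagUnitary_unitary hL, one_mulVec]
    · intro e; rw [e, mulVec_mulVec, lagUnitary_unitary' hL, one_mulVec]
  symm
  have hto : ∀ v : (L₁ ⊓ L₂ : Submodule ℂ _), plusPart v.1
      ∈ Module.End.eigenspace (Matrix.toLin' (souriauMatrix L₁ L₂)) (-1) := fun v => by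
    rw [hE, ← (hmem h₂ v.1).1 v.2.2, ← (hmem h₁ v.1).1 v.2.1]
  let f : (L₁ ⊓ L₂ : Submodule ℂ _) →ₗ[ℂ]
      Module.End.eigenspace (Matrix.toLin' (souriauMatrix L₁ L₂)) (-1) :=
    { toFun := fun v => ⟨plusPart v.1, hto v⟩
      map_add' := fun u v => by
        ext i
        simp only [plusPart, Submodule.coe_add, Pi.add_apply]
        ring
      map_smul' := fun c v => by
        ext i
        simp only [plusPart, Submodule.coe_smul, Pi.smul_apply, smul_eq_mul, RingHom.id_apply]
        ring }
  refine LinearEquiv.finrank_eq (LinearEquiv.ofBijective f ⟨?_, ?_⟩)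
  · intro u v huv
    have e : plusPart u.1 = plusPart v.1 := congrArg Subtype.val huv
    refine Subtype.ext (ext_parts e ?_)
    rw [(hmem h₁ u.1).1 u.2.1, (hmem h₁ v.1).1 v.2.1, e]
  · rintro ⟨p, hp⟩
    rw [hE] at hp
    refine ⟨⟨ofParts p ((lagUnitary L₁)ᴴ *ᵥ p), ?_, ?_⟩, ?_⟩
    · rw [SetLike.mem_coe, hmem h₁]; simp
    · rw [SetLike.mem_coe, hmem h₂]; simp [hp]
    · exact Subtype.ext (plusPart_ofParts _ _)

end LagrangianGeometry

section Crossing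

open Matrix

variable {n : ℕ}

theorem continuous_ofParts : Continuous fun pq : (Fin n → ℂ) × (Fin n → ℂ) =>
    ofParts pq.1 pq.2 := by
  refine continuous_pi fun i => ?_
  rcases i with i | i <;> simp only [ofParts, Sum.elim_inl, Sum.elim_inr] <;> fun_prop

theorem tendsto_mulVec {α m k : Type*} [Fintype k] {l : Filter α} {M : α → Matrix m k ℂ}
    {v : α → k → ℂ} {M₀ : Matrix m k ℂ} {v₀ : k → ℂ} (hM : Tendsto M l (𝓝 M₀))
    (hv : Tendsto v l (𝓝 v₀)) : Tendsto (fun t => M t *ᵥ v t) l (𝓝 (M₀ *ᵥ v₀)) := by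
  have h : Continuous fun p : Matrix m k ℂ × (k → ℂ) => p.1 *ᵥ p.2 :=
    Continuous.matrix_mulVec continuous_fst continuous_snd
  have h2 := (h.tendsto (M₀, v₀)).comp (hM.prodMk_nhds hv)
  exact h2

theorem ofParts_mem_iff {L : Submodule ℂ (Fin n ⊕ Fin n → ℂ)} (hL : IsLagrangian L)
    (p q : Fin n → ℂ) : ofParts p q ∈ L ↔ q = (lagUnitary L)ᴴ *ᵥ p := by
  rw [hL.mem_iff, plusPart_ofParts, minusPart_ofParts]
  constructor
  · intro e; rw [e, mulVec_mulVec, lagUnitary_unitary hL, one_mulVec]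
  · intro e; rw [e, mulVec_mulVec, lagUnitary_unitary' hL, one_mulVec]

set_option maxHeartbeats 1000000 in
/-- If the symplectic form of `z ∈ L t₀` with nearby `z' ∈ L t` is, to first order, a negative
multiple of `t - t₀`, then eigenvalues of the Souriau matrix pass `-1` clockwise. -/
theorem souriauMatrix_crossing {L₁ : Submodule ℂ (Fin n ⊕ Fin n → ℂ)} (h₁ : IsLagrangian L₁)
    {L : ℝ → Submodule ℂ (Fin n ⊕ Fin n → ℂ)} {s : Set ℝ} (hL : IsLagrangianPath L s) {t₀ : ℝ}
    (ht₀ : t₀ ∈ s)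
    (hcr : ∀ z ∈ L t₀, z ≠ 0 → ∀ (t : ℕ → ℝ) (z' : ℕ → Fin n ⊕ Fin n → ℂ),
      (∀ k, t k ∈ s ∧ t k ≠ t₀ ∧ z' k ∈ L (t k)) → Tendsto t atTop (𝓝 t₀) →
      Tendsto z' atTop (𝓝 z) → ∃ G : ℝ, 0 < G ∧
        Tendsto (fun k => star z ⬝ᵥ Matrix.J (Fin n) ℂ *ᵥ z' k / ((t₀ - t k : ℝ) : ℂ)) atTop
          (𝓝 (G : ℂ))) :
    ∃ ε > 0, ∀ᶠ t in 𝓝[s \ {t₀}] t₀, ∀ θ : ℝ, |θ| ≤ ε → 0 ≤ θ * (t - t₀) →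
      circlePoint θ ∉ spectrum ℂ (souriauMatrix L₁ (L t)) := by
  by_contra hcon
  push Not at hcon
  have hk : ∀ k : ℕ, ∃ t, t ∈ s ∧ t ≠ t₀ ∧ |t - t₀| < 1 / (k + 1 : ℝ) ∧ ∃ θ : ℝ,
      |θ| ≤ 1 / (k + 1 : ℝ) ∧ 0 ≤ θ * (t - t₀) ∧ ∃ v : Fin n → ℂ, ‖v‖ = 1 ∧
        (lagUnitary L₁ * (lagUnitary (L t))ᴴ) *ᵥ v = Complex.exp (θ * Complex.I) • v := by
    intro k
    have hpos : (0 : ℝ) < 1 / (k + 1 : ℝ) := by positivity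
    have h1 := hcon _ hpos
    have h2 : ∀ᶠ t in 𝓝[s \ {t₀}] t₀, (t ∈ s ∧ t ≠ t₀) ∧ |t - t₀| < 1 / (k + 1 : ℝ) := by
      refine (eventually_mem_nhdsWithin.mono fun t ht => ⟨ht.1, ht.2⟩).and ?_
      exact mem_nhdsWithin_of_mem_nhds (Metric.ball_mem_nhds t₀ hpos)
    obtain ⟨t, ⟨θ, hθ, hθ', hsp⟩, ⟨hts, hne⟩, hlt⟩ := (h1.and_eventually h2).exists
    refine ⟨t, hts, hne, hlt, θ, hθ, hθ', ?_⟩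
    rw [← Matrix.spectrum_toLin', ← Module.End.hasEigenvalue_iff_mem_spectrum] at hsp
    obtain ⟨v, hv⟩ := hsp.exists_hasEigenvector
    have hv0 : ‖v‖ ≠ 0 := norm_ne_zero_iff.2 hv.2
    have hv1 := hv.apply_eq_smul
    rw [Matrix.toLin'_apply, souriauMatrix_eq (hL.1 t hts), circlePoint_eq, neg_mulVec, neg_smul,
      neg_inj] at hv1
    refine ⟨((‖v‖⁻¹ : ℝ) : ℂ) • v, ?_, ?_⟩
    · rw [norm_smul, Complex.norm_real, norm_inv, norm_norm, inv_mul_cancel₀ hv0]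
    · rw [mulVec_smul, hv1, smul_comm]
  choose t hts hne hlt θ hθ hθ' v hv1 hv2 using hk
  obtain ⟨v₀, -, φ, hφ, hvφ⟩ := (isCompact_sphere (0 : Fin n → ℂ) 1).tendsto_subseq
    (x := v) (fun k => by simp [hv1 k])
  have hzero : Tendsto (fun k : ℕ => 1 / (k + 1 : ℝ)) atTop (𝓝 0) :=
    tendsto_one_div_add_atTop_nhds_zero_nat
  have ht : Tendsto (t ∘ φ) atTop (𝓝 t₀) := by
    refine (tendsto_iff_dist_tendsto_zero.2 ?_ : Tendsto t atTop (𝓝 t₀)).comp hφ.tendsto_atTop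
    exact squeeze_zero (fun _ => dist_nonneg) (fun k => (hlt k).le) hzero
  have hθ0 : Tendsto (θ ∘ φ) atTop (𝓝 0) := by
    refine Tendsto.comp ?_ hφ.tendsto_atTop
    exact squeeze_zero_norm (fun k => hθ k) hzero
  have hexp : Tendsto (fun k => Complex.exp (θ (φ k) * Complex.I)) atTop (𝓝 1) := by
    have : Continuous fun x : ℝ => Complex.exp (x * Complex.I) := by fun_prop
    have h := (this.tendsto 0).comp hθ0
    rw [Complex.ofReal_zero, zero_mul, Complex.exp_zero] at h
    exact h
  have hU : Tendsto (fun k => (lagUnitary (L (t (φ k))))ᴴ) atTop (𝓝 (lagUnitary (L t₀))ᴴ) := by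
    have h3 : Tendsto (t ∘ φ) atTop (𝓝[s] t₀) :=
      tendsto_nhdsWithin_iff.2 ⟨ht, Eventually.of_forall fun k => hts _⟩
    have h4 := ((continuousWithinAt_lagUnitary hL) t₀ ht₀).tendsto.comp h3
    exact (continuous_id.matrix_conjTranspose.tendsto _).comp h4
  have hq : Tendsto (fun k => (lagUnitary (L (t (φ k))))ᴴ *ᵥ v (φ k)) atTop
      (𝓝 ((lagUnitary (L t₀))ᴴ *ᵥ v₀)) := tendsto_mulVec hU hvφ
  have hfix : (lagUnitary L₁ * (lagUnitary (L t₀))ᴴ) *ᵥ v₀ = v₀ := by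
    have e1 : Tendsto (fun k => lagUnitary L₁ *ᵥ ((lagUnitary (L (t (φ k))))ᴴ *ᵥ v (φ k))) atTop
        (𝓝 (lagUnitary L₁ *ᵥ ((lagUnitary (L t₀))ᴴ *ᵥ v₀))) :=
      tendsto_mulVec tendsto_const_nhds hq
    have e2 : Tendsto (fun k => Complex.exp (θ (φ k) * Complex.I) • v (φ k)) atTop
        (𝓝 ((1 : ℂ) • v₀)) := hexp.smul hvφ
    rw [← mulVec_mulVec]
    rw [one_smul] at e2
    refine tendsto_nhds_unique e1 (e2.congr fun k => ?_)
    rw [← hv2 (φ k), mulVec_mulVec]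
  have hv₀n : ‖v₀‖ = 1 :=
    tendsto_nhds_unique ((continuous_norm.tendsto v₀).comp hvφ)
      (tendsto_const_nhds.congr fun k => (hv1 (φ k)).symm)
  have hv₀ : v₀ ≠ 0 := by rw [← norm_ne_zero_iff, hv₀n]; norm_num
  set z := ofParts v₀ ((lagUnitary (L t₀))ᴴ *ᵥ v₀) with hz
  have hz0 : z ≠ 0 := fun h => hv₀ (by
    rw [← plusPart_ofParts v₀ ((lagUnitary (L t₀))ᴴ *ᵥ v₀), ← hz, h]
    funext i; simp [plusPart])
  have hzL : z ∈ L t₀ := (ofParts_mem_iff (hL.1 t₀ ht₀) _ _).2 rfl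
  obtain ⟨G, hG, hlim⟩ := hcr z hzL hz0 (t ∘ φ)
    (fun k => ofParts (v (φ k)) ((lagUnitary (L (t (φ k))))ᴴ *ᵥ v (φ k)))
    (fun k => ⟨hts _, hne _, (ofParts_mem_iff (hL.1 _ (hts _)) _ _).2 rfl⟩) ht
    ((continuous_ofParts.tendsto (_, _)).comp (hvφ.prodMk_nhds hq))
  have hU₁ : (lagUnitary (L t₀))ᴴ *ᵥ v₀ = (lagUnitary L₁)ᴴ *ᵥ v₀ := by
    conv_rhs => rw [← hfix, mulVec_mulVec, ← Matrix.mul_assoc, lagUnitary_unitary h₁,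
      Matrix.one_mul]
  have hform : ∀ k, star z ⬝ᵥ Matrix.J (Fin n) ℂ *ᵥ
      (ofParts (v (φ k)) ((lagUnitary (L (t (φ k))))ᴴ *ᵥ v (φ k)))
      = Complex.I / 2 * ((1 - Complex.exp (θ (φ k) * Complex.I)) * (star v₀ ⬝ᵥ v (φ k))) := by
    intro k
    rw [star_dotProduct_J_mulVec_eq, hz]
    simp only [plusPart_ofParts, minusPart_ofParts]
    rw [hU₁, star_mulVec, conjTranspose_conjTranspose, ← dotProduct_mulVec, mulVec_mulVec, hv2,
      dotProduct_smul, smul_eq_mul]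
    ring
  have hβ : Tendsto (fun k => star v₀ ⬝ᵥ v (φ k)) atTop (𝓝 (star v₀ ⬝ᵥ v₀)) := by
    have : Continuous fun w : Fin n → ℂ => star v₀ ⬝ᵥ w := by fun_prop
    exact (this.tendsto v₀).comp hvφ
  have hβpos : 0 < star v₀ ⬝ᵥ v₀ := dotProduct_star_self_pos_iff.2 hv₀
  obtain ⟨b, hb, hbe⟩ : ∃ b : ℝ, 0 < b ∧ star v₀ ⬝ᵥ v₀ = (b : ℂ) := by
    obtain ⟨h1, h2⟩ := Complex.lt_def.1 hβpos
    exact ⟨(star v₀ ⬝ᵥ v₀).re, by simpa using h1, Complex.ext (by simp) (by simpa using h2.symm)⟩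
  rw [hbe] at hβ
  have hbne : (b : ℂ) ≠ 0 := by exact_mod_cast hb.ne'
  have hlim2 := ((hlim.div hβ hbne).mul_const (2 * Complex.I)).neg
  have hre : ∀ᶠ k in atTop, -(star z ⬝ᵥ Matrix.J (Fin n) ℂ *ᵥ
      (ofParts (v (φ k)) ((lagUnitary (L (t (φ k))))ᴴ *ᵥ v (φ k)))
        / (((t₀ - (t ∘ φ) k : ℝ)) : ℂ) / (star v₀ ⬝ᵥ v (φ k)) * (2 * Complex.I))
      = (1 - Complex.exp (θ (φ k) * Complex.I)) / ((t₀ - t (φ k) : ℝ) : ℂ) := by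
    filter_upwards [hβ.eventually_ne hbne] with k hk
    have h3 : ((t₀ - t (φ k) : ℝ) : ℂ) ≠ 0 := by
      exact_mod_cast sub_ne_zero.2 (hne (φ k)).symm
    rw [hform]
    simp only [Function.comp_apply]
    field_simp
    rw [Complex.I_sq]
    ring
  have hlim3 := (Complex.continuous_im.tendsto _).comp (hlim2.congr' hre)
  have hnn : ∀ k, 0 ≤ ((1 - Complex.exp (θ (φ k) * Complex.I)) / ((t₀ - t (φ k) : ℝ) : ℂ)).im := by
    intro k
    have hp := Real.pi_gt_three
    have hθk : |θ (φ k)| ≤ 1 := (hθ (φ k)).trans (by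
      rw [div_le_one (by positivity)]; linarith [Nat.cast_nonneg (α := ℝ) (φ k)])
    rw [abs_le] at hθk
    rw [Complex.div_ofReal_im, Complex.sub_im, Complex.one_im, Complex.exp_ofReal_mul_I_im, zero_sub]
    have h4 := hθ' (φ k)
    rcases lt_or_gt_of_ne (hne (φ k)) with h5 | h5
    · have h6 : θ (φ k) ≤ 0 := by nlinarith
      have := Real.sin_nonpos_of_nonpos_of_neg_pi_le h6 (by linarith)
      exact div_nonneg (by linarith) (by linarith)
    · have h6 : 0 ≤ θ (φ k) := by nlinarith
      have := Real.sin_nonneg_of_nonneg_of_le_pi h6 (by linarith)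
      exact div_nonneg_of_nonpos (by linarith) (by linarith)
  have hge := ge_of_tendsto' hlim3 hnn
  have hval : (-((G : ℂ) / (b : ℂ) * (2 * Complex.I))).im = -(2 * G / b) := by
    rw [← Complex.ofReal_div]
    simp
    ring
  rw [hval] at hge
  have : 0 < 2 * G / b := by positivity
  linarith

end Crossing

section IntegralEquations

variable {F : Type*} [NormedAddCommGroup F] [NormedSpace ℂ F] [CompleteSpace F]

/-- A linear integral equation with small kernel has a bounded continuous solution. -/
theorem exists_bounded_solution (μ : Measure ℝ) (k : ℝ → ℝ → F →L[ℂ] F) (g : ℝ → F)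
    (hg : Continuous g) {Cg : ℝ} (hgb : ∀ x, ‖g x‖ ≤ Cg)
    (hm : ∀ x, AEStronglyMeasurable (k x) μ)
    (hdom : ∀ x₀, ∃ bound : ℝ → ℝ, Integrable bound μ ∧
      ∀ᶠ x in 𝓝 x₀, ∀ᵐ s ∂μ, ‖k x s‖ ≤ bound s)
    (hcont : ∀ x₀, ∀ᵐ s ∂μ, ContinuousAt (fun x => k x s) x₀)
    {q : ℝ} (hq0 : 0 ≤ q) (hq1 : q < 1) (hq : ∀ x, ∫ s, ‖k x s‖ ∂μ ≤ q) :
    ∃ y : ℝ → F, Continuous y ∧ (∃ C, ∀ x, ‖y x‖ ≤ C) ∧ ∀ x, y x = g x + ∫ s, k x s (y s) ∂μ := by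
  have hint : ∀ x, Integrable (k x) μ := fun x => by
    obtain ⟨bound, hb, hx⟩ := hdom x
    exact hb.mono' (hm x) hx.self_of_nhds
  have hmeas : ∀ (y : BoundedContinuousFunction ℝ F) x,
      AEStronglyMeasurable (fun s => k x s (y s)) μ := fun y x =>
    ContinuousLinearMap.aestronglyMeasurable_comp₂
      (ContinuousLinearMap.id ℂ (F →L[ℂ] F)) (hm x) y.continuous.aestronglyMeasurable
  have hle : ∀ (y : BoundedContinuousFunction ℝ F) x s, ‖k x s (y s)‖ ≤ ‖k x s‖ * ‖y‖ :=
    fun y x s => (k x s).le_opNorm_of_le (y.norm_coe_le_norm s)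
  have hint2 : ∀ (y : BoundedContinuousFunction ℝ F) x, Integrable (fun s => k x s (y s)) μ :=
    fun y x => ((hint x).norm.mul_const ‖y‖).mono' (hmeas y x) (ae_of_all _ (hle y x))
  have hcontI : ∀ y : BoundedContinuousFunction ℝ F, Continuous fun x => ∫ s, k x s (y s) ∂μ := by
    intro y
    refine continuous_iff_continuousAt.2 fun x₀ => ?_
    obtain ⟨bound, hb, hx⟩ := hdom x₀
    refine continuousAt_of_dominated (bound := fun s => bound s * ‖y‖)
      (Eventually.of_forall fun x => hmeas y x) ?_ (hb.mul_const _) ?_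
    · filter_upwards [hx] with x hx
      filter_upwards [hx] with s hs
      exact (hle y x s).trans (mul_le_mul_of_nonneg_right hs (norm_nonneg _))
    · filter_upwards [hcont x₀] with s hs
      exact hs.clm_apply continuousAt_const
  have hbdd : ∀ (y : BoundedContinuousFunction ℝ F) x, ‖∫ s, k x s (y s) ∂μ‖ ≤ q * ‖y‖ := by
    intro y x
    calc ‖∫ s, k x s (y s) ∂μ‖ ≤ ∫ s, ‖k x s‖ * ‖y‖ ∂μ :=
          norm_integral_le_of_norm_le ((hint x).norm.mul_const _) (ae_of_all _ (hle y x))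
      _ = (∫ s, ‖k x s‖ ∂μ) * ‖y‖ := integral_mul_const _ _
      _ ≤ q * ‖y‖ := mul_le_mul_of_nonneg_right (hq x) (norm_nonneg _)
  let T : BoundedContinuousFunction ℝ F → BoundedContinuousFunction ℝ F := fun y =>
    BoundedContinuousFunction.ofNormedAddCommGroup (fun x => g x + ∫ s, k x s (y s) ∂μ)
      (hg.add (hcontI y)) (Cg + q * ‖y‖)
      (fun x => (norm_add_le _ _).trans (add_le_add (hgb x) (hbdd y x)))
  have hT : ContractingWith ⟨q, hq0⟩ T := by
    refine ⟨by exact_mod_cast hq1, LipschitzWith.of_dist_le_mul fun y z => ?_⟩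
    refine (BoundedContinuousFunction.dist_le (by positivity)).2 fun x => ?_
    have e : T y x - T z x = ∫ s, k x s ((y - z) s) ∂μ := by
      change (g x + ∫ s, k x s (y s) ∂μ) - (g x + ∫ s, k x s (z s) ∂μ) = _
      rw [add_sub_add_left_eq_sub, ← integral_sub (hint2 y x) (hint2 z x)]
      simp
    rw [dist_eq_norm, e, dist_eq_norm]
    exact hbdd (y - z) x
  obtain ⟨y, hy⟩ : ∃ y, T y = y := ⟨_, hT.fixedPoint_isFixedPt⟩
  exact ⟨y, y.continuous, ⟨_, y.norm_coe_le_norm⟩, fun x =>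
    (congrArg (fun y : BoundedContinuousFunction ℝ F => y x) hy).symm⟩

omit [CompleteSpace F] [NormedSpace ℂ F] in
/-- Gronwall's inequality in integral form. -/
theorem norm_le_of_integral_le {f : ℝ → F} (hf : Continuous f) {a b δ M : ℝ} (hM : 0 < M)
    (h : ∀ x ∈ Set.Icc a b, ‖f x‖ ≤ δ + M * ∫ s in a..x, ‖f s‖) {x : ℝ} (hx : x ∈ Set.Icc a b) :
    ‖f x‖ ≤ δ * Real.exp (M * (x - a)) := by
  have hd : ∀ x, HasDerivAt (fun x => ∫ s in a..x, ‖f s‖) ‖f x‖ x := fun x =>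
    intervalIntegral.integral_hasDerivAt_right (hf.norm.intervalIntegrable _ _)
      hf.norm.aestronglyMeasurable.stronglyMeasurableAtFilter hf.norm.continuousAt
  have hnn : ∀ x ∈ Set.Icc a b, 0 ≤ ∫ s in a..x, ‖f s‖ := fun x hx =>
    intervalIntegral.integral_nonneg hx.1 fun _ _ => norm_nonneg _
  have key := norm_le_gronwallBound_of_norm_deriv_right_le (f := fun x => ∫ s in a..x, ‖f s‖)
    (f' := fun x => ‖f x‖) (δ := 0) (K := M) (ε := δ) (a := a) (b := b)
    (fun x _ => (hd x).continuousAt.continuousWithinAt) (fun x _ => (hd x).hasDerivWithinAt)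
    (by simp) (fun x hx => by
      have hx' := Set.Ico_subset_Icc_self hx
      rw [norm_norm, Real.norm_of_nonneg (hnn x hx')]
      linarith [h x hx']) x hx
  rw [gronwallBound_of_K_ne_0 hM.ne', Real.norm_of_nonneg (hnn x hx)] at key
  have h1 : M * ∫ s in a..x, ‖f s‖ ≤ δ * (Real.exp (M * (x - a)) - 1) := by
    calc M * ∫ s in a..x, ‖f s‖
        ≤ M * (0 * Real.exp (M * (x - a)) + δ / M * (Real.exp (M * (x - a)) - 1)) :=
          mul_le_mul_of_nonneg_left key hM.le
      _ = δ * (Real.exp (M * (x - a)) - 1) := by field_simp; ring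
  linarith [h x hx]

/-- The fundamental theorem of calculus for absolutely continuous functions with a bounded
derivative. -/
theorem AbsolutelyContinuousOnInterval.sub_eq_integral {f h : ℝ → F} {a b C : ℝ} (hab : a ≤ b)
    (hf : AbsolutelyContinuousOnInterval f a b) (hh : IntervalIntegrable h volume a b)
    (hC : ∀ᵐ x, x ∈ Set.uIoc a b → ‖h x‖ ≤ C)
    (hd : ∀ᵐ x, x ∈ Set.Ioo a b → HasDerivAt f (h x) x) :
    f b - f a = ∫ x in a..b, h x := by
  have hii : ∀ x ∈ Set.uIcc a b, ∀ y ∈ Set.uIcc a b, IntervalIntegrable h volume x y :=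
    fun x hx y hy => hh.mono_set (Set.uIcc_subset_uIcc hx hy)
  have hLip : LipschitzOnWith (Real.toNNReal C) (fun x => ∫ s in a..x, h s) (Set.uIcc a b) := by
    refine LipschitzOnWith.of_dist_le_mul fun x hx y hy => ?_
    rw [dist_eq_norm, intervalIntegral.integral_interval_sub_left
      (hii a Set.left_mem_uIcc x hx) (hii a Set.left_mem_uIcc y hy), Real.dist_eq]
    refine (intervalIntegral.norm_integral_le_of_norm_le_const_ae (C := C) ?_).trans ?_
    · filter_upwards [hC] with s hs hs'
      rw [Set.uIcc_of_le hab] at hx hy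
      rw [Set.uIoc_of_le hab] at hs
      exact hs ⟨lt_of_le_of_lt (le_min hy.1 hx.1) hs'.1, hs'.2.trans (max_le hy.2 hx.2)⟩
    · exact mul_le_mul_of_nonneg_right (Real.le_coe_toNNReal C) (abs_nonneg _)
  have hAC := hf.sub hLip.absolutelyContinuousOnInterval
  obtain ⟨c, hc⟩ := hAC.const_of_ae_hasDerivAt_zero (by
    have hne : ∀ᵐ x : ℝ, x ≠ a ∧ x ≠ b := by
      have h1 : ∀ᵐ x : ℝ, x ∉ ({a, b} : Set ℝ) :=
        measure_eq_zero_iff_ae_notMem.1 ((Set.toFinite _).measure_zero _)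
      filter_upwards [h1] with x hx
      simpa using hx
    filter_upwards [hd, hne, hh.ae_hasDerivAt_integral] with x h1 h2 h3 hx
    have hx' := hx
    rw [Set.uIcc_of_le hab] at hx'
    have h4 := h1 ⟨lt_of_le_of_ne hx'.1 (Ne.symm h2.1), lt_of_le_of_ne hx'.2 h2.2⟩
    have h5 := h4.sub (h3 hx a Set.left_mem_uIcc)
    rw [sub_self] at h5
    exact h5)
  have e1 := hc a Set.left_mem_uIcc
  have e2 := hc b Set.right_mem_uIcc
  simp only [Pi.sub_apply, intervalIntegral.integral_same, sub_zero] at e1 e2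
  rw [e1, ← e2]
  abel

end IntegralEquations

section LinearODE

variable {E : Type*} [NormedAddCommGroup E] [NormedSpace ℂ E] [CompleteSpace E]

/-- A measurable bounded coefficient on the half-line. -/
structure BddCoef (A : ℝ → E →L[ℂ] E) (M : ℝ) : Prop where
  pos : 0 < M
  meas : AEStronglyMeasurable A halfLine
  bdd : ∀ᵐ s ∂halfLine, ‖A s‖ ≤ M

/-- Solutions of `y' = A y` on `[0, ∞)`, in integrated form. -/
structure IsIntSol (A : ℝ → E →L[ℂ] E) (y : ℝ → E) : Prop where
  cont : Continuous y
  eq : ∀ x, 0 ≤ x → y x = y 0 + ∫ s in (0)..x, A s (y s)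

theorem uIoc_subset_Ioi {a b : ℝ} (ha : 0 ≤ a) (hb : 0 ≤ b) : Set.uIoc a b ⊆ Set.Ioi 0 :=
  fun _ hx => lt_of_le_of_lt (le_min ha hb) hx.1

theorem ae_of_ae_halfLine {p : ℝ → Prop} (h : ∀ᵐ s ∂halfLine, p s) {a b : ℝ} (ha : 0 ≤ a)
    (hb : 0 ≤ b) : ∀ᵐ s, s ∈ Set.uIoc a b → p s := by
  rw [ae_restrict_iff' measurableSet_Ioi] at h
  filter_upwards [h] with s hs hs'
  exact hs (uIoc_subset_Ioi ha hb hs')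

variable {A : ℝ → E →L[ℂ] E} {M : ℝ}

omit [CompleteSpace E] in
theorem BddCoef.intervalIntegrable (hA : BddCoef A M) {y : ℝ → E} (hy : Continuous y) {a b : ℝ}
    (ha : 0 ≤ a) (hb : 0 ≤ b) : IntervalIntegrable (fun s => A s (y s)) volume a b := by
  rw [intervalIntegrable_iff]
  have hsub := uIoc_subset_Ioi ha hb
  have hm : AEStronglyMeasurable (fun s => A s (y s)) (volume.restrict (Set.uIoc a b)) :=
    ContinuousLinearMap.aestronglyMeasurable_comp₂
      (ContinuousLinearMap.id ℂ (E →L[ℂ] E)) (hA.meas.mono_set hsub) hy.aestronglyMeasurable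
  have hi : IntegrableOn (fun s => M * ‖y s‖) (Set.uIoc a b) :=
    ((continuous_const.mul hy.norm).intervalIntegrable a b).def'
  refine Integrable.mono' hi hm ?_
  rw [ae_restrict_iff' measurableSet_uIoc]
  filter_upwards [ae_of_ae_halfLine hA.bdd ha hb] with s hs hs'
  exact (A s).le_of_opNorm_le (hs hs') _

omit [CompleteSpace E] in
theorem BddCoef.norm_integral_le (hA : BddCoef A M) {y : ℝ → E} (hy : Continuous y) {a b : ℝ}
    (ha : 0 ≤ a) (hab : a ≤ b) :
    ‖∫ s in a..b, A s (y s)‖ ≤ M * ∫ s in a..b, ‖y s‖ := by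
  rw [← intervalIntegral.integral_const_mul]
  refine intervalIntegral.norm_integral_le_of_norm_le hab ?_
    ((continuous_const.mul hy.norm).intervalIntegrable a b)
  filter_upwards [ae_of_ae_halfLine hA.bdd ha (ha.trans hab)] with s hs hs'
  rw [← Set.uIoc_of_le hab] at hs'
  exact (A s).le_of_opNorm_le (hs hs') _

omit [CompleteSpace E] in
theorem IsIntSol.sub_eq {y : ℝ → E} (hA : BddCoef A M) (hy : IsIntSol A y) {a b : ℝ}
    (ha : 0 ≤ a) (hb : 0 ≤ b) : y b - y a = ∫ s in a..b, A s (y s) := by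
  rw [hy.eq a ha, hy.eq b hb, add_sub_add_left_eq_sub,
    intervalIntegral.integral_interval_sub_left (hA.intervalIntegrable hy.cont le_rfl hb)
      (hA.intervalIntegrable hy.cont le_rfl ha)]

omit [CompleteSpace E] in
theorem IsIntSol.norm_le {y : ℝ → E} (hA : BddCoef A M) (hy : IsIntSol A y) {a b : ℝ}
    (ha : 0 ≤ a) (hab : a ≤ b) : ‖y b‖ ≤ ‖y a‖ * Real.exp (M * (b - a)) := by
  refine norm_le_of_integral_le hy.cont hA.pos (a := a) (b := b) (fun x hx => ?_)
    (Set.right_mem_Icc.2 hab)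
  have h1 := hy.sub_eq hA ha (ha.trans hx.1)
  calc ‖y x‖ = ‖y a + ∫ s in a..x, A s (y s)‖ := by rw [← h1]; congr 1; abel
    _ ≤ _ := (norm_add_le _ _).trans (add_le_add_right (hA.norm_integral_le hy.cont ha hx.1) _)

omit [CompleteSpace E] in
theorem IsIntSol.norm_le_backward {y : ℝ → E} (hA : BddCoef A M) (hy : IsIntSol A y) {a b : ℝ}
    (ha : 0 ≤ a) (hab : a ≤ b) : ‖y a‖ ≤ ‖y b‖ * Real.exp (M * (b - a)) := by
  have key := norm_le_of_integral_le (f := fun t => y (b - t)) (by have := hy.cont; fun_prop)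
    hA.pos (a := 0) (b := b - a) (δ := ‖y b‖) (fun x hx => ?_) (x := b - a)
    (Set.right_mem_Icc.2 (by linarith))
  · simpa using key
  · have h0 : 0 ≤ b - x := by linarith [hx.2]
    have h1 := hy.sub_eq hA h0 (ha.trans hab)
    have h2 := hA.norm_integral_le hy.cont h0 (by linarith [hx.1] : b - x ≤ b)
    rw [intervalIntegral.integral_comp_sub_left (fun s => ‖y s‖) b, sub_zero]
    calc ‖y (b - x)‖ = ‖y b - ∫ s in (b - x)..b, A s (y s)‖ := by rw [← h1]; congr 1; abel
      _ ≤ _ := (norm_sub_le _ _).trans (add_le_add_right h2 _)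

omit [CompleteSpace E] in
theorem IsIntSol.sub {y z : ℝ → E} (hA : BddCoef A M) (hy : IsIntSol A y) (hz : IsIntSol A z) :
    IsIntSol A (y - z) := by
  refine ⟨hy.cont.sub hz.cont, fun x hx => ?_⟩
  simp only [Pi.sub_apply, map_sub]
  rw [intervalIntegral.integral_sub (hA.intervalIntegrable hy.cont le_rfl hx)
    (hA.intervalIntegrable hz.cont le_rfl hx), hy.eq x hx, hz.eq x hx]
  abel

omit [CompleteSpace E] in
/-- Solutions agreeing at one point of `[0, ∞)` agree on `[0, ∞)`. -/
theorem IsIntSol.unique {y z : ℝ → E} (hA : BddCoef A M) (hy : IsIntSol A y)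
    (hz : IsIntSol A z) {a x : ℝ} (ha : 0 ≤ a) (hx : 0 ≤ x) (h : y a = z a) : y x = z x := by
  have hd := hy.sub hA hz
  have h0 : ‖(y - z) a‖ = 0 := by simp [h]
  have : ‖(y - z) x‖ ≤ 0 := by
    rcases le_total a x with hax | hax
    · have := hd.norm_le hA ha hax
      rwa [h0, zero_mul] at this
    · have := hd.norm_le_backward hA hx hax
      rwa [h0, zero_mul] at this
  simpa [sub_eq_zero] using this

/-- Existence of solutions with given initial value. -/
theorem BddCoef.exists_isIntSol (hA : BddCoef A M) (c : E) :
    ∃ y : ℝ → E, y 0 = c ∧ IsIntSol A y := by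
  set K := 2 * M with hK
  have hKpos : 0 < K := by have := hA.pos; positivity
  set k : ℝ → ℝ → E →L[ℂ] E := fun x s =>
    if s ≤ x then ((Real.exp (-K * (x - s)) : ℝ) : ℂ) • A s
    else 0 with hk
  have hkm : ∀ x, AEStronglyMeasurable (k x) halfLine := fun x => by
    have h1 : AEStronglyMeasurable (fun s => ((Real.exp (-K * (x - s)) : ℝ) : ℂ) •
        A s) halfLine := by
      have hc : Continuous fun s : ℝ => ((Real.exp (-K * (x - s)) : ℝ) : ℂ) := by fun_prop
      exact hc.aestronglyMeasurable.smul hA.meas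
    have h2 := h1.indicator (measurableSet_Iic (a := x))
    refine h2.congr (Eventually.of_forall fun s => ?_)
    simp only [hk, Set.indicator, Set.mem_Iic]
  have hkn : ∀ x, ∀ᵐ s ∂halfLine, ‖k x s‖ ≤
      (Set.Ioc 0 x).indicator (fun s => M * Real.exp (-K * (x - s))) s := by
    intro x
    filter_upwards [hA.bdd, ae_restrict_mem measurableSet_Ioi] with s hs hs0
    by_cases h : s ≤ x
    · rw [Set.indicator_of_mem (show s ∈ Set.Ioc 0 x from ⟨hs0, h⟩)]
      have e : k x s = ((Real.exp (-K * (x - s)) : ℝ) : ℂ) •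
        A s := if_pos h
      rw [e, norm_smul, Complex.norm_real, Real.norm_eq_abs, Real.abs_exp, mul_comm]
      exact mul_le_mul_of_nonneg_right hs (Real.exp_pos _).le
    · have e : k x s = 0 := if_neg h
      rw [e, norm_zero]
      exact Set.indicator_nonneg (fun s _ => mul_nonneg hA.pos.le (Real.exp_pos _).le) _
  have hindint : ∀ x, Integrable
      ((Set.Ioc 0 x).indicator (fun s => M * Real.exp (-K * (x - s)))) halfLine := fun x => by
    refine (Integrable.mono_measure ?_ Measure.restrict_le_self)
    rw [integrable_indicator_iff measurableSet_Ioc]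
    exact (Continuous.integrableOn_Icc (by fun_prop)).mono_set Set.Ioc_subset_Icc_self
  have hkdom : ∀ x₀, ∃ bound : ℝ → ℝ, Integrable bound halfLine ∧
      ∀ᶠ x in 𝓝 x₀, ∀ᵐ s ∂halfLine, ‖k x s‖ ≤ bound s := by
    refine fun x₀ => ⟨(Set.Ioc 0 (x₀ + 1)).indicator (fun _ => M), ?_, ?_⟩
    · refine Integrable.mono_measure ?_ Measure.restrict_le_self
      rw [integrable_indicator_iff measurableSet_Ioc]
      exact integrableOn_const (by simp)
    · filter_upwards [Iio_mem_nhds (show x₀ < x₀ + 1 by linarith)] with x hx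
      filter_upwards [hkn x] with s hs
      refine hs.trans ?_
      refine (Set.indicator_le_indicator' fun h => ?_).trans
        (Set.indicator_le_indicator_of_subset (Set.Ioc_subset_Ioc_right (le_of_lt hx))
          (fun s => hA.pos.le) s)
      refine mul_le_of_le_one_right hA.pos.le (Real.exp_le_one_iff.2 ?_)
      nlinarith [h.2]
  have hkcont : ∀ x₀, ∀ᵐ s ∂halfLine, ContinuousAt (fun x => k x s) x₀ := by
    intro x₀
    have hne : ∀ᵐ s ∂halfLine, s ≠ x₀ :=
      ae_restrict_of_ae (by simp [ae_iff])
    filter_upwards [hne] with s hs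
    rcases lt_or_gt_of_ne hs with h | h
    · have hc : ContinuousAt (fun x => ((Real.exp (-K * (x - s)) : ℝ) : ℂ) •
          A s) x₀ := by fun_prop
      refine hc.congr ?_
      filter_upwards [Ioi_mem_nhds h] with x hx
      exact (if_pos (le_of_lt (Set.mem_Ioi.1 hx))).symm
    · refine (continuousAt_const (y := 0)).congr ?_
      filter_upwards [Iio_mem_nhds h] with x hx
      exact (if_neg (not_le.2 hx)).symm
  have hkq : ∀ x, ∫ s, ‖k x s‖ ∂halfLine ≤ 1 / 2 := by
    intro x
    refine (integral_mono_of_nonneg (Eventually.of_forall fun _ => norm_nonneg _) (hindint x)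
      (hkn x)).trans ?_
    rcases le_or_gt x 0 with hx | hx
    · simp [Set.Ioc_eq_empty (not_lt.2 hx)]
    rw [setIntegral_indicator measurableSet_Ioc,
      Set.inter_eq_self_of_subset_right (fun s hs => hs.1), ← intervalIntegral.integral_of_le hx.le]
    have hd : ∀ s ∈ Set.uIcc 0 x, HasDerivAt (fun s => 1 / 2 * Real.exp (-K * (x - s)))
        (M * Real.exp (-K * (x - s))) s := fun s _ => by
      have h1 : HasDerivAt (fun s => -K * (x - s)) K s := by
        simpa using ((hasDerivAt_id s).const_sub x).const_mul (-K)
      refine (h1.exp.const_mul (1 / 2)).congr_deriv ?_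
      rw [hK]; ring
    rw [intervalIntegral.integral_eq_sub_of_hasDerivAt hd
      (Continuous.intervalIntegrable (by fun_prop) _ _)]
    have := Real.exp_pos (-K * (x - 0))
    simp only [sub_self, mul_zero, Real.exp_zero]
    linarith
  obtain ⟨Z, hZc, ⟨C, hC⟩, hZ⟩ := exists_bounded_solution halfLine k
    (fun x => ((Real.exp (-K * max x 0) : ℝ) : ℂ) • c) (by fun_prop)
    (Cg := ‖c‖) (fun x => by
      rw [norm_smul, Complex.norm_real, Real.norm_eq_abs, Real.abs_exp]
      refine mul_le_of_le_one_left (norm_nonneg _) (Real.exp_le_one_iff.2 ?_)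
      have : 0 ≤ max x 0 := le_max_right _ _
      nlinarith)
    hkm hkdom hkcont (q := 1 / 2) (by norm_num) (by norm_num) hkq
  have h00 : Z 0 = c := by
    have : ∫ s, k 0 s (Z s) ∂halfLine = 0 := by
      rw [← integral_zero ℝ E (μ := halfLine)]
      refine integral_congr_ae ?_
      filter_upwards [ae_restrict_mem measurableSet_Ioi] with s hs
      simp only [hk, if_neg (not_le.2 (Set.mem_Ioi.1 hs)), _root_.zero_apply]
    rw [hZ 0, this]
    simp
  refine ⟨fun x => ((Real.exp (K * max x 0) : ℝ) : ℂ) • Z x, by simp [h00], by fun_prop,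
    fun x hx => ?_⟩
  simp only [max_self, mul_zero, Real.exp_zero, Complex.ofReal_one, one_smul, h00,
    max_eq_left hx]
  have e2 : ∫ s, k x s (Z s) ∂halfLine = ∫ s in (0)..x,
      ((Real.exp (-K * x) : ℝ) : ℂ) • A s (((Real.exp (K * max s 0) : ℝ) : ℂ) • Z s) := by
    rw [intervalIntegral.integral_of_le hx]
    have h1 : ∫ s, k x s (Z s) ∂halfLine = ∫ s in Set.Ioi 0, (Set.Ioc 0 x).indicator
        (fun s => ((Real.exp (-K * x) : ℝ) : ℂ) •
          A s (((Real.exp (K * max s 0) : ℝ) : ℂ) • Z s)) s := by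
      refine setIntegral_congr_fun measurableSet_Ioi fun s hs => ?_
      by_cases h : s ≤ x
      · rw [Set.indicator_of_mem (show s ∈ Set.Ioc 0 x from ⟨hs, h⟩)]
        simp only [hk, if_pos h, max_eq_left (le_of_lt (Set.mem_Ioi.1 hs))]
        rw [map_smul, smul_smul, ← Complex.ofReal_mul, ← Real.exp_add, _root_.smul_apply]
        congr 3
        ring_nf
      · rw [Set.indicator_of_notMem (fun h' => h h'.2)]
        simp only [hk, if_neg h, _root_.zero_apply]
    rw [h1, setIntegral_indicator measurableSet_Ioc,
      Set.inter_eq_self_of_subset_right (fun s hs => hs.1)]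
  rw [hZ x, e2, intervalIntegral.integral_smul, smul_add, smul_smul, smul_smul, max_eq_left hx,
    ← Complex.ofReal_mul, ← Real.exp_add]
  simp

/-- The fundamental solution. -/
theorem BddCoef.exists_fundamental (hA : BddCoef A M) :
    ∃ Φ : ℝ → E →L[ℂ] E, Continuous Φ ∧ Φ 0 = 1 ∧ ∀ c, IsIntSol A fun x => Φ x c := by
  have hL : BddCoef (fun s => ContinuousLinearMap.mul ℂ (E →L[ℂ] E) (A s)) M :=
    ⟨hA.pos, (ContinuousLinearMap.mul ℂ (E →L[ℂ] E)).continuous.comp_aestronglyMeasurable hA.meas,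
      hA.bdd.mono fun s hs => (ContinuousLinearMap.opNorm_mul_apply_le _ _ _).trans hs⟩
  obtain ⟨Φ, h0, hΦ⟩ := hL.exists_isIntSol 1
  refine ⟨Φ, hΦ.cont, h0, fun c => ⟨by have := hΦ.cont; fun_prop, fun x hx => ?_⟩⟩
  rw [hΦ.eq x hx, _root_.add_apply, ContinuousLinearMap.intervalIntegral_apply
    (hL.intervalIntegrable hΦ.cont le_rfl hx)]
  rfl

end LinearODE

section SolutionRegularity

variable {E : Type*} [NormedAddCommGroup E] [NormedSpace ℂ E]
  {A : ℝ → E →L[ℂ] E} {M : ℝ} {y : ℝ → E}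

theorem exists_norm_le_on_Icc {F : Type*} [NormedAddCommGroup F] {f : ℝ → F} (hf : Continuous f)
    (a b : ℝ) : ∃ C, 0 ≤ C ∧ ∀ x ∈ Set.Icc a b, ‖f x‖ ≤ C := by
  obtain ⟨C, hC⟩ := isCompact_Icc.exists_bound_of_continuousOn (s := Set.Icc a b) hf.continuousOn
  exact ⟨max C 0, le_max_right _ _, fun x hx => (hC x hx).trans (le_max_left _ _)⟩

theorem IsIntSol.exists_lipschitzOnWith (hA : BddCoef A M) (hy : IsIntSol A y) {a b : ℝ}
    (ha : 0 ≤ a) : ∃ K, LipschitzOnWith K y (Set.Icc a b) := by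
  obtain ⟨C, hC0, hC⟩ := exists_norm_le_on_Icc hy.cont a b
  refine ⟨Real.toNNReal (M * C), LipschitzOnWith.of_dist_le_mul fun s hs t ht => ?_⟩
  rw [Real.coe_toNNReal _ (mul_nonneg hA.pos.le hC0), dist_eq_norm, Real.dist_eq,
    hy.sub_eq hA (ha.trans ht.1) (ha.trans hs.1)]
  refine intervalIntegral.norm_integral_le_of_norm_le_const_ae ?_
  filter_upwards [ae_of_ae_halfLine hA.bdd (ha.trans ht.1) (ha.trans hs.1)] with r hr hr'
  refine (A r).le_of_opNorm_le_of_le (hr hr') (hC r ?_)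
  exact ⟨(le_min ht.1 hs.1).trans hr'.1.le, hr'.2.trans (max_le ht.2 hs.2)⟩

theorem IsIntSol.acLoc (hA : BddCoef A M) (hy : IsIntSol A y) : ACLoc y := fun b hb => by
  obtain ⟨K, hK⟩ := hy.exists_lipschitzOnWith hA le_rfl (b := b)
  rw [← Set.uIcc_of_le hb.le] at hK
  exact hK.absolutelyContinuousOnInterval

theorem IsIntSol.ae_hasDerivAt [CompleteSpace E] (hA : BddCoef A M) (hy : IsIntSol A y) :
    ∀ᵐ x ∂halfLine, HasDerivAt y (A x (y x)) x := by
  rw [ae_restrict_iff' measurableSet_Ioi]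
  have h : ∀ N : ℕ, ∀ᵐ x : ℝ, x ∈ Set.uIcc (0 : ℝ) N →
      HasDerivAt (fun x => ∫ s in (0)..x, A s (y s)) (A x (y x)) x := fun N => by
    filter_upwards [(hA.intervalIntegrable hy.cont le_rfl
      (Nat.cast_nonneg N)).ae_hasDerivAt_integral] with x hx hx'
    exact hx hx' 0 Set.left_mem_uIcc
  filter_upwards [ae_all_iff.2 h] with x hx hx0
  obtain ⟨N, hN⟩ := exists_nat_ge x
  have h1 := (hx N (by rw [Set.uIcc_of_le (Nat.cast_nonneg N)]; exact ⟨hx0.le, hN⟩)).const_add (y 0)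
  refine h1.congr_of_eventuallyEq ?_
  filter_upwards [Ioi_mem_nhds hx0] with s hs
  exact hy.eq s (le_of_lt hs)

theorem ACLoc.continuousOn {F : Type*} [SeminormedAddCommGroup F] {f : ℝ → F} (hf : ACLoc f) :
    ContinuousOn f (Set.Ici 0) := by
  intro x hx
  have hx0 : (0 : ℝ) ≤ x := hx
  have hx1 : (0 : ℝ) < x + 1 := by linarith
  have h0 : AbsolutelyContinuousOnInterval f 0 (x + 1) := hf (x + 1) hx1
  have h1 := AbsolutelyContinuousOnInterval.continuousOn h0
  rw [Set.uIcc_of_le hx1.le] at h1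
  have h2 : ContinuousWithinAt f (Set.Icc 0 (x + 1)) x := h1 x ⟨hx0, by linarith⟩
  refine h2.mono_of_mem_nhdsWithin ?_
  have h3 : Set.Ici 0 ∩ Set.Iio (x + 1) ∈ 𝓝[Set.Ici 0] x :=
    Filter.inter_mem self_mem_nhdsWithin (mem_nhdsWithin_of_mem_nhds (Iio_mem_nhds (by linarith)))
  exact Filter.mem_of_superset h3 fun s hs => ⟨hs.1, hs.2.le⟩

/-- Almost everywhere solutions are solutions of the integrated equation. -/
theorem ACLoc.isIntSol [CompleteSpace E] (hA : BddCoef A M) (hy : ACLoc y)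
    (hd : ∀ᵐ x ∂halfLine, HasDerivAt y (A x (y x)) x) : IsIntSol A fun x => y (max x 0) := by
  have hc : Continuous fun x => y (max x 0) :=
    hy.continuousOn.comp_continuous (by fun_prop) (fun x => le_max_right x 0)
  refine ⟨hc, fun x hx => ?_⟩
  rcases hx.eq_or_lt with rfl | hx
  · simp
  obtain ⟨C, hC0, hC⟩ := exists_norm_le_on_Icc hc 0 x
  have h := AbsolutelyContinuousOnInterval.sub_eq_integral (h := fun s => A s (y (max s 0)))
    (C := M * C) hx.le (hy x hx) (hA.intervalIntegrable hc le_rfl hx.le) ?_ ?_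
  · simp only [max_eq_left hx.le, max_self]
    rw [← h]; abel
  · filter_upwards [ae_of_ae_halfLine hA.bdd le_rfl hx.le] with s hs hs'
    refine (A s).le_of_opNorm_le_of_le (hs hs') (hC s ?_)
    rw [Set.uIoc_of_le hx.le] at hs'
    exact Set.Ioc_subset_Icc_self hs'
  · rw [ae_restrict_iff' measurableSet_Ioi] at hd
    filter_upwards [hd] with s hs hs'
    have := hs hs'.1
    rwa [max_eq_left hs'.1.le]

/-- Solutions on `[a, ∞)` are restrictions of solutions on `[0, ∞)`. -/
theorem IsIntSol.eq_of_integral_eq (hA : BddCoef A M) (hy : IsIntSol A y) {z : ℝ → E}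
    (hz : Continuous z) {a : ℝ} (ha : 0 ≤ a) (h : z a = y a)
    (hzeq : ∀ x, a ≤ x → z x = z a + ∫ s in a..x, A s (z s)) {x : ℝ} (hx : a ≤ x) : z x = y x := by
  have key := norm_le_of_integral_le (f := fun x => z x - y x) (hz.sub hy.cont) hA.pos (a := a)
    (b := x) (δ := 0) (fun t ht => ?_) (Set.right_mem_Icc.2 hx)
  · rw [zero_mul] at key
    exact sub_eq_zero.1 (norm_le_zero_iff.1 key)
  · have e : z t - y t = ∫ s in a..t, A s (z s - y s) := by
      simp only [map_sub]
      rw [intervalIntegral.integral_sub (hA.intervalIntegrable hz ha (ha.trans ht.1))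
        (hA.intervalIntegrable hy.cont ha (ha.trans ht.1)), ← hy.sub_eq hA ha (ha.trans ht.1),
        hzeq t ht.1, h]
      abel
    rw [e, zero_add]
    exact hA.norm_integral_le (hz.sub hy.cont) ha ht.1

/-- Continuous dependence on the coefficient and on the initial value. -/
theorem IsIntSol.norm_sub_le {A' : ℝ → E →L[ℂ] E} {M' : ℝ} {z : ℝ → E} (hA : BddCoef A M)
    (hA' : BddCoef A' M') (hy : IsIntSol A y) (hz : IsIntSol A' z) {δ C x : ℝ}
    (hδ0 : 0 ≤ δ) (hδ : ∀ᵐ s ∂halfLine, ‖A' s - A s‖ ≤ δ) (hx : 0 ≤ x)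
    (hC : ∀ s ∈ Set.Icc 0 x, ‖y s‖ ≤ C) :
    ‖z x - y x‖ ≤ (‖z 0 - y 0‖ + δ * C * x) * Real.exp (M' * x) := by
  have hC0 : 0 ≤ C := (norm_nonneg _).trans (hC 0 (Set.left_mem_Icc.2 hx))
  have key := norm_le_of_integral_le (f := fun x => z x - y x) (hz.cont.sub hy.cont) hA'.pos (a := 0)
    (b := x) (δ := ‖z 0 - y 0‖ + δ * C * x) (fun t ht => ?_) (Set.right_mem_Icc.2 hx)
  · rwa [sub_zero] at key
  · have i1 := hA'.intervalIntegrable hz.cont le_rfl ht.1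
    have i2 := hA'.intervalIntegrable hy.cont le_rfl ht.1
    have i3 := hA.intervalIntegrable hy.cont le_rfl ht.1
    have e : z t - y t = (z 0 - y 0) + ((∫ s in (0)..t, (A' s (y s) - A s (y s))) +
        ∫ s in (0)..t, A' s (z s - y s)) := by
      simp only [map_sub]
      rw [intervalIntegral.integral_sub i2 i3, intervalIntegral.integral_sub i1 i2,
        hz.eq t ht.1, hy.eq t ht.1]
      abel
    have hb : ‖∫ s in (0)..t, (A' s (y s) - A s (y s))‖ ≤ δ * C * |t - 0| := by
      refine intervalIntegral.norm_integral_le_of_norm_le_const_ae ?_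
      filter_upwards [ae_of_ae_halfLine hδ le_rfl ht.1] with s hs hs'
      rw [← _root_.sub_apply]
      refine (A' s - A s).le_of_opNorm_le_of_le (hs hs') (hC s ?_)
      rw [Set.uIoc_of_le ht.1] at hs'
      exact ⟨hs'.1.le, hs'.2.trans ht.2⟩
    rw [sub_zero, abs_of_nonneg ht.1] at hb
    have hb' : δ * C * t ≤ δ * C * x := mul_le_mul_of_nonneg_left ht.2 (mul_nonneg hδ0 hC0)
    rw [e]
    have h1 := hA'.norm_integral_le (hz.cont.sub hy.cont) le_rfl ht.1
    calc _ ≤ ‖z 0 - y 0‖ + (‖∫ s in (0)..t, (A' s (y s) - A s (y s))‖ +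
          ‖∫ s in (0)..t, A' s (z s - y s)‖) :=
          (norm_add_le _ _).trans (add_le_add_right (norm_add_le _ _) _)
      _ ≤ ‖z 0 - y 0‖ + (δ * C * x + M' * ∫ s in (0)..t, ‖z s - y s‖) :=
          add_le_add_right (add_le_add (hb.trans hb') h1) _
      _ = _ := by ring

variable {G : Type*} [NormedAddCommGroup G] [NormedSpace ℂ G] {A' : ℝ → G →L[ℂ] G} {M' : ℝ}
  {z : ℝ → G} {F : Type*} [NormedAddCommGroup F] [NormedSpace ℂ F]

/-- The product rule along solutions, in integrated form. -/
theorem IsIntSol.bilinear_sub_eq_integral [CompleteSpace E] [CompleteSpace G]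
    [CompleteSpace F]
    (B : E →L[ℝ] G →L[ℝ] F) (hA : BddCoef A M) (hA' : BddCoef A' M') (hy : IsIntSol A y)
    (hz : IsIntSol A' z) {a b : ℝ} (ha : 0 ≤ a) (hab : a ≤ b) :
    IntervalIntegrable (fun s => B (A s (y s)) (z s) + B (y s) (A' s (z s))) volume a b ∧
    B (y b) (z b) - B (y a) (z a) = ∫ s in a..b, (B (A s (y s)) (z s) + B (y s) (A' s (z s))) := by
  obtain ⟨C, hC0, hC⟩ := exists_norm_le_on_Icc hy.cont a b
  obtain ⟨D, hD0, hD⟩ := exists_norm_le_on_Icc hz.cont a b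
  have hb : 0 ≤ b := ha.trans hab
  have hbd : ∀ᵐ s, s ∈ Set.uIoc a b → ‖B (A s (y s)) (z s) + B (y s) (A' s (z s))‖ ≤
      ‖B‖ * (M * C) * D + ‖B‖ * C * (M' * D) := by
    filter_upwards [ae_of_ae_halfLine hA.bdd ha hb, ae_of_ae_halfLine hA'.bdd ha hb] with s h1 h2 hs
    have hs' : s ∈ Set.Icc a b := by
      rw [Set.uIoc_of_le hab] at hs; exact Set.Ioc_subset_Icc_self hs
    refine (norm_add_le _ _).trans (add_le_add ?_ ?_)
    · refine (B.le_opNorm₂ _ _).trans ?_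
      have := (A s).le_of_opNorm_le_of_le (h1 hs) (hC s hs')
      have := hD s hs'
      have := hA.pos
      gcongr
    · refine (B.le_opNorm₂ _ _).trans ?_
      have := (A' s).le_of_opNorm_le_of_le (h2 hs) (hD s hs')
      have := hC s hs'
      have := hA'.pos
      gcongr
  have hsub := uIoc_subset_Ioi ha hb
  have hii : IntervalIntegrable (fun s => B (A s (y s)) (z s) + B (y s) (A' s (z s))) volume a b := by
    rw [intervalIntegrable_iff]
    have m1 := (hA.intervalIntegrable hy.cont ha hb).def'.aestronglyMeasurable
    have m2 := (hA'.intervalIntegrable hz.cont ha hb).def'.aestronglyMeasurable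
    have m3 := (B.aestronglyMeasurable_comp₂ m1 hz.cont.aestronglyMeasurable).add
      (B.aestronglyMeasurable_comp₂ hy.cont.aestronglyMeasurable m2)
    refine Integrable.mono' (g := fun _ => ‖B‖ * (M * C) * D + ‖B‖ * C * (M' * D))
      (integrableOn_const (by simp)) m3 ?_
    · rw [ae_restrict_iff' measurableSet_uIoc]
      exact hbd
  refine ⟨hii, ?_⟩
  obtain ⟨K, hK⟩ := hy.exists_lipschitzOnWith hA ha (b := b)
  obtain ⟨L, hL⟩ := hz.exists_lipschitzOnWith hA' ha (b := b)
  have hLip : LipschitzOnWith (Real.toNNReal (‖B‖ * (K * D + C * L))) (fun s => B (y s) (z s))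
      (Set.Icc a b) := by
    refine LipschitzOnWith.of_dist_le_mul fun s hs t ht => ?_
    rw [Real.coe_toNNReal _ (by positivity), dist_eq_norm]
    have e : B (y s) (z s) - B (y t) (z t) = B (y s - y t) (z s) + B (y t) (z s - z t) := by
      simp
    have h1 := hK.dist_le_mul s hs t ht
    have h2 := hL.dist_le_mul s hs t ht
    rw [dist_eq_norm] at h1 h2
    rw [e]
    calc _ ≤ ‖B‖ * (K * dist s t) * D + ‖B‖ * C * (L * dist s t) := by
          refine (norm_add_le _ _).trans (add_le_add ?_ ?_)
          · refine (B.le_opNorm₂ _ _).trans ?_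
            have := hD s hs
            gcongr
          · refine (B.le_opNorm₂ _ _).trans ?_
            have := hC t ht
            gcongr
      _ = _ := by ring
  rw [← Set.uIcc_of_le hab] at hLip
  refine AbsolutelyContinuousOnInterval.sub_eq_integral hab hLip.absolutelyContinuousOnInterval
    hii hbd ?_
  have d1 := hy.ae_hasDerivAt hA
  have d2 := hz.ae_hasDerivAt hA'
  rw [ae_restrict_iff' measurableSet_Ioi] at d1 d2
  filter_upwards [d1, d2] with s h1 h2 hs
  have hs0 : s ∈ Set.Ioi 0 := lt_of_le_of_lt ha hs.1
  rw [add_comm]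
  exact B.hasDerivAt_of_bilinear (fun _ => h1 hs0) (fun _ => h2 hs0)

end SolutionRegularity

section Forms

variable {ι κ : Type*} [Fintype ι] [Fintype κ]

/-- The squared Euclidean norm. -/
noncomputable def nsq (v : ι → ℂ) : ℝ := ∑ i, ‖v i‖ ^ 2

theorem nsq_nonneg (v : ι → ℂ) : 0 ≤ nsq v := Finset.sum_nonneg fun _ _ => by positivity

theorem star_dotProduct_self_eq_nsq (v : ι → ℂ) : star v ⬝ᵥ v = ((nsq v : ℝ) : ℂ) := by
  simp only [dotProduct, nsq, Pi.star_apply, RCLike.star_def, Complex.ofReal_sum, Complex.ofReal_pow]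
  exact Finset.sum_congr rfl fun i _ => Complex.conj_mul' _

theorem nsq_eq_re (v : ι → ℂ) : nsq v = (star v ⬝ᵥ v).re := by
  rw [star_dotProduct_self_eq_nsq, Complex.ofReal_re]

theorem nsq_eq_zero {v : ι → ℂ} : nsq v = 0 ↔ v = 0 := by
  rw [nsq, Finset.sum_eq_zero_iff_of_nonneg fun _ _ => by positivity]
  simp [funext_iff]

theorem nsq_pos {v : ι → ℂ} (hv : v ≠ 0) : 0 < nsq v :=
  lt_of_le_of_ne (nsq_nonneg v) fun h => hv (nsq_eq_zero.1 h.symm)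

@[fun_prop]
theorem continuous_nsq : Continuous (nsq : (ι → ℂ) → ℝ) := by unfold nsq; fun_prop

theorem norm_apply_sq_le_nsq (v : ι → ℂ) (i : ι) : ‖v i‖ ^ 2 ≤ nsq v :=
  Finset.single_le_sum (f := fun i => ‖v i‖ ^ 2) (fun _ _ => by positivity) (Finset.mem_univ i)

theorem norm_sq_le_nsq (v : ι → ℂ) : ‖v‖ ^ 2 ≤ nsq v := by
  have h : ‖v‖ ≤ Real.sqrt (nsq v) := by
    refine (pi_norm_le_iff_of_nonneg (Real.sqrt_nonneg _)).2 fun i => ?_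
    exact Real.le_sqrt_of_sq_le (norm_apply_sq_le_nsq v i)
  calc ‖v‖ ^ 2 ≤ Real.sqrt (nsq v) ^ 2 := by gcongr
    _ = nsq v := Real.sq_sqrt (nsq_nonneg v)

theorem nsq_le_norm_sq (v : ι → ℂ) : nsq v ≤ Fintype.card ι * ‖v‖ ^ 2 := by
  calc nsq v ≤ ∑ _i : ι, ‖v‖ ^ 2 :=
        Finset.sum_le_sum fun i _ => by gcongr; exact norm_le_pi_norm v i
    _ = _ := by simp

theorem nsq_sumElim (v : ι → ℂ) (w : κ → ℂ) : nsq (Sum.elim v w) = nsq v + nsq w := by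
  simp [nsq]

theorem norm_star_dotProduct_mulVec_le {M : Matrix ι κ ℂ} {K : ℝ} (hM : ∀ i j, ‖M i j‖ ≤ K)
    (u : ι → ℂ) (v : κ → ℂ) :
    ‖star u ⬝ᵥ M.mulVec v‖ ≤ Fintype.card ι * Fintype.card κ * K * ‖u‖ * ‖v‖ := by
  have h : ∀ i j, ‖star (u i) * (M i j * v j)‖ ≤ ‖u‖ * (K * ‖v‖) := fun i j => by
    rw [norm_mul, norm_star, norm_mul]
    have := norm_le_pi_norm u i
    have := norm_le_pi_norm v j
    have := hM i j
    have : 0 ≤ K := (norm_nonneg _).trans (hM i j)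
    gcongr
  calc ‖star u ⬝ᵥ M.mulVec v‖ = ‖∑ i, ∑ j, star (u i) * (M i j * v j)‖ := by
        simp [dotProduct, Matrix.mulVec, Finset.mul_sum]
    _ ≤ ∑ i : ι, ∑ j : κ, ‖u‖ * (K * ‖v‖) :=
        (norm_sum_le _ _).trans (Finset.sum_le_sum fun i _ =>
          (norm_sum_le _ _).trans (Finset.sum_le_sum fun j _ => h i j))
    _ = _ := by simp; ring

theorem norm_star_dotProduct_mulVec_self_le {M : Matrix ι ι ℂ} {K : ℝ} (hM : ∀ i j, ‖M i j‖ ≤ K)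
    (u : ι → ℂ) :
    ‖star u ⬝ᵥ M.mulVec u‖ ≤ Fintype.card ι * Fintype.card ι * K * nsq u := by
  rcases isEmpty_or_nonempty ι with h | ⟨⟨i⟩⟩
  · simp [dotProduct]
  have hK : 0 ≤ K := (norm_nonneg _).trans (hM i i)
  refine (norm_star_dotProduct_mulVec_le hM u u).trans ?_
  rw [mul_assoc _ ‖u‖]
  have : ‖u‖ * ‖u‖ ≤ nsq u := (sq ‖u‖).symm.trans_le (norm_sq_le_nsq u)
  gcongr

/-- The sesquilinear form of a matrix, as a real bilinear map. -/
noncomputable def sesq (N : Matrix ι ι ℂ) : (ι → ℂ) →L[ℝ] (ι → ℂ) →L[ℝ] ℂ :=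
  LinearMap.toContinuousBilinearMap (LinearMap.mk₂ ℝ (fun u v => star u ⬝ᵥ N.mulVec v)
    (fun u u' v => by simp [add_dotProduct]) (fun c u v => by simp [smul_dotProduct])
    (fun u v v' => by simp [Matrix.mulVec_add, dotProduct_add])
    (fun c u v => by simp [Matrix.mulVec_smul, dotProduct_smul]))

@[simp]
theorem sesq_apply (N : Matrix ι ι ℂ) (u v : ι → ℂ) : sesq N u v = star u ⬝ᵥ N.mulVec v := rfl

theorem star_mulVec_dotProduct (M N : Matrix ι ι ℂ) (u v : ι → ℂ) :
    star (M.mulVec u) ⬝ᵥ N.mulVec v = star u ⬝ᵥ (M.conjTranspose * N).mulVec v := by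
  rw [Matrix.star_mulVec, ← Matrix.mulVec_mulVec, Matrix.dotProduct_mulVec,
    Matrix.dotProduct_mulVec, Matrix.dotProduct_mulVec]

variable [DecidableEq ι]

/-- Multiplication by a matrix as a continuous linear map. -/
noncomputable def mulVecCLM (M : Matrix ι ι ℂ) : (ι → ℂ) →L[ℂ] (ι → ℂ) :=
  LinearMap.toContinuousLinearMap (Matrix.toLin' M)

@[simp]
theorem mulVecCLM_apply (M : Matrix ι ι ℂ) (v : ι → ℂ) : mulVecCLM M v = M.mulVec v := rfl

theorem mulVecCLM_sub (M N : Matrix ι ι ℂ) : mulVecCLM (M - N) = mulVecCLM M - mulVecCLM N := by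
  ext1 v
  simp [Matrix.sub_mulVec]

theorem norm_mulVecCLM_le {M : Matrix ι ι ℂ} {K : ℝ} (hK : 0 ≤ K) (hM : ∀ i j, ‖M i j‖ ≤ K) :
    ‖mulVecCLM M‖ ≤ Fintype.card ι * K := by
  refine ContinuousLinearMap.opNorm_le_bound _ (by positivity) fun v => ?_
  refine (pi_norm_le_iff_of_nonneg (by positivity)).2 fun i => ?_
  calc ‖∑ j, M i j * v j‖ ≤ ∑ _j : ι, K * ‖v‖ := by
        refine (norm_sum_le _ _).trans (Finset.sum_le_sum fun j _ => ?_)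
        rw [norm_mul]
        have := norm_le_pi_norm v j
        have := hM i j
        gcongr
    _ = _ := by simp; ring

theorem continuous_mulVecCLM : Continuous (mulVecCLM : Matrix ι ι ℂ → _) :=
  (LinearMap.toContinuousLinearMap.toLinearMap ∘ₗ
    (Matrix.toLin' : Matrix ι ι ℂ ≃ₗ[ℂ] _).toLinearMap).continuous_of_finiteDimensional

theorem sesq_mulVec_add (M M' N : Matrix ι ι ℂ) (u v : ι → ℂ) :
    sesq N (mulVecCLM M u) v + sesq N u (mulVecCLM M' v) =
      star u ⬝ᵥ (M.conjTranspose * N + N * M').mulVec v := by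
  simp only [sesq_apply, mulVecCLM_apply, star_mulVec_dotProduct, Matrix.mulVec_mulVec,
    Matrix.add_mulVec, dotProduct_add]

end Forms

section HamiltonianSystem

variable {n : ℕ}

/-- The coefficients `R = P⁻¹`, `V`, `Q` of the system `φ' = R ψ`, `ψ' = (V - lam Q) φ`. -/
structure HSys (n : ℕ) where
  /-- inverse of the leading coefficient -/
  R : ℝ → Matrix (Fin n) (Fin n) ℂ
  /-- potential -/
  V : ℝ → Matrix (Fin n) (Fin n) ℂ
  /-- weight -/
  Q : ℝ → Matrix (Fin n) (Fin n) ℂ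

/-- The coefficient matrix of `φ' = R ψ`, `ψ' = W φ`. -/
def blockCoef (R W : Matrix (Fin n) (Fin n) ℂ) : Matrix (Fin n ⊕ Fin n) (Fin n ⊕ Fin n) ℂ :=
  Matrix.fromBlocks 0 R W 0

/-- The coefficient of the system at the spectral parameter `lam`. -/
noncomputable def HSys.coef (T : HSys n) (lam x : ℝ) :
    (Fin n ⊕ Fin n → ℂ) →L[ℂ] (Fin n ⊕ Fin n → ℂ) :=
  mulVecCLM (blockCoef (T.R x) (T.V x - (lam : ℂ) • T.Q x))

/-- Uniform bounds of a system with the endstates `Rp`, `Vp`, `Qp`. -/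
structure HSys.Bounds (T : HSys n) (Rp Vp Qp : Matrix (Fin n) (Fin n) ℂ) (K θ η : ℝ) : Prop where
  K_pos : 0 < K
  θ_pos : 0 < θ
  η_pos : 0 < η
  meas : AEStronglyMeasurable T.R halfLine ∧ AEStronglyMeasurable T.V halfLine ∧
    AEStronglyMeasurable T.Q halfLine
  herm : ∀ᵐ x ∂halfLine, (T.R x).IsHermitian ∧ (T.V x).IsHermitian ∧ (T.Q x).IsHermitian
  lower : ∀ᵐ x ∂halfLine, ∀ v : Fin n → ℂ,
    θ * nsq v ≤ (star v ⬝ᵥ (T.R x).mulVec v).re ∧ θ * nsq v ≤ (star v ⬝ᵥ (T.Q x).mulVec v).re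
  bound : ∀ᵐ x ∂halfLine, ∀ i j, ‖T.R x i j‖ ≤ K ∧ ‖T.V x i j‖ ≤ K ∧ ‖T.Q x i j‖ ≤ K
  decay : ∀ᵐ x ∂halfLine, ∀ i j, ‖T.R x i j - Rp i j‖ ≤ K * Real.exp (-η * x) ∧
    ‖T.V x i j - Vp i j‖ ≤ K * Real.exp (-η * x) ∧ ‖T.Q x i j - Qp i j‖ ≤ K * Real.exp (-η * x)
  herm_end : Rp.IsHermitian ∧ Vp.IsHermitian ∧ Qp.IsHermitian
  lower_end : ∀ v : Fin n → ℂ, θ * nsq v ≤ (star v ⬝ᵥ Rp.mulVec v).re ∧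
    θ * nsq v ≤ (star v ⬝ᵥ Qp.mulVec v).re
  bound_end : ∀ i j, ‖Rp i j‖ ≤ K ∧ ‖Vp i j‖ ≤ K ∧ ‖Qp i j‖ ≤ K

/-- The system translated by `p`, which for `p = ∞` is the constant system of the endstates. -/
noncomputable def HSys.shift (T : HSys n) (Rp Vp Qp : Matrix (Fin n) (Fin n) ℂ) (p : ENNReal) :
    HSys n where
  R x := if p = ⊤ then Rp else T.R (p.toReal + x)
  V x := if p = ⊤ then Vp else T.V (p.toReal + x)
  Q x := if p = ⊤ then Qp else T.Q (p.toReal + x)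

theorem ae_halfLine_shift {p : ℝ → Prop} {a : ℝ} (ha : 0 ≤ a) (h : ∀ᵐ x ∂halfLine, p x) :
    ∀ᵐ x ∂halfLine, p (a + x) := by
  rw [ae_restrict_iff' measurableSet_Ioi] at h ⊢
  have := (measurePreserving_add_left (volume : Measure ℝ) a).quasiMeasurePreserving.ae h
  filter_upwards [this] with x hx hx0
  exact hx (show (0 : ℝ) < a + x by linarith [Set.mem_Ioi.1 hx0])

theorem aestronglyMeasurable_halfLine_shift {F : Type*} [TopologicalSpace F] {f : ℝ → F} {a : ℝ}
    (ha : 0 ≤ a) (h : AEStronglyMeasurable f halfLine) :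
    AEStronglyMeasurable (fun x => f (a + x)) halfLine := by
  have h1 : AEStronglyMeasurable f (volume.restrict (Set.Ioi a)) :=
    h.mono_set (Set.Ioi_subset_Ioi ha)
  have h2 : MeasurePreserving (fun x => a + x) halfLine (volume.restrict (Set.Ioi a)) := by
    have := (measurePreserving_add_left (volume : Measure ℝ) a).restrict_preimage
      (measurableSet_Ioi (a := a))
    simpa using this
  exact h1.comp_measurePreserving h2

variable {T : HSys n} {Rp Vp Qp : Matrix (Fin n) (Fin n) ℂ} {K θ η : ℝ}

theorem HSys.Bounds.shift (hT : T.Bounds Rp Vp Qp K θ η) (p : ENNReal) :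
    (T.shift Rp Vp Qp p).Bounds Rp Vp Qp K θ η := by
  have hp : 0 ≤ p.toReal := ENNReal.toReal_nonneg
  by_cases h : p = ⊤
  · have e : ∀ x, 0 ≤ K * Real.exp (-η * x) := fun x => mul_nonneg hT.K_pos.le (Real.exp_pos _).le
    exact ⟨hT.K_pos, hT.θ_pos, hT.η_pos,
      by simp only [HSys.shift, h, if_true]; exact
        ⟨aestronglyMeasurable_const, aestronglyMeasurable_const, aestronglyMeasurable_const⟩,
      by simp only [HSys.shift, h, if_true]; exact Eventually.of_forall fun _ => hT.herm_end,
      by simp only [HSys.shift, h, if_true]; exact Eventually.of_forall fun _ => hT.lower_end,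
      by simp only [HSys.shift, h, if_true]; exact Eventually.of_forall fun _ => hT.bound_end,
      Eventually.of_forall fun x i j => by simpa [HSys.shift, h] using e x,
      hT.herm_end, hT.lower_end, hT.bound_end⟩
  · refine ⟨hT.K_pos, hT.θ_pos, hT.η_pos, ?_, ?_, ?_, ?_, ?_, hT.herm_end, hT.lower_end,
      hT.bound_end⟩ <;> simp only [HSys.shift, h, if_false]
    · exact ⟨aestronglyMeasurable_halfLine_shift hp hT.meas.1,
        aestronglyMeasurable_halfLine_shift hp hT.meas.2.1,
        aestronglyMeasurable_halfLine_shift hp hT.meas.2.2⟩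
    · exact ae_halfLine_shift hp hT.herm
    · exact ae_halfLine_shift hp hT.lower
    · exact ae_halfLine_shift hp hT.bound
    · filter_upwards [ae_halfLine_shift hp hT.decay] with x hx i j
      have e : K * Real.exp (-η * (p.toReal + x)) ≤ K * Real.exp (-η * x) := by
        have := hT.η_pos
        exact mul_le_mul_of_nonneg_left (Real.exp_le_exp.2 (by nlinarith)) hT.K_pos.le
      exact ⟨(hx i j).1.trans e, (hx i j).2.1.trans e, (hx i j).2.2.trans e⟩

theorem HSys.Bounds.ae_norm_shift_sub_le (hT : T.Bounds Rp Vp Qp K θ η) {p : ENNReal} (hp : p ≠ ⊤) :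
    ∀ᵐ x ∂halfLine, ∀ i j,
      ‖(T.shift Rp Vp Qp p).R x i j - Rp i j‖ ≤ K * Real.exp (-η * p.toReal) ∧
      ‖(T.shift Rp Vp Qp p).V x i j - Vp i j‖ ≤ K * Real.exp (-η * p.toReal) ∧
      ‖(T.shift Rp Vp Qp p).Q x i j - Qp i j‖ ≤ K * Real.exp (-η * p.toReal) := by
  simp only [HSys.shift, hp, if_false]
  filter_upwards [ae_halfLine_shift (a := p.toReal) ENNReal.toReal_nonneg hT.decay,
    ae_restrict_mem measurableSet_Ioi] with x hx hx0 i j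
  have e : K * Real.exp (-η * (p.toReal + x)) ≤ K * Real.exp (-η * p.toReal) := by
    have := hT.η_pos
    have := Set.mem_Ioi.1 hx0
    exact mul_le_mul_of_nonneg_left (Real.exp_le_exp.2 (by nlinarith)) hT.K_pos.le
  exact ⟨(hx i j).1.trans e, (hx i j).2.1.trans e, (hx i j).2.2.trans e⟩

theorem norm_blockCoef_le {R W : Matrix (Fin n) (Fin n) ℂ} {C : ℝ} (hC : 0 ≤ C)
    (hR : ∀ i j, ‖R i j‖ ≤ C) (hW : ∀ i j, ‖W i j‖ ≤ C) :
    ‖mulVecCLM (blockCoef R W)‖ ≤ 2 * n * C := by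
  refine (norm_mulVecCLM_le hC fun i j => ?_).trans (by simp; linarith)
  rcases i with i | i <;> rcases j with j | j <;> simp [blockCoef, hC, hR, hW]

/-- A bound for the coefficient operators. -/
noncomputable def coefBound (n : ℕ) (K lam : ℝ) : ℝ := 2 * n * (K + |lam| * K) + 1

theorem HSys.Bounds.bddCoef (hT : T.Bounds Rp Vp Qp K θ η) (lam : ℝ) :
    BddCoef (T.coef lam) (coefBound n K lam) := by
  have hK := hT.K_pos
  refine ⟨by unfold coefBound; positivity, ?_, ?_⟩
  · have hc : Continuous fun M : Matrix (Fin n) (Fin n) ℂ × Matrix (Fin n) (Fin n) ℂ ×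
        Matrix (Fin n) (Fin n) ℂ => mulVecCLM (blockCoef M.1 (M.2.1 - (lam : ℂ) • M.2.2)) := by
      refine continuous_mulVecCLM.comp ?_
      unfold blockCoef
      exact Continuous.matrix_fromBlocks continuous_const (by fun_prop) (by fun_prop)
        continuous_const
    have hm : AEStronglyMeasurable (fun x => (T.R x, T.V x, T.Q x)) halfLine :=
      hT.meas.1.prodMk (hT.meas.2.1.prodMk hT.meas.2.2)
    have := hc.comp_aestronglyMeasurable hm
    exact this
  · filter_upwards [hT.bound] with x hx
    refine (norm_blockCoef_le (C := K + |lam| * K) (by positivity) (fun i j => ?_)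
      (fun i j => ?_)).trans (by unfold coefBound; linarith)
    · exact (hx i j).1.trans (by nlinarith [abs_nonneg lam])
    · refine (norm_sub_le _ _).trans (add_le_add (hx i j).2.1 ?_)
      rw [Matrix.smul_apply, norm_smul, Complex.norm_real, Real.norm_eq_abs]
      exact mul_le_mul_of_nonneg_left (hx i j).2.2 (abs_nonneg _)

/-- The fundamental solution. -/
noncomputable def HSys.Φ (T : HSys n) (lam : ℝ) :
    ℝ → (Fin n ⊕ Fin n → ℂ) →L[ℂ] (Fin n ⊕ Fin n → ℂ) :=
  open Classical in
  if h : ∃ Φ : ℝ → (Fin n ⊕ Fin n → ℂ) →L[ℂ] (Fin n ⊕ Fin n → ℂ),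
    Continuous Φ ∧ Φ 0 = 1 ∧ ∀ c, IsIntSol (T.coef lam) fun x => Φ x c then h.choose else 0

theorem HSys.Bounds.Φ_spec (hT : T.Bounds Rp Vp Qp K θ η) (lam : ℝ) :
    Continuous (T.Φ lam) ∧ T.Φ lam 0 = 1 ∧ ∀ c, IsIntSol (T.coef lam) fun x => T.Φ lam x c := by
  have h := (hT.bddCoef lam).exists_fundamental
  rw [HSys.Φ, dif_pos h]
  exact h.choose_spec

/-- Every solution is given by the fundamental solution. -/
theorem HSys.Bounds.eq_Φ (hT : T.Bounds Rp Vp Qp K θ η) {lam : ℝ} {y : ℝ → Fin n ⊕ Fin n → ℂ}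
    (hy : IsIntSol (T.coef lam) y) {x : ℝ} (hx : 0 ≤ x) : y x = T.Φ lam x (y 0) :=
  hy.unique (hT.bddCoef lam) ((hT.Φ_spec lam).2.2 (y 0)) le_rfl hx (by simp [(hT.Φ_spec lam).2.1])

/-- The derivative of the symplectic form along a pair of solutions. -/
theorem blockCoef_J {R₁ W₁ R₂ W₂ : Matrix (Fin n) (Fin n) ℂ} (hR : R₁.IsHermitian)
    (hW : W₁.IsHermitian) :
    (blockCoef R₁ W₁).conjTranspose * Matrix.J (Fin n) ℂ + Matrix.J (Fin n) ℂ * blockCoef R₂ W₂ =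
      Matrix.fromBlocks (W₁ - W₂) 0 0 (R₂ - R₁) := by
  simp [blockCoef, Matrix.J, Matrix.fromBlocks_conjTranspose, Matrix.fromBlocks_multiply,
    Matrix.fromBlocks_add, hR.eq, hW.eq]
  constructor <;> abel

theorem isHermitian_sub_real_smul {V Q : Matrix (Fin n) (Fin n) ℂ} (hV : V.IsHermitian)
    (hQ : Q.IsHermitian) (lam : ℝ) : (V - (lam : ℂ) • Q).IsHermitian := by
  refine hV.sub ?_
  rw [Matrix.IsHermitian, Matrix.conjTranspose_smul, hQ.eq, RCLike.star_def, Complex.conj_ofReal]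

/-- The Lagrange identity. -/
theorem HSys.Bounds.lagrange_identity (hT : T.Bounds Rp Vp Qp K θ η) {lam mu : ℝ}
    {z y : ℝ → Fin n ⊕ Fin n → ℂ} (hz : IsIntSol (T.coef lam) z) (hy : IsIntSol (T.coef mu) y)
    {a b : ℝ} (ha : 0 ≤ a) (hab : a ≤ b) :
    (star (z b) ⬝ᵥ (Matrix.J (Fin n) ℂ).mulVec (y b)) -
      star (z a) ⬝ᵥ (Matrix.J (Fin n) ℂ).mulVec (y a) =
    ((mu - lam : ℝ) : ℂ) * ∫ s in a..b,
      star (z s ∘ Sum.inl) ⬝ᵥ (T.Q s).mulVec (y s ∘ Sum.inl) := by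
  have h := (hz.bilinear_sub_eq_integral (sesq (Matrix.J (Fin n) ℂ)) (hT.bddCoef lam)
    (hT.bddCoef mu) hy ha hab).2
  simp only [sesq_apply] at h
  rw [h, ← intervalIntegral.integral_const_mul]
  refine intervalIntegral.integral_congr_ae ?_
  filter_upwards [ae_of_ae_halfLine hT.herm ha (ha.trans hab)] with s hs hs'
  obtain ⟨h1, h2, h3⟩ := hs hs'
  have e := sesq_mulVec_add (blockCoef (T.R s) (T.V s - (lam : ℂ) • T.Q s))
    (blockCoef (T.R s) (T.V s - (mu : ℂ) • T.Q s)) (Matrix.J (Fin n) ℂ) (z s) (y s)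
  simp only [sesq_apply] at e
  simp only [HSys.coef]
  rw [e, blockCoef_J h1 (isHermitian_sub_real_smul h2 h3 lam), sub_self]
  have e2 : T.V s - (lam : ℂ) • T.Q s - (T.V s - (mu : ℂ) • T.Q s) =
      ((mu - lam : ℝ) : ℂ) • T.Q s := by
    rw [Complex.ofReal_sub, sub_smul]; abel
  rw [e2, ← Sum.elim_comp_inl_inr (z s), ← Sum.elim_comp_inl_inr (y s), Matrix.fromBlocks_mulVec]
  simp only [Sum.elim_comp_inl, Sum.elim_comp_inr, Matrix.zero_mulVec, add_zero]
  rw [Function.star_sumElim, sumElim_dotProduct_sumElim, dotProduct_zero, add_zero, Matrix.smul_mulVec,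
    dotProduct_smul, smul_eq_mul]

/-- The fundamental solution preserves the symplectic form. -/
theorem HSys.Bounds.Φ_symplectic (hT : T.Bounds Rp Vp Qp K θ η) (lam : ℝ) {x : ℝ} (hx : 0 ≤ x)
    (u v : Fin n ⊕ Fin n → ℂ) :
    star (T.Φ lam x u) ⬝ᵥ (Matrix.J (Fin n) ℂ).mulVec (T.Φ lam x v) =
      star u ⬝ᵥ (Matrix.J (Fin n) ℂ).mulVec v := by
  obtain ⟨-, h0, h⟩ := hT.Φ_spec lam
  have := hT.lagrange_identity (h u) (h v) le_rfl hx
  rw [sub_self, Complex.ofReal_zero, zero_mul, h0, sub_eq_zero] at this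
  exact this

theorem HSys.Bounds.Φ_injective (hT : T.Bounds Rp Vp Qp K θ η) (lam : ℝ) {x : ℝ} (hx : 0 ≤ x) :
    Function.Injective (T.Φ lam x) := by
  intro u v huv
  obtain ⟨-, h0, h⟩ := hT.Φ_spec lam
  have := (h u).unique (hT.bddCoef lam) (h v) hx le_rfl huv
  simpa [h0] using this

end HamiltonianSystem

section VariationOfConstants

/-- A function given by the variation of constants formula solves its equation. -/
theorem variation_of_constants {g : ℝ → ℂ} {a C x₀ x : ℝ} {k : ℂ} (hx : x₀ ≤ x)
    (hg : IntervalIntegrable g volume x₀ x) (hC : ∀ᵐ s, s ∈ Set.uIoc x₀ x → ‖g s‖ ≤ C) :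
    (Real.exp (a * x) : ℂ) * (k + ∫ s in x₀..x, g s) - Real.exp (a * x₀) * k =
      ∫ s in x₀..x, ((a : ℂ) * (Real.exp (a * s) * (k + ∫ t in x₀..s, g t)) +
        Real.exp (a * s) * g s) := by
  have hii : ∀ s ∈ Set.uIcc x₀ x, ∀ t ∈ Set.uIcc x₀ x, IntervalIntegrable g volume s t :=
    fun s hs t ht => hg.mono_set (Set.uIcc_subset_uIcc hs ht)
  have hLip : LipschitzOnWith (Real.toNNReal C) (fun s => k + ∫ t in x₀..s, g t)
      (Set.uIcc x₀ x) := by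
    refine LipschitzOnWith.of_dist_le_mul fun s hs t ht => ?_
    rw [dist_eq_norm, add_sub_add_left_eq_sub, intervalIntegral.integral_interval_sub_left
      (hii x₀ Set.left_mem_uIcc s hs) (hii x₀ Set.left_mem_uIcc t ht), Real.dist_eq]
    refine (intervalIntegral.norm_integral_le_of_norm_le_const_ae (C := C) ?_).trans
      (mul_le_mul_of_nonneg_right (Real.le_coe_toNNReal C) (abs_nonneg _))
    filter_upwards [hC] with r hr hr'
    rw [Set.uIcc_of_le hx] at hs ht
    rw [Set.uIoc_of_le hx] at hr
    exact hr ⟨lt_of_le_of_lt (le_min ht.1 hs.1) hr'.1, hr'.2.trans (max_le ht.2 hs.2)⟩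
  have hAC1 := hLip.absolutelyContinuousOnInterval
  have hAC2 : AbsolutelyContinuousOnInterval (fun s : ℝ => (Real.exp (a * s) : ℂ)) x₀ x := by
    refine ContDiffOn.absolutelyContinuousOnInterval ?_
    exact (Complex.ofRealCLM.contDiff.comp
      (Real.contDiff_exp.comp (contDiff_const.mul contDiff_id))).contDiffOn
  have hc1 : ContinuousOn (fun s => k + ∫ t in x₀..s, g t) (Set.uIcc x₀ x) := hLip.continuousOn
  have hce : Continuous fun s : ℝ => (Real.exp (a * s) : ℂ) := by fun_prop
  have hcf : ContinuousOn
      (fun s => (a : ℂ) * (Real.exp (a * s) * (k + ∫ t in x₀..s, g t))) (Set.uIcc x₀ x) :=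
    continuousOn_const.mul (hce.continuousOn.mul hc1)
  have hint : IntervalIntegrable (fun s => (a : ℂ) * (Real.exp (a * s) * (k + ∫ t in x₀..s, g t)) +
      Real.exp (a * s) * g s) volume x₀ x :=
    hcf.intervalIntegrable.add (hg.continuousOn_mul hce.continuousOn)
  obtain ⟨C1, hC1⟩ := isCompact_uIcc.exists_bound_of_continuousOn hcf
  obtain ⟨C2, hC2⟩ := (isCompact_uIcc (a := x₀) (b := x)).exists_bound_of_continuousOn hce.continuousOn
  have key := AbsolutelyContinuousOnInterval.sub_eq_integral (C := C1 + C2 * C) hx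
    (hAC2.smul hAC1) hint ?_ ?_
  · simpa [smul_eq_mul] using key
  · filter_upwards [hC] with s hs hs'
    have hm : s ∈ Set.uIcc x₀ x := Set.uIoc_subset_uIcc hs'
    refine (norm_add_le _ _).trans (add_le_add (hC1 s hm) ?_)
    rw [norm_mul]
    exact mul_le_mul (hC2 s hm) (hs hs') (norm_nonneg _) ((norm_nonneg _).trans (hC2 s hm))
  · filter_upwards [hg.ae_hasDerivAt_integral] with s hs hs'
    have hm : s ∈ Set.uIcc x₀ x := by rw [Set.uIcc_of_le hx]; exact Set.Ioo_subset_Icc_self hs'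
    have h1 : HasDerivAt (fun s => k + ∫ t in x₀..s, g t) (g s) s :=
      (hs hm x₀ Set.left_mem_uIcc).const_add k
    have h2 : HasDerivAt (fun s : ℝ => (Real.exp (a * s) : ℂ)) ((Real.exp (a * s) * a : ℝ) : ℂ) s :=
      (by simpa using ((hasDerivAt_id s).const_mul a).exp : HasDerivAt (fun s => Real.exp (a * s))
        (Real.exp (a * s) * a) s).ofReal_comp
    refine (h2.mul h1).congr_deriv ?_
    push_cast
    ring

end VariationOfConstants

section Levinson

variable {E : Type*} [NormedAddCommGroup E] [NormedSpace ℂ E] [FiniteDimensional ℂ E]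
  {ι : Type*} [Fintype ι] {A : ℝ → E →L[ℂ] E} {M : ℝ}

/-- The scalar kernel: decaying modes are integrated from the left, the others from infinity. -/
noncomputable def modeKernel (d x s : ℝ) : ℝ :=
  if d < 0 then (if s ≤ x then Real.exp (d * (x - s)) else 0)
  else if s ≤ x then 0 else -Real.exp (d * (x - s))

theorem abs_modeKernel_le (d x s : ℝ) : |modeKernel d x s| ≤ 1 := by
  unfold modeKernel
  split_ifs with h1 h2 h2
  · rw [Real.abs_exp, Real.exp_le_one_iff]; nlinarith
  · simp
  · simp
  · rw [abs_neg, Real.abs_exp, Real.exp_le_one_iff]; nlinarith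

theorem measurable_modeKernel (d x : ℝ) : Measurable (modeKernel d x) := by
  unfold modeKernel
  split_ifs with h
  · exact Measurable.ite measurableSet_Iic (by fun_prop) measurable_const
  · exact Measurable.ite measurableSet_Iic measurable_const (by fun_prop)

theorem continuousAt_modeKernel (d : ℝ) {x s : ℝ} (h : s ≠ x) :
    ContinuousAt (fun x => modeKernel d x s) x := by
  unfold modeKernel
  rcases lt_or_gt_of_ne h with h | h
  · have hc : ContinuousAt (fun x => if d < 0 then Real.exp (d * (x - s)) else 0) x := by
      split_ifs <;> fun_prop
    refine hc.congr ?_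
    filter_upwards [Ioi_mem_nhds h] with t ht
    simp [le_of_lt (Set.mem_Ioi.1 ht)]
  · have hc : ContinuousAt (fun x => if d < 0 then 0 else -Real.exp (d * (x - s))) x := by
      split_ifs <;> fun_prop
    refine hc.congr ?_
    filter_upwards [Iio_mem_nhds h] with t ht
    simp [not_le.2 (Set.mem_Iio.1 ht)]

theorem tendsto_modeKernel (d s : ℝ) : Tendsto (fun x => modeKernel d x s) atTop (𝓝 0) := by
  unfold modeKernel
  by_cases hd : d < 0
  · have h1 : Tendsto (fun x => Real.exp (d * (x - s))) atTop (𝓝 0) :=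
      Real.tendsto_exp_atBot.comp ((tendsto_atTop_add_const_right _ (-s) tendsto_id).const_mul_atTop_of_neg hd)
    refine h1.congr' ?_
    filter_upwards [eventually_ge_atTop s] with x hx
    simp [hd, hx]
  · refine tendsto_const_nhds.congr' ?_
    filter_upwards [eventually_ge_atTop s] with x hx
    simp [hd, hx]

theorem integral_modeKernel {d x₀ x : ℝ} (hx : x₀ ≤ x) {r : ℝ → ℂ}
    (hr : IntegrableOn r (Set.Ioi x₀)) :
    ∫ s in Set.Ioi x₀, (modeKernel d x s : ℂ) * r s =
      Real.exp (d * x) * ((if d < 0 then 0 else -∫ s in Set.Ioi x₀, (Real.exp (-d * s) : ℂ) * r s) +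
        ∫ s in x₀..x, (Real.exp (-d * s) : ℂ) * r s) := by
  have hexp : ∀ s, (Real.exp (d * (x - s)) : ℂ) = Real.exp (d * x) * Real.exp (-d * s) := fun s => by
    rw [← Complex.ofReal_mul, ← Real.exp_add]; congr 2; ring
  by_cases hd : d < 0
  · simp only [if_pos hd, zero_add]
    rw [intervalIntegral.integral_of_le hx, ← integral_const_mul]
    have h1 : ∫ s in Set.Ioi x₀, (modeKernel d x s : ℂ) * r s = ∫ s in Set.Ioi x₀,
        (Set.Iic x).indicator (fun s => (Real.exp (d * x) : ℂ) * (Real.exp (-d * s) * r s)) s := by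
      refine integral_congr_ae (Eventually.of_forall fun s => ?_)
      by_cases h : s ≤ x
      · simp only [modeKernel, if_pos hd, if_pos h]
        rw [Set.indicator_of_mem (show s ∈ Set.Iic x from h), hexp, mul_assoc]
      · simp only [modeKernel, if_pos hd, if_neg h]
        rw [Set.indicator_of_notMem (show s ∉ Set.Iic x from h)]
        simp
    rw [h1, setIntegral_indicator measurableSet_Iic, Set.Ioi_inter_Iic]
  · simp only [if_neg hd]
    have hd' : 0 ≤ d := not_lt.1 hd
    have hb : IntegrableOn (fun s => (Real.exp (-d * s) : ℂ) * r s) (Set.Ioi x₀) := by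
      refine Integrable.bdd_mul (c := Real.exp (-d * x₀)) hr (Continuous.aestronglyMeasurable
        (by fun_prop)) ?_
      filter_upwards [ae_restrict_mem measurableSet_Ioi] with s hs
      rw [Complex.norm_real, Real.norm_eq_abs, Real.abs_exp, Real.exp_le_exp]
      nlinarith [Set.mem_Ioi.1 hs]
    have hsplit : ∫ s in Set.Ioi x₀, (Real.exp (-d * s) : ℂ) * r s =
        (∫ s in x₀..x, (Real.exp (-d * s) : ℂ) * r s) +
          ∫ s in Set.Ioi x, (Real.exp (-d * s) : ℂ) * r s := by
      rw [intervalIntegral.integral_of_le hx, ← setIntegral_union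
        (Set.Ioc_disjoint_Ioi le_rfl) measurableSet_Ioi (hb.mono_set Set.Ioc_subset_Ioi_self)
        (hb.mono_set (Set.Ioi_subset_Ioi hx)), Set.Ioc_union_Ioi_eq_Ioi hx]
    have h1 : ∫ s in Set.Ioi x₀, (modeKernel d x s : ℂ) * r s = ∫ s in Set.Ioi x₀,
        (Set.Ioi x).indicator (fun s => -(Real.exp (d * x) : ℂ) * (Real.exp (-d * s) * r s)) s := by
      refine integral_congr_ae (Eventually.of_forall fun s => ?_)
      by_cases h : s ≤ x
      · simp only [modeKernel, if_neg hd, if_pos h]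
        rw [Set.indicator_of_notMem (show s ∉ Set.Ioi x from not_lt.2 h)]
        simp
      · simp only [modeKernel, if_neg hd, if_neg h]
        rw [Set.indicator_of_mem (show s ∈ Set.Ioi x from not_le.1 h), Complex.ofReal_neg, hexp]
        ring
    rw [h1, setIntegral_indicator measurableSet_Ioi, Set.Ioi_inter_Ioi, max_eq_right hx,
      integral_const_mul, hsplit]
    ring

end Levinson
section Levinson

variable {E : Type*} [NormedAddCommGroup E] [NormedSpace ℂ E] [FiniteDimensional ℂ E]
  {ι : Type*} [Fintype ι] {A : ℝ → E →L[ℂ] E} {M : ℝ}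

/-- The coordinate functionals of a basis as continuous linear maps. -/
noncomputable def coordCLM (b : Module.Basis ι ℂ E) (j : ι) : E →L[ℂ] ℂ :=
  LinearMap.toContinuousLinearMap (b.coord j)

omit [Fintype ι] in
@[simp]
theorem coordCLM_apply (b : Module.Basis ι ℂ E) (j : ι) (v : E) :
    coordCLM b j v = b.repr v j := rfl

omit [FiniteDimensional ℂ E] [Fintype ι] in
theorem repr_of_diagonal {b : Module.Basis ι ℂ E} {a : ι → ℝ} {Ai : E →L[ℂ] E}
    (hb : ∀ j, Ai (b j) = (a j : ℂ) • b j) (v : E) (j : ι) :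
    b.repr (Ai v) j = a j * b.repr v j := by
  classical
  have h : b.coord j ∘ₗ (Ai : E →ₗ[ℂ] E) = (a j : ℂ) • b.coord j := b.ext fun k => by
    by_cases hkj : k = j
    · simp [hb, hkj]
    · simp [hb, hkj]
  exact LinearMap.congr_fun h v

/-- Levinson's theorem for an exponentially small perturbation of a diagonalizable matrix with
real eigenvalues, in a weighted integral form. -/
theorem exists_mode_integral (b : Module.Basis ι ℂ E) (a : ι → ℝ) (i : ι) (Ai : E →L[ℂ] E)
    (hA : BddCoef A M) {C η : ℝ} (hη : 0 < η) (hC : 0 ≤ C)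
    (hdec : ∀ᵐ s ∂halfLine, ‖A s - Ai‖ ≤ C * Real.exp (-η * s)) :
    ∃ (x₀ : ℝ) (z : ℝ → E), 0 ≤ x₀ ∧ Continuous z ∧ (∃ D, ∀ x, ‖z x‖ ≤ D) ∧
      Tendsto z atTop (𝓝 (b i)) ∧ ∀ x j, b.repr (z x) j = b.repr (b i) j +
        ∫ s in Set.Ioi x₀, (modeKernel (a j - a i) x s : ℂ) * b.repr ((A s - Ai) (z s)) j := by
  set P : ι → E →L[ℂ] E := fun j => (coordCLM b j).smulRight (b j) with hP
  set N : ℝ := ∑ j, ‖P j‖ * C with hN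
  have hN0 : 0 ≤ N := by positivity
  set k : ℝ → ℝ → E →L[ℂ] E := fun x s =>
    ∑ j, (modeKernel (a j - a i) x s : ℂ) • (P j).comp (A s - Ai) with hk
  obtain ⟨x₀, hx₀, hx₀N⟩ : ∃ x₀ : ℝ, 0 ≤ x₀ ∧ N * (Real.exp (-η * x₀) / η) ≤ 1 / 2 := by
    have h1 : Tendsto (fun x => N * (Real.exp (-η * x) / η)) atTop (𝓝 (N * (0 / η))) := by
      refine ((Real.tendsto_exp_atBot.comp ?_).div_const η).const_mul N
      exact tendsto_id.const_mul_atTop_of_neg (by linarith)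
    rw [zero_div, mul_zero] at h1
    obtain ⟨x, hx1, hx2⟩ := ((h1.eventually (ge_mem_nhds (by norm_num : (0 : ℝ) < 1 / 2))).and
      (eventually_ge_atTop 0)).exists
    exact ⟨x, hx2, hx1⟩
  set μ : Measure ℝ := volume.restrict (Set.Ioi x₀) with hμ
  have hsub : Set.Ioi x₀ ⊆ Set.Ioi 0 := Set.Ioi_subset_Ioi hx₀
  have hdec' : ∀ᵐ s ∂μ, ‖A s - Ai‖ ≤ C * Real.exp (-η * s) :=
    ae_mono (Measure.restrict_mono hsub le_rfl) hdec
  have hmA : AEStronglyMeasurable (fun s => A s - Ai) μ :=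
    (hA.meas.mono_set hsub).sub aestronglyMeasurable_const
  have hkm : ∀ x, AEStronglyMeasurable (k x) μ := fun x => by
    refine Finset.aestronglyMeasurable_fun_sum _ fun j _ => ?_
    have h1 : AEStronglyMeasurable (fun s => (modeKernel (a j - a i) x s : ℂ)) μ :=
      (Complex.measurable_ofReal.comp (measurable_modeKernel _ x)).aestronglyMeasurable
    have h2 : AEStronglyMeasurable (fun s => (P j).comp (A s - Ai)) μ :=
      (ContinuousLinearMap.compL ℂ E E E (P j)).continuous.comp_aestronglyMeasurable hmA
    exact h1.smul h2
  have hkn : ∀ x, ∀ᵐ s ∂μ, ‖k x s‖ ≤ N * Real.exp (-η * s) := fun x => by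
    filter_upwards [hdec'] with s hs
    simp only [hk, hN, Finset.sum_mul]
    refine (norm_sum_le _ _).trans (Finset.sum_le_sum fun j _ => ?_)
    rw [norm_smul, Complex.norm_real, Real.norm_eq_abs, mul_assoc]
    calc _ ≤ 1 * (‖P j‖ * ‖A s - Ai‖) :=
          mul_le_mul (abs_modeKernel_le _ _ _) (ContinuousLinearMap.opNorm_comp_le _ _)
            (norm_nonneg _) zero_le_one
      _ ≤ _ := by rw [one_mul]; gcongr
  have hbint : Integrable (fun s => N * Real.exp (-η * s)) μ :=
    (integrableOn_exp_mul_Ioi (by linarith) x₀).const_mul N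
  have hkc : ∀ x₁, ∀ᵐ s ∂μ, ContinuousAt (fun x => k x s) x₁ := fun x₁ => by
    have hne : ∀ᵐ s ∂μ, s ≠ x₁ := ae_restrict_of_ae (by simp [ae_iff])
    filter_upwards [hne] with s hs
    refine tendsto_finsetSum _ fun j _ => ?_
    exact ((Complex.continuous_ofReal.continuousAt.comp
      (continuousAt_modeKernel (a j - a i) hs)).smul continuousAt_const)
  obtain ⟨z, hzc, ⟨D, hD⟩, hz⟩ := exists_bounded_solution μ k (fun _ => b i) continuous_const
    (Cg := ‖b i‖) (fun _ => le_rfl) hkm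
    (fun x₁ => ⟨_, hbint, Eventually.of_forall hkn⟩) hkc (q := 1 / 2) (by norm_num) (by norm_num)
    (fun x => by
      refine (integral_mono_of_nonneg (Eventually.of_forall fun _ => norm_nonneg _) hbint
        (hkn x)).trans ?_
      rw [integral_const_mul, integral_exp_mul_Ioi (by linarith)]
      refine le_trans (le_of_eq ?_) hx₀N
      rw [neg_div_neg_eq])
  have hD0 : 0 ≤ D := (norm_nonneg _).trans (hD 0)
  have hmz : ∀ x, AEStronglyMeasurable (fun s => k x s (z s)) μ := fun x =>
    ContinuousLinearMap.aestronglyMeasurable_comp₂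
      (ContinuousLinearMap.id ℂ (E →L[ℂ] E)) (hkm x) hzc.aestronglyMeasurable
  have hkz : ∀ x, ∀ᵐ s ∂μ, ‖k x s (z s)‖ ≤ N * Real.exp (-η * s) * D := fun x => by
    filter_upwards [hkn x] with s hs
    exact (k x s).le_of_opNorm_le_of_le hs (hD s)
  have hiz : ∀ x, Integrable (fun s => k x s (z s)) μ := fun x =>
    (hbint.mul_const D).mono' (hmz x) (hkz x)
  refine ⟨x₀, z, hx₀, hzc, ⟨D, hD⟩, ?_, fun x j => ?_⟩
  · have h0 : Tendsto (fun x => ∫ s, k x s (z s) ∂μ) atTop (𝓝 (∫ _s, (0 : E) ∂μ)) := by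
      refine tendsto_integral_filter_of_dominated_convergence
        (fun s => N * Real.exp (-η * s) * D) (Eventually.of_forall hmz)
        (Eventually.of_forall hkz) (hbint.mul_const D) (Eventually.of_forall fun s => ?_)
      have h1 : Tendsto (fun x => k x s) atTop (𝓝 (∑ j, ((0 : ℝ) : ℂ) • (P j).comp (A s - Ai))) :=
        tendsto_finsetSum _ fun j _ => ((Complex.continuous_ofReal.tendsto 0).comp
          (tendsto_modeKernel (a j - a i) s)).smul_const _
      have h2 : Tendsto (fun x => k x s (z s)) atTop
          (𝓝 ((∑ j, ((0 : ℝ) : ℂ) • (P j).comp (A s - Ai)) (z s))) :=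
        (ContinuousLinearMap.apply ℂ E (z s)).continuous.continuousAt.tendsto.comp h1
      simpa only [Complex.ofReal_zero, zero_smul, Finset.sum_const_zero, _root_.zero_apply] using h2
    have h1 := h0.const_add (b i)
    rw [integral_zero, add_zero] at h1
    exact h1.congr fun x => (hz x).symm
  · have h1 : coordCLM b j (z x) = coordCLM b j (b i) + ∫ s, coordCLM b j (k x s (z s)) ∂μ := by
      rw [ContinuousLinearMap.integral_comp_comm _ (hiz x), ← map_add, ← hz x]
    simp only [coordCLM_apply] at h1
    rw [h1]
    congr 1
    refine integral_congr_ae (Eventually.of_forall fun s => ?_)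
    have e : k x s (z s) = ∑ j, ((modeKernel (a j - a i) x s : ℂ) *
        b.repr ((A s - Ai) (z s)) j) • b j := by
      simp only [hk, hP, _root_.sum_apply, _root_.smul_apply,
        ContinuousLinearMap.comp_apply, ContinuousLinearMap.smulRight_apply, coordCLM_apply,
        smul_smul]
    simp only
    rw [e, b.repr_sum_self]

/-- Levinson's theorem: every mode of the limiting equation is asymptotic to a solution. -/
theorem exists_asymptotic_solution (b : Module.Basis ι ℂ E) (a : ι → ℝ) (i : ι) (Ai : E →L[ℂ] E)
    (hb : ∀ j, Ai (b j) = (a j : ℂ) • b j)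
    (hA : BddCoef A M) {C η : ℝ} (hη : 0 < η) (hC : 0 ≤ C)
    (hdec : ∀ᵐ s ∂halfLine, ‖A s - Ai‖ ≤ C * Real.exp (-η * s))
    {Φ : ℝ → E →L[ℂ] E} (hΦ : ∀ c, IsIntSol A fun x => Φ x c)
    (hinj : ∀ x, 0 ≤ x → Function.Injective (Φ x)) :
    ∃ u, Tendsto (fun x => (Real.exp (-a i * x) : ℂ) • Φ x u) atTop (𝓝 (b i)) := by
  obtain ⟨x₀, z, hx₀, hzc, ⟨D, hD⟩, hlim, hz⟩ := exists_mode_integral b a i Ai hA hη hC hdec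
  have hsub : Set.Ioi x₀ ⊆ Set.Ioi 0 := Set.Ioi_subset_Ioi hx₀
  set r : ι → ℝ → ℂ := fun j s => b.repr ((A s - Ai) (z s)) j with hr
  have hmr : ∀ j, AEStronglyMeasurable (r j) (volume.restrict (Set.Ioi x₀)) := fun j => by
    refine (coordCLM b j).continuous.comp_aestronglyMeasurable ?_
    exact ContinuousLinearMap.aestronglyMeasurable_comp₂
      (ContinuousLinearMap.id ℂ (E →L[ℂ] E)) ((hA.meas.mono_set hsub).sub aestronglyMeasurable_const)
      hzc.aestronglyMeasurable
  have hrb : ∀ j, ∀ᵐ s ∂(volume.restrict (Set.Ioi x₀)),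
      ‖r j s‖ ≤ ‖coordCLM b j‖ * (C * Real.exp (-η * s) * D) := fun j => by
    filter_upwards [ae_mono (Measure.restrict_mono hsub le_rfl) hdec] with s hs
    exact (coordCLM b j).le_opNorm_of_le ((A s - Ai).le_of_opNorm_le_of_le hs (hD s))
  have hri : ∀ j, IntegrableOn (r j) (Set.Ioi x₀) := fun j =>
    Integrable.mono' ((((integrableOn_exp_mul_Ioi (by linarith : -η < 0) x₀).const_mul C).mul_const
      D).const_mul _) (hmr j) (hrb j)
  set y : ℝ → E := fun x => (Real.exp (a i * x) : ℂ) • z x with hy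
  have hyc : Continuous y := by fun_prop
  -- the coordinates of `y` satisfy the variation of constants formula
  have hform : ∀ j, ∃ κ : ℂ, ∀ x, x₀ ≤ x → b.repr (y x) j = Real.exp (a j * x) *
      (κ + ∫ s in x₀..x, (Real.exp (-a j * s) : ℂ) * b.repr ((A s - Ai) (y s)) j) := by
    intro j
    refine ⟨b.repr (b i) j + (if a j - a i < 0 then 0 else
      -∫ s in Set.Ioi x₀, (Real.exp (-(a j - a i) * s) : ℂ) * r j s), fun x hx => ?_⟩
    have e1 : b.repr (y x) j = Real.exp (a i * x) * b.repr (z x) j := by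
      simp [hy]
    have e2 : ∀ s, (Real.exp (-a j * s) : ℂ) * b.repr ((A s - Ai) (y s)) j =
        Real.exp (-(a j - a i) * s) * r j s := fun s => by
      simp only [hy, hr, map_smul, Finsupp.smul_apply, smul_eq_mul]
      rw [← mul_assoc, ← Complex.ofReal_mul, ← Real.exp_add]
      congr 3; ring
    have e3 : (Real.exp (a i * x) : ℂ) * Real.exp ((a j - a i) * x) = Real.exp (a j * x) := by
      rw [← Complex.ofReal_mul, ← Real.exp_add]; congr 2; ring
    have e4 : (Real.exp (a i * x) : ℂ) * b.repr (b i) j = Real.exp (a j * x) * b.repr (b i) j := by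
      by_cases hij : i = j
      · rw [hij]
      · simp [hij]
    rw [e1, hz x j, integral_modeKernel hx (hri j), mul_add, e4, ← mul_assoc, e3,
      intervalIntegral.integral_congr (fun s _ => e2 s)]
    ring
  have hAi : ∀ s t, x₀ ≤ s → x₀ ≤ t → IntervalIntegrable (fun s => A s (y s)) volume s t :=
    fun s t hs ht => hA.intervalIntegrable hyc (hx₀.trans hs) (hx₀.trans ht)
  have hyeq : ∀ x, x₀ ≤ x → y x = y x₀ + ∫ s in x₀..x, A s (y s) := by
    intro x hx
    rw [← sub_eq_iff_eq_add']
    refine b.ext_elem fun j => ?_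
    obtain ⟨κ, hκ⟩ := hform j
    have hint : IntervalIntegrable (fun s => (Real.exp (-a j * s) : ℂ) *
        b.repr ((A s - Ai) (y s)) j) volume x₀ x := by
      have h1 : IntervalIntegrable (fun s => (A s - Ai) (y s)) volume x₀ x :=
        (hAi x₀ x le_rfl hx).sub ((Ai.continuous.comp hyc).intervalIntegrable _ _)
      have h2 : IntervalIntegrable (fun s => coordCLM b j ((A s - Ai) (y s))) volume x₀ x :=
        ⟨(coordCLM b j).integrable_comp h1.1, (coordCLM b j).integrable_comp h1.2⟩
      refine h2.continuousOn_mul (Continuous.continuousOn ?_)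
      fun_prop
    obtain ⟨B, hB0, hB⟩ := exists_norm_le_on_Icc (f := fun s => (Real.exp (-a j * s) : ℂ))
      (by fun_prop) x₀ x
    obtain ⟨B', hB'0, hB'⟩ := exists_norm_le_on_Icc hyc x₀ x
    have hbd : ∀ᵐ s, s ∈ Set.uIoc x₀ x → ‖(Real.exp (-a j * s) : ℂ) *
        b.repr ((A s - Ai) (y s)) j‖ ≤ B * (‖coordCLM b j‖ * ((M + ‖Ai‖) * B')) := by
      filter_upwards [ae_of_ae_halfLine hA.bdd hx₀ (hx₀.trans hx)] with s hs hs'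
      have hm : s ∈ Set.Icc x₀ x := by
        rw [Set.uIoc_of_le hx] at hs'; exact Set.Ioc_subset_Icc_self hs'
      rw [norm_mul]
      refine mul_le_mul (hB s hm) ?_ (norm_nonneg _) hB0
      exact (coordCLM b j).le_opNorm_of_le ((A s - Ai).le_of_opNorm_le_of_le
        ((norm_sub_le _ _).trans (add_le_add_left (hs hs') _)) (hB' s hm))
    have key := variation_of_constants (a := a j) (k := κ) hx hint hbd
    have h0 := hκ x₀ le_rfl
    rw [intervalIntegral.integral_same, add_zero] at h0
    rw [← hκ x hx, ← h0] at key
    have e1 : b.repr (∫ s in x₀..x, A s (y s)) j = ∫ s in x₀..x, b.repr (A s (y s)) j := by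
      exact ((coordCLM b j).intervalIntegral_comp_comm (hAi x₀ x le_rfl hx)).symm
    rw [map_sub, Finsupp.sub_apply, key, e1]
    refine intervalIntegral.integral_congr fun s hs => ?_
    rw [Set.uIcc_of_le hx] at hs
    rw [← hκ s hs.1, ← mul_assoc, ← Complex.ofReal_mul, ← Real.exp_add]
    rw [show a j * s + -a j * s = 0 by ring, Real.exp_zero, Complex.ofReal_one, one_mul,
      _root_.sub_apply, map_sub, Finsupp.sub_apply, repr_of_diagonal hb]
    ring
  obtain ⟨u, hu⟩ : ∃ u, Φ x₀ u = y x₀ :=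
    (LinearMap.injective_iff_surjective (f := (Φ x₀ : E →ₗ[ℂ] E))).1 (hinj x₀ hx₀) (y x₀)
  refine ⟨u, hlim.congr' ?_⟩
  filter_upwards [eventually_ge_atTop x₀] with x hx
  have h1 := (hΦ u).eq_of_integral_eq hA hyc hx₀ hu.symm hyeq hx
  rw [← h1]
  simp only [hy]
  rw [smul_smul, ← Complex.ofReal_mul, ← Real.exp_add]
  simp

end Levinson

section Eigenbasis

variable {n : ℕ}

theorem posDef_of_lower {M : Matrix (Fin n) (Fin n) ℂ} {θ : ℝ} (hθ : 0 < θ) (hM : M.IsHermitian)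
    (h : ∀ v, θ * nsq v ≤ (star v ⬝ᵥ M.mulVec v).re) : M.PosDef := by
  refine Matrix.PosDef.of_dotProduct_mulVec_pos hM fun x hx => ?_
  rw [RCLike.pos_iff (K := ℂ)]
  exact ⟨lt_of_lt_of_le (mul_pos hθ (nsq_pos hx)) (h x), hM.im_star_dotProduct_mulVec_self x⟩

open scoped MatrixOrder in
theorem Matrix.PosDef.exists_eq_conjTranspose_mul_self {M : Matrix (Fin n) (Fin n) ℂ}
    (hM : M.PosDef) : ∃ N : Matrix (Fin n) (Fin n) ℂ, M = N.conjTranspose * N ∧ IsUnit N.det := by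
  obtain ⟨N, hN⟩ := CStarAlgebra.nonneg_iff_eq_star_mul_self.1 hM.posSemidef.nonneg
  rw [Matrix.star_eq_conjTranspose] at hN
  refine ⟨N, hN, isUnit_iff_ne_zero.2 fun h => ?_⟩
  have := hM.det_pos
  rw [hN, Matrix.det_mul, h, mul_zero] at this
  exact lt_irrefl _ this

/-- The limiting coefficient matrix is diagonalizable with nonzero real eigenvalues. -/
theorem exists_eigenbasis {R W : Matrix (Fin n) (Fin n) ℂ} (hR : R.PosDef) (hW : W.PosDef) :
    ∃ (b : Module.Basis (Fin n ⊕ Fin n) ℂ (Fin n ⊕ Fin n → ℂ)) (a : Fin n ⊕ Fin n → ℝ),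
      (∀ i, mulVecCLM (blockCoef R W) (b i) = (a i : ℂ) • b i) ∧ ∀ i, a i ≠ 0 := by
  obtain ⟨A, hA, hAu⟩ := hR.exists_eq_conjTranspose_mul_self
  obtain ⟨B, hB, hBu⟩ := hW.exists_eq_conjTranspose_mul_self
  set H : Matrix (Fin n ⊕ Fin n) (Fin n ⊕ Fin n) ℂ :=
    Matrix.fromBlocks 0 (B * A.conjTranspose) (A * B.conjTranspose) 0 with hH
  have hHh : H.IsHermitian := by
    simp [hH, Matrix.IsHermitian, Matrix.fromBlocks_conjTranspose, Matrix.conjTranspose_mul]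
  set N : Matrix (Fin n ⊕ Fin n) (Fin n ⊕ Fin n) ℂ := Matrix.fromBlocks B 0 0 A with hN
  have hNM : N * blockCoef R W = H * N := by
    simp [hN, hH, blockCoef, Matrix.fromBlocks_multiply, hA, hB, Matrix.mul_assoc]
  have hNu : IsUnit N.det := by
    rw [hN, Matrix.det_fromBlocks_zero₂₁]
    exact hBu.mul hAu
  let e : (Fin n ⊕ Fin n → ℂ) ≃ₗ[ℂ] (Fin n ⊕ Fin n → ℂ) :=
    Matrix.toLin'OfInv (Matrix.nonsing_inv_mul N hNu) (Matrix.mul_nonsing_inv N hNu)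
  let b : Module.Basis (Fin n ⊕ Fin n) ℂ (Fin n ⊕ Fin n → ℂ) :=
    (hHh.eigenvectorBasis.toBasis.map (WithLp.linearEquiv 2 ℂ (Fin n ⊕ Fin n → ℂ))).map e.symm
  have hb : ∀ i, N.mulVec (b i) = hHh.eigenvectorBasis i := fun i => by
    have : e (b i) = hHh.eigenvectorBasis i := by simp [b]
    exact this
  have heig : ∀ i, (blockCoef R W).mulVec (b i) = (hHh.eigenvalues i : ℂ) • b i := fun i => by
    refine e.injective ?_
    change N.mulVec _ = N.mulVec _
    rw [Matrix.mulVec_mulVec, hNM, ← Matrix.mulVec_mulVec, hb, hHh.mulVec_eigenvectorBasis,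
      Matrix.mulVec_smul, hb]
    rfl
  refine ⟨b, hHh.eigenvalues, heig, fun i hi => ?_⟩
  have h0 := heig i
  rw [hi, Complex.ofReal_zero, zero_smul, ← Sum.elim_comp_inl_inr (b i), blockCoef,
    Matrix.fromBlocks_mulVec] at h0
  simp only [Sum.elim_comp_inl, Sum.elim_comp_inr, Matrix.zero_mulVec, add_zero, zero_add] at h0
  have h1 : ∀ j, (R.mulVec (b i ∘ Sum.inr)) j = 0 := fun j => congrFun h0 (Sum.inl j)
  have h2 : ∀ j, (W.mulVec (b i ∘ Sum.inl)) j = 0 := fun j => congrFun h0 (Sum.inr j)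
  have h3 : b i ∘ Sum.inr = 0 :=
    Matrix.eq_zero_of_mulVec_eq_zero hR.det_pos.ne' (funext h1)
  have h4 : b i ∘ Sum.inl = 0 :=
    Matrix.eq_zero_of_mulVec_eq_zero hW.det_pos.ne' (funext h2)
  refine b.ne_zero i ?_
  rw [← Sum.elim_comp_inl_inr (b i), h3, h4]
  ext j
  rcases j with j | j <;> rfl

end Eigenbasis

section Modes

variable {E : Type*} [NormedAddCommGroup E] [NormedSpace ℂ E]
  {ι : Type*} [Fintype ι]

/-- An asymptotic diagonalization `Φ x (u i) = e^{a i x} Θ x (b i)` with `Θ x → 1`. -/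
structure AsymptoticModes (ι : Type*) (Φ : ℝ → E →L[ℂ] E) (Ai : E →L[ℂ] E) where
  /-- the eigenvectors of the limiting operator -/
  b : Module.Basis ι ℂ E
  /-- the initial values of the modes -/
  u : Module.Basis ι ℂ E
  /-- the exponents -/
  a : ι → ℝ
  /-- the correction factor -/
  Θ : ℝ → E →L[ℂ] E
  eig : ∀ i, Ai (b i) = (a i : ℂ) • b i
  ne_zero : ∀ i, a i ≠ 0
  tendsto : Tendsto Θ atTop (𝓝 1)
  eq : ∀ x i, Φ x (u i) = (Real.exp (a i * x) : ℂ) • Θ x (b i)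

theorem exists_asymptoticModes [FiniteDimensional ℂ E] {Φ : ℝ → E →L[ℂ] E} {Ai : E →L[ℂ] E}
    (b : Module.Basis ι ℂ E) (a : ι → ℝ) (hb : ∀ i, Ai (b i) = (a i : ℂ) • b i)
    (ha : ∀ i, a i ≠ 0)
    (h : ∀ i, ∃ u, Tendsto (fun x => (Real.exp (-a i * x) : ℂ) • Φ x u) atTop (𝓝 (b i))) :
    Nonempty (AsymptoticModes ι Φ Ai) := by
  choose u hu using h
  obtain ⟨x, hx, hx0⟩ : ∃ x : ℝ, LinearIndependent ℂ (fun i => (Real.exp (-a i * x) : ℂ) • Φ x (u i)) ∧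
      0 ≤ x := by
    have h1 : Tendsto (fun x => fun i => (Real.exp (-a i * x) : ℂ) • Φ x (u i)) atTop (𝓝 b) :=
      tendsto_pi_nhds.2 hu
    exact ((h1.eventually b.linearIndependent.eventually).and (eventually_ge_atTop 0)).exists
  have hui : LinearIndependent ℂ u := by
    have h2 : LinearIndependent ℂ (fun i => Φ x (u i)) := by
      have := hx.units_smul fun i => Units.mk0 (Real.exp (a i * x) : ℂ)
        (by exact_mod_cast (Real.exp_pos _).ne')
      convert this using 1
      ext1 i
      simp only [Pi.smul_apply', Units.smul_def, Units.val_mk0]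
      rw [smul_smul, ← Complex.ofReal_mul, ← Real.exp_add]
      simp
    exact LinearIndependent.of_comp (Φ x : E →ₗ[ℂ] E) h2
  have hcard : Fintype.card ι = Module.finrank ℂ E := (Module.finrank_eq_card_basis b).symm
  let ub : Module.Basis ι ℂ E :=
    Module.Basis.mk hui (by rw [hui.span_eq_top_of_card_eq_finrank' hcard])
  let Θ : ℝ → E →L[ℂ] E := fun x => ∑ i, (coordCLM b i).smulRight
    ((Real.exp (-a i * x) : ℂ) • Φ x (u i))
  refine ⟨⟨b, ub, a, Θ, hb, ha, ?_, fun x i => ?_⟩⟩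
  · have h1 : Tendsto Θ atTop (𝓝 (∑ i, (coordCLM b i).smulRight (b i))) := by
      refine tendsto_finsetSum _ fun i _ => ?_
      exact ((ContinuousLinearMap.smulRightL ℂ E E (coordCLM b i)).continuous.tendsto _).comp (hu i)
    convert h1 using 2
    ext1 v
    simp [_root_.sum_apply, b.sum_repr]
  · classical
    have : Θ x (b i) = (Real.exp (-a i * x) : ℂ) • Φ x (u i) := by
      simp only [Θ, _root_.sum_apply, ContinuousLinearMap.smulRight_apply, coordCLM_apply,
        b.repr_self]
      rw [Finset.sum_eq_single i (fun j _ hj => by simp [Ne.symm hj])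
        (by simp)]
      simp
    rw [this, smul_smul, ← Complex.ofReal_mul, ← Real.exp_add]
    simp [ub]

namespace AsymptoticModes

variable {Φ : ℝ → E →L[ℂ] E} {Ai : E →L[ℂ] E} (m : AsymptoticModes ι Φ Ai)
include m

theorem apply_eq (w : E) (x : ℝ) :
    Φ x w = m.Θ x (∑ i, ((Real.exp (m.a i * x) : ℂ) * m.u.repr w i) • m.b i) := by
  conv_lhs => rw [← m.u.sum_repr w]
  simp only [map_sum, map_smul, m.eq, smul_smul, mul_comm]

theorem tendsto_apply {w : E} {mu : ℝ} (hw : ∀ i, m.u.repr w i ≠ 0 → m.a i ≤ mu) :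
    Tendsto (fun x => (Real.exp (-mu * x) : ℂ) • Φ x w) atTop
      (𝓝 (∑ i, (if m.a i = mu then m.u.repr w i else 0) • m.b i)) := by
  have h1 : Tendsto (fun x => ∑ i, ((Real.exp ((m.a i - mu) * x) : ℂ) * m.u.repr w i) • m.b i)
      atTop (𝓝 (∑ i, (if m.a i = mu then m.u.repr w i else 0) • m.b i)) := by
    refine tendsto_finsetSum _ fun i _ => Tendsto.smul_const ?_ _
    split_ifs with h
    · simp [h]
    · by_cases h0 : m.u.repr w i = 0
      · simp [h0]
      · have hlt : m.a i - mu < 0 := sub_neg.2 (lt_of_le_of_ne (hw i h0) h)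
        have h2 : Tendsto (fun x => Real.exp ((m.a i - mu) * x)) atTop (𝓝 0) :=
          Real.tendsto_exp_atBot.comp (tendsto_id.const_mul_atTop_of_neg hlt)
        have h3 := ((Complex.continuous_ofReal.tendsto 0).comp h2).mul_const (m.u.repr w i)
        simpa using h3
  have ht : Tendsto m.Θ atTop (𝓝 1) := m.tendsto
  have h2 : Tendsto (fun x => m.Θ x (∑ i, ((Real.exp ((m.a i - mu) * x) : ℂ) *
      m.u.repr w i) • m.b i)) atTop (𝓝 (∑ i, (if m.a i = mu then m.u.repr w i else 0) • m.b i)) :=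
    (isBoundedBilinearMap_apply (𝕜 := ℂ) (E := E) (F := E)).continuous.continuousAt.tendsto.comp
      (ht.prodMk_nhds h1)
  refine h2.congr fun x => ?_
  rw [m.apply_eq, ← map_smul, Finset.smul_sum]
  congr 1
  refine Finset.sum_congr rfl fun i _ => ?_
  rw [smul_smul, ← mul_assoc, ← Complex.ofReal_mul, ← Real.exp_add]
  congr 4; ring

theorem eig_sum (c : ι → ℂ) (mu : ℝ) :
    Ai (∑ i, (if m.a i = mu then c i else 0) • m.b i) =
      (mu : ℂ) • ∑ i, (if m.a i = mu then c i else 0) • m.b i := by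
  simp only [map_sum, map_smul, m.eig, Finset.smul_sum, smul_smul]
  refine Finset.sum_congr rfl fun i _ => ?_
  split_ifs with h
  · rw [h, mul_comm]
  · simp

/-- Every nonzero solution has a leading exponent and a leading eigenvector. -/
theorem exists_leading {w : E} (hw : w ≠ 0) : ∃ (mu : ℝ) (v : E), v ≠ 0 ∧
    Ai v = (mu : ℂ) • v ∧ (∃ i, m.a i = mu ∧ m.u.repr w i ≠ 0) ∧
    (∀ i, m.u.repr w i ≠ 0 → m.a i ≤ mu) ∧
    Tendsto (fun x => (Real.exp (-mu * x) : ℂ) • Φ x w) atTop (𝓝 v) := by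
  classical
  have hne : (Finset.univ.filter fun i => m.u.repr w i ≠ 0).Nonempty := by
    by_contra h
    rw [Finset.not_nonempty_iff_eq_empty, Finset.filter_eq_empty_iff] at h
    refine hw (m.u.ext_elem fun i => ?_)
    simpa using h (Finset.mem_univ i)
  obtain ⟨k, hk, hmax⟩ := Finset.exists_max_image _ m.a hne
  rw [Finset.mem_filter] at hk
  have hle : ∀ i, m.u.repr w i ≠ 0 → m.a i ≤ m.a k := fun i hi => hmax i (by simp [hi])
  refine ⟨m.a k, _, ?_, m.eig_sum _ _, ⟨k, rfl, hk.2⟩, hle, m.tendsto_apply hle⟩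
  intro h0
  have := congrArg (fun v => m.b.repr v k) h0
  simp only [m.b.repr_sum_self, map_zero, Finsupp.zero_apply, if_true] at this
  exact hk.2 this

end AsymptoticModes

/-- The initial values of the solutions that tend to zero. -/
def decaySpace (Φ : ℝ → E →L[ℂ] E) : Submodule ℂ E where
  carrier := {w | Tendsto (fun x => Φ x w) atTop (𝓝 0)}
  zero_mem' := by simp
  add_mem' {v w} hv hw := by simpa using Tendsto.add hv hw
  smul_mem' c v hv := by simpa using Tendsto.const_smul hv c

theorem mem_decaySpace {Φ : ℝ → E →L[ℂ] E} {w : E} :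
    w ∈ decaySpace Φ ↔ Tendsto (fun x => Φ x w) atTop (𝓝 0) := Iff.rfl

theorem mem_decaySpace_of_exp {Φ : ℝ → E →L[ℂ] E} {w : E} {δ : ℝ} (hδ : 0 < δ)
    (h : Tendsto (fun x => (Real.exp (δ * x) : ℂ) • Φ x w) atTop (𝓝 0)) : w ∈ decaySpace Φ := by
  have h2 : Tendsto (fun x => Real.exp (-δ * x)) atTop (𝓝 0) :=
    Real.tendsto_exp_atBot.comp (tendsto_id.const_mul_atTop_of_neg (by linarith))
  have h3 := ((Complex.continuous_ofReal.tendsto 0).comp h2).smul h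
  rw [smul_zero] at h3
  refine h3.congr fun x => ?_
  simp only [Function.comp_apply]
  rw [smul_smul, ← Complex.ofReal_mul, ← Real.exp_add]
  simp

namespace AsymptoticModes

variable {Φ : ℝ → E →L[ℂ] E} {Ai : E →L[ℂ] E} (m : AsymptoticModes ι Φ Ai)
include m

theorem tendsto_of_forall {w : E} (h : ∀ i, m.u.repr w i ≠ 0 → m.a i < 0) :
    ∃ δ > 0, Tendsto (fun x => (Real.exp (δ * x) : ℂ) • Φ x w) atTop (𝓝 0) := by
  by_cases hw : w = 0
  · exact ⟨1, one_pos, by simp [hw]⟩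
  obtain ⟨mu, v, -, -, ⟨i, hi, hi0⟩, -, ht⟩ := m.exists_leading hw
  have hmu : mu < 0 := hi ▸ h i hi0
  refine ⟨-mu / 2, by linarith, ?_⟩
  have h2 : Tendsto (fun x => Real.exp (mu / 2 * x)) atTop (𝓝 0) :=
    Real.tendsto_exp_atBot.comp (tendsto_id.const_mul_atTop_of_neg (by linarith))
  have h3 := ((Complex.continuous_ofReal.tendsto 0).comp h2).smul ht
  rw [Complex.ofReal_zero, zero_smul] at h3
  refine h3.congr fun x => ?_
  simp only [Function.comp_apply]
  rw [smul_smul, ← Complex.ofReal_mul, ← Real.exp_add]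
  congr 3; ring

/-- A solution that does not decay grows exponentially along an eigenvector. -/
theorem exists_leading_pos {w : E} (hw : w ∉ decaySpace Φ) : ∃ (mu : ℝ) (v : E), 0 < mu ∧ v ≠ 0 ∧
    Ai v = (mu : ℂ) • v ∧
    Tendsto (fun x => (Real.exp (-mu * x) : ℂ) • Φ x w) atTop (𝓝 v) := by
  have hw0 : w ≠ 0 := fun h => hw (h ▸ zero_mem _)
  obtain ⟨mu, v, hv, hev, ⟨i, hi, -⟩, hle, ht⟩ := m.exists_leading hw0
  refine ⟨mu, v, ?_, hv, hev, ht⟩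
  by_contra hmu
  have hmu' : mu < 0 := lt_of_le_of_ne (not_lt.1 hmu) (hi ▸ m.ne_zero i)
  obtain ⟨δ, hδ, h⟩ := m.tendsto_of_forall (w := w) fun i hi => (hle i hi).trans_lt hmu'
  exact hw (mem_decaySpace_of_exp hδ h)

theorem mem_decaySpace_iff {w : E} :
    w ∈ decaySpace Φ ↔ ∀ i, m.u.repr w i ≠ 0 → m.a i < 0 := by
  constructor
  · intro hw i hi
    by_contra hpos
    have hw0 : w ≠ 0 := fun h => hi (by simp [h])
    obtain ⟨mu, v, hv, -, -, hle, ht⟩ := m.exists_leading hw0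
    have hmu : 0 ≤ mu := (not_lt.1 hpos).trans (hle i hi)
    have hb : IsBoundedUnder (· ≤ ·) atTop (norm ∘ fun x => (Real.exp (-mu * x) : ℂ)) :=
      isBoundedUnder_of_eventually_le (a := 1) (by
        filter_upwards [eventually_ge_atTop 0] with x hx
        rw [Function.comp_apply, Complex.norm_real, Real.norm_eq_abs, Real.abs_exp,
          Real.exp_le_one_iff]
        nlinarith)
    have h0 : Tendsto (fun x => (Real.exp (-mu * x) : ℂ) • Φ x w) atTop (𝓝 0) :=
      hb.smul_tendsto_zero hw
    exact hv (tendsto_nhds_unique ht h0)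
  · intro h
    obtain ⟨δ, hδ, h⟩ := m.tendsto_of_forall h
    exact mem_decaySpace_of_exp hδ h

theorem exists_exp_decay {w : E} (hΦ : Continuous fun x => Φ x w) (hw : w ∈ decaySpace Φ) :
    ∃ C δ : ℝ, 0 < δ ∧ 0 ≤ C ∧ ∀ x, 0 ≤ x → ‖Φ x w‖ ≤ C * Real.exp (-δ * x) := by
  obtain ⟨δ, hδ, h⟩ := m.tendsto_of_forall (m.mem_decaySpace_iff.1 hw)
  have h1 : ∀ᶠ x in atTop, ‖(Real.exp (δ * x) : ℂ) • Φ x w‖ ≤ 1 := by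
    have := h.norm
    rw [norm_zero] at this
    exact this.eventually (ge_mem_nhds one_pos)
  obtain ⟨X, hX⟩ := eventually_atTop.1 h1
  obtain ⟨C, hC0, hC⟩ := exists_norm_le_on_Icc
    (f := fun x => (Real.exp (δ * x) : ℂ) • Φ x w) (by fun_prop) 0 X
  refine ⟨max C 1, δ, hδ, hC0.trans (le_max_left _ _), fun x hx => ?_⟩
  have h2 : ‖(Real.exp (δ * x) : ℂ) • Φ x w‖ ≤ max C 1 := by
    rcases le_total X x with h | h
    · exact (hX x h).trans (le_max_right _ _)
    · exact (hC x ⟨hx, h⟩).trans (le_max_left _ _)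
  rw [norm_smul, Complex.norm_real, Real.norm_eq_abs, Real.abs_exp] at h2
  calc ‖Φ x w‖ = Real.exp (δ * x) * ‖Φ x w‖ * Real.exp (-δ * x) := by
        rw [mul_comm (Real.exp _) ‖_‖, mul_assoc, ← Real.exp_add]; simp
    _ ≤ _ := mul_le_mul_of_nonneg_right h2 (Real.exp_pos _).le

end AsymptoticModes

end Modes

section SystemModes

variable {n : ℕ} {T : HSys n} {Rp Vp Qp : Matrix (Fin n) (Fin n) ℂ} {K θ η lam c : ℝ}

/-- `Vp - lam Qp` is bounded below by `c`. -/
def GapBound (Vp Qp : Matrix (Fin n) (Fin n) ℂ) (c lam : ℝ) : Prop :=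
  ∀ v : Fin n → ℂ, c * nsq v ≤ (star v ⬝ᵥ (Vp - (lam : ℂ) • Qp).mulVec v).re

/-- The limiting coefficient. -/
noncomputable def endCoef (Rp Vp Qp : Matrix (Fin n) (Fin n) ℂ) (lam : ℝ) :
    (Fin n ⊕ Fin n → ℂ) →L[ℂ] (Fin n ⊕ Fin n → ℂ) :=
  mulVecCLM (blockCoef Rp (Vp - (lam : ℂ) • Qp))

theorem norm_mulVecCLM_blockCoef_sub_le {R V Q R' V' Q' : Matrix (Fin n) (Fin n) ℂ}
    {δ lam lam' : ℝ} (hδ : 0 ≤ δ) (hK : 0 ≤ K)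
    (h : ∀ i j, ‖R i j - R' i j‖ ≤ δ ∧ ‖V i j - V' i j‖ ≤ δ ∧ ‖Q i j - Q' i j‖ ≤ δ)
    (hQ : ∀ i j, ‖Q' i j‖ ≤ K) :
    ‖mulVecCLM (blockCoef R (V - (lam : ℂ) • Q)) - mulVecCLM (blockCoef R' (V' - (lam' : ℂ) • Q'))‖ ≤
      2 * n * ((1 + |lam|) * δ + |lam - lam'| * K) := by
  rw [← mulVecCLM_sub]
  have e : blockCoef R (V - (lam : ℂ) • Q) - blockCoef R' (V' - (lam' : ℂ) • Q') =
      blockCoef (R - R') ((V - V') - (lam : ℂ) • (Q - Q') - ((lam - lam' : ℝ) : ℂ) • Q') := by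
    unfold blockCoef
    ext i j
    rcases i with i | i <;> rcases j with j | j <;> simp
    ring
  rw [e]
  refine norm_blockCoef_le (by positivity) (fun i j => ?_) (fun i j => ?_)
  · refine (h i j).1.trans ?_
    nlinarith [mul_nonneg (abs_nonneg lam) hδ, mul_nonneg (abs_nonneg (lam - lam')) hK]
  · simp only [Matrix.sub_apply, Matrix.smul_apply, smul_eq_mul]
    refine (norm_sub_le _ _).trans ?_
    have h1 : ‖V i j - V' i j - (lam : ℂ) * (Q i j - Q' i j)‖ ≤ δ + |lam| * δ := by
      refine (norm_sub_le _ _).trans (add_le_add (h i j).2.1 ?_)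
      rw [norm_mul, Complex.norm_real, Real.norm_eq_abs]
      exact mul_le_mul_of_nonneg_left (h i j).2.2 (abs_nonneg _)
    have h2 : ‖((lam - lam' : ℝ) : ℂ) * Q' i j‖ ≤ |lam - lam'| * K := by
      rw [norm_mul, Complex.norm_real, Real.norm_eq_abs]
      exact mul_le_mul_of_nonneg_left (hQ i j) (abs_nonneg _)
    linarith

theorem HSys.Bounds.ae_norm_coef_sub_le (hT : T.Bounds Rp Vp Qp K θ η) (lam : ℝ) :
    ∀ᵐ x ∂halfLine, ‖T.coef lam x - endCoef Rp Vp Qp lam‖ ≤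
      2 * n * (1 + |lam|) * K * Real.exp (-η * x) := by
  filter_upwards [hT.decay] with x hx
  refine (norm_mulVecCLM_blockCoef_sub_le (K := K) (mul_nonneg hT.K_pos.le (Real.exp_pos _).le)
    hT.K_pos.le hx (fun i j => (hT.bound_end i j).2.2)).trans (le_of_eq ?_)
  rw [sub_self, abs_zero]
  ring

theorem HSys.Bounds.nonempty_modes (hT : T.Bounds Rp Vp Qp K θ η) (hc : 0 < c)
    (hg : GapBound Vp Qp c lam) :
    Nonempty (AsymptoticModes (Fin n ⊕ Fin n) (T.Φ lam) (endCoef Rp Vp Qp lam)) := by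
  obtain ⟨b, a, hb, ha⟩ := exists_eigenbasis
    (posDef_of_lower hT.θ_pos hT.herm_end.1 fun v => (hT.lower_end v).1)
    (posDef_of_lower hc (isHermitian_sub_real_smul hT.herm_end.2.1 hT.herm_end.2.2 lam) hg)
  have hK := hT.K_pos
  exact exists_asymptoticModes b a hb ha fun i =>
    exists_asymptotic_solution b a i (endCoef Rp Vp Qp lam) hb (hT.bddCoef lam) hT.η_pos
      (by positivity) (hT.ae_norm_coef_sub_le lam) (hT.Φ_spec lam).2.2
      (fun x hx => hT.Φ_injective lam hx)

theorem sesq_J_endCoef (hT : T.Bounds Rp Vp Qp K θ η) (u v : Fin n ⊕ Fin n → ℂ) :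
    star (endCoef Rp Vp Qp lam u) ⬝ᵥ (Matrix.J (Fin n) ℂ).mulVec v +
      star u ⬝ᵥ (Matrix.J (Fin n) ℂ).mulVec (endCoef Rp Vp Qp lam v) = 0 := by
  have h := sesq_mulVec_add (blockCoef Rp (Vp - (lam : ℂ) • Qp))
    (blockCoef Rp (Vp - (lam : ℂ) • Qp)) (Matrix.J (Fin n) ℂ) u v
  rw [blockCoef_J hT.herm_end.1
    (isHermitian_sub_real_smul hT.herm_end.2.1 hT.herm_end.2.2 lam)] at h
  simp only [sub_self, Matrix.fromBlocks_zero, Matrix.zero_mulVec, dotProduct_zero] at h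
  exact h

theorem isIsotropic_span {s : Set (Fin n ⊕ Fin n → ℂ)}
    (h : ∀ u ∈ s, ∀ v ∈ s, star v ⬝ᵥ (Matrix.J (Fin n) ℂ).mulVec u = 0) :
    IsIsotropic (Submodule.span ℂ s) := by
  intro u hu v hv
  induction hv using Submodule.span_induction with
  | zero => simp
  | add v w _ _ hv hw => rw [star_add, add_dotProduct, hv, hw, add_zero]
  | smul c v _ hv => rw [star_smul, smul_dotProduct, hv, smul_zero]
  | mem v hv =>
    induction hu using Submodule.span_induction with
    | zero => simp
    | add u w _ _ hu hw => rw [Matrix.mulVec_add, dotProduct_add, hu, hw, add_zero]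
    | smul c u _ hu => rw [Matrix.mulVec_smul, dotProduct_smul, hu, smul_zero]
    | mem u hu => exact h u hu v hv

theorem tendsto_star_dotProduct_mulVec {α ι : Type*} [Fintype ι] {l : Filter α}
    (N : Matrix ι ι ℂ) {f g : α → ι → ℂ} {u v : ι → ℂ} (hf : Tendsto f l (𝓝 u))
    (hg : Tendsto g l (𝓝 v)) :
    Tendsto (fun x => star (f x) ⬝ᵥ N.mulVec (g x)) l (𝓝 (star u ⬝ᵥ N.mulVec v)) := by
  have h1 : Tendsto (fun x => sesq N (f x)) l (𝓝 (sesq N u)) := ((sesq N).continuous.tendsto u).comp hf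
  have h2 : Tendsto (fun x => sesq N (f x) (g x)) l (𝓝 (sesq N u v)) :=
    (isBoundedBilinearMap_apply (𝕜 := ℝ) (E := ι → ℂ) (F := ℂ)).continuous.continuousAt.tendsto.comp
      (h1.prodMk_nhds hg)
  exact h2

theorem HSys.Bounds.isIsotropic_decaySpace (hT : T.Bounds Rp Vp Qp K θ η) (lam : ℝ) :
    IsIsotropic (decaySpace (T.Φ lam)) := by
  intro u hu v hv
  have hu' : Tendsto (fun x => T.Φ lam x u) atTop (𝓝 0) := hu
  have hv' : Tendsto (fun x => T.Φ lam x v) atTop (𝓝 0) := hv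
  have h1 := tendsto_star_dotProduct_mulVec (Matrix.J (Fin n) ℂ) hv' hu'
  rw [Matrix.mulVec_zero, dotProduct_zero] at h1
  have h2 : Tendsto (fun _ : ℝ => star v ⬝ᵥ (Matrix.J (Fin n) ℂ).mulVec u) atTop (𝓝 0) := by
    refine h1.congr' ?_
    filter_upwards [eventually_ge_atTop 0] with x hx
    exact hT.Φ_symplectic lam hx v u
  exact tendsto_nhds_unique tendsto_const_nhds h2

/-- The decaying solutions form a Lagrangian subspace. -/
theorem HSys.Bounds.isLagrangian_decaySpace (hT : T.Bounds Rp Vp Qp K θ η) (hc : 0 < c)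
    (hg : GapBound Vp Qp c lam) : IsLagrangian (decaySpace (T.Φ lam)) := by
  classical
  obtain ⟨m⟩ := hT.nonempty_modes hc hg
  refine (hT.isIsotropic_decaySpace lam).isLagrangian ?_
  set p : Fin n ⊕ Fin n → Prop := fun i => m.a i < 0 with hp
  have hpos : IsIsotropic (Submodule.span ℂ (Set.range fun i : {i // ¬ p i} => m.b i)) := by
    refine isIsotropic_span ?_
    rintro _ ⟨⟨i, hi⟩, rfl⟩ _ ⟨⟨j, hj⟩, rfl⟩
    have h := sesq_J_endCoef (lam := lam) hT (m.b j) (m.b i)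
    rw [m.eig, m.eig, star_smul, smul_dotProduct, Matrix.mulVec_smul, dotProduct_smul,
      RCLike.star_def, Complex.conj_ofReal, ← add_smul, ← Complex.ofReal_add] at h
    have h1 : 0 < m.a i := lt_of_le_of_ne (not_lt.1 hi) (m.ne_zero i).symm
    have h2 : 0 < m.a j := lt_of_le_of_ne (not_lt.1 hj) (m.ne_zero j).symm
    refine (smul_eq_zero.1 h).resolve_left ?_
    exact_mod_cast (add_pos h2 h1).ne'
  have h1 : Fintype.card {i // ¬ p i} ≤ n := by
    have hli := m.b.linearIndependent.comp (fun i : {i // ¬ p i} => (i : Fin n ⊕ Fin n))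
      Subtype.val_injective
    rw [← finrank_span_eq_card hli]
    exact hpos.finrank_le
  have h2 : Fintype.card {i // p i} ≤ Module.finrank ℂ (decaySpace (T.Φ lam)) := by
    have hli := m.u.linearIndependent.comp (fun i : {i // p i} => (i : Fin n ⊕ Fin n))
      Subtype.val_injective
    rw [← finrank_span_eq_card hli]
    refine Submodule.finrank_mono (Submodule.span_le.2 ?_)
    rintro _ ⟨⟨i, hi⟩, rfl⟩
    refine m.mem_decaySpace_iff.2 fun j hj => ?_
    have : i = j := by
      by_contra h
      exact hj (by simp [h])
    exact this ▸ hi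
  have h3 := Fintype.card_subtype_compl p
  rw [Fintype.card_sum, Fintype.card_fin] at h3
  have h4 := Fintype.card_subtype_le p
  rw [Fintype.card_sum, Fintype.card_fin] at h4
  omega

/-- The first component of an eigenvector is nonzero. -/
theorem endCoef_eigenvector_inl_ne_zero (hT : T.Bounds Rp Vp Qp K θ η) {mu : ℝ}
    {v : Fin n ⊕ Fin n → ℂ} (hv : v ≠ 0) (h : endCoef Rp Vp Qp lam v = (mu : ℂ) • v) :
    v ∘ Sum.inl ≠ 0 := by
  intro h0
  refine hv ?_
  have hR := posDef_of_lower hT.θ_pos hT.herm_end.1 fun v => (hT.lower_end v).1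
  have h1 : Rp.mulVec (v ∘ Sum.inr) = (mu : ℂ) • (v ∘ Sum.inl) := by
    rw [endCoef, mulVecCLM_apply, ← Sum.elim_comp_inl_inr v, blockCoef,
      Matrix.fromBlocks_mulVec] at h
    simp only [Sum.elim_comp_inl, Sum.elim_comp_inr, Matrix.zero_mulVec, zero_add] at h
    ext j
    exact congrFun h (Sum.inl j)
  rw [h0, smul_zero] at h1
  have h2 := Matrix.eq_zero_of_mulVec_eq_zero hR.det_pos.ne' h1
  rw [← Sum.elim_comp_inl_inr v, h0, h2]
  ext j
  rcases j with j | j <;> rfl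

end SystemModes

section Lyapunov

variable {n : ℕ} {T : HSys n} {Rp Vp Qp : Matrix (Fin n) (Fin n) ℂ} {K θ η lam c : ℝ}

/-- The matrix of the form `k |φ|² + Re (φ, ψ)`. -/
noncomputable def lyapMatrix (n : ℕ) (k : ℝ) : Matrix (Fin n ⊕ Fin n) (Fin n ⊕ Fin n) ℂ :=
  Matrix.fromBlocks ((k : ℂ) • 1) ((1 / 2 : ℂ) • 1) ((1 / 2 : ℂ) • 1) 0

/-- The form `k |φ|² + Re (φ, ψ)`. -/
noncomputable def lyap (k : ℝ) (v : Fin n ⊕ Fin n → ℂ) : ℝ :=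
  (star v ⬝ᵥ (lyapMatrix n k).mulVec v).re

theorem re_star_dotProduct_comm {ι : Type*} [Fintype ι] (u v : ι → ℂ) :
    (star u ⬝ᵥ v).re = (star v ⬝ᵥ u).re := by
  rw [← Complex.conj_re, ← RCLike.star_def, Matrix.star_dotProduct, star_star, dotProduct_comm]

theorem lyap_eq (k : ℝ) (v : Fin n ⊕ Fin n → ℂ) :
    lyap k v = k * nsq (v ∘ Sum.inl) + (star (v ∘ Sum.inl) ⬝ᵥ (v ∘ Sum.inr)).re := by
  rw [lyap, lyapMatrix, ← Sum.elim_comp_inl_inr v, Matrix.fromBlocks_mulVec]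
  simp only [Sum.elim_comp_inl, Sum.elim_comp_inr, Function.star_sumElim,
    sumElim_dotProduct_sumElim, Matrix.smul_mulVec, Matrix.one_mulVec, Matrix.zero_mulVec, add_zero,
    dotProduct_add, dotProduct_smul, smul_eq_mul, Complex.add_re, Complex.re_ofReal_mul, ← nsq_eq_re]
  have h : ∀ z : ℂ, ((1 / 2 : ℂ) * z).re = 1 / 2 * z.re := fun z => by
    have : ((1 / 2 : ℂ) * z) = ((1 / 2 : ℝ) : ℂ) * z := by push_cast; rfl
    rw [this, Complex.re_ofReal_mul]
  rw [h, h, re_star_dotProduct_comm (v ∘ Sum.inr)]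
  ring

theorem continuous_lyap (k : ℝ) : Continuous (lyap k : (Fin n ⊕ Fin n → ℂ) → ℝ) :=
  continuous_iff_continuousAt.2 fun _ =>
    (Complex.continuous_re.tendsto _).comp
      (tendsto_star_dotProduct_mulVec (lyapMatrix n k) tendsto_id tendsto_id)

theorem lyap_smul (k r : ℝ) (v : Fin n ⊕ Fin n → ℂ) : lyap k ((r : ℂ) • v) = r ^ 2 * lyap k v := by
  rw [lyap, star_smul, smul_dotProduct, Matrix.mulVec_smul, dotProduct_smul, smul_smul, smul_eq_mul,
    RCLike.star_def, Complex.conj_ofReal, ← Complex.ofReal_mul, Complex.re_ofReal_mul, lyap, sq]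

/-- The derivative of the Lyapunov form. -/
theorem blockCoef_lyapMatrix {R W : Matrix (Fin n) (Fin n) ℂ} (hR : R.IsHermitian)
    (hW : W.IsHermitian) (k : ℝ) :
    (blockCoef R W).conjTranspose * lyapMatrix n k + lyapMatrix n k * blockCoef R W =
      Matrix.fromBlocks W ((k : ℂ) • R) ((k : ℂ) • R) R := by
  simp only [blockCoef, lyapMatrix, Matrix.fromBlocks_conjTranspose, Matrix.fromBlocks_multiply,
    Matrix.fromBlocks_add, hR.eq, hW.eq, Matrix.conjTranspose_zero, Matrix.zero_mul, Matrix.mul_zero,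
    zero_add, add_zero, Matrix.smul_mul, Matrix.mul_smul, Matrix.one_mul, Matrix.mul_one]
  have h : ∀ M : Matrix (Fin n) (Fin n) ℂ, (1 / 2 : ℂ) • M + (1 / 2 : ℂ) • M = M := fun M => by
    rw [← add_smul]; norm_num
  rw [smul_zero, smul_zero, zero_add, zero_add, add_zero, h, h]

theorem re_blockForm (R W : Matrix (Fin n) (Fin n) ℂ) (k : ℝ) (hR : R.IsHermitian)
    (v : Fin n ⊕ Fin n → ℂ) :
    (star v ⬝ᵥ (Matrix.fromBlocks W ((k : ℂ) • R) ((k : ℂ) • R) R).mulVec v).re =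
      (star (v ∘ Sum.inl) ⬝ᵥ W.mulVec (v ∘ Sum.inl)).re +
      2 * k * (star (v ∘ Sum.inl) ⬝ᵥ R.mulVec (v ∘ Sum.inr)).re +
      (star (v ∘ Sum.inr) ⬝ᵥ R.mulVec (v ∘ Sum.inr)).re := by
  conv_lhs => rw [← Sum.elim_comp_inl_inr v, Matrix.fromBlocks_mulVec]
  simp only [Sum.elim_comp_inl, Sum.elim_comp_inr, Function.star_sumElim,
    sumElim_dotProduct_sumElim, Matrix.smul_mulVec,
    dotProduct_add, dotProduct_smul, smul_eq_mul, Complex.add_re, Complex.re_ofReal_mul]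
  have : (star (v ∘ Sum.inr) ⬝ᵥ R.mulVec (v ∘ Sum.inl)).re =
      (star (v ∘ Sum.inl) ⬝ᵥ R.mulVec (v ∘ Sum.inr)).re := by
    rw [re_star_dotProduct_comm, Matrix.star_mulVec, hR.eq, ← Matrix.dotProduct_mulVec]
  rw [this]
  ring

theorem nsq_eq_add (v : Fin n ⊕ Fin n → ℂ) : nsq v = nsq (v ∘ Sum.inl) + nsq (v ∘ Sum.inr) := by
  conv_lhs => rw [← Sum.elim_comp_inl_inr v, nsq_sumElim]

/-- Growth of a quadratic form along a solution. -/
theorem HSys.Bounds.form_growth (hT : T.Bounds Rp Vp Qp K θ η)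
    (N : Matrix (Fin n ⊕ Fin n) (Fin n ⊕ Fin n) ℂ) {C a b : ℝ} (ha : 0 ≤ a) (hab : a ≤ b)
    (h : ∀ᵐ x ∂halfLine, a < x → ∀ v : Fin n ⊕ Fin n → ℂ, C * nsq v ≤
      (star v ⬝ᵥ ((blockCoef (T.R x) (T.V x - (lam : ℂ) • T.Q x)).conjTranspose * N +
        N * blockCoef (T.R x) (T.V x - (lam : ℂ) • T.Q x)).mulVec v).re)
    {y : ℝ → Fin n ⊕ Fin n → ℂ} (hy : IsIntSol (T.coef lam) y) :
    C * ∫ s in a..b, nsq (y s) ≤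
      (star (y b) ⬝ᵥ N.mulVec (y b)).re - (star (y a) ⬝ᵥ N.mulVec (y a)).re := by
  obtain ⟨hi, he⟩ := hy.bilinear_sub_eq_integral (sesq N) (hT.bddCoef lam) (hT.bddCoef lam) hy ha hab
  simp only [sesq_apply] at he hi
  rw [← Complex.sub_re, he, ← Complex.reCLM_apply, ← Complex.reCLM.intervalIntegral_comp_comm hi,
    ← intervalIntegral.integral_const_mul]
  refine intervalIntegral.integral_mono_ae_restrict hab ?_ ?_ ?_
  · exact ((continuous_const.mul (continuous_nsq.comp hy.cont))).intervalIntegrable _ _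
  · exact ⟨Complex.reCLM.integrable_comp hi.1, Complex.reCLM.integrable_comp hi.2⟩
  · rw [Filter.EventuallyLE, ae_restrict_iff' measurableSet_Icc]
    have hne : ∀ᵐ s : ℝ, s ≠ a := by simp [ae_iff]
    filter_upwards [ae_of_ae_halfLine h ha (ha.trans hab), hne] with s hs hsa hs'
    have hlt : a < s := lt_of_le_of_ne hs'.1 hsa.symm
    have := hs (by rw [Set.uIoc_of_le hab]; exact ⟨hlt, hs'.2⟩) hlt (y s)
    rw [← sesq_mulVec_add] at this
    exact this

/-- A coercive lower bound for the derivative of the Lyapunov form `lyap k` beyond `X`. -/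
def HSys.Coercive (T : HSys n) (lam k X C : ℝ) : Prop :=
  ∀ᵐ x ∂halfLine, X < x → ∀ v : Fin n ⊕ Fin n → ℂ, C * nsq v ≤
    (star v ⬝ᵥ ((blockCoef (T.R x) (T.V x - (lam : ℂ) • T.Q x)).conjTranspose * lyapMatrix n k +
      lyapMatrix n k * blockCoef (T.R x) (T.V x - (lam : ℂ) • T.Q x)).mulVec v).re

/-- For large `x` the form `lyap 0` is coercive. -/
theorem HSys.Bounds.coercive_zero (hT : T.Bounds Rp Vp Qp K θ η) (hg : GapBound Vp Qp c lam)
    {X : ℝ} (hX : n * n * ((1 + |lam|) * K) * Real.exp (-η * X) ≤ c / 2) :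
    T.Coercive lam 0 X (min (c / 2) θ) := by
  filter_upwards [hT.herm, hT.lower, hT.decay] with x hh hl hd hx v
  obtain ⟨h1, h2, h3⟩ := hh
  rw [blockCoef_lyapMatrix h1 (isHermitian_sub_real_smul h2 h3 lam), re_blockForm _ _ _ h1, mul_zero,
    zero_mul, add_zero, nsq_eq_add v, mul_add]
  set p := v ∘ Sum.inl
  set q := v ∘ Sum.inr
  have hp := nsq_nonneg p
  have hq := nsq_nonneg q
  refine add_le_add ?_ ?_
  · have e : T.V x - (lam : ℂ) • T.Q x = (Vp - (lam : ℂ) • Qp) +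
        ((T.V x - Vp) - (lam : ℂ) • (T.Q x - Qp)) := by rw [smul_sub]; abel
    have hδ : ∀ i j, ‖((T.V x - Vp) - (lam : ℂ) • (T.Q x - Qp)) i j‖ ≤
        (1 + |lam|) * K * Real.exp (-η * X) := fun i j => by
      simp only [Matrix.sub_apply, Matrix.smul_apply, smul_eq_mul]
      have h4 : K * Real.exp (-η * x) ≤ K * Real.exp (-η * X) := by
        have := hT.η_pos
        exact mul_le_mul_of_nonneg_left (Real.exp_le_exp.2 (by nlinarith)) hT.K_pos.le
      refine (norm_sub_le _ _).trans ?_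
      rw [norm_mul, Complex.norm_real, Real.norm_eq_abs]
      have h5 := (hd i j).2.1.trans h4
      have h6 := mul_le_mul_of_nonneg_left ((hd i j).2.2.trans h4) (abs_nonneg lam)
      linarith
    have h7 := norm_star_dotProduct_mulVec_self_le hδ p
    have h8 := neg_le_of_abs_le ((Complex.abs_re_le_norm _).trans h7)
    rw [e, Matrix.add_mulVec, dotProduct_add, Complex.add_re]
    have h9 := hg p
    rw [Fintype.card_fin] at h8
    have h10 : (n * n * ((1 + |lam|) * K * Real.exp (-η * X))) * nsq p ≤ c / 2 * nsq p := by
      refine mul_le_mul_of_nonneg_right (le_trans (le_of_eq ?_) hX) hp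
      ring
    have h11 : min (c / 2) θ * nsq p ≤ c / 2 * nsq p :=
      mul_le_mul_of_nonneg_right (min_le_left _ _) hp
    linarith
  · exact (mul_le_mul_of_nonneg_right (min_le_right _ _) hq).trans (hl q).1

/-- For very negative spectral parameters the form `lyap k` is coercive on the half-line. -/
theorem HSys.Bounds.coercive_of_le (hT : T.Bounds Rp Vp Qp K θ η) {k : ℝ} (hk : 0 ≤ k)
    (hlam : 2 * (k * (n * n * K)) ^ 2 / θ + θ / 2 + n * n * K ≤ -lam * θ) :
    T.Coercive lam k 0 (θ / 2) := by
  have hθ := hT.θ_pos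
  have hK := hT.K_pos
  filter_upwards [hT.herm, hT.lower, hT.bound] with x hh hl hb hx v
  obtain ⟨h1, h2, h3⟩ := hh
  rw [blockCoef_lyapMatrix h1 (isHermitian_sub_real_smul h2 h3 lam), re_blockForm _ _ _ h1,
    nsq_eq_add v]
  set p := v ∘ Sum.inl
  set q := v ∘ Sum.inr
  set A : ℝ := n * n * K with hA
  have hA0 : 0 ≤ A := by positivity
  have hp := nsq_nonneg p
  have hq := nsq_nonneg q
  have e1 : (star p ⬝ᵥ (T.V x - (lam : ℂ) • T.Q x).mulVec p).re =
      (star p ⬝ᵥ (T.V x).mulVec p).re + (-lam) * (star p ⬝ᵥ (T.Q x).mulVec p).re := by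
    rw [Matrix.sub_mulVec, dotProduct_sub, Matrix.smul_mulVec, dotProduct_smul, smul_eq_mul,
      Complex.sub_re, Complex.re_ofReal_mul]
    ring
  have h4 := neg_le_of_abs_le ((Complex.abs_re_le_norm _).trans
    (norm_star_dotProduct_mulVec_self_le (fun i j => (hb i j).2.1) p))
  have h5 := neg_le_of_abs_le ((Complex.abs_re_le_norm _).trans
    (norm_star_dotProduct_mulVec_le (fun i j => (hb i j).1) p q))
  rw [Fintype.card_fin] at h4 h5
  have hnl : 0 ≤ -lam := by
    have : 0 ≤ -lam * θ := le_trans (by positivity) hlam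
    exact nonneg_of_mul_nonneg_left this hθ
  have h6 : -lam * (θ * nsq p) ≤ -lam * (star p ⬝ᵥ (T.Q x).mulVec p).re :=
    mul_le_mul_of_nonneg_left (hl p).2 hnl
  have h7 := (hl q).1
  have h8 := norm_sq_le_nsq p
  have h9 := norm_sq_le_nsq q
  -- the mixed term is absorbed by Young's inequality
  have h10 : 2 * k * (A * (‖p‖ * ‖q‖)) ≤ 2 * (k * A) ^ 2 / θ * nsq p + θ / 2 * nsq q := by
    have h11 : 2 * k * (A * (‖p‖ * ‖q‖)) ≤ 2 * (k * A) ^ 2 / θ * ‖p‖ ^ 2 + θ / 2 * ‖q‖ ^ 2 := by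
      have h12 : 0 ≤ (2 * (k * A) * ‖p‖ - θ * ‖q‖) ^ 2 / (2 * θ) := by positivity
      have h13 : (2 * (k * A) * ‖p‖ - θ * ‖q‖) ^ 2 / (2 * θ) =
          2 * (k * A) ^ 2 / θ * ‖p‖ ^ 2 + θ / 2 * ‖q‖ ^ 2 - 2 * k * (A * (‖p‖ * ‖q‖)) := by
        field_simp
        ring
      linarith
    have h14 : 2 * (k * A) ^ 2 / θ * ‖p‖ ^ 2 ≤ 2 * (k * A) ^ 2 / θ * nsq p :=
      mul_le_mul_of_nonneg_left h8 (by positivity)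
    have h15 : θ / 2 * ‖q‖ ^ 2 ≤ θ / 2 * nsq q := mul_le_mul_of_nonneg_left h9 (by positivity)
    linarith
  have h16 : 2 * k * -(A * (‖p‖ * ‖q‖)) ≤ 2 * k * (star p ⬝ᵥ (T.R x).mulVec q).re := by
    refine mul_le_mul_of_nonneg_left (le_trans (le_of_eq ?_) h5) (by positivity)
    rw [hA]; ring
  have h17 := mul_le_mul_of_nonneg_right hlam hp
  rw [e1]
  nlinarith

theorem HSys.Bounds.lyap_growth (hT : T.Bounds Rp Vp Qp K θ η) {k X C a b : ℝ}
    (h : T.Coercive lam k X C) (ha : 0 ≤ a) (hX : X ≤ a) (hab : a ≤ b)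
    {y : ℝ → Fin n ⊕ Fin n → ℂ} (hy : IsIntSol (T.coef lam) y) :
    C * ∫ s in a..b, nsq (y s) ≤ lyap k (y b) - lyap k (y a) :=
  hT.form_growth (lyapMatrix n k) ha hab
    (h.mono fun _ hx hlt => hx (lt_of_le_of_lt hX hlt)) hy

theorem intervalIntegral_nsq_nonneg {y : ℝ → Fin n ⊕ Fin n → ℂ} {a b : ℝ} (hab : a ≤ b) :
    0 ≤ ∫ s in a..b, nsq (y s) :=
  intervalIntegral.integral_nonneg hab fun _ _ => nsq_nonneg _

theorem tendsto_lyap_of_mem_decaySpace (k : ℝ) {w : Fin n ⊕ Fin n → ℂ} (hw : w ∈ decaySpace (T.Φ lam)) :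
    Tendsto (fun x => lyap k (T.Φ lam x w)) atTop (𝓝 0) := by
  have h0 : lyap k (0 : Fin n ⊕ Fin n → ℂ) = 0 := by simp [lyap]
  have h1 : Tendsto (fun x => T.Φ lam x w) atTop (𝓝 0) := hw
  have := ((continuous_lyap k).tendsto 0).comp h1
  rw [h0] at this
  exact this

/-- The Lyapunov form is nonpositive on decaying solutions. -/
theorem HSys.Bounds.lyap_nonpos (hT : T.Bounds Rp Vp Qp K θ η) {k X C x : ℝ} (hC : 0 ≤ C)
    (h : T.Coercive lam k X C) (hx : 0 ≤ x) (hX : X ≤ x) {w : Fin n ⊕ Fin n → ℂ}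
    (hw : w ∈ decaySpace (T.Φ lam)) : lyap k (T.Φ lam x w) ≤ 0 := by
  refine ge_of_tendsto (tendsto_lyap_of_mem_decaySpace k hw) ?_
  filter_upwards [eventually_ge_atTop x] with b hb
  have := hT.lyap_growth h hx hX hb ((hT.Φ_spec lam).2.2 w)
  have := mul_nonneg hC (intervalIntegral_nsq_nonneg (y := fun x => T.Φ lam x w) hb)
  linarith

/-- The Lyapunov form is negative on nonzero decaying solutions. -/
theorem HSys.Bounds.lyap_neg (hT : T.Bounds Rp Vp Qp K θ η) {k X C x : ℝ} (hC : 0 < C)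
    (h : T.Coercive lam k X C) (hx : 0 ≤ x) (hX : X ≤ x) {w : Fin n ⊕ Fin n → ℂ}
    (hw : w ∈ decaySpace (T.Φ lam)) (hw0 : w ≠ 0) : lyap k (T.Φ lam x w) < 0 := by
  have h1 := hT.lyap_nonpos hC.le h (x := x + 1) (by linarith) (by linarith) hw
  have h2 := hT.lyap_growth h hx hX (by linarith : x ≤ x + 1) ((hT.Φ_spec lam).2.2 w)
  have h3 : 0 < ∫ s in x..x + 1, nsq (T.Φ lam s w) := by
    refine intervalIntegral.intervalIntegral_pos_of_pos_on ?_ (fun s hs => ?_) (by linarith)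
    · exact (continuous_nsq.comp ((hT.Φ_spec lam).2.2 w).cont).intervalIntegrable _ _
    · refine nsq_pos fun h0 => hw0 (hT.Φ_injective lam (hx.trans hs.1.le) ?_)
      rw [h0, map_zero]
  have := mul_pos hC h3
  linarith

/-- Solutions on which the form `lyap 0` stays nonpositive decay. -/
theorem HSys.Bounds.mem_decaySpace_of_lyap (hT : T.Bounds Rp Vp Qp K θ η) (hc : 0 < c)
    (hg : GapBound Vp Qp c lam) {w : Fin n ⊕ Fin n → ℂ}
    (h : ∃ᶠ x in atTop, lyap 0 (T.Φ lam x w) ≤ 0) : w ∈ decaySpace (T.Φ lam) := by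
  obtain ⟨m⟩ := hT.nonempty_modes hc hg
  by_contra hw
  obtain ⟨mu, v, hmu, hv, hev, ht⟩ := m.exists_leading_pos hw
  have h1 : lyap 0 v ≤ 0 := by
    have h2 := ((continuous_lyap 0).tendsto v).comp ht
    refine le_of_not_gt fun hpos => ?_
    have h3 := h2.eventually (lt_mem_nhds hpos)
    obtain ⟨x, hx1, hx2⟩ := (h.and_eventually h3).exists
    simp only [Function.comp_apply, lyap_smul] at hx2
    have := mul_nonpos_of_nonneg_of_nonpos (sq_nonneg (Real.exp (-mu * x))) hx1
    linarith
  have h4 := sesq_mulVec_add (blockCoef Rp (Vp - (lam : ℂ) • Qp))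
    (blockCoef Rp (Vp - (lam : ℂ) • Qp)) (lyapMatrix n 0) v v
  rw [blockCoef_lyapMatrix hT.herm_end.1
    (isHermitian_sub_real_smul hT.herm_end.2.1 hT.herm_end.2.2 lam)] at h4
  have h5 : mulVecCLM (blockCoef Rp (Vp - (lam : ℂ) • Qp)) v = (mu : ℂ) • v := hev
  rw [h5] at h4
  simp only [sesq_apply, star_smul, smul_dotProduct, Matrix.mulVec_smul, dotProduct_smul,
    RCLike.star_def, Complex.conj_ofReal, smul_eq_mul] at h4
  have h6 := congrArg Complex.re h4
  rw [Complex.add_re, Complex.re_ofReal_mul, re_blockForm _ _ _ hT.herm_end.1, mul_zero, zero_mul,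
    add_zero] at h6
  have h7 := hg (v ∘ Sum.inl)
  have h8 := (hT.lower_end (v ∘ Sum.inr)).1
  have h9 := nsq_pos hv
  rw [nsq_eq_add] at h9
  have h10 : 0 < c * nsq (v ∘ Sum.inl) + θ * nsq (v ∘ Sum.inr) := by
    have hn1 := nsq_nonneg (v ∘ Sum.inl)
    have hn2 := nsq_nonneg (v ∘ Sum.inr)
    have hθ := hT.θ_pos
    rcases hn1.eq_or_lt with h | h
    · rw [← h, zero_add] at h9
      rw [← h, mul_zero, zero_add]
      positivity
    · positivity
  have h11 : mu * lyap 0 v ≤ 0 := mul_nonpos_of_nonneg_of_nonpos hmu.le h1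
  rw [lyap] at h11
  linarith

end Lyapunov

section UniformBound

variable {n : ℕ} {T : HSys n} {Rp Vp Qp : Matrix (Fin n) (Fin n) ℂ} {K θ η lam c : ℝ}

theorem coefBound_mono {lam Λ : ℝ} (hK : 0 ≤ K) (h : |lam| ≤ Λ) :
    coefBound n K lam ≤ coefBound n K Λ := by
  have : Λ ≤ |Λ| := le_abs_self Λ
  unfold coefBound
  have : |lam| * K ≤ |Λ| * K := mul_le_mul_of_nonneg_right (h.trans this) hK
  gcongr

theorem HSys.Bounds.norm_Φ_le (hT : T.Bounds Rp Vp Qp K θ η) {Λ x X : ℝ} (h : |lam| ≤ Λ)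
    (hx : 0 ≤ x) (hX : x ≤ X) (w : Fin n ⊕ Fin n → ℂ) :
    ‖T.Φ lam x w‖ ≤ ‖w‖ * Real.exp (coefBound n K Λ * X) := by
  have h1 := ((hT.Φ_spec lam).2.2 w).norm_le (hT.bddCoef lam) le_rfl hx
  simp only [(hT.Φ_spec lam).2.1, one_apply_eq_self, sub_zero] at h1
  refine h1.trans (mul_le_mul_of_nonneg_left (Real.exp_le_exp.2 ?_) (norm_nonneg _))
  have h2 := coefBound_mono (n := n) hT.K_pos.le h
  have h3 := (hT.bddCoef lam).pos
  nlinarith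

/-- Decaying solutions are bounded by their initial values, locally uniformly in the spectral
parameter. -/
theorem HSys.Bounds.exists_uniform_bound (hT : T.Bounds Rp Vp Qp K θ η) {Λ X : ℝ} (hc : 0 < c)
    (hX0 : 0 ≤ X) (hX : n * n * ((1 + Λ) * K) * Real.exp (-η * X) ≤ c / 2) :
    ∃ B, 0 ≤ B ∧ ∀ lam, |lam| ≤ Λ → GapBound Vp Qp c lam → ∀ w ∈ decaySpace (T.Φ lam),
      ∀ x, 0 ≤ x → ‖T.Φ lam x w‖ ≤ B * ‖w‖ := by
  have hK := hT.K_pos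
  set C := min (c / 2) θ with hC
  have hCpos : 0 < C := lt_min (by linarith) hT.θ_pos
  set b : ℝ := (n + n) * (n + n) * ((2 + Λ) * K) with hb
  set L : ℝ := (n + n) * (n + n) * 1 with hL
  set D : ℝ := 1 + (1 + b / C * L) * (n + n) with hD
  set e := Real.exp (coefBound n K Λ * X) with he
  refine ⟨Real.sqrt (max D 1) * e, by positivity, fun lam hlam hg w hw x hx => ?_⟩
  have hΛ : 0 ≤ Λ := (abs_nonneg _).trans hlam
  have hb0 : 0 ≤ b := by positivity
  have hL0 : 0 ≤ L := by positivity
  have hD1 : 1 ≤ D := by rw [hD]; linarith [show 0 ≤ (1 + b / C * L) * ((n : ℝ) + n) by positivity]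
  have hepos : 0 < e := Real.exp_pos _
  rw [max_eq_left hD1]
  rcases le_total x X with hxX | hxX
  · refine (hT.norm_Φ_le hlam hx hxX w).trans ?_
    rw [mul_comm ‖w‖]
    refine mul_le_mul_of_nonneg_right ?_ (norm_nonneg _)
    exact le_mul_of_one_le_left hepos.le (Real.one_le_sqrt.2 hD1)
  · have hy := (hT.Φ_spec lam).2.2 w
    set y := fun x => T.Φ lam x w
    have hco : T.Coercive lam 0 X C := hT.coercive_zero hg (by
      refine le_trans (mul_le_mul_of_nonneg_right ?_ (Real.exp_pos _).le) hX
      gcongr)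
    have g1 := hT.lyap_growth hco hX0 le_rfl hxX hy
    have g2 := hT.lyap_nonpos hCpos.le hco hx hxX hw
    have g3 : (-b) * ∫ s in X..x, nsq (y s) ≤ _ := hT.form_growth (lam := lam) (-1) hX0 hxX (C := -b) (by
      filter_upwards [hT.bound] with s hs _ v
      have hent : ∀ i j, ‖((blockCoef (T.R s) (T.V s - (lam : ℂ) • T.Q s)).conjTranspose * (-1) +
          (-1) * blockCoef (T.R s) (T.V s - (lam : ℂ) • T.Q s)) i j‖ ≤ (2 + Λ) * K := fun i j => by
        have hRW : ∀ i j, ‖T.R s i j‖ + ‖(T.V s - (lam : ℂ) • T.Q s) j i‖ ≤ (2 + Λ) * K := by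
          intro i j
          have h1 : ‖(T.V s - (lam : ℂ) • T.Q s) j i‖ ≤ K + Λ * K := by
            rw [Matrix.sub_apply, Matrix.smul_apply, smul_eq_mul]
            refine (norm_sub_le _ _).trans (add_le_add (hs j i).2.1 ?_)
            rw [norm_mul, Complex.norm_real, Real.norm_eq_abs]
            exact mul_le_mul hlam (hs j i).2.2 (norm_nonneg _) hΛ
          linarith [(hs i j).1]
        have hpos : 0 ≤ (2 + Λ) * K := by positivity
        rw [Matrix.mul_neg, Matrix.mul_one, Matrix.neg_mul, Matrix.one_mul, ← neg_add, Matrix.neg_apply,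
          norm_neg, Matrix.add_apply, Matrix.conjTranspose_apply]
        refine (norm_add_le _ _).trans ?_
        rw [norm_star]
        rcases i with i | i <;> rcases j with j | j
        · simpa [blockCoef] using hpos
        · have := hRW i j
          simp only [blockCoef, Matrix.fromBlocks_apply₁₂, Matrix.fromBlocks_apply₂₁]
          linarith
        · have := hRW j i
          simp only [blockCoef, Matrix.fromBlocks_apply₁₂, Matrix.fromBlocks_apply₂₁]
          linarith
        · simpa [blockCoef] using hpos
      have := neg_le_of_abs_le ((Complex.abs_re_le_norm _).trans
        (norm_star_dotProduct_mulVec_self_le hent v))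
      rw [Fintype.card_sum, Fintype.card_fin] at this
      push_cast at this
      linarith) hy
    simp only [Matrix.neg_mulVec, Matrix.one_mulVec, dotProduct_neg, Complex.neg_re,
      ← nsq_eq_re] at g3
    have g4 : -lyap 0 (y X) ≤ L * nsq (y X) := by
      have hent : ∀ i j, ‖lyapMatrix n 0 i j‖ ≤ 1 := fun i j => by
        rcases i with i | i <;> rcases j with j | j <;>
          simp [lyapMatrix, Matrix.one_apply] <;> split_ifs <;> norm_num
      have := neg_le_of_abs_le ((Complex.abs_re_le_norm _).trans
        (norm_star_dotProduct_mulVec_self_le hent (y X)))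
      rw [Fintype.card_sum, Fintype.card_fin] at this
      push_cast at this
      rw [lyap]
      linarith
    have g5 : b * ∫ s in X..x, nsq (y s) ≤ b / C * (L * nsq (y X)) := by
      have h1 : C * ∫ s in X..x, nsq (y s) ≤ L * nsq (y X) := by linarith
      calc b * ∫ s in X..x, nsq (y s) = b / C * (C * ∫ s in X..x, nsq (y s)) := by
            field_simp
        _ ≤ _ := mul_le_mul_of_nonneg_left h1 (by positivity)
    have g6 : nsq (y x) ≤ (1 + b / C * L) * nsq (y X) := by linarith
    have g7 := nsq_le_norm_sq (y X)
    rw [Fintype.card_sum, Fintype.card_fin] at g7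
    push_cast at g7
    have g8 : ‖y X‖ ≤ ‖w‖ * e := hT.norm_Φ_le hlam hX0 le_rfl w
    have g9 : ‖y x‖ ^ 2 ≤ D * (‖w‖ * e) ^ 2 := by
      calc ‖y x‖ ^ 2 ≤ nsq (y x) := norm_sq_le_nsq _
        _ ≤ (1 + b / C * L) * ((n + n) * ‖y X‖ ^ 2) :=
          g6.trans (mul_le_mul_of_nonneg_left g7 (by positivity))
        _ ≤ (1 + b / C * L) * ((n + n) * (‖w‖ * e) ^ 2) := by gcongr
        _ ≤ D * (‖w‖ * e) ^ 2 := by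
          rw [hD]; nlinarith [sq_nonneg (‖w‖ * e)]
    calc ‖y x‖ ≤ Real.sqrt (D * (‖w‖ * e) ^ 2) := Real.le_sqrt_of_sq_le g9
      _ = Real.sqrt D * e * ‖w‖ := by
        rw [Real.sqrt_mul (by linarith), Real.sqrt_sq (by positivity)]; ring

end UniformBound

section ContinuousDependence

variable {n : ℕ} {T : HSys n} {Rp Vp Qp : Matrix (Fin n) (Fin n) ℂ} {K θ η c : ℝ}

/-- Joint continuity of solutions in the system, the spectral parameter, the point and the initial
value. -/
theorem HSys.Bounds.tendsto_Φ {α : Type*} {l : Filter α} {T' : α → HSys n}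
    (hT : T.Bounds Rp Vp Qp K θ η) (hT' : ∀ t, (T' t).Bounds Rp Vp Qp K θ η) {ε : α → ℝ}
    (hε : Tendsto ε l (𝓝 0)) (hε0 : ∀ t, 0 ≤ ε t)
    (hd : ∀ᶠ t in l, ∀ᵐ x ∂halfLine, ∀ i j, ‖(T' t).R x i j - T.R x i j‖ ≤ ε t ∧
      ‖(T' t).V x i j - T.V x i j‖ ≤ ε t ∧ ‖(T' t).Q x i j - T.Q x i j‖ ≤ ε t)
    {lam : α → ℝ} {lam₀ : ℝ} (hlam : Tendsto lam l (𝓝 lam₀)) {v : α → Fin n ⊕ Fin n → ℂ}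
    {v₀ : Fin n ⊕ Fin n → ℂ} (hv : Tendsto v l (𝓝 v₀)) {x : α → ℝ} {x₀ : ℝ}
    (hx : Tendsto x l (𝓝 x₀)) (hx0 : ∀ᶠ t in l, 0 ≤ x t) :
    Tendsto (fun t => (T' t).Φ (lam t) (x t) (v t)) l (𝓝 (T.Φ lam₀ x₀ v₀)) := by
  have hy := (hT.Φ_spec lam₀).2.2 v₀
  obtain ⟨C, hC0, hC⟩ := exists_norm_le_on_Icc hy.cont 0 (x₀ + 1)
  set δ : α → ℝ := fun t => 2 * n * ((1 + |lam t|) * ε t + |lam t - lam₀| * K) with hδ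
  have hδ0 : ∀ t, 0 ≤ δ t := fun t => by
    have := hε0 t
    have := hT.K_pos
    positivity
  have hδlim : Tendsto δ l (𝓝 0) := by
    have h1 : Tendsto δ l (𝓝 (2 * n * ((1 + |lam₀|) * 0 + |lam₀ - lam₀| * K))) :=
      (((hlam.abs.const_add 1).mul hε).add ((hlam.sub_const lam₀).abs.mul_const K)).const_mul _
    simpa using h1
  have hlim : Tendsto (fun t => (‖v t - v₀‖ + δ t * C * (x₀ + 1)) *
      Real.exp (coefBound n K (|lam₀| + 1) * (x₀ + 1))) l (𝓝 0) := by
    have h1 := (((tendsto_iff_norm_sub_tendsto_zero.1 hv).add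
      ((hδlim.mul_const C).mul_const (x₀ + 1))).mul_const
      (Real.exp (coefBound n K (|lam₀| + 1) * (x₀ + 1))))
    simpa using h1
  have h1 : Tendsto (fun t => (T' t).Φ (lam t) (x t) (v t) - T.Φ lam₀ (x t) v₀) l (𝓝 0) := by
    refine squeeze_zero_norm' ?_ hlim
    have hl1 : ∀ᶠ t in l, |lam t| ≤ |lam₀| + 1 :=
      hlam.abs.eventually (ge_mem_nhds (by linarith))
    have hx1 : ∀ᶠ t in l, x t ≤ x₀ + 1 := hx.eventually (ge_mem_nhds (by linarith))
    filter_upwards [hl1, hx1, hx0, hd] with t ht1 ht2 ht3 ht4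
    have hz := ((hT' t).Φ_spec (lam t)).2.2 (v t)
    have key := hy.norm_sub_le (hT.bddCoef lam₀) ((hT' t).bddCoef (lam t)) hz (hδ0 t) (C := C)
      (x := x t) (by
        filter_upwards [ht4, hT.bound] with s hs hs'
        exact norm_mulVecCLM_blockCoef_sub_le (hε0 t) hT.K_pos.le hs fun i j => (hs' i j).2.2)
      ht3 (fun s hs => hC s ⟨hs.1, hs.2.trans ht2⟩)
    simp only [(hT.Φ_spec lam₀).2.1, ((hT' t).Φ_spec (lam t)).2.1,
      one_apply_eq_self] at key
    have h2 := coefBound_mono (n := n) hT.K_pos.le ht1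
    have h3 := ((hT' t).bddCoef (lam t)).pos
    have h4 := hδ0 t
    refine key.trans (mul_le_mul ?_ (Real.exp_le_exp.2 ?_) (Real.exp_pos _).le ?_)
    · gcongr
    · gcongr
      exact h3.le.trans h2
    · have : 0 ≤ x₀ + 1 := ht3.trans ht2
      positivity
  have h2 : Tendsto (fun t => T.Φ lam₀ (x t) v₀) l (𝓝 (T.Φ lam₀ x₀ v₀)) :=
    (hy.cont.tendsto x₀).comp hx
  simpa using h1.add h2

/-- The decaying solutions of the translated systems. -/
noncomputable def HSys.decayFamily (T : HSys n) (Rp Vp Qp : Matrix (Fin n) (Fin n) ℂ) (p : ENNReal)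
    (lam : ℝ) : Submodule ℂ (Fin n ⊕ Fin n → ℂ) :=
  decaySpace ((T.shift Rp Vp Qp p).Φ lam)

theorem HSys.Bounds.shift_Φ (hT : T.Bounds Rp Vp Qp K θ η) (lam : ℝ) {p : ENNReal} (hp : p ≠ ⊤)
    {x : ℝ} (hx : 0 ≤ x) (w : Fin n ⊕ Fin n → ℂ) :
    (T.shift Rp Vp Qp p).Φ lam x (T.Φ lam p.toReal w) = T.Φ lam (p.toReal + x) w := by
  have hy := (hT.Φ_spec lam).2.2 w
  have h1 : IsIntSol ((T.shift Rp Vp Qp p).coef lam) fun x => T.Φ lam (p.toReal + x) w := by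
    refine ⟨by have := hy.cont; fun_prop, fun x hx => ?_⟩
    have hp0 : 0 ≤ p.toReal := ENNReal.toReal_nonneg
    have h2 := hy.sub_eq (hT.bddCoef lam) hp0 (add_nonneg hp0 hx)
    rw [sub_eq_iff_eq_add'] at h2
    rw [h2, add_zero]
    congr 1
    have h3 := intervalIntegral.integral_comp_add_left
      (fun s => T.coef lam s (T.Φ lam s w)) p.toReal (a := 0) (b := x)
    rw [add_zero] at h3
    rw [← h3]
    simp only [HSys.coef, HSys.shift, hp, if_false]
  have h2 := (hT.shift p).eq_Φ h1 hx
  rw [h2, add_zero]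

theorem HSys.Bounds.Φ_mem_decayFamily (hT : T.Bounds Rp Vp Qp K θ η) (lam : ℝ) {p : ENNReal}
    (hp : p ≠ ⊤) (w : Fin n ⊕ Fin n → ℂ) :
    T.Φ lam p.toReal w ∈ T.decayFamily Rp Vp Qp p lam ↔ w ∈ decaySpace (T.Φ lam) := by
  rw [HSys.decayFamily, mem_decaySpace, mem_decaySpace]
  have h1 : (fun x => (T.shift Rp Vp Qp p).Φ lam x (T.Φ lam p.toReal w)) =ᶠ[atTop]
      fun x => T.Φ lam (p.toReal + x) w := by
    filter_upwards [eventually_ge_atTop 0] with x hx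
    exact hT.shift_Φ lam hp hx w
  rw [tendsto_congr' h1]
  constructor
  · intro h
    have h2 := h.comp (tendsto_atTop_add_const_left atTop (-p.toReal) tendsto_id)
    refine h2.congr fun x => ?_
    simp
  · intro h
    exact h.comp (tendsto_atTop_add_const_left atTop p.toReal tendsto_id)

theorem HSys.Bounds.decayFamily_eq_map (hT : T.Bounds Rp Vp Qp K θ η) (lam : ℝ) {p : ENNReal}
    (hp : p ≠ ⊤) : T.decayFamily Rp Vp Qp p lam =
      (decaySpace (T.Φ lam)).map (T.Φ lam p.toReal : (Fin n ⊕ Fin n → ℂ) →ₗ[ℂ] _) := by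
  ext v
  rw [Submodule.mem_map]
  constructor
  · intro hv
    obtain ⟨w, rfl⟩ := (LinearMap.injective_iff_surjective
      (f := (T.Φ lam p.toReal : (Fin n ⊕ Fin n → ℂ) →ₗ[ℂ] _))).1
      (hT.Φ_injective lam ENNReal.toReal_nonneg) v
    exact ⟨w, (hT.Φ_mem_decayFamily lam hp w).1 hv, rfl⟩
  · rintro ⟨w, hw, rfl⟩
    exact (hT.Φ_mem_decayFamily lam hp w).2 hw

theorem HSys.Bounds.isLagrangian_decayFamily (hT : T.Bounds Rp Vp Qp K θ η) (hc : 0 < c) {lam : ℝ}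
    (hg : GapBound Vp Qp c lam) (p : ENNReal) : IsLagrangian (T.decayFamily Rp Vp Qp p lam) :=
  (hT.shift p).isLagrangian_decaySpace hc hg

theorem exists_late (n : ℕ) {K η c : ℝ} (hη : 0 < η) (hc : 0 < c) (Λ : ℝ) : ∃ X : ℝ, 0 ≤ X ∧
    n * n * ((1 + Λ) * K) * Real.exp (-η * X) ≤ c / 2 := by
  have h1 : Tendsto (fun x => n * n * ((1 + Λ) * K) * Real.exp (-η * x)) atTop
      (𝓝 (n * n * ((1 + Λ) * K) * 0)) :=
    (Real.tendsto_exp_atBot.comp (tendsto_id.const_mul_atTop_of_neg (by linarith))).const_mul _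
  rw [mul_zero] at h1
  obtain ⟨X, h2, h3⟩ := ((h1.eventually (ge_mem_nhds (by linarith : (0 : ℝ) < c / 2))).and
    (eventually_ge_atTop 0)).exists
  exact ⟨X, h3, h2⟩

/-- Closedness of the decaying solutions in the spectral parameter, for convergent systems. -/
theorem HSys.Bounds.mem_decaySpace_of_tendsto {α : Type*} {l : Filter α} [l.NeBot] {T' : α → HSys n}
    (hT : T.Bounds Rp Vp Qp K θ η) (hT' : ∀ t, (T' t).Bounds Rp Vp Qp K θ η) {ε : α → ℝ}
    (hε : Tendsto ε l (𝓝 0)) (hε0 : ∀ t, 0 ≤ ε t)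
    (hd : ∀ᶠ t in l, ∀ᵐ x ∂halfLine, ∀ i j, ‖(T' t).R x i j - T.R x i j‖ ≤ ε t ∧
      ‖(T' t).V x i j - T.V x i j‖ ≤ ε t ∧ ‖(T' t).Q x i j - T.Q x i j‖ ≤ ε t)
    {lam : α → ℝ} {lam₀ : ℝ} (hlam : Tendsto lam l (𝓝 lam₀)) (hc : 0 < c)
    (hg : ∀ᶠ t in l, GapBound Vp Qp c (lam t)) (hg₀ : GapBound Vp Qp c lam₀)
    {v : α → Fin n ⊕ Fin n → ℂ} {v₀ : Fin n ⊕ Fin n → ℂ} (hv : Tendsto v l (𝓝 v₀))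
    (hmem : ∀ᶠ t in l, v t ∈ decaySpace ((T' t).Φ (lam t))) : v₀ ∈ decaySpace (T.Φ lam₀) := by
  obtain ⟨X, hX0, hX⟩ := exists_late n (K := K) hT.η_pos hc (|lam₀| + 1)
  refine hT.mem_decaySpace_of_lyap hc hg₀ (Eventually.frequently ?_)
  filter_upwards [eventually_ge_atTop X] with x hx
  have h1 := hT.tendsto_Φ hT' hε hε0 hd hlam hv (tendsto_const_nhds (x := x))
    (Eventually.of_forall fun _ => hX0.trans hx)
  have h2 := ((continuous_lyap 0).tendsto _).comp h1
  refine le_of_tendsto h2 ?_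
  have hl1 : ∀ᶠ t in l, |lam t| ≤ |lam₀| + 1 := hlam.abs.eventually (ge_mem_nhds (by linarith))
  filter_upwards [hl1, hg, hmem] with t ht1 ht2 ht3
  have hK := hT.K_pos
  refine (hT' t).lyap_nonpos (lt_min (half_pos hc) hT.θ_pos).le ((hT' t).coercive_zero ht2 (X := X)
    (le_trans (mul_le_mul_of_nonneg_right ?_ (Real.exp_pos _).le) hX)) (hX0.trans hx) hx ht3
  gcongr

end ContinuousDependence

section DecayFamily

variable {n : ℕ} {T : HSys n} {Rp Vp Qp : Matrix (Fin n) (Fin n) ℂ} {K θ η c : ℝ}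

/-- Continuity of the Lagrangian subspace of decaying solutions on `[0, ∞]`. -/
theorem HSys.Bounds.tendsto_projMatrix_decayFamily (hT : T.Bounds Rp Vp Qp K θ η)
    {q₀ : ENNReal × ℝ} {l : Filter (ENNReal × ℝ)} (hl : l ≤ 𝓝 q₀) (hc : 0 < c)
    (hg : ∀ᶠ q in l, GapBound Vp Qp c q.2) (hg₀ : GapBound Vp Qp c q₀.2) :
    Tendsto (fun q => projMatrix (T.decayFamily Rp Vp Qp q.1 q.2)) l
      (𝓝 (projMatrix (T.decayFamily Rp Vp Qp q₀.1 q₀.2))) := by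
  refine tendsto_projMatrix_of_closed
    (hg.mono fun q hq => (hT.isLagrangian_decayFamily hc hq q.1).1)
    (hT.isLagrangian_decayFamily hc hg₀ q₀.1).1.le ?_
  intro g hgl u w hu hw
  have hp : Tendsto (fun q : ENNReal × ℝ => q.1) g (𝓝 q₀.1) :=
    (continuous_fst.tendsto q₀).mono_left (hgl.trans hl)
  have hlam : Tendsto (fun q : ENNReal × ℝ => q.2) g (𝓝 q₀.2) :=
    (continuous_snd.tendsto q₀).mono_left (hgl.trans hl)
  have hg' := hg.filter_mono hgl
  have hK := hT.K_pos
  by_cases htop : q₀.1 = ⊤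
  · set ε : ENNReal × ℝ → ℝ := fun q => if q.1 = ⊤ then 0 else K * Real.exp (-η * q.1.toReal) with hε
    have hε0 : ∀ q, 0 ≤ ε q := fun q => by simp only [hε]; split_ifs <;> positivity
    have hεlim : Tendsto ε g (𝓝 0) := by
      refine tendsto_order.2 ⟨fun a ha => Eventually.of_forall fun q => ha.trans_le (hε0 q),
        fun a ha => ?_⟩
      have h1 : Tendsto (fun x => K * Real.exp (-η * x)) atTop (𝓝 (K * 0)) :=
        (Real.tendsto_exp_atBot.comp
          (tendsto_id.const_mul_atTop_of_neg (neg_lt_zero.2 hT.η_pos))).const_mul _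
      rw [mul_zero] at h1
      obtain ⟨X, hX⟩ := eventually_atTop.1 (h1.eventually (gt_mem_nhds ha))
      rw [htop] at hp
      filter_upwards [hp.eventually (lt_mem_nhds (ENNReal.ofReal_lt_top (r := X)))] with q hq
      by_cases h : q.1 = ⊤
      · simpa [hε, h] using ha
      · simp only [hε, h, if_false]
        exact hX _ (ENNReal.ofReal_le_iff_le_toReal h |>.1 hq.le)
    have hu' : ∀ᶠ q in (g : Filter (ENNReal × ℝ)),
        u q ∈ decaySpace ((T.shift Rp Vp Qp q.1).Φ q.2) := hu
    change w ∈ decaySpace ((T.shift Rp Vp Qp q₀.1).Φ q₀.2)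
    refine (hT.shift q₀.1).mem_decaySpace_of_tendsto (l := (g : Filter (ENNReal × ℝ)))
      (T' := fun q => T.shift Rp Vp Qp q.1) (lam := fun q => q.2) (v := u) (ε := ε)
      (fun q => hT.shift q.1) hεlim hε0
      (Eventually.of_forall fun q => ?_) hlam hc hg' hg₀ hw hu'
    by_cases h : q.1 = ⊤
    · simp [HSys.shift, hε, h, htop]
    · simpa [HSys.shift, hε, h, htop] using hT.ae_norm_shift_sub_le h
  · have hne : ∀ᶠ q in (g : Filter (ENNReal × ℝ)), q.1 ≠ ⊤ :=
      hp.eventually (isOpen_ne.mem_nhds htop)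
    have hx : Tendsto (fun q : ENNReal × ℝ => q.1.toReal) g (𝓝 q₀.1.toReal) :=
      (ENNReal.tendsto_toReal htop).comp hp
    have hsurj : ∀ q : ENNReal × ℝ, ∃ v, T.Φ q.2 q.1.toReal v = u q := fun q =>
      (LinearMap.injective_iff_surjective
        (f := (T.Φ q.2 q.1.toReal : (Fin n ⊕ Fin n → ℂ) →ₗ[ℂ] _))).1
        (hT.Φ_injective q.2 ENNReal.toReal_nonneg) (u q)
    choose v hv using hsurj
    -- the initial values are bounded, hence converge along the ultrafilter
    have hbd : ∀ᶠ q in (g : Filter (ENNReal × ℝ)), v q ∈ Metric.closedBall (0 : Fin n ⊕ Fin n → ℂ)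
        ((‖w‖ + 1) * Real.exp (coefBound n K (|q₀.2| + 1) * (q₀.1.toReal + 1))) := by
      have hl1 : ∀ᶠ q in (g : Filter (ENNReal × ℝ)), |q.2| ≤ |q₀.2| + 1 :=
        hlam.abs.eventually (ge_mem_nhds (by linarith))
      have hx1 : ∀ᶠ q in (g : Filter (ENNReal × ℝ)), q.1.toReal ≤ q₀.1.toReal + 1 :=
        hx.eventually (ge_mem_nhds (by linarith))
      have hw1 : ∀ᶠ q in (g : Filter (ENNReal × ℝ)), ‖u q‖ ≤ ‖w‖ + 1 :=
        hw.norm.eventually (ge_mem_nhds (by linarith))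
      filter_upwards [hl1, hx1, hw1] with q h1 h2 h3
      have h4 := ((hT.Φ_spec q.2).2.2 (v q)).norm_le_backward (hT.bddCoef q.2) le_rfl
        (ENNReal.toReal_nonneg (a := q.1))
      simp only [hv, (hT.Φ_spec q.2).2.1, one_apply_eq_self, sub_zero] at h4
      have h5 := coefBound_mono (n := n) hT.K_pos.le h1
      have h6 := (hT.bddCoef q.2).pos
      rw [mem_closedBall_zero_iff]
      refine h4.trans ?_
      have h7 : 0 ≤ q.1.toReal := ENNReal.toReal_nonneg
      gcongr
      exact h6.le.trans h5
    obtain ⟨v₀, -, hv₀⟩ := (isCompact_closedBall _ _).ultrafilter_le_nhds (g.map v)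
      (by rw [Ultrafilter.coe_map, le_principal_iff]; exact hbd)
    have hv₀' : Tendsto v g (𝓝 v₀) := hv₀
    have hcl : v₀ ∈ decaySpace (T.Φ q₀.2) := by
      refine hT.mem_decaySpace_of_tendsto (T' := fun _ => T) (ε := fun _ => 0) (fun _ => hT)
        tendsto_const_nhds (fun _ => le_rfl) (by simp) hlam hc hg' hg₀ hv₀' ?_
      filter_upwards [hu, hne] with q h1 h2
      rw [← hv q] at h1
      exact (hT.Φ_mem_decayFamily q.2 h2 (v q)).1 h1
    have hlim := hT.tendsto_Φ (T' := fun _ => T) (ε := fun _ => 0) (fun _ => hT)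
        tendsto_const_nhds (fun _ => le_rfl) (by simp) hlam hv₀' hx
        (Eventually.of_forall fun q => ENNReal.toReal_nonneg)
    simp only [hv] at hlim
    rw [tendsto_nhds_unique hw hlim]
    exact (hT.Φ_mem_decayFamily q₀.2 htop v₀).2 hcl

end DecayFamily

section Crossing

variable {n : ℕ} {T : HSys n} {Rp Vp Qp : Matrix (Fin n) (Fin n) ℂ} {K θ η c lam : ℝ}

theorem aestronglyMeasurable_matrixForm {α : Type*} [MeasurableSpace α] {μ : Measure α}
    {ι : Type*} [Fintype ι] {M : α → Matrix ι ι ℂ} {f g : α → ι → ℂ}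
    (hM : AEStronglyMeasurable M μ) (hf : AEStronglyMeasurable f μ)
    (hg : AEStronglyMeasurable g μ) :
    AEStronglyMeasurable (fun x => star (f x) ⬝ᵥ (M x).mulVec (g x)) μ := by
  have hM' : ∀ i j, AEStronglyMeasurable (fun x => M x i j) μ := fun i j =>
    (continuous_apply_apply i j).comp_aestronglyMeasurable hM
  have hf' : ∀ i, AEStronglyMeasurable (fun x => star (f x i)) μ := fun i =>
    (continuous_star.comp (continuous_apply i)).comp_aestronglyMeasurable hf
  have hg' : ∀ i, AEStronglyMeasurable (fun x => g x i) μ := fun i =>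
    (continuous_apply i).comp_aestronglyMeasurable hg
  simp only [dotProduct, Matrix.mulVec, Pi.star_apply]
  exact Finset.aestronglyMeasurable_fun_sum _ fun i _ =>
    (hf' i).mul (Finset.aestronglyMeasurable_fun_sum _ fun j _ => (hM' i j).mul (hg' j))

/-- The first component of a nonzero solution does not vanish near infinity. -/
theorem HSys.Bounds.eventually_inl_ne_zero (hT : T.Bounds Rp Vp Qp K θ η) (hc : 0 < c)
    (hg : GapBound Vp Qp c lam) {w : Fin n ⊕ Fin n → ℂ} (hw : w ≠ 0) :
    ∀ᶠ x in atTop, T.Φ lam x w ∘ (Sum.inl : Fin n → Fin n ⊕ Fin n) ≠ 0 := by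
  obtain ⟨m⟩ := hT.nonempty_modes hc hg
  obtain ⟨mu, v, hv, hev, -, -, ht⟩ := m.exists_leading hw
  have hv1 := endCoef_eigenvector_inl_ne_zero hT hv hev
  have hcont : Continuous fun v : Fin n ⊕ Fin n → ℂ => v ∘ (Sum.inl : Fin n → Fin n ⊕ Fin n) :=
    continuous_pi fun i => continuous_apply (Sum.inl i)
  have h1 : Tendsto (fun x => ((Real.exp (-mu * x) : ℂ) • T.Φ lam x w) ∘
      (Sum.inl : Fin n → Fin n ⊕ Fin n)) atTop (𝓝 (v ∘ Sum.inl)) := (hcont.tendsto v).comp ht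
  filter_upwards [h1.eventually_ne hv1] with x hx h0
  refine hx ?_
  ext i
  have := congrFun h0 i
  simp only [Function.comp_apply, Pi.zero_apply] at this
  simp [this]

/-- The first component of a nonzero decaying solution has positive weighted norm. -/
theorem HSys.Bounds.integral_pos (hT : T.Bounds Rp Vp Qp K θ η) (hc : 0 < c)
    (hg : GapBound Vp Qp c lam) {w : Fin n ⊕ Fin n → ℂ} (hw : w ≠ 0)
    (hi : Integrable (fun s => star (T.Φ lam s w ∘ Sum.inl) ⬝ᵥ
      (T.Q s).mulVec (T.Φ lam s w ∘ Sum.inl)) halfLine) :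
    0 < ∫ s in Set.Ioi 0, (star (T.Φ lam s w ∘ Sum.inl) ⬝ᵥ
      (T.Q s).mulVec (T.Φ lam s w ∘ Sum.inl)).re := by
  have hne := hT.eventually_inl_ne_zero hc hg hw
  have hnn : 0 ≤ᵐ[halfLine] fun s => (star (T.Φ lam s w ∘ Sum.inl) ⬝ᵥ
      (T.Q s).mulVec (T.Φ lam s w ∘ Sum.inl)).re := by
    filter_upwards [hT.lower] with s hs
    exact (mul_nonneg hT.θ_pos.le (nsq_nonneg _)).trans (hs _).2
  rw [integral_pos_iff_support_of_nonneg_ae hnn hi.re]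
  obtain ⟨X, hX⟩ := eventually_atTop.1 hne
  have hsub : ∀ᵐ s ∂halfLine, s ∈ Set.Ioi (max X 0) → s ∈ Function.support fun s =>
      (star (T.Φ lam s w ∘ Sum.inl) ⬝ᵥ (T.Q s).mulVec (T.Φ lam s w ∘ Sum.inl)).re := by
    filter_upwards [hT.lower] with s hs hs'
    have h1 := hX s ((le_max_left X 0).trans (le_of_lt hs'))
    exact (lt_of_lt_of_le (mul_pos hT.θ_pos (nsq_pos h1)) (hs _).2).ne'
  refine lt_of_lt_of_le ?_ (measure_mono_ae (s := Set.Ioi (max X 0)) hsub)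
  rw [Measure.restrict_apply measurableSet_Ioi,
    Set.inter_eq_self_of_subset_left (Set.Ioi_subset_Ioi (le_max_right X 0)), Real.volume_Ioi]
  exact ENNReal.zero_lt_top

/-- The crossing form of the decaying solutions in the spectral parameter is positive. -/
theorem HSys.Bounds.tendsto_crossing (hT : T.Bounds Rp Vp Qp K θ η) (hc : 0 < c)
    (hg : GapBound Vp Qp c lam) {w : Fin n ⊕ Fin n → ℂ} (hw : w ∈ decaySpace (T.Φ lam)) (hw0 : w ≠ 0)
    {t : ℕ → ℝ} {w' : ℕ → Fin n ⊕ Fin n → ℂ} (hne : ∀ k, t k ≠ lam)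
    (hgt : ∀ᶠ k in atTop, GapBound Vp Qp c (t k)) (hmem : ∀ k, w' k ∈ decaySpace (T.Φ (t k)))
    (ht : Tendsto t atTop (𝓝 lam)) (hw' : Tendsto w' atTop (𝓝 w)) :
    ∃ G : ℝ, 0 < G ∧ Tendsto (fun k => star w ⬝ᵥ (Matrix.J (Fin n) ℂ).mulVec (w' k) /
      ((lam - t k : ℝ) : ℂ)) atTop (𝓝 (G : ℂ)) := by
  obtain ⟨X, hX0, hX⟩ := exists_late n (K := K) hT.η_pos hc (|lam| + 1)
  obtain ⟨B, hB0, hB⟩ := hT.exists_uniform_bound hc hX0 hX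
  obtain ⟨m⟩ := hT.nonempty_modes hc hg
  have hcw := ((hT.Φ_spec lam).2.2 w).cont
  obtain ⟨C, δ, hδ, hC0, hC⟩ := m.exists_exp_decay hcw hw
  have hK := hT.K_pos
  have hl1 : ∀ᶠ k in atTop, |t k| ≤ |lam| + 1 := ht.abs.eventually (ge_mem_nhds (by linarith))
  have hw1 : ∀ᶠ k in atTop, ‖w' k‖ ≤ ‖w‖ + 1 := hw'.norm.eventually (ge_mem_nhds (by linarith))
  set f : ℕ → ℝ → ℂ := fun k s => star (T.Φ lam s w ∘ Sum.inl) ⬝ᵥ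
    (T.Q s).mulVec (T.Φ (t k) s (w' k) ∘ Sum.inl) with hf
  set F : ℝ → ℂ := fun s => star (T.Φ lam s w ∘ Sum.inl) ⬝ᵥ
    (T.Q s).mulVec (T.Φ lam s w ∘ Sum.inl) with hF
  have hinl : ∀ v : Fin n ⊕ Fin n → ℂ, ‖v ∘ Sum.inl‖ ≤ ‖v‖ := fun v =>
    (pi_norm_le_iff_of_nonneg (norm_nonneg _)).2 fun i => norm_le_pi_norm v (Sum.inl i)
  set bound : ℝ → ℝ := fun s => n * n * K * (C * Real.exp (-δ * s)) * (B * (‖w‖ + 1)) with hbound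
  have hbi : Integrable bound halfLine :=
    (((integrableOn_exp_mul_Ioi (by linarith : -δ < 0) 0).const_mul C).const_mul _).mul_const _
  have hcinl : ∀ (lam' : ℝ) (v), Continuous fun s => T.Φ lam' s v ∘ (Sum.inl : Fin n → Fin n ⊕ Fin n) :=
    fun lam' v => by
      have := ((hT.Φ_spec lam').2.2 v).cont
      exact continuous_pi fun i => (continuous_apply (Sum.inl i)).comp this
  have hle : ∀ (v : ℝ → Fin n ⊕ Fin n → ℂ), (∀ s, 0 ≤ s → ‖v s‖ ≤ B * (‖w‖ + 1)) →
      ∀ᵐ s ∂halfLine, ‖star (T.Φ lam s w ∘ Sum.inl) ⬝ᵥ (T.Q s).mulVec (v s ∘ Sum.inl)‖ ≤ bound s := by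
    intro v hv
    filter_upwards [hT.bound, ae_restrict_mem measurableSet_Ioi] with s hs hs0
    have h1 := norm_star_dotProduct_mulVec_le (fun i j => (hs i j).2.2) (T.Φ lam s w ∘ Sum.inl)
      (v s ∘ Sum.inl)
    rw [Fintype.card_fin] at h1
    refine h1.trans ?_
    have h2 := (hinl _).trans (hC s (le_of_lt hs0))
    have h3 := (hinl _).trans (hv s (le_of_lt hs0))
    simp only [hbound]
    gcongr
  have hfb : ∀ᶠ k in atTop, ∀ᵐ s ∂halfLine, ‖f k s‖ ≤ bound s := by
    filter_upwards [hl1, hw1, hgt] with k h1 h2 h3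
    refine hle (fun s => T.Φ (t k) s (w' k)) fun s hs => ?_
    exact (hB (t k) h1 h3 _ (hmem k) s hs).trans (mul_le_mul_of_nonneg_left h2 hB0)
  have hFb : ∀ᵐ s ∂halfLine, ‖F s‖ ≤ bound s :=
    hle (fun s => T.Φ lam s w) fun s hs =>
      (hB lam (by linarith) hg _ hw s hs).trans (mul_le_mul_of_nonneg_left (by linarith) hB0)
  have hfm : ∀ k, AEStronglyMeasurable (f k) halfLine := fun k =>
    aestronglyMeasurable_matrixForm hT.meas.2.2 (hcinl lam w).aestronglyMeasurable
      (hcinl (t k) (w' k)).aestronglyMeasurable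
  have hFi : Integrable F halfLine :=
    hbi.mono' (aestronglyMeasurable_matrixForm hT.meas.2.2 (hcinl lam w).aestronglyMeasurable
      (hcinl lam w).aestronglyMeasurable) hFb
  have hlim : Tendsto (fun k => ∫ s, f k s ∂halfLine) atTop (𝓝 (∫ s, F s ∂halfLine)) := by
    refine tendsto_integral_filter_of_dominated_convergence bound (Eventually.of_forall hfm) hfb hbi ?_
    filter_upwards [ae_restrict_mem measurableSet_Ioi] with s hs
    have h1 := hT.tendsto_Φ (T' := fun _ => T) (ε := fun _ => 0) (fun _ => hT)
        tendsto_const_nhds (fun _ => le_rfl) (by simp) ht hw' (tendsto_const_nhds (x := s))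
        (Eventually.of_forall fun _ => le_of_lt hs)
    have hcont : Continuous fun v : Fin n ⊕ Fin n → ℂ => v ∘ (Sum.inl : Fin n → Fin n ⊕ Fin n) :=
      continuous_pi fun i => continuous_apply (Sum.inl i)
    exact tendsto_star_dotProduct_mulVec (T.Q s) tendsto_const_nhds ((hcont.tendsto _).comp h1)
  -- the Lagrange identity on the half-line
  have hid : ∀ᶠ k in atTop, star w ⬝ᵥ (Matrix.J (Fin n) ℂ).mulVec (w' k) /
      ((lam - t k : ℝ) : ℂ) = ∫ s, f k s ∂halfLine := by
    filter_upwards [hfb] with k hk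
    have hfi : Integrable (f k) halfLine := hbi.mono' (hfm k) hk
    have h1 : Tendsto (fun b => ∫ s in (0)..b, f k s) atTop (𝓝 (∫ s, f k s ∂halfLine)) :=
      intervalIntegral_tendsto_integral_Ioi 0 hfi tendsto_id
    have hw2 : Tendsto (fun x => T.Φ lam x w) atTop (𝓝 0) := hw
    have hw3 : Tendsto (fun x => T.Φ (t k) x (w' k)) atTop (𝓝 0) := hmem k
    have h2 := tendsto_star_dotProduct_mulVec (Matrix.J (Fin n) ℂ) hw2 hw3
    rw [Matrix.mulVec_zero, dotProduct_zero] at h2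
    have h3 : (0 : ℂ) - star w ⬝ᵥ (Matrix.J (Fin n) ℂ).mulVec (w' k) =
        ((t k - lam : ℝ) : ℂ) * ∫ s, f k s ∂halfLine := by
      refine tendsto_nhds_unique (h2.sub_const _) ((h1.const_mul _).congr' ?_)
      filter_upwards [eventually_ge_atTop 0] with b hb
      have := hT.lagrange_identity ((hT.Φ_spec lam).2.2 w) ((hT.Φ_spec (t k)).2.2 (w' k)) le_rfl hb
      simp only [(hT.Φ_spec _).2.1, one_apply_eq_self] at this
      exact this.symm
    have h4 : ((lam - t k : ℝ) : ℂ) ≠ 0 := by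
      exact_mod_cast sub_ne_zero.2 (hne k).symm
    rw [div_eq_iff h4]
    rw [zero_sub, neg_eq_iff_eq_neg] at h3
    rw [h3]
    push_cast
    ring
  refine ⟨∫ s, (F s).re ∂halfLine, hT.integral_pos hc hg hw0 hFi, ?_⟩
  have hreal : ∫ s, F s ∂halfLine = ((∫ s, (F s).re ∂halfLine : ℝ) : ℂ) := by
    refine Eq.trans ?_ integral_complex_ofReal
    refine integral_congr_ae ?_
    filter_upwards [hT.herm] with s hs
    exact Complex.ext (by simp) (by
      simpa using (hs.2.2.im_star_dotProduct_mulVec_self (T.Φ lam s w ∘ Sum.inl)))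
  rw [← hreal]
  exact hlim.congr' (hid.mono fun k hk => hk.symm)

end Crossing

section LeadingParts

variable {ι : Type*} [Fintype ι]

/-- The part of the coordinate vector `c` with exponent `mu`. -/
noncomputable def levelPart (a : ι → ℝ) (mu : ℝ) : (ι → ℂ) →ₗ[ℂ] (ι → ℂ) where
  toFun c i := if a i = mu then c i else 0
  map_add' c d := by ext i; simp only [Pi.add_apply]; split_ifs <;> simp
  map_smul' r c := by ext i; simp only [Pi.smul_apply, RingHom.id_apply]; split_ifs <;> simp

omit [Fintype ι] in
theorem levelPart_apply (a : ι → ℝ) (mu : ℝ) (c : ι → ℂ) (i : ι) :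
    levelPart a mu c i = if a i = mu then c i else 0 := rfl

/-- The leading parts of the elements of `C`. -/
def leadingParts (a : ι → ℝ) (C : Submodule ℂ (ι → ℂ)) : Set (ι → ℂ) :=
  {d | ∃ mu, ∃ c ∈ C, (∀ i, c i ≠ 0 → a i ≤ mu) ∧ d = levelPart a mu c}

/-- Limits of exponentially rescaled elements of `C` lie in the span of the leading parts. -/
theorem mem_span_leadingParts (a : ι → ℝ) {T : Type*} {l : Filter T} [l.NeBot] {x : T → ℝ}
    (hx : Tendsto x l atTop) (s : Finset ℝ) : ∀ (C : Submodule ℂ (ι → ℂ)),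
    (∀ c ∈ C, ∀ i, c i ≠ 0 → a i ∈ s) → ∀ (c : T → ι → ℂ) (d : ι → ℂ), (∀ t, c t ∈ C) →
    (∀ i, Tendsto (fun t => (Real.exp (a i * x t) : ℂ) * c t i) l (𝓝 (d i))) →
    d ∈ Submodule.span ℂ (leadingParts a C) := by
  induction s using Finset.induction_on_max with
  | empty =>
    intro C hC c d hc hd
    have h0 : d = 0 := by
      ext i
      have h : ∀ t, c t i = 0 := fun t => by
        by_contra h
        simpa using hC (c t) (hc t) i h
      have := hd i
      simp only [h, mul_zero] at this
      exact (tendsto_nhds_unique this tendsto_const_nhds)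
    rw [h0]
    exact zero_mem _
  | insert mu s hmu ih =>
    intro C hC c d hc hd
    have hle : ∀ c ∈ C, ∀ i, c i ≠ 0 → a i ≤ mu := fun c hc i hi => by
      rcases Finset.mem_insert.1 (hC c hc i hi) with h | h
      · exact h.le
      · exact (hmu _ h).le
    set P := levelPart a mu with hP
    -- a linear section of `P` on `C`
    obtain ⟨σ, hσ⟩ := ((P.domRestrict C).rangeRestrict).exists_rightInverse_of_surjective
      (LinearMap.range_rangeRestrict _)
    have hPσ : ∀ r, P (σ r : ι → ℂ) = r := fun r => by
      have := congrArg Subtype.val (LinearMap.congr_fun hσ r)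
      simpa using this
    set r : T → LinearMap.range (P.domRestrict C) := fun t => ⟨P (c t), ⟨⟨c t, hc t⟩, rfl⟩⟩ with hr
    have hlim : Tendsto (fun t => (Real.exp (mu * x t) : ℂ) • (r t : ι → ℂ)) l (𝓝 (P d)) := by
      refine tendsto_pi_nhds.2 fun i => ?_
      simp only [hr, hP, Pi.smul_apply, levelPart_apply, smul_eq_mul]
      split_ifs with h
      · simpa [h] using hd i
      · simp
    have hPd : P d ∈ LinearMap.range (P.domRestrict C) :=
      (Submodule.closed_of_finiteDimensional _).mem_of_tendsto hlim
        (Eventually.of_forall fun t => Submodule.smul_mem _ _ (r t).2)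
    have hlim' : Tendsto (fun t => (Real.exp (mu * x t) : ℂ) • r t) l (𝓝 ⟨P d, hPd⟩) := by
      rw [tendsto_subtype_rng]
      exact hlim
    have hσlim : Tendsto (fun t => (Real.exp (mu * x t) : ℂ) • (σ (r t) : ι → ℂ)) l
        (𝓝 (σ ⟨P d, hPd⟩ : ι → ℂ)) := by
      have h1 := ((LinearMap.continuous_of_finiteDimensional (C.subtype ∘ₗ σ)).tendsto _).comp hlim'
      refine h1.congr fun t => ?_
      simp
    have h1 : P d ∈ Submodule.span ℂ (leadingParts a C) :=
      Submodule.subset_span ⟨mu, σ ⟨P d, hPd⟩, (σ _).2, hle _ (σ _).2, (hPσ ⟨P d, hPd⟩).symm⟩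
    have h2 : d - P d ∈ Submodule.span ℂ (leadingParts a (C ⊓ LinearMap.ker P)) := by
      refine ih (C ⊓ LinearMap.ker P) ?_ (fun t => c t - σ (r t)) _ (fun t => ?_) fun i => ?_
      · rintro c ⟨hc, hc'⟩ i hi
        rcases Finset.mem_insert.1 (hC c hc i hi) with h | h
        · have := congrFun (LinearMap.mem_ker.1 hc') i
          rw [hP, levelPart_apply, if_pos h] at this
          exact absurd this hi
        · exact h
      · refine ⟨sub_mem (hc t) (σ (r t)).2, ?_⟩
        change P _ = 0
        rw [map_sub, hPσ, sub_self]
      · by_cases h : a i = mu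
        · have h3 : ∀ t, (σ (r t) : ι → ℂ) i = c t i := fun t => by
            have := congrFun (hPσ (r t)) i
            simpa [hP, levelPart_apply, h, hr] using this
          have h4 : (d - P d) i = 0 := by simp [hP, levelPart_apply, h]
          simp [h3, h4, h]
        · by_cases hlt : mu < a i
          · have h3 : ∀ c ∈ C, c i = 0 := fun c hc => by
              by_contra h0
              exact absurd (hle c hc i h0) (not_le.2 hlt)
            have h4 := hd i
            simp only [h3 _ (hc _), mul_zero] at h4
            have h5 : d i = 0 := tendsto_nhds_unique h4 tendsto_const_nhds
            simp [h3 _ (hc _), h3 _ (σ _).2, h5, hP, levelPart_apply, h]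
          · have hlt' : a i - mu < 0 := sub_neg.2 (lt_of_le_of_ne (not_lt.1 hlt) h)
            have h3 : Tendsto (fun t => Real.exp ((a i - mu) * x t)) l (𝓝 0) :=
              Real.tendsto_exp_atBot.comp (hx.const_mul_atTop_of_neg hlt')
            have h4 := (((Complex.continuous_ofReal.tendsto 0).comp h3).mul
              (tendsto_pi_nhds.1 hσlim i))
            have h5 := (hd i).sub h4
            simp only [Complex.ofReal_zero, zero_mul, sub_zero] at h5
            have h6 : (d - P d) i = d i := by simp [hP, levelPart_apply, h]
            rw [h6]
            refine h5.congr fun t => ?_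
            simp only [Function.comp_apply, Pi.smul_apply, smul_eq_mul, Pi.sub_apply]
            rw [← mul_assoc, ← Complex.ofReal_mul, ← Real.exp_add, mul_sub]
            congr 4
            ring
    have h3 : Submodule.span ℂ (leadingParts a (C ⊓ LinearMap.ker P)) ≤
        Submodule.span ℂ (leadingParts a C) := by
      refine Submodule.span_mono ?_
      rintro d ⟨nu, c, hc, h⟩
      exact ⟨nu, c, hc.1, h⟩
    have := add_mem h1 (h3 h2)
    simpa using this

omit [Fintype ι] in
/-- Vectors of negative exponents in the span of the leading parts come from elements of negative
exponents. -/
theorem mem_span_leadingParts_of_neg (a : ι → ℝ) {C : Submodule ℂ (ι → ℂ)} {d : ι → ℂ}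
    (hd : d ∈ Submodule.span ℂ (leadingParts a C)) (hneg : ∀ i, d i ≠ 0 → a i < 0)
    {C' : Submodule ℂ (ι → ℂ)} (hC' : ∀ c ∈ C, (∀ i, c i ≠ 0 → a i < 0) → c ∈ C') :
    d ∈ Submodule.span ℂ (leadingParts a C') := by
  let N : (ι → ℂ) →ₗ[ℂ] (ι → ℂ) :=
    { toFun := fun c i => if a i < 0 then c i else 0
      map_add' := fun c d => by ext i; simp only [Pi.add_apply]; split_ifs <;> simp
      map_smul' := fun r c => by
        ext i; simp only [Pi.smul_apply, RingHom.id_apply]; split_ifs <;> simp }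
  have hN : ∀ c i, N c i = if a i < 0 then c i else 0 := fun _ _ => rfl
  have h1 : N d = d := by
    ext i
    rw [hN]
    split_ifs with h
    · rfl
    · by_contra h0
      exact h (hneg i (Ne.symm h0))
  have h2 := Submodule.mem_map_of_mem (f := N) hd
  rw [h1, Submodule.map_span] at h2
  refine Submodule.span_le.2 ?_ h2
  rintro _ ⟨_, ⟨mu, c, hc, hle, rfl⟩, rfl⟩
  by_cases hmu : mu < 0
  · refine Submodule.subset_span ⟨mu, c, hC' c hc fun i hi => (hle i hi).trans_lt hmu, hle, ?_⟩
    ext i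
    rw [hN, levelPart_apply]
    split_ifs with h3 h4 <;> first | rfl | (exfalso; linarith)
  · have : N (levelPart a mu c) = 0 := by
      ext i
      rw [hN, levelPart_apply]
      split_ifs with h3 h4 <;> first | rfl | (exfalso; linarith)
    rw [this]
    exact zero_mem _

end LeadingParts

section PropagatedLimit

variable {E : Type*} [NormedAddCommGroup E] [NormedSpace ℂ E] [FiniteDimensional ℂ E]

/-- The limits of curves in `C` moved by `Φ`. -/
def limitSpace (Φ : ℝ → E →L[ℂ] E) (C : Submodule ℂ E) : Submodule ℂ E where
  carrier := {w | ∃ c : ℝ → E, (∀ x, c x ∈ C) ∧ Tendsto (fun x => Φ x (c x)) atTop (𝓝 w)}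
  zero_mem' := ⟨0, fun _ => zero_mem _, by simp⟩
  add_mem' := by
    rintro v w ⟨c, hc, h⟩ ⟨d, hd, k⟩
    exact ⟨c + d, fun x => add_mem (hc x) (hd x), by simpa using h.add k⟩
  smul_mem' := by
    rintro r v ⟨c, hc, h⟩
    exact ⟨r • c, fun x => Submodule.smul_mem _ r (hc x), by simpa using h.const_smul r⟩

omit [FiniteDimensional ℂ E] in
theorem mem_limitSpace {Φ : ℝ → E →L[ℂ] E} {C : Submodule ℂ E} {w : E} : w ∈ limitSpace Φ C ↔
    ∃ c : ℝ → E, (∀ x, c x ∈ C) ∧ Tendsto (fun x => Φ x (c x)) atTop (𝓝 w) := Iff.rfl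

theorem finrank_limitSpace_le (Φ : ℝ → E →L[ℂ] E) (C : Submodule ℂ E) :
    Module.finrank ℂ (limitSpace Φ C) ≤ Module.finrank ℂ C := by
  set b := Module.finBasis ℂ (limitSpace Φ C) with hb
  have hb' : LinearIndependent ℂ fun i => (b i : E) :=
    b.linearIndependent.map' _ (Submodule.ker_subtype _)
  choose c hc h using fun i => mem_limitSpace.1 (b i).2
  have h1 : Tendsto (fun x i => Φ x (c i x)) atTop (𝓝 fun i => (b i : E)) :=
    tendsto_pi_nhds.2 h
  obtain ⟨x, hx⟩ := (h1.eventually hb'.eventually).exists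
  have h2 : LinearIndependent ℂ fun i => c i x := by
    refine LinearIndependent.of_comp (Φ x : E →ₗ[ℂ] E) ?_
    exact hx
  have h3 : LinearIndependent ℂ fun i => (⟨c i x, hc i x⟩ : C) :=
    LinearIndependent.of_comp C.subtype h2
  simpa using h3.fintype_card_le_finrank

variable {ι : Type*} [Fintype ι] {Φ : ℝ → E →L[ℂ] E} {Ai : E →L[ℂ] E}

omit [FiniteDimensional ℂ E] in
theorem AsymptoticModes.mem_limitSpace_of_leadingParts (m : AsymptoticModes ι Φ Ai)
    {C : Submodule ℂ E} {d : ι → ℂ}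
    (hd : d ∈ Submodule.span ℂ (leadingParts m.a (C.map (m.u.equivFun : E →ₗ[ℂ] (ι → ℂ))))) :
    m.b.equivFun.symm d ∈ limitSpace Φ C := by
  have : Submodule.span ℂ (leadingParts m.a (C.map (m.u.equivFun : E →ₗ[ℂ] (ι → ℂ)))) ≤
      (limitSpace Φ C).comap (m.b.equivFun.symm : (ι → ℂ) →ₗ[ℂ] E) := by
    refine Submodule.span_le.2 ?_
    rintro _ ⟨mu, _, ⟨w, hw, rfl⟩, hle, rfl⟩
    refine ⟨fun x => (Real.exp (-mu * x) : ℂ) • w, fun x => Submodule.smul_mem _ _ hw, ?_⟩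
    have h1 := m.tendsto_apply (w := w) (mu := mu) hle
    simp only [map_smul]
    convert h1 using 2
    simp [Module.Basis.equivFun_symm_apply, levelPart_apply]
  exact this hd

theorem AsymptoticModes.repr_mem_leadingParts (m : AsymptoticModes ι Φ Ai)
    {C : Submodule ℂ E} {T : Type*} {l : Filter T} [l.NeBot] {x : T → ℝ}
    (hx : Tendsto x l atTop) {c : T → E} (hc : ∀ t, c t ∈ C) {w : E}
    (h : Tendsto (fun t => Φ (x t) (c t)) l (𝓝 w)) :
    m.b.equivFun w ∈
      Submodule.span ℂ (leadingParts m.a (C.map (m.u.equivFun : E →ₗ[ℂ] (ι → ℂ)))) := by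
  classical
  refine mem_span_leadingParts m.a hx (Finset.univ.image m.a) _ (by simp)
    (fun t => m.u.equivFun (c t)) _ (fun t => Submodule.mem_map_of_mem (hc t)) fun i => ?_
  have hcomp : CompleteSpace E := FiniteDimensional.complete ℂ E
  have h1 : Tendsto (fun t => m.Θ (x t)) l (𝓝 1) := m.tendsto.comp hx
  have h2 : Tendsto (Ring.inverse ∘ fun t => m.Θ (x t)) l (𝓝 1) := by
    have := (NormedRing.inverse_continuousAt (1 : (E →L[ℂ] E)ˣ)).tendsto.comp h1
    simpa using this
  have h3 : Tendsto (fun t => Ring.inverse (m.Θ (x t)) (Φ (x t) (c t))) l (𝓝 w) := by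
    have := (isBoundedBilinearMap_apply (𝕜 := ℂ) (E := E) (F := E)).continuous.continuousAt.tendsto.comp
      (h2.prodMk_nhds h)
    exact this
  have hu : ∀ᶠ t in l, IsUnit (m.Θ (x t)) :=
    h1.eventually (Units.isOpen.mem_nhds isUnit_one)
  have h4 : Tendsto (fun t => ∑ i, ((Real.exp (m.a i * x t) : ℂ) * m.u.repr (c t) i) • m.b i) l
      (𝓝 w) := by
    refine h3.congr' (hu.mono fun t ht => ?_)
    rw [m.apply_eq, ← mul_apply_eq_comp, Ring.inverse_mul_cancel _ ht]
    rfl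
  have h5 := ((LinearMap.continuous_of_finiteDimensional
    (m.b.equivFun : E →ₗ[ℂ] (ι → ℂ))).tendsto w).comp h4
  have h6 := tendsto_pi_nhds.1 h5 i
  refine h6.congr fun t => ?_
  have := m.b.equivFun.apply_symm_apply fun i => (Real.exp (m.a i * x t) : ℂ) * m.u.repr (c t) i
  rw [Module.Basis.equivFun_symm_apply] at this
  exact congrFun this i

theorem AsymptoticModes.mem_limitSpace_of_tendsto (m : AsymptoticModes ι Φ Ai)
    {C : Submodule ℂ E} {T : Type*} {l : Filter T} [l.NeBot] {x : T → ℝ}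
    (hx : Tendsto x l atTop) {c : T → E} (hc : ∀ t, c t ∈ C) {w : E}
    (h : Tendsto (fun t => Φ (x t) (c t)) l (𝓝 w)) : w ∈ limitSpace Φ C := by
  have := m.mem_limitSpace_of_leadingParts (m.repr_mem_leadingParts hx hc h)
  simpa using this

theorem AsymptoticModes.limitSpace_inf_le (m : AsymptoticModes ι Φ Ai) {C D : Submodule ℂ E}
    (hD : ∀ w ∈ D, ∀ i, m.b.repr w i ≠ 0 → m.a i < 0) :
    limitSpace Φ C ⊓ D ≤ limitSpace Φ (C ⊓ decaySpace Φ) := by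
  rintro w ⟨⟨c, hc, h⟩, hw⟩
  have h1 := m.repr_mem_leadingParts tendsto_id hc h
  have h2 := mem_span_leadingParts_of_neg m.a h1 (hD w hw)
    (C' := (C ⊓ decaySpace Φ).map (m.u.equivFun : E →ₗ[ℂ] (ι → ℂ))) (by
      rintro _ ⟨v, hv, rfl⟩ hneg
      exact Submodule.mem_map_of_mem ⟨hv, m.mem_decaySpace_iff.2 hneg⟩)
  have := m.mem_limitSpace_of_leadingParts h2
  simpa using this

end PropagatedLimit

section BoundaryPath

variable {n : ℕ} {T : HSys n} {Rp Vp Qp : Matrix (Fin n) (Fin n) ℂ} {K θ η c lam : ℝ}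
  {C : Submodule ℂ (Fin n ⊕ Fin n → ℂ)}

theorem isLagrangian_of_tendsto_projMatrix {α : Type*} {l : Filter α} [l.NeBot]
    {L : α → Submodule ℂ (Fin n ⊕ Fin n → ℂ)} {M : Submodule ℂ (Fin n ⊕ Fin n → ℂ)}
    (hL : ∀ᶠ t in l, Module.finrank ℂ (L t) = n) (hM : IsIsotropic M)
    (h : Tendsto (fun t => projMatrix (L t)) l (𝓝 (projMatrix M))) : IsLagrangian M := by
  refine ⟨?_, hM⟩
  by_contra hne
  have h0 : projMatrix M = 0 := by
    have hfr : frameOf M = 0 := by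
      rw [frameOf, dif_neg]
      rintro ⟨X, hX⟩
      refine hne ?_
      rw [← hX.2, finrank_span_eq_card hX.1, Fintype.card_fin]
    rw [projMatrix, hfr, Matrix.zero_mul, Matrix.zero_mul]
  rw [h0] at h
  have htr : Continuous fun P : Matrix (Fin n ⊕ Fin n) (Fin n ⊕ Fin n) ℂ => P.trace := by
    simp only [Matrix.trace, Matrix.diag]
    fun_prop
  have h1 := (htr.tendsto _).comp h
  have h2 : Tendsto (fun _ : α => (n : ℂ)) l (𝓝 0) := by
    rw [Matrix.trace_zero] at h1
    refine h1.congr' (hL.mono fun t ht => ?_)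
    simp only [Function.comp_apply, (isOrthProj_projMatrix ht).trace_eq, ht]
  have h3 : n = 0 := by exact_mod_cast tendsto_nhds_unique tendsto_const_nhds h2
  have := hM.finrank_le
  omega

theorem tendsto_projMatrix_map {α : Type*} {l : Filter α}
    {A : α → (Fin n ⊕ Fin n → ℂ) →L[ℂ] (Fin n ⊕ Fin n → ℂ)}
    {A₀ : (Fin n ⊕ Fin n → ℂ) →L[ℂ] (Fin n ⊕ Fin n → ℂ)} (hC : Module.finrank ℂ C = n)
    (hA : Tendsto A l (𝓝 A₀)) (hA₀ : IsUnit A₀) :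
    Tendsto (fun t => projMatrix (C.map (A t : (Fin n ⊕ Fin n → ℂ) →ₗ[ℂ] (Fin n ⊕ Fin n → ℂ)))) l
      (𝓝 (projMatrix (C.map (A₀ : (Fin n ⊕ Fin n → ℂ) →ₗ[ℂ] (Fin n ⊕ Fin n → ℂ))))) := by
  have hu : ∀ᶠ t in l, IsUnit (A t) := hA.eventually (Units.isOpen.mem_nhds hA₀)
  have hinj : ∀ B : (Fin n ⊕ Fin n → ℂ) →L[ℂ] (Fin n ⊕ Fin n → ℂ), IsUnit B →
      Function.Injective B := fun B hB => by
    refine Function.LeftInverse.injective (g := (Ring.inverse B : (Fin n ⊕ Fin n → ℂ) →L[ℂ] (Fin n ⊕ Fin n → ℂ))) fun v => ?_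
    rw [← mul_apply_eq_comp, Ring.inverse_mul_cancel _ hB]
    rfl
  have hfr : ∀ B : (Fin n ⊕ Fin n → ℂ) →L[ℂ] (Fin n ⊕ Fin n → ℂ), IsUnit B →
      Module.finrank ℂ (C.map (B : (Fin n ⊕ Fin n → ℂ) →ₗ[ℂ] (Fin n ⊕ Fin n → ℂ))) = n :=
    fun B hB => by rw [← (Submodule.equivMapOfInjective (B : (Fin n ⊕ Fin n → ℂ) →ₗ[ℂ] (Fin n ⊕ Fin n → ℂ)) (hinj B hB) C).finrank_eq, hC]
  refine tendsto_projMatrix_of_closed (hu.mono fun t ht => hfr _ ht) (hfr _ hA₀).le ?_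
  intro g hgl u w hu' hw
  obtain ⟨U, hU⟩ := hA₀
  have h1 : Tendsto (fun t => Ring.inverse (A t)) g (𝓝 (Ring.inverse A₀)) := by
    rw [← hU]
    refine (NormedRing.inverse_continuousAt U).tendsto.comp ?_
    rw [hU]
    exact hA.mono_left hgl
  have h2 : Tendsto (fun t => Ring.inverse (A t) (u t)) g (𝓝 (Ring.inverse A₀ w)) :=
    (isBoundedBilinearMap_apply (𝕜 := ℂ) (E := Fin n ⊕ Fin n → ℂ)
      (F := Fin n ⊕ Fin n → ℂ)).continuous.continuousAt.tendsto.comp (h1.prodMk_nhds hw)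
  have h3 : Ring.inverse A₀ w ∈ C := by
    refine (Submodule.closed_of_finiteDimensional C).mem_of_tendsto h2 ?_
    filter_upwards [hu', hu.filter_mono hgl] with t ht htu
    obtain ⟨v, hv, hv'⟩ := ht
    rw [← hv', ContinuousLinearMap.coe_coe, ← mul_apply_eq_comp,
      Ring.inverse_mul_cancel _ htu]
    exact hv
  refine ⟨_, h3, ?_⟩
  rw [ContinuousLinearMap.coe_coe, ← mul_apply_eq_comp,
    Ring.mul_inverse_cancel _ ⟨U, hU⟩]
  rfl

theorem HSys.Bounds.isUnit_Φ (hT : T.Bounds Rp Vp Qp K θ η) (lam : ℝ) {x : ℝ} (hx : 0 ≤ x) :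
    IsUnit (T.Φ lam x) := by
  rw [ContinuousLinearMap.isUnit_iff_bijective]
  have h := hT.Φ_injective lam hx
  exact ⟨h, (LinearMap.injective_iff_surjective
    (f := (T.Φ lam x : (Fin n ⊕ Fin n → ℂ) →ₗ[ℂ] _))).1 h⟩

theorem HSys.Bounds.isLagrangian_map (hT : T.Bounds Rp Vp Qp K θ η) (lam : ℝ) (hC : IsLagrangian C)
    {x : ℝ} (hx : 0 ≤ x) : IsLagrangian (C.map (T.Φ lam x : (Fin n ⊕ Fin n → ℂ) →ₗ[ℂ] (Fin n ⊕ Fin n → ℂ))) := by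
  refine ⟨?_, ?_⟩
  · rw [← (Submodule.equivMapOfInjective (T.Φ lam x : (Fin n ⊕ Fin n → ℂ) →ₗ[ℂ] (Fin n ⊕ Fin n → ℂ))
      (hT.Φ_injective lam hx) C).finrank_eq, hC.1]
  · rintro _ ⟨u, hu, rfl⟩ _ ⟨v, hv, rfl⟩
    simp only [ContinuousLinearMap.coe_coe]
    rw [hT.Φ_symplectic lam hx]
    exact hC.2 u hu v hv

theorem HSys.Bounds.repr_neg_of_mem (hT : T.Bounds Rp Vp Qp K θ η) {ι : Type*} [Fintype ι]
    (m : AsymptoticModes ι (T.Φ lam) (endCoef Rp Vp Qp lam)) {w : Fin n ⊕ Fin n → ℂ}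
    (hw : w ∈ T.decayFamily Rp Vp Qp ⊤ lam) {i : ι} (hi : m.b.repr w i ≠ 0) : m.a i < 0 := by
  have hw' : Tendsto (fun x => (T.shift Rp Vp Qp ⊤).Φ lam x w) atTop (𝓝 0) := hw
  set y : ℝ → Fin n ⊕ Fin n → ℂ := fun x =>
    ∑ j, ((Real.exp (m.a j * x) : ℂ) * m.b.repr w j) • m.b j with hy
  have hyd : ∀ x, HasDerivAt y (endCoef Rp Vp Qp lam (y x)) x := by
    intro x
    simp only [hy, map_sum, map_smul, m.eig, smul_smul]
    refine HasDerivAt.fun_sum fun j _ => ?_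
    have h1 : HasDerivAt (fun x : ℝ => (Real.exp (m.a j * x) : ℂ))
        ((Real.exp (m.a j * x) * (m.a j * 1) : ℝ) : ℂ) x :=
      (((hasDerivAt_id x).const_mul (m.a j)).exp).ofReal_comp
    have h2 := ((h1.mul_const (m.b.repr w j)).smul_const (m.b j))
    convert h2 using 2
    push_cast
    ring
  have hyc : Continuous y := continuous_iff_continuousAt.2 fun x => (hyd x).continuousAt
  have hsol : IsIntSol ((T.shift Rp Vp Qp ⊤).coef lam) y := by
    refine ⟨hyc, fun x hx => ?_⟩
    have h1 : ∀ s, (T.shift Rp Vp Qp ⊤).coef lam s (y s) = endCoef Rp Vp Qp lam (y s) := fun s => by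
      simp [HSys.coef, HSys.shift, endCoef]
    simp only [h1]
    rw [intervalIntegral.integral_eq_sub_of_hasDerivAt (fun s _ => hyd s)
      (((endCoef Rp Vp Qp lam).continuous.comp hyc).intervalIntegrable _ _)]
    abel
  have hy0 : y 0 = w := by
    simp only [hy, mul_zero, Real.exp_zero, Complex.ofReal_one, one_mul]
    exact m.b.sum_repr w
  have h1 : Tendsto y atTop (𝓝 0) := by
    refine hw'.congr' ((eventually_ge_atTop 0).mono fun x hx => ?_)
    rw [← hy0]
    exact ((hT.shift ⊤).eq_Φ hsol hx).symm
  have h2 := ((LinearMap.continuous_of_finiteDimensional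
    (m.b.equivFun : (Fin n ⊕ Fin n → ℂ) →ₗ[ℂ] (ι → ℂ))).tendsto 0).comp h1
  have h3 := (tendsto_pi_nhds.1 h2 i).norm
  have h4 : ∀ x, m.b.equivFun (y x) i = (Real.exp (m.a i * x) : ℂ) * m.b.repr w i := fun x => by
    have := m.b.equivFun.apply_symm_apply fun i => (Real.exp (m.a i * x) : ℂ) * m.b.repr w i
    rw [Module.Basis.equivFun_symm_apply] at this
    exact congrFun this i
  refine lt_of_le_of_ne (not_lt.1 fun hpos => hi ?_) (m.ne_zero i)
  rw [map_zero, Pi.zero_apply, norm_zero] at h3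
  rw [← norm_le_zero_iff]
  refine ge_of_tendsto h3 ((eventually_ge_atTop 0).mono fun x hx => ?_)
  simp only [Function.comp_apply, LinearEquiv.coe_coe]
  rw [h4, norm_mul, Complex.norm_real, Real.norm_eq_abs, Real.abs_exp]
  exact le_mul_of_one_le_left (norm_nonneg _) (Real.one_le_exp (by positivity))

/-- A Lagrangian subspace moved by the flow has a Lagrangian limit, and its intersection with the
limiting decaying solutions does not grow. -/
theorem HSys.Bounds.exists_isLagrangianLimit (hT : T.Bounds Rp Vp Qp K θ η) (hc : 0 < c)
    (hg : GapBound Vp Qp c lam) (hC : IsLagrangian C) :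
    IsLagrangianLimit (fun x => C.map (T.Φ lam x : (Fin n ⊕ Fin n → ℂ) →ₗ[ℂ] (Fin n ⊕ Fin n → ℂ)))
        (limitSpace (T.Φ lam) C) ∧
      Module.finrank ℂ (limitSpace (T.Φ lam) C ⊓ T.decayFamily Rp Vp Qp ⊤ lam : Submodule ℂ _) ≤
        Module.finrank ℂ (C ⊓ decaySpace (T.Φ lam) : Submodule ℂ _) := by
  obtain ⟨m⟩ := hT.nonempty_modes hc hg
  have hfr : ∀ᶠ x in atTop,
      Module.finrank ℂ (C.map (T.Φ lam x : (Fin n ⊕ Fin n → ℂ) →ₗ[ℂ] (Fin n ⊕ Fin n → ℂ))) = n :=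
    (eventually_ge_atTop 0).mono fun x hx => (hT.isLagrangian_map lam hC hx).1
  have hiso : IsIsotropic (limitSpace (T.Φ lam) C) := by
    rintro u ⟨d, hd, hu⟩ v ⟨e, he, hv⟩
    refine tendsto_nhds_unique (tendsto_star_dotProduct_mulVec (Matrix.J (Fin n) ℂ) hv hu)
      (tendsto_const_nhds.congr' ((eventually_ge_atTop 0).mono fun x hx => ?_))
    exact ((hT.Φ_symplectic lam hx _ _).trans (hC.2 _ (hd x) _ (he x))).symm
  have hlim := tendsto_projMatrix_of_closed (M := limitSpace (T.Φ lam) C) hfr hiso.finrank_le (by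
    intro g hgl u w hu hw
    have h1 : ∀ x, ∃ v ∈ C, u x ∈ C.map (T.Φ lam x : (Fin n ⊕ Fin n → ℂ) →ₗ[ℂ] (Fin n ⊕ Fin n → ℂ)) →
        T.Φ lam x v = u x := fun x => by
      by_cases h : u x ∈ C.map (T.Φ lam x : (Fin n ⊕ Fin n → ℂ) →ₗ[ℂ] (Fin n ⊕ Fin n → ℂ))
      · obtain ⟨v, hv, hv'⟩ := h
        exact ⟨v, hv, fun _ => hv'⟩
      · exact ⟨0, zero_mem _, fun h' => absurd h' h⟩
    choose v hv hv' using h1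
    refine m.mem_limitSpace_of_tendsto (l := (g : Filter ℝ)) (x := fun x => x) hgl hv ?_
    exact hw.congr' (hu.mono fun x hx => (hv' x hx).symm))
  refine ⟨⟨isLagrangian_of_tendsto_projMatrix hfr hiso hlim, hlim⟩, ?_⟩
  exact (Submodule.finrank_mono (m.limitSpace_inf_le fun w hw i hi => hT.repr_neg_of_mem m hw hi)).trans
    (finrank_limitSpace_le _ _)

end BoundaryPath

section InverseBounds

variable {n : ℕ} {M N : Matrix (Fin n) (Fin n) ℂ} {θ K : ℝ}

theorem isUnit_det_of_lower (hθ : 0 < θ) (h : ∀ v, θ * nsq v ≤ (star v ⬝ᵥ M.mulVec v).re) :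
    IsUnit M.det := by
  rw [← Matrix.isUnit_iff_isUnit_det, ← Matrix.mulVec_injective_iff_isUnit]
  refine (injective_iff_map_eq_zero M.mulVecLin).2 fun v hv => ?_
  have h1 := h v
  rw [show M.mulVec v = 0 from hv, dotProduct_zero, Complex.zero_re] at h1
  have h2 : nsq v ≤ 0 := nonpos_of_mul_nonpos_right h1 hθ
  exact nsq_eq_zero.1 (le_antisymm h2 (nsq_nonneg v))

theorem norm_inv_apply_le (hθ : 0 < θ) (h : ∀ v, θ * nsq v ≤ (star v ⬝ᵥ M.mulVec v).re)
    (i j : Fin n) : ‖M⁻¹ i j‖ ≤ n * n / θ := by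
  have hu := isUnit_det_of_lower hθ h
  set w := M⁻¹.mulVec (Pi.single j 1) with hw
  have h0 : M.mulVec w = Pi.single j 1 := by
    rw [hw, Matrix.mulVec_mulVec, Matrix.mul_nonsing_inv _ hu, Matrix.one_mulVec]
  have h1 : θ * ‖w‖ ^ 2 ≤ n * n * ‖w‖ := by
    have h2 := h w
    rw [h0] at h2
    have h3 := norm_star_dotProduct_mulVec_le (M := (1 : Matrix (Fin n) (Fin n) ℂ)) (K := 1)
      (fun i j => by rw [Matrix.one_apply]; split_ifs <;> simp) w (Pi.single j 1)
    rw [Matrix.one_mulVec, Fintype.card_fin, Pi.norm_single, norm_one] at h3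
    have h4 := (Complex.re_le_norm _).trans h3
    have h5 := mul_le_mul_of_nonneg_left (norm_sq_le_nsq w) hθ.le
    linarith
  have h2 : ‖w‖ ≤ n * n / θ := by
    rw [le_div_iff₀ hθ]
    rcases (norm_nonneg w).eq_or_lt with h3 | h3
    · rw [← h3]; simp; positivity
    · nlinarith
  calc ‖M⁻¹ i j‖ = ‖w i‖ := by rw [hw, Matrix.mulVec_single_one]; rfl
    _ ≤ _ := (norm_le_pi_norm w i).trans h2

theorem lower_inv (hθ : 0 < θ) (hM : M.IsHermitian)
    (h : ∀ v, θ * nsq v ≤ (star v ⬝ᵥ M.mulVec v).re) (hK : 0 ≤ K) (hb : ∀ i j, ‖M i j‖ ≤ K)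
    (v : Fin n → ℂ) :
    θ / (n * (n * K) ^ 2 + 1) * nsq v ≤ (star v ⬝ᵥ M⁻¹.mulVec v).re := by
  have hu := isUnit_det_of_lower hθ h
  set w := M⁻¹.mulVec v with hw
  have h0 : M.mulVec w = v := by
    rw [hw, Matrix.mulVec_mulVec, Matrix.mul_nonsing_inv _ hu, Matrix.one_mulVec]
  have h1 : star v ⬝ᵥ w = star w ⬝ᵥ M.mulVec w := by
    conv_lhs => rw [← h0]
    have := star_mulVec_dotProduct M (1 : Matrix (Fin n) (Fin n) ℂ) w w
    rw [Matrix.one_mulVec, Matrix.mul_one, hM.eq] at this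
    exact this
  rw [h1]
  refine le_trans ?_ (h w)
  have h2 : ‖v‖ ≤ n * K * ‖w‖ := by
    have h3 := (mulVecCLM M).le_of_opNorm_le (norm_mulVecCLM_le hK hb) w
    rw [mulVecCLM_apply, h0, Fintype.card_fin] at h3
    exact h3
  have h3 := nsq_le_norm_sq v
  rw [Fintype.card_fin] at h3
  have h4 : nsq v ≤ (n * (n * K) ^ 2 + 1) * nsq w := by
    have h5 := norm_sq_le_nsq w
    calc nsq v ≤ n * ‖v‖ ^ 2 := h3
      _ ≤ n * (n * K * ‖w‖) ^ 2 := by gcongr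
      _ = n * (n * K) ^ 2 * ‖w‖ ^ 2 := by ring
      _ ≤ n * (n * K) ^ 2 * nsq w := by gcongr
      _ ≤ _ := by nlinarith [nsq_nonneg w]
  rw [div_mul_eq_mul_div, div_le_iff₀ (by positivity)]
  nlinarith

theorem norm_inv_sub_inv_apply_le (hM : IsUnit M.det) (hN : IsUnit N.det) {B : ℝ} (hB : 0 ≤ B)
    (hMB : ∀ i j, ‖M⁻¹ i j‖ ≤ B) (hNB : ∀ i j, ‖N⁻¹ i j‖ ≤ B) (i j : Fin n) :
    ‖M⁻¹ i j - N⁻¹ i j‖ ≤ B * B * ∑ k, ∑ l, ‖M k l - N k l‖ := by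
  have e : M⁻¹ - N⁻¹ = M⁻¹ * ((N - M) * N⁻¹) := by
    rw [Matrix.sub_mul, Matrix.mul_sub, Matrix.mul_nonsing_inv _ hN, Matrix.mul_one,
      ← Matrix.mul_assoc, Matrix.nonsing_inv_mul _ hM, Matrix.one_mul]
  rw [← Matrix.sub_apply, e, Matrix.mul_apply, Finset.mul_sum]
  refine (norm_sum_le _ _).trans (Finset.sum_le_sum fun k _ => ?_)
  rw [Matrix.mul_apply, Finset.mul_sum, Finset.mul_sum]
  refine (norm_sum_le _ _).trans (Finset.sum_le_sum fun l _ => ?_)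
  rw [norm_mul, norm_mul, Matrix.sub_apply, norm_sub_rev]
  have h1 := hMB i k
  have h2 := hNB l j
  calc ‖M⁻¹ i k‖ * (‖M k l - N k l‖ * ‖N⁻¹ l j‖) ≤ B * (‖M k l - N k l‖ * B) := by gcongr
    _ = _ := by ring

end InverseBounds

section Coefficients

variable {n : ℕ}

theorem aestronglyMeasurable_matrix {α : Type*} [MeasurableSpace α] {μ : Measure α}
    {M : α → Matrix (Fin n) (Fin n) ℂ} (h : ∀ i j, AEStronglyMeasurable (fun x => M x i j) μ) :
    AEStronglyMeasurable M μ := by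
  have h1 : ∀ i, AEMeasurable (fun x => M x i) μ := fun i =>
    aemeasurable_pi_iff.2 fun j => (h i j).aemeasurable
  have h2 : AEMeasurable (fun x => (fun i j => M x i j : Fin n → Fin n → ℂ)) μ :=
    aemeasurable_pi_iff.2 h1
  have h3 := h2.aestronglyMeasurable
  exact h3

theorem aestronglyMeasurable_matrix_inv {α : Type*} [MeasurableSpace α] {μ : Measure α}
    {M : α → Matrix (Fin n) (Fin n) ℂ} (h : AEStronglyMeasurable M μ) :
    AEStronglyMeasurable (fun x => (M x)⁻¹) μ := by
  refine aestronglyMeasurable_matrix fun i j => ?_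
  have h1 : AEStronglyMeasurable (fun x => (M x).det) μ :=
    (Continuous.matrix_det continuous_id).comp_aestronglyMeasurable h
  have h2 : AEStronglyMeasurable (fun x => (M x).adjugate i j) μ :=
    ((continuous_apply_apply i j).comp (Continuous.matrix_adjugate continuous_id)).comp_aestronglyMeasurable h
  have e : (fun x => (M x)⁻¹ i j) = fun x => ((M x).det)⁻¹ * (M x).adjugate i j := by
    funext x
    rw [Matrix.inv_def, Matrix.smul_apply, Ring.inverse_eq_inv', smul_eq_mul]
  rw [e]
  exact (h1.aemeasurable.inv.aestronglyMeasurable).mul h2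

theorem frequently_of_ae_halfLine {p : ℝ → Prop} (h : ∀ᵐ x ∂halfLine, p x) :
    ∃ᶠ x in atTop, p x := by
  rw [frequently_atTop]
  intro X
  by_contra hcon
  push Not at hcon
  rw [ae_iff] at h
  have h1 : Set.Ioi (max X 0) ⊆ {x | ¬ p x} := fun x hx =>
    hcon x ((le_max_left X 0).trans (le_of_lt hx))
  have h2 := measure_mono_null h1 h
  rw [Measure.restrict_apply measurableSet_Ioi,
    Set.inter_eq_self_of_subset_left (Set.Ioi_subset_Ioi (le_max_right X 0)), Real.volume_Ioi] at h2
  exact ENNReal.top_ne_zero h2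

theorem lower_of_decay {M : ℝ → Matrix (Fin n) (Fin n) ℂ} {Mp : Matrix (Fin n) (Fin n) ℂ}
    {θ C η : ℝ} (hη : 0 < η)
    (hl : ∀ᵐ x ∂halfLine, ∀ v, θ * nsq v ≤ (star v ⬝ᵥ (M x).mulVec v).re)
    (hd : ∀ᵐ x ∂halfLine, ∀ i j, ‖M x i j - Mp i j‖ ≤ C * Real.exp (-η * x)) (v : Fin n → ℂ) :
    θ * nsq v ≤ (star v ⬝ᵥ Mp.mulVec v).re := by
  have h1 : Tendsto (fun x => (star v ⬝ᵥ Mp.mulVec v).re +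
      n * n * (C * Real.exp (-η * x)) * nsq v) atTop
      (𝓝 ((star v ⬝ᵥ Mp.mulVec v).re + n * n * (C * 0) * nsq v)) :=
    ((((Real.tendsto_exp_atBot.comp
      (tendsto_id.const_mul_atTop_of_neg (neg_lt_zero.2 hη))).const_mul C).const_mul _).mul_const
        _).const_add _
  simp only [mul_zero, zero_mul, add_zero] at h1
  refine ge_of_tendsto_of_frequently h1 ?_
  refine (frequently_of_ae_halfLine (hl.and hd)).mono fun x hx => ?_
  have h2 := norm_star_dotProduct_mulVec_self_le (M := M x - Mp) (fun i j => hx.2 i j) v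
  rw [Matrix.sub_mulVec, dotProduct_sub, Fintype.card_fin] at h2
  have h3 := (Complex.re_le_norm _).trans h2
  rw [Complex.sub_re] at h3
  linarith [hx.1 v]

/-- The first-order system of a Sturm-Liouville problem. -/
noncomputable def SturmLiouville.toHSys (S : SturmLiouville n) : HSys n :=
  ⟨fun x => (S.P x)⁻¹, S.V, S.Q⟩

theorem SturmLiouville.RegularCoefficients.continuousOn_P {S : SturmLiouville n}
    (h : S.RegularCoefficients) (i j : Fin n) : ContinuousOn (fun x => S.P x i j) (Set.Ici 0) :=
  (h.P_ac i j).continuousOn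

/-- The lower bound of `P` holds everywhere on `[0, ∞)`. -/
theorem SturmLiouville.RegularCoefficients.exists_P_lower {S : SturmLiouville n}
    (h : S.RegularCoefficients) : ∃ θ > 0, ∀ x, 0 ≤ x → ∀ v : Fin n → ℂ,
      θ * nsq v ≤ (star v ⬝ᵥ (S.P x).mulVec v).re := by
  obtain ⟨θ, hθ, hP⟩ := h.P_lower
  refine ⟨θ, hθ, fun x hx v => ?_⟩
  have hc : ContinuousOn (fun x => (star v ⬝ᵥ (S.P x).mulVec v).re) (Set.Ici 0) := by
    refine Complex.continuous_re.comp_continuousOn ?_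
    simp only [dotProduct, Matrix.mulVec]
    exact continuousOn_finsetSum _ fun i _ => continuousOn_const.mul
      (continuousOn_finsetSum _ fun j _ => (h.continuousOn_P i j).mul continuousOn_const)
  have hc' : ContinuousWithinAt (fun x => (star v ⬝ᵥ (S.P x).mulVec v).re) (Set.Ioi x) x :=
    (hc x hx).mono fun y hy => hx.trans (le_of_lt hy)
  refine ge_of_tendsto_of_frequently hc' ?_
  intro hcon
  rw [ae_iff] at hP
  obtain ⟨y, hy, hsub⟩ := mem_nhdsGT_iff_exists_Ioo_subset.1 hcon
  have h1 : Set.Ioo x y ⊆ {x | ¬ ∀ v : Fin n → ℂ,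
      θ * (star v ⬝ᵥ v).re ≤ (star v ⬝ᵥ (S.P x).mulVec v).re} := fun z hz hz' => by
    have := hz' v
    rw [← nsq_eq_re] at this
    exact hsub hz this
  have h2 := measure_mono_null h1 hP
  rw [Measure.restrict_apply measurableSet_Ioo, Set.inter_eq_self_of_subset_left
    (show Set.Ioo x y ⊆ Set.Ioi 0 from fun z hz => lt_of_le_of_lt hx hz.1), Real.volume_Ioo] at h2
  have hy' : x < y := hy
  simp at h2
  linarith

theorem norm_apply_le_sum (M : Matrix (Fin n) (Fin n) ℂ) (i j : Fin n) :
    ‖M i j‖ ≤ ∑ k, ∑ l, ‖M k l‖ :=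
  (Finset.single_le_sum (f := fun l => ‖M i l‖) (fun _ _ => norm_nonneg _)
    (Finset.mem_univ j)).trans (Finset.single_le_sum (f := fun k => ∑ l, ‖M k l‖)
      (fun _ _ => Finset.sum_nonneg fun _ _ => norm_nonneg _) (Finset.mem_univ i))

theorem SturmLiouville.exists_bounds {S : SturmLiouville n} {Pp Vp Qp : Matrix (Fin n) (Fin n) ℂ}
    (h1 : S.RegularCoefficients) (h2 : S.HasEndstates Pp Vp Qp) :
    ∃ K θ η, S.toHSys.Bounds Pp⁻¹ Vp Qp K θ η := by
  obtain ⟨C, η, hC, hη, hd⟩ := h2.decay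
  obtain ⟨θP, hθP, hP⟩ := h1.P_lower
  obtain ⟨θQ, hθQ, hQ⟩ := h1.Q_lower
  simp only [← nsq_eq_re] at hP hQ
  have hPp := lower_of_decay hη hP (hd.mono fun x hx i j => (hx i j).1)
  have hQp := lower_of_decay hη hQ (hd.mono fun x hx i j => (hx i j).2.2.1)
  set B : ℝ := n * n / θP with hB
  have hB0 : 0 ≤ B := by positivity
  set sz : Matrix (Fin n) (Fin n) ℂ → ℝ := fun M => ∑ k, ∑ l, ‖M k l‖ with hsz
  have hsz0 : ∀ M, 0 ≤ sz M := fun M =>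
    Finset.sum_nonneg fun _ _ => Finset.sum_nonneg fun _ _ => norm_nonneg _
  set K₁ : ℝ := sz Pp + sz Vp + sz Qp + C with hK₁
  have hK₁0 : 0 < K₁ := by linarith [hsz0 Pp, hsz0 Vp, hsz0 Qp]
  set K : ℝ := K₁ + B + B * B * (n * (n * C)) with hK
  have hK₁K : K₁ ≤ K := by
    have : 0 ≤ B * B * (n * (n * C)) := by positivity
    linarith
  have hBK : B ≤ K := by
    have : 0 ≤ B * B * (n * (n * C)) := by positivity
    linarith
  have hCK₁ : C ≤ K₁ := by linarith [hsz0 Pp, hsz0 Vp, hsz0 Qp]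
  set θR : ℝ := θP / (n * (n * K₁) ^ 2 + 1) with hθR
  have hθR0 : 0 < θR := by positivity
  have hexp : ∀ᵐ x ∂halfLine, Real.exp (-η * x) ≤ 1 := by
    filter_upwards [ae_restrict_mem measurableSet_Ioi] with x hx
    rw [Real.exp_le_one_iff]
    have : (0 : ℝ) < x := hx
    nlinarith
  have hbd : ∀ {M Mp : Matrix (Fin n) (Fin n) ℂ} {x : ℝ}, Real.exp (-η * x) ≤ 1 → sz Mp + C ≤ K₁ →
      ∀ i j, ‖M i j - Mp i j‖ ≤ C * Real.exp (-η * x) → ‖M i j‖ ≤ K₁ := by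
    intro M Mp x hx hMp i j h
    have h3 : ‖M i j‖ ≤ ‖M i j - Mp i j‖ + ‖Mp i j‖ := by
      simpa using norm_add_le (M i j - Mp i j) (Mp i j)
    have h4 := norm_apply_le_sum Mp i j
    have h5 : C * Real.exp (-η * x) ≤ C := mul_le_of_le_one_right hC.le hx
    simp only [hsz] at hMp
    linarith
  have hKP : sz Pp + C ≤ K₁ := by linarith [hsz0 Vp, hsz0 Qp]
  have hKV : sz Vp + C ≤ K₁ := by linarith [hsz0 Pp, hsz0 Qp]
  have hKQ : sz Qp + C ≤ K₁ := by linarith [hsz0 Vp, hsz0 Pp]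
  have hPpb : ∀ i j, ‖Pp i j‖ ≤ K₁ := fun i j => by
    have h4 : ‖Pp i j‖ ≤ sz Pp := norm_apply_le_sum Pp i j
    linarith
  have hVpb : ∀ i j, ‖Vp i j‖ ≤ K₁ := fun i j => by
    have h4 : ‖Vp i j‖ ≤ sz Vp := norm_apply_le_sum Vp i j
    linarith
  have hQpb : ∀ i j, ‖Qp i j‖ ≤ K₁ := fun i j => by
    have h4 : ‖Qp i j‖ ≤ sz Qp := norm_apply_le_sum Qp i j
    linarith
  refine ⟨K, min θR θQ, η, by linarith, lt_min hθR0 hθQ, hη, ⟨?_, ?_, ?_⟩, ?_, ?_, ?_, ?_, ?_, ?_, ?_⟩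
  · refine aestronglyMeasurable_matrix_inv (aestronglyMeasurable_matrix fun i j => ?_)
    exact ((h1.continuousOn_P i j).mono Set.Ioi_subset_Ici_self).aestronglyMeasurable measurableSet_Ioi
  · exact aestronglyMeasurable_matrix fun i j =>
      (h1.V_int i j).aestronglyMeasurable.mono_set Set.Ioi_subset_Ici_self
  · exact aestronglyMeasurable_matrix fun i j =>
      (h1.Q_int i j).aestronglyMeasurable.mono_set Set.Ioi_subset_Ici_self
  · filter_upwards [h1.hermitian] with x hx
    exact ⟨hx.1.inv, hx.2⟩
  · filter_upwards [h1.hermitian, hP, hQ, hd, hexp] with x hx hxP hxQ hxd hxe v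
    have h3 := lower_inv hθP hx.1 hxP hK₁0.le (fun i j => hbd hxe hKP i j (hxd i j).1) v
    have h4 := nsq_nonneg v
    exact ⟨(mul_le_mul_of_nonneg_right (min_le_left _ _) h4).trans h3,
      (mul_le_mul_of_nonneg_right (min_le_right _ _) h4).trans (hxQ v)⟩
  · filter_upwards [hP, hd, hexp] with x hxP hxd hxe i j
    exact ⟨(norm_inv_apply_le hθP hxP i j).trans hBK, (hbd hxe hKV i j (hxd i j).2.1).trans hK₁K,
      (hbd hxe hKQ i j (hxd i j).2.2.1).trans hK₁K⟩
  · filter_upwards [hP, hd] with x hxP hxd i j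
    have he := Real.exp_pos (-η * x)
    have hCK : C * Real.exp (-η * x) ≤ K * Real.exp (-η * x) := by gcongr; linarith
    refine ⟨?_, (hxd i j).2.1.trans hCK, (hxd i j).2.2.1.trans hCK⟩
    have h3 := norm_inv_sub_inv_apply_le (isUnit_det_of_lower hθP hxP) (isUnit_det_of_lower hθP hPp)
      hB0 (norm_inv_apply_le hθP hxP) (norm_inv_apply_le hθP hPp) i j
    refine h3.trans ?_
    calc B * B * ∑ k, ∑ l, ‖S.P x k l - Pp k l‖
        ≤ B * B * ∑ _k : Fin n, ∑ _l : Fin n, C * Real.exp (-η * x) := by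
          gcongr with k _ l _
          exact (hxd k l).1
      _ = B * B * (n * (n * C)) * Real.exp (-η * x) := by simp; ring
      _ ≤ _ := by gcongr; linarith
  · exact ⟨h2.P_posDef.isHermitian.inv, h2.V_hermitian, h2.Q_posDef.isHermitian⟩
  · intro v
    have h3 := lower_inv hθP h2.P_posDef.isHermitian hPp hK₁0.le hPpb v
    have h4 := nsq_nonneg v
    exact ⟨(mul_le_mul_of_nonneg_right (min_le_left _ _) h4).trans h3,
      (mul_le_mul_of_nonneg_right (min_le_right _ _) h4).trans (hQp v)⟩
  · exact fun i j => ⟨(norm_inv_apply_le hθP hPp i j).trans hBK, (hVpb i j).trans hK₁K,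
      (hQpb i j).trans hK₁K⟩

theorem HSys.Bounds.gapBound {T : HSys n} {Rp Vp Qp : Matrix (Fin n) (Fin n) ℂ} {K θ η lam : ℝ}
    (hT : T.Bounds Rp Vp Qp K θ η) (hlam : lam ≤ kappa Vp Qp) :
    GapBound Vp Qp ((kappa Vp Qp - lam) * θ) lam := by
  intro v
  rcases eq_or_ne v 0 with rfl | hv
  · simp [nsq]
  have hQ : ∀ {r : Fin n → ℂ}, r ≠ 0 → 0 < (star r ⬝ᵥ Qp.mulVec r).re := fun {r} hr =>
    (mul_pos hT.θ_pos (nsq_pos hr)).trans_le (hT.lower_end r).2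
  have hbdd : BddBelow (Set.range fun r : {r : Fin n → ℂ // r ≠ 0} =>
      (star r.1 ⬝ᵥ Vp.mulVec r.1).re / (star r.1 ⬝ᵥ Qp.mulVec r.1).re) := by
    refine ⟨-(n * n * K / θ), ?_⟩
    rintro _ ⟨⟨r, hr⟩, rfl⟩
    have h1 := norm_star_dotProduct_mulVec_self_le (fun i j => (hT.bound_end i j).2.1) r
    rw [Fintype.card_fin] at h1
    have h2 := neg_le_of_abs_le ((Complex.abs_re_le_norm _).trans h1)
    have h3 := (hT.lower_end r).2
    have hK := hT.K_pos
    have hθ := hT.θ_pos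
    simp only
    rw [le_div_iff₀ (hQ hr)]
    have h4 : n * n * K / θ * (θ * nsq r) ≤ n * n * K / θ * (star r ⬝ᵥ Qp.mulVec r).re := by gcongr
    have h5 : n * n * K / θ * (θ * nsq r) = n * n * K * nsq r := by field_simp
    linarith
  have h1 : kappa Vp Qp ≤ (star v ⬝ᵥ Vp.mulVec v).re / (star v ⬝ᵥ Qp.mulVec v).re :=
    ciInf_le hbdd ⟨v, hv⟩
  rw [le_div_iff₀ (hQ hv)] at h1
  have h2 := mul_le_mul_of_nonneg_left (hT.lower_end v).2 (sub_nonneg.2 hlam)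
  rw [Matrix.sub_mulVec, dotProduct_sub, Matrix.smul_mulVec, dotProduct_smul, Complex.sub_re,
    smul_eq_mul, Complex.re_ofReal_mul]
  linarith

theorem GapBound.mono {Vp Qp : Matrix (Fin n) (Fin n) ℂ} {c c' lam : ℝ} (h : GapBound Vp Qp c lam)
    (hc : c' ≤ c) : GapBound Vp Qp c' lam := fun v =>
  (mul_le_mul_of_nonneg_right hc (nsq_nonneg v)).trans (h v)

end Coefficients

section AbsoluteContinuity

/-- Absolute continuity from a bound of the increments. -/
theorem ACLoc.of_dist_le {X ι : Type*} [PseudoMetricSpace X] [Fintype ι] {Y : ι → Type*}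
    [∀ k, PseudoMetricSpace (Y k)] {f : ∀ k, ℝ → Y k} {g : ℝ → X} (hf : ∀ k, ACLoc (f k))
    (h : ∀ b, 0 < b → ∃ C, ∀ x ∈ Set.Icc 0 b, ∀ y ∈ Set.Icc 0 b,
      dist (g x) (g y) ≤ C * ∑ k, dist (f k x) (f k y)) : ACLoc g := by
  intro b hb
  obtain ⟨C, hC⟩ := h b hb
  have h1 : Tendsto (fun E : ℕ × (ℕ → ℝ × ℝ) => C * ∑ k, ∑ i ∈ Finset.range E.1,
      dist (f k (E.2 i).1) (f k (E.2 i).2)) (AbsolutelyContinuousOnInterval.totalLengthFilter ⊓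
      𝓟 (AbsolutelyContinuousOnInterval.disjWithin 0 b)) (𝓝 (C * ∑ _k : ι, 0)) :=
    (tendsto_finsetSum _ fun k _ => hf k b hb).const_mul C
  simp only [Finset.sum_const_zero, mul_zero] at h1
  refine squeeze_zero' (Eventually.of_forall fun E => Finset.sum_nonneg fun _ _ => dist_nonneg) ?_ h1
  have hmem : ∀ᶠ E in AbsolutelyContinuousOnInterval.totalLengthFilter ⊓
      𝓟 (AbsolutelyContinuousOnInterval.disjWithin 0 b),
      E ∈ AbsolutelyContinuousOnInterval.disjWithin 0 b :=
    (eventually_principal.2 fun _ hx => hx).filter_mono inf_le_right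
  filter_upwards [hmem] with E hE
  rw [Finset.sum_comm, Finset.mul_sum]
  refine Finset.sum_le_sum fun i hi => ?_
  have h2 := hE.1 i hi
  rw [Set.uIcc_of_le hb.le] at h2
  exact hC _ h2.1 _ h2.2

theorem ACLoc.pi {ι : Type*} [Fintype ι] {f : ℝ → ι → ℂ} (hf : ∀ i, ACLoc fun x => f x i) :
    ACLoc f :=
  ACLoc.of_dist_le hf fun b _ => ⟨1, fun x _ y _ => by
    rw [one_mul]
    refine (dist_pi_le_iff (Finset.sum_nonneg fun _ _ => dist_nonneg)).2 fun i => ?_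
    exact Finset.single_le_sum (f := fun i => dist (f x i) (f y i)) (fun _ _ => dist_nonneg)
      (Finset.mem_univ i)⟩

theorem ACLoc.apply {ι : Type*} [Fintype ι] {f : ℝ → ι → ℂ} (hf : ACLoc f) (i : ι) :
    ACLoc fun x => f x i :=
  ACLoc.of_dist_le (ι := Unit) (f := fun _ => f) (fun _ => hf) fun b _ =>
    ⟨1, fun x _ y _ => by simpa using dist_le_pi_dist (f x) (f y) i⟩

theorem ACLoc.sum {ι : Type*} [Fintype ι] {f : ι → ℝ → ℂ} (hf : ∀ i, ACLoc (f i)) :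
    ACLoc fun x => ∑ i, f i x :=
  ACLoc.of_dist_le hf fun b _ => ⟨1, fun x _ y _ => by
    rw [one_mul]
    exact dist_sum_sum_le _ _ _⟩

theorem ACLoc.mul {f g : ℝ → ℂ} (hf : ACLoc f) (hg : ACLoc g) : ACLoc fun x => f x * g x := by
  intro b hb
  have h1 : AbsolutelyContinuousOnInterval f 0 b := hf b hb
  have h2 : AbsolutelyContinuousOnInterval g 0 b := hg b hb
  have h3 := h1.smul h2
  exact h3

theorem ACLoc.mulVec {n : ℕ} {M : ℝ → Matrix (Fin n) (Fin n) ℂ} {f : ℝ → Fin n → ℂ}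
    (hM : ∀ i j, ACLoc fun x => M x i j) (hf : ACLoc f) : ACLoc fun x => (M x).mulVec (f x) := by
  refine ACLoc.pi (f := fun x => (M x).mulVec (f x)) fun i => ?_
  have h : ∀ j, ACLoc fun x => M x i j * f x j := fun j => by
    have h1 := hM i j
    have h2 : ACLoc fun x => f x j := hf.apply j
    exact h1.mul h2
  have h3 : ACLoc fun x => ∑ j, M x i j * f x j := ACLoc.sum h
  exact h3

theorem ACLoc.matrix_inv {n : ℕ} {M : ℝ → Matrix (Fin n) (Fin n) ℂ} {θ : ℝ}
    (hM : ∀ i j, ACLoc fun x => M x i j) (hθ : 0 < θ)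
    (h : ∀ x, 0 ≤ x → ∀ v, θ * nsq v ≤ (star v ⬝ᵥ (M x).mulVec v).re) (i j : Fin n) :
    ACLoc fun x => (M x)⁻¹ i j := by
  refine ACLoc.of_dist_le (ι := Fin n × Fin n) (f := fun k x => M x k.1 k.2) (fun k => hM _ _)
    fun b _ => ⟨n * n / θ * (n * n / θ), fun x hx y hy => ?_⟩
  rw [dist_eq_norm, Fintype.sum_prod_type]
  simp only [dist_eq_norm]
  exact norm_inv_sub_inv_apply_le (isUnit_det_of_lower hθ (h x hx.1))
    (isUnit_det_of_lower hθ (h y hy.1)) (by positivity) (norm_inv_apply_le hθ (h x hx.1))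
    (norm_inv_apply_le hθ (h y hy.1)) i j

end AbsoluteContinuity

section SquareIntegrable

variable {n : ℕ} {Rp Vp Qp : Matrix (Fin n) (Fin n) ℂ} {K θ η c lam : ℝ} {T : HSys n}

/-- A solution with square integrable first component decays. -/
theorem HSys.Bounds.mem_decaySpace_of_memLp (hT : T.Bounds Rp Vp Qp K θ η) (hc : 0 < c) (hg : GapBound Vp Qp c lam)
    {w : Fin n ⊕ Fin n → ℂ}
    (h : ∀ i, MemLp (fun x => T.Φ lam x w (Sum.inl i)) 2 halfLine) : w ∈ decaySpace (T.Φ lam) := by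
  by_contra hw
  obtain ⟨m⟩ := hT.nonempty_modes hc hg
  obtain ⟨mu, v, hmu, hv, hev, ht⟩ := m.exists_leading_pos hw
  have hv1 := endCoef_eigenvector_inl_ne_zero hT hv hev
  obtain ⟨i, hi⟩ := Function.ne_iff.1 hv1
  have hi' : 0 < ‖v (Sum.inl i)‖ := norm_pos_iff.2 hi
  have h1 := (tendsto_pi_nhds.1 ht (Sum.inl i)).norm
  have h2 : ∀ᶠ x in atTop, ‖v (Sum.inl i)‖ / 2 ≤ ‖T.Φ lam x w (Sum.inl i)‖ := by
    filter_upwards [h1.eventually (le_mem_nhds (half_lt_self hi')), eventually_ge_atTop 0]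
      with x hx hx0
    refine hx.trans ?_
    rw [Pi.smul_apply, norm_smul, Complex.norm_real, Real.norm_eq_abs, Real.abs_exp]
    refine mul_le_of_le_one_left (norm_nonneg _) (Real.exp_le_one_iff.2 ?_)
    nlinarith
  obtain ⟨X, hX⟩ := eventually_atTop.1 h2
  obtain ⟨ε, hε⟩ : ∃ ε : NNReal, (ε : ℝ) = ‖v (Sum.inl i)‖ / 2 := ⟨⟨_, (half_pos hi').le⟩, rfl⟩
  have hε0 : ε ≠ 0 := by
    rw [← NNReal.coe_ne_zero, hε]
    exact (half_pos hi').ne'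
  have h3 := (h i).meas_ge_lt_top two_ne_zero ENNReal.ofNat_ne_top hε0
  refine h3.not_ge ?_
  have h4 : Set.Ioi (max X 0) ⊆ {x | ε ≤ ‖T.Φ lam x w (Sum.inl i)‖₊} := fun x hx => by
    have := hX x ((le_max_left X 0).trans (le_of_lt hx))
    rw [← hε] at this
    exact this
  refine le_trans ?_ (measure_mono h4)
  rw [Measure.restrict_apply measurableSet_Ioi,
    Set.inter_eq_self_of_subset_left (Set.Ioi_subset_Ioi (le_max_right X 0)), Real.volume_Ioi]

theorem HSys.Bounds.memLp_of_mem_decaySpace (hT : T.Bounds Rp Vp Qp K θ η) (hc : 0 < c) (hg : GapBound Vp Qp c lam)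
    {w : Fin n ⊕ Fin n → ℂ} (hw : w ∈ decaySpace (T.Φ lam)) (i : Fin n ⊕ Fin n) :
    MemLp (fun x => T.Φ lam x w i) 2 halfLine := by
  obtain ⟨m⟩ := hT.nonempty_modes hc hg
  have hcont := ((hT.Φ_spec lam).2.2 w).cont
  obtain ⟨C, δ, hδ, hC0, hC⟩ := m.exists_exp_decay hcont hw
  have h1 : MemLp (fun x => C * Real.exp (-δ * x)) 2 halfLine := by
    rw [memLp_two_iff_integrable_sq (by fun_prop)]
    have h2 : Integrable (fun x => C ^ 2 * Real.exp ((-(2 * δ)) * x)) halfLine :=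
      (integrableOn_exp_mul_Ioi (by linarith : -(2 * δ) < 0) 0).const_mul _
    refine h2.congr (Eventually.of_forall fun x => ?_)
    simp only
    rw [mul_pow, ← Real.exp_nat_mul]
    congr 2
    push_cast
    ring
  refine h1.of_le ((continuous_apply i).comp hcont).aestronglyMeasurable ?_
  filter_upwards [ae_restrict_mem measurableSet_Ioi] with x hx
  have h3 := (norm_le_pi_norm (T.Φ lam x w) i).trans (hC x (le_of_lt hx))
  exact h3.trans (Real.le_norm_self _)

end SquareIntegrable

section Solutions

variable {n : ℕ} {S : SturmLiouville n} {Rp Vp Qp : Matrix (Fin n) (Fin n) ℂ} {K θ η c lam : ℝ}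

theorem J_mulVec_eq_hamiltonian_iff (x : ℝ) (y y' : Fin n ⊕ Fin n → ℂ) :
    (Matrix.J (Fin n) ℂ).mulVec y' = (S.hamiltonian x lam).mulVec y ↔
      y' = S.toHSys.coef lam x y := by
  have hJJ : Matrix.J (Fin n) ℂ * Matrix.J (Fin n) ℂ = -1 := Matrix.J_squared _ _
  have e : Matrix.J (Fin n) ℂ * blockCoef ((S.P x)⁻¹) (S.V x - (lam : ℂ) • S.Q x) =
      S.hamiltonian x lam := by
    simp [Matrix.J, blockCoef, SturmLiouville.hamiltonian, Matrix.fromBlocks_multiply]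
  have e2 : S.toHSys.coef lam x y =
      (blockCoef ((S.P x)⁻¹) (S.V x - (lam : ℂ) • S.Q x)).mulVec y := rfl
  rw [← e, e2, ← Matrix.mulVec_mulVec]
  constructor
  · intro h
    have := congrArg (Matrix.J (Fin n) ℂ).mulVec h
    rw [Matrix.mulVec_mulVec, Matrix.mulVec_mulVec, hJJ, Matrix.neg_mulVec, Matrix.neg_mulVec,
      Matrix.one_mulVec, Matrix.one_mulVec] at this
    exact neg_injective this
  · rintro rfl
    rfl

theorem mem_solutions_iff {y : ℝ → Fin n ⊕ Fin n → ℂ} : y ∈ S.solutions lam ↔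
    ACLoc y ∧ ∀ᵐ x ∂halfLine, HasDerivAt y (S.toHSys.coef lam x (y x)) x := by
  refine and_congr_right fun _ => eventually_congr (Eventually.of_forall fun x => ?_)
  constructor
  · rintro ⟨y', hy, h⟩
    rwa [(J_mulVec_eq_hamiltonian_iff x _ _).1 h] at hy
  · exact fun h => ⟨_, h, (J_mulVec_eq_hamiltonian_iff x _ _).2 rfl⟩

variable (hT : S.toHSys.Bounds Rp Vp Qp K θ η)
include hT

theorem SturmLiouville.eq_Φ_of_mem_solutions {y : ℝ → Fin n ⊕ Fin n → ℂ} (hy : y ∈ S.solutions lam)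
    {x : ℝ} (hx : 0 ≤ x) : y x = S.toHSys.Φ lam x (y 0) := by
  obtain ⟨h1, h2⟩ := mem_solutions_iff.1 hy
  have h3 := hT.eq_Φ (h1.isIntSol (hT.bddCoef lam) h2) hx
  simpa [hx] using h3

theorem SturmLiouville.Φ_mem_solutions (lam : ℝ) (w : Fin n ⊕ Fin n → ℂ) :
    (fun x => S.toHSys.Φ lam x w) ∈ S.solutions lam := by
  have h := (hT.Φ_spec lam).2.2 w
  exact mem_solutions_iff.2 ⟨h.acLoc (hT.bddCoef lam), h.ae_hasDerivAt (hT.bddCoef lam)⟩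

theorem SturmLiouville.ell₁_eq {x : ℝ} (hx : 0 ≤ x) (lam : ℝ) : S.ell₁ x lam =
    (LinearMap.range (Matrix.J (Fin n) ℂ * S.α.conjTranspose).mulVecLin).map
      (S.toHSys.Φ lam x : (Fin n ⊕ Fin n → ℂ) →ₗ[ℂ] (Fin n ⊕ Fin n → ℂ)) := by
  refine le_antisymm ?_ ?_
  · rintro _ ⟨y, ⟨hy, hy0⟩, rfl⟩
    exact ⟨y 0, hy0, (S.eq_Φ_of_mem_solutions hT hy hx).symm⟩
  · rintro _ ⟨w, hw, rfl⟩
    refine ⟨fun x => S.toHSys.Φ lam x w, ⟨S.Φ_mem_solutions hT lam w, ?_⟩, rfl⟩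
    change S.toHSys.Φ lam 0 w ∈
      LinearMap.range (Matrix.J (Fin n) ℂ * S.α.conjTranspose).mulVecLin
    rw [(hT.Φ_spec lam).2.1]
    exact hw

theorem SturmLiouville.ell₁_zero (lam : ℝ) : S.ell₁ 0 lam =
    LinearMap.range (Matrix.J (Fin n) ℂ * S.α.conjTranspose).mulVecLin := by
  rw [S.ell₁_eq hT le_rfl, (hT.Φ_spec lam).2.1]
  exact Submodule.map_id _

theorem SturmLiouville.ell₂_eq (hc : 0 < c) (hg : GapBound Vp Qp c lam) {x : ℝ} (hx : 0 ≤ x) :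
    S.ell₂ x lam = S.toHSys.decayFamily Rp Vp Qp (ENNReal.ofReal x) lam := by
  rw [hT.decayFamily_eq_map lam ENNReal.ofReal_ne_top, ENNReal.toReal_ofReal hx]
  refine le_antisymm ?_ ?_
  · rintro _ ⟨y, ⟨hy, hy2⟩, rfl⟩
    refine ⟨y 0, ?_, (S.eq_Φ_of_mem_solutions hT hy hx).symm⟩
    refine hT.mem_decaySpace_of_memLp hc hg fun i => (hy2 (Sum.inl i)).ae_eq ?_
    filter_upwards [ae_restrict_mem measurableSet_Ioi] with s hs
    rw [S.eq_Φ_of_mem_solutions hT hy (le_of_lt hs)]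
  · rintro _ ⟨w, hw, rfl⟩
    exact ⟨fun x => S.toHSys.Φ lam x w, ⟨S.Φ_mem_solutions hT lam w,
      hT.memLp_of_mem_decaySpace hc hg hw⟩, rfl⟩

end Solutions

section LagrangianLimits

variable {n : ℕ}

theorem IsLagrangianLimit.unique {L : ℝ → Submodule ℂ (Fin n ⊕ Fin n → ℂ)}
    {M M' : Submodule ℂ (Fin n ⊕ Fin n → ℂ)} (h : IsLagrangianLimit L M)
    (h' : IsLagrangianLimit L M') : M = M' :=
  projMatrix_injective h.1.1 h'.1.1 (tendsto_nhds_unique h.2 h'.2)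

theorem IsLagrangianLimit.eq {L : ℝ → Submodule ℂ (Fin n ⊕ Fin n → ℂ)}
    {M : Submodule ℂ (Fin n ⊕ Fin n → ℂ)} (h : IsLagrangianLimit L M) : lagrangianLimit L = M := by
  have h' : ∃ M, IsLagrangianLimit L M := ⟨M, h⟩
  rw [lagrangianLimit, dif_pos h']
  exact h'.choose_spec.unique h

theorem IsLagrangian.compactifiedPath_const {M : Submodule ℂ (Fin n ⊕ Fin n → ℂ)}
    (h : IsLagrangian M) : compactifiedPath (fun _ => M) = fun _ => M := by
  have : IsLagrangianLimit (fun _ => M) M := ⟨h, tendsto_const_nhds⟩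
  funext p
  rw [compactifiedPath, this.eq, ite_self]

variable {S : SturmLiouville n} {Rp Vp Qp : Matrix (Fin n) (Fin n) ℂ} {K θ η c lam : ℝ}

theorem SturmLiouville.ell₂plus_eq (hT : S.toHSys.Bounds Rp Vp Qp K θ η) (hc : 0 < c)
    (hg : GapBound Vp Qp c lam) : S.ell₂plus lam = S.toHSys.decayFamily Rp Vp Qp ⊤ lam := by
  refine IsLagrangianLimit.eq ⟨hT.isLagrangian_decayFamily hc hg ⊤, ?_⟩
  have h1 : Tendsto (fun x : ℝ => (ENNReal.ofReal x, lam)) atTop (𝓝 (⊤, lam)) :=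
    ENNReal.tendsto_ofReal_atTop.prodMk_nhds tendsto_const_nhds
  have h2 := hT.tendsto_projMatrix_decayFamily (q₀ := (⊤, lam))
    (l := map (fun x : ℝ => (ENNReal.ofReal x, lam)) atTop) h1 hc
    (eventually_map.2 (Eventually.of_forall fun _ => hg)) hg
  rw [tendsto_map'_iff] at h2
  refine h2.congr' ((eventually_ge_atTop 0).mono fun x hx => ?_)
  simp only [Function.comp_apply]
  rw [S.ell₂_eq hT hc hg hx]

theorem SturmLiouville.SelfAdjointBoundary.isLagrangian (h : S.SelfAdjointBoundary) :
    IsLagrangian (LinearMap.range (Matrix.J (Fin n) ℂ * S.α.conjTranspose).mulVecLin) := by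
  have hJJ : Matrix.J (Fin n) ℂ * Matrix.J (Fin n) ℂ = -1 := Matrix.J_squared _ _
  have hJt : (Matrix.J (Fin n) ℂ).conjTranspose = -Matrix.J (Fin n) ℂ := by
    simp [Matrix.J, Matrix.fromBlocks_conjTranspose, Matrix.fromBlocks_neg]
  refine ⟨?_, ?_⟩
  · have h1 : (Matrix.J (Fin n) ℂ * S.α.conjTranspose).rank = n := by
      rw [Matrix.rank_mul_eq_right_of_isUnit_det]
      · rw [Matrix.rank_conjTranspose, h.rank_eq]
      · exact Matrix.isUnit_det_J _ _
    exact h1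
  · rintro _ ⟨a, rfl⟩ _ ⟨b, rfl⟩
    simp only [Matrix.mulVecLin_apply]
    have e : (Matrix.J (Fin n) ℂ * S.α.conjTranspose).conjTranspose * Matrix.J (Fin n) ℂ *
        (Matrix.J (Fin n) ℂ * S.α.conjTranspose) = 0 := by
      rw [Matrix.conjTranspose_mul, Matrix.conjTranspose_conjTranspose, hJt]
      calc S.α * -Matrix.J (Fin n) ℂ * Matrix.J (Fin n) ℂ * (Matrix.J (Fin n) ℂ * S.α.conjTranspose)
          = -(S.α * (Matrix.J (Fin n) ℂ * Matrix.J (Fin n) ℂ) * (Matrix.J (Fin n) ℂ *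
            S.α.conjTranspose)) := by simp only [Matrix.mul_neg, Matrix.neg_mul, Matrix.mul_assoc]
        _ = S.α * Matrix.J (Fin n) ℂ * S.α.conjTranspose := by
          rw [hJJ]; simp only [Matrix.mul_neg, Matrix.neg_mul, Matrix.mul_one, neg_neg, Matrix.mul_assoc]
        _ = 0 := h.isotropic
    rw [Matrix.star_mulVec, ← Matrix.dotProduct_mulVec, Matrix.mulVec_mulVec, Matrix.mulVec_mulVec,
      e, Matrix.zero_mulVec, dotProduct_zero]

theorem SturmLiouville.SelfAdjointBoundary.mem_range_iff (h : S.SelfAdjointBoundary)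
    (v : Fin n ⊕ Fin n → ℂ) :
    v ∈ LinearMap.range (Matrix.J (Fin n) ℂ * S.α.conjTranspose).mulVecLin ↔ S.α.mulVec v = 0 := by
  have hle : LinearMap.range (Matrix.J (Fin n) ℂ * S.α.conjTranspose).mulVecLin ≤
      LinearMap.ker S.α.mulVecLin := by
    rintro _ ⟨a, rfl⟩
    rw [LinearMap.mem_ker, Matrix.mulVecLin_apply, Matrix.mulVecLin_apply, Matrix.mulVec_mulVec,
      ← Matrix.mul_assoc, h.isotropic, Matrix.zero_mulVec]
  have hdim : Module.finrank ℂ (LinearMap.ker S.α.mulVecLin) = n := by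
    have h1 := LinearMap.finrank_range_add_finrank_ker S.α.mulVecLin
    have h2 : Module.finrank ℂ (LinearMap.range S.α.mulVecLin) = n := h.rank_eq
    rw [h2, Module.finrank_fintype_fun_eq_card, Fintype.card_sum, Fintype.card_fin] at h1
    omega
  rw [Submodule.eq_of_le_of_finrank_eq hle (by rw [h.isLagrangian.1, hdim])]
  rfl

end LagrangianLimits

section Eigenspaces

variable {n : ℕ} {S : SturmLiouville n} {Rp Vp Qp : Matrix (Fin n) (Fin n) ℂ} {K θ η c lam : ℝ}

theorem SturmLiouville.mem_eigenspace_iff (φ : HalfLineL2 n) : φ ∈ S.eigenspace lam ↔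
    ∃ f f' w : ℝ → Fin n → ℂ, (∀ᵐ x ∂halfLine, (φ x).ofLp = f x) ∧ ACLoc f ∧ ACLoc f' ∧
    (∀ x ∈ Set.Ici (0 : ℝ), HasDerivWithinAt f (f' x) (Set.Ici 0) x) ∧
    (∀ᵐ x ∂halfLine, HasDerivAt (fun s => (S.P s).mulVec (f' s)) (w x) x) ∧
    (∀ᵐ x ∂halfLine, (lam : ℂ) • f x = (S.Q x)⁻¹.mulVec (-w x + (S.V x).mulVec (f x))) ∧
    S.α₁.mulVec (f 0) + S.α₂.mulVec ((S.P 0).mulVec (f' 0)) = 0 := by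
  have key : ∀ f w : ℝ → Fin n → ℂ, (∀ᵐ x ∂halfLine, (φ x).ofLp = f x) →
      ((∀ᵐ x ∂halfLine, (((lam : ℂ) • φ : HalfLineL2 n) x).ofLp =
        (S.Q x)⁻¹.mulVec (-w x + (S.V x).mulVec (f x))) ↔
      ∀ᵐ x ∂halfLine, (lam : ℂ) • f x = (S.Q x)⁻¹.mulVec (-w x + (S.V x).mulVec (f x))) := by
    intro f w hf
    refine eventually_congr ?_
    filter_upwards [hf, Lp.coeFn_smul (lam : ℂ) φ] with x hx hx'
    rw [hx', Pi.smul_apply, WithLp.ofLp_smul, hx]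
  constructor
  · rintro ⟨f, f', w, h1, h2, h3, h4, h5, h6, h7⟩
    exact ⟨f, f', w, h1, h2, h3, h4, h5, (key f w h1).1 h6, h7⟩
  · rintro ⟨f, f', w, h1, h2, h3, h4, h5, h6, h7⟩
    exact ⟨f, f', w, h1, h2, h3, h4, h5, (key f w h1).2 h6, h7⟩

theorem SturmLiouville.coef_apply (x : ℝ) (u v : Fin n → ℂ) : S.toHSys.coef lam x (Sum.elim u v) =
    Sum.elim ((S.P x)⁻¹.mulVec v) ((S.V x - (lam : ℂ) • S.Q x).mulVec u) := by
  change (blockCoef ((S.P x)⁻¹) (S.V x - (lam : ℂ) • S.Q x)).mulVec (Sum.elim u v) = _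
  rw [blockCoef, Matrix.fromBlocks_mulVec]
  simp

theorem SturmLiouville.α_mulVec (u v : Fin n → ℂ) :
    S.α.mulVec (Sum.elim u v) = S.α₁.mulVec u + S.α₂.mulVec v := by
  rw [SturmLiouville.α, Matrix.fromCols_mulVec]
  simp

theorem SturmLiouville.RegularCoefficients.ae_isUnit_Q (h : S.RegularCoefficients) :
    ∀ᵐ x ∂halfLine, IsUnit (S.Q x).det := by
  obtain ⟨θ, hθ, hQ⟩ := h.Q_lower
  simp only [← nsq_eq_re] at hQ
  exact hQ.mono fun x hx => isUnit_det_of_lower hθ hx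

/-- Boundary solutions with square integrable first component are eigenfunctions. -/
theorem SturmLiouville.mem_eigenspace_of_solution (h : S.RegularCoefficients)
    (hA : S.SelfAdjointBoundary) (hT : S.toHSys.Bounds Rp Vp Qp K θ η) {w : Fin n ⊕ Fin n → ℂ}
    (hw : w ∈ LinearMap.range (Matrix.J (Fin n) ℂ * S.α.conjTranspose).mulVecLin) {φ : HalfLineL2 n}
    (hφ : ∀ᵐ x ∂halfLine, (φ x).ofLp = S.toHSys.Φ lam x w ∘ Sum.inl) : φ ∈ S.eigenspace lam := by
  obtain ⟨θP, hθP, hP⟩ := h.exists_P_lower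
  have hPu : ∀ x, 0 ≤ x → IsUnit (S.P x).det := fun x hx => isUnit_det_of_lower hθP (hP x hx)
  have hsol := (hT.Φ_spec lam).2.2 w
  set y : ℝ → Fin n ⊕ Fin n → ℂ := fun x => S.toHSys.Φ lam x w with hy
  have hy0 : y 0 = w := by simp only [hy, (hT.Φ_spec lam).2.1]; rfl
  have hyc : Continuous y := hsol.cont
  have hyac : ACLoc y := hsol.acLoc (hT.bddCoef lam)
  have hyd := hsol.ae_hasDerivAt (hT.bddCoef lam)
  have hac : ∀ i, ACLoc fun x => y x i := fun i => hyac.apply i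
  have hsplit : ∀ x, y x = Sum.elim (y x ∘ Sum.inl) (y x ∘ Sum.inr) := fun x =>
    (Sum.elim_comp_inl_inr (y x)).symm
  have hRac : ∀ i j, ACLoc fun x => (S.P x)⁻¹ i j := fun i j => ACLoc.matrix_inv h.P_ac hθP hP i j
  set f' : ℝ → Fin n → ℂ := fun x => (S.P x)⁻¹.mulVec (y x ∘ Sum.inr) with hf'
  have hf'ac : ACLoc f' := ACLoc.mulVec hRac (ACLoc.pi fun i => hac (Sum.inr i))
  have hf'c : Continuous fun x => f' (max x 0) :=
    hf'ac.continuousOn.comp_continuous (by fun_prop) fun x => le_max_right x 0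
  have hinl : Continuous fun v : Fin n ⊕ Fin n → ℂ => v ∘ (Sum.inl : Fin n → Fin n ⊕ Fin n) :=
    continuous_pi fun i => continuous_apply (Sum.inl i)
  have hfeq : ∀ x, 0 ≤ x → y x ∘ (Sum.inl : Fin n → Fin n ⊕ Fin n) =
      y 0 ∘ Sum.inl + ∫ s in (0)..x, f' (max s 0) := by
    intro x hx
    rcases hx.eq_or_lt with rfl | hx'
    · simp
    obtain ⟨C, hC0, hC⟩ := exists_norm_le_on_Icc hf'c 0 x
    have h1 := AbsolutelyContinuousOnInterval.sub_eq_integral (f := fun x => y x ∘ Sum.inl)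
      (h := fun s => f' (max s 0)) (C := C) hx (ACLoc.pi (fun i => hac (Sum.inl i)) x hx')
      (hf'c.intervalIntegrable _ _) (Eventually.of_forall fun s hs => hC s (by
        rw [Set.uIoc_of_le hx] at hs
        exact ⟨hs.1.le, hs.2⟩)) (by
        rw [ae_restrict_iff' measurableSet_Ioi] at hyd
        filter_upwards [hyd] with s hs hs'
        have h2 := hs hs'.1
        rw [hsplit s, S.coef_apply] at h2
        rw [max_eq_left (le_of_lt hs'.1)]
        exact hasDerivAt_pi.2 fun i => hasDerivAt_pi.1 h2 (Sum.inl i))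
    rw [← h1]
    abel
  rw [S.mem_eigenspace_iff]
  refine ⟨fun x => y x ∘ Sum.inl, f', fun x => (S.V x - (lam : ℂ) • S.Q x).mulVec (y x ∘ Sum.inl), hφ,
    ACLoc.pi fun i => hac (Sum.inl i), hf'ac, ?_, ?_, ?_, ?_⟩
  · intro x hx
    have h1 : HasDerivAt (fun x => y 0 ∘ (Sum.inl : Fin n → Fin n ⊕ Fin n) +
        ∫ s in (0)..x, f' (max s 0)) (f' (max x 0)) x :=
      (intervalIntegral.integral_hasDerivAt_right (hf'c.intervalIntegrable _ _)
        hf'c.aestronglyMeasurable.stronglyMeasurableAtFilter hf'c.continuousAt).const_add _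
    rw [max_eq_left hx] at h1
    exact h1.hasDerivWithinAt.congr (fun s hs => hfeq s hs) (hfeq x hx)
  · filter_upwards [hyd, ae_restrict_mem measurableSet_Ioi] with x hx hx0
    have h2 := hx
    rw [hsplit x, S.coef_apply] at h2
    have h3 : HasDerivAt (fun s => y s ∘ (Sum.inr : Fin n → Fin n ⊕ Fin n))
        ((S.V x - (lam : ℂ) • S.Q x).mulVec (y x ∘ Sum.inl)) x :=
      hasDerivAt_pi.2 fun i => hasDerivAt_pi.1 h2 (Sum.inr i)
    refine h3.congr_of_eventuallyEq ?_
    filter_upwards [Ioi_mem_nhds hx0] with s hs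
    simp only [hf']
    rw [Matrix.mulVec_mulVec, Matrix.mul_nonsing_inv _ (hPu s (le_of_lt hs)), Matrix.one_mulVec]
  · filter_upwards [h.ae_isUnit_Q] with x hx
    have : -(S.V x - (lam : ℂ) • S.Q x).mulVec (y x ∘ Sum.inl) + (S.V x).mulVec (y x ∘ Sum.inl) =
        (S.Q x).mulVec ((lam : ℂ) • (y x ∘ Sum.inl)) := by
      rw [Matrix.sub_mulVec, Matrix.smul_mulVec, Matrix.mulVec_smul]
      abel
    rw [this, Matrix.mulVec_mulVec, Matrix.nonsing_inv_mul _ hx, Matrix.one_mulVec]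
  · have h1 := (hA.mem_range_iff w).1 hw
    rw [← hy0, hsplit 0, S.α_mulVec] at h1
    simp only [hf']
    rw [Matrix.mulVec_mulVec _ (S.P 0), Matrix.mul_nonsing_inv _ (hPu 0 le_rfl), Matrix.one_mulVec]
    exact h1

/-- Eigenfunctions are first components of decaying boundary solutions. -/
theorem SturmLiouville.exists_solution_of_mem_eigenspace (h : S.RegularCoefficients)
    (hA : S.SelfAdjointBoundary) (hT : S.toHSys.Bounds Rp Vp Qp K θ η) (hc : 0 < c)
    (hg : GapBound Vp Qp c lam) {φ : HalfLineL2 n} (hφ : φ ∈ S.eigenspace lam) :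
    ∃ w ∈ LinearMap.range (Matrix.J (Fin n) ℂ * S.α.conjTranspose).mulVecLin ⊓
      decaySpace (S.toHSys.Φ lam), ∀ᵐ x ∂halfLine, (φ x).ofLp = S.toHSys.Φ lam x w ∘ Sum.inl := by
  obtain ⟨θP, hθP, hP⟩ := h.exists_P_lower
  have hPu : ∀ x, 0 ≤ x → IsUnit (S.P x).det := fun x hx => isUnit_det_of_lower hθP (hP x hx)
  obtain ⟨f, f', w, h1, h2, h3, h4, h5, h6, h7⟩ := (S.mem_eigenspace_iff φ).1 hφ
  set y : ℝ → Fin n ⊕ Fin n → ℂ := fun x => Sum.elim (f x) ((S.P x).mulVec (f' x)) with hy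
  have hPf : ACLoc fun x => (S.P x).mulVec (f' x) := ACLoc.mulVec h.P_ac h3
  have hyac : ACLoc y := by
    refine ACLoc.pi fun i => ?_
    rcases i with i | i
    · exact h2.apply i
    · exact hPf.apply i
  have hysol : y ∈ S.solutions lam := by
    refine mem_solutions_iff.2 ⟨hyac, ?_⟩
    filter_upwards [h5, h6, h.ae_isUnit_Q, ae_restrict_mem measurableSet_Ioi] with x hx5 hx6 hxQ hx0
    have hx0' : (0 : ℝ) ≤ x := le_of_lt hx0
    have e1 : w x = (S.V x - (lam : ℂ) • S.Q x).mulVec (f x) := by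
      have := congrArg (S.Q x).mulVec hx6
      rw [Matrix.mulVec_mulVec, Matrix.mul_nonsing_inv _ hxQ, Matrix.one_mulVec,
        Matrix.mulVec_smul] at this
      rw [Matrix.sub_mulVec, Matrix.smul_mulVec, this]
      abel
    have e2 : f' x = (S.P x)⁻¹.mulVec ((S.P x).mulVec (f' x)) := by
      rw [Matrix.mulVec_mulVec, Matrix.nonsing_inv_mul _ (hPu x hx0'), Matrix.one_mulVec]
    have e3 : HasDerivAt f (f' x) x := (h4 x hx0').hasDerivAt (Ici_mem_nhds hx0)
    have e4 : S.toHSys.coef lam x (y x) = Sum.elim (f' x) (w x) := by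
      rw [hy, S.coef_apply, ← e1, ← e2]
    rw [e4]
    refine hasDerivAt_pi.2 fun i => ?_
    rcases i with i | i
    · exact hasDerivAt_pi.1 e3 i
    · exact hasDerivAt_pi.1 hx5 i
  have hyΦ := fun {x : ℝ} (hx : 0 ≤ x) => S.eq_Φ_of_mem_solutions hT hysol hx
  have hae : ∀ᵐ x ∂halfLine, (φ x).ofLp = S.toHSys.Φ lam x (y 0) ∘ Sum.inl := by
    filter_upwards [h1, ae_restrict_mem measurableSet_Ioi] with x hx hx0
    rw [hx, ← hyΦ (le_of_lt hx0)]
    rfl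
  refine ⟨y 0, ⟨?_, ?_⟩, hae⟩
  · rw [SetLike.mem_coe, hA.mem_range_iff, hy, S.α_mulVec]
    exact h7
  · refine hT.mem_decaySpace_of_memLp hc hg fun i => ?_
    have h8 : MemLp (fun x => φ x i) 2 halfLine := (memLp_piLp_iff).1 (Lp.memLp φ) i
    refine h8.ae_eq (hae.mono fun x hx => ?_)
    exact congrFun hx i

/-- The multiplicity of an eigenvalue is the dimension of an intersection of Lagrangian
subspaces. -/
theorem SturmLiouville.rank_eigenspace (h : S.RegularCoefficients)
    (hA : S.SelfAdjointBoundary) (hT : S.toHSys.Bounds Rp Vp Qp K θ η) (hc : 0 < c)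
    (hg : GapBound Vp Qp c lam) : Module.rank ℂ (S.eigenspace lam) =
      Module.finrank ℂ (LinearMap.range (Matrix.J (Fin n) ℂ * S.α.conjTranspose).mulVecLin ⊓
        decaySpace (S.toHSys.Φ lam) : Submodule ℂ _) := by
  set C := LinearMap.range (Matrix.J (Fin n) ℂ * S.α.conjTranspose).mulVecLin with hC
  set D := C ⊓ decaySpace (S.toHSys.Φ lam) with hD
  have hmem : ∀ w : D, MemLp (fun x => (WithLp.toLp 2 (S.toHSys.Φ lam x w ∘ Sum.inl) :
      EuclideanSpace ℂ (Fin n))) 2 halfLine := fun w => by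
    rw [memLp_piLp_iff]
    exact fun i => hT.memLp_of_mem_decaySpace hc hg w.2.2 (Sum.inl i)
  have hae : ∀ w : D, ∀ᵐ x ∂halfLine, ((hmem w).toLp _ x).ofLp = S.toHSys.Φ lam x w ∘ Sum.inl :=
    fun w => (hmem w).coeFn_toLp.mono fun x hx => by rw [hx]
  let G : D →ₗ[ℂ] S.eigenspace lam :=
    { toFun := fun w => ⟨(hmem w).toLp _, S.mem_eigenspace_of_solution h hA hT w.2.1 (hae w)⟩
      map_add' := fun v w => by
        refine Subtype.ext (Lp.ext ?_)
        filter_upwards [(hmem (v + w)).coeFn_toLp, (hmem v).coeFn_toLp, (hmem w).coeFn_toLp,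
          Lp.coeFn_add ((hmem v).toLp _) ((hmem w).toLp _)] with x h1 h2 h3 h4
        refine h1.trans (Eq.trans ?_ h4.symm)
        rw [Pi.add_apply, h2, h3, Submodule.coe_add, map_add]
        rfl
      map_smul' := fun r w => by
        refine Subtype.ext (Lp.ext ?_)
        filter_upwards [(hmem (r • w)).coeFn_toLp, (hmem w).coeFn_toLp,
          Lp.coeFn_smul r ((hmem w).toLp _)] with x h1 h2 h4
        refine h1.trans (Eq.trans ?_ h4.symm)
        rw [Pi.smul_apply, h2, Submodule.coe_smul, map_smul]
        rfl }
  have hinj : Function.Injective G := by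
    refine (injective_iff_map_eq_zero G).2 fun w hw => ?_
    by_contra hw0
    have hw0' : (w : Fin n ⊕ Fin n → ℂ) ≠ 0 := fun h => hw0 (Subtype.ext h)
    have h1 : (hmem w).toLp _ = 0 := congrArg Subtype.val hw
    have h2 := hae w
    rw [h1] at h2
    have h3 : ∀ᵐ x ∂halfLine, S.toHSys.Φ lam x w ∘ (Sum.inl : Fin n → Fin n ⊕ Fin n) = 0 := by
      filter_upwards [h2, Lp.coeFn_zero (EuclideanSpace ℂ (Fin n)) 2 halfLine] with x hx hx'
      rw [← hx, hx']
      rfl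
    obtain ⟨x, hx, hx'⟩ := ((frequently_of_ae_halfLine h3).and_eventually
      (hT.eventually_inl_ne_zero hc hg hw0')).exists
    exact hx' hx
  have hsurj : Function.Surjective G := by
    rintro ⟨φ, hφ⟩
    obtain ⟨w, hw, hwφ⟩ := S.exists_solution_of_mem_eigenspace h hA hT hc hg hφ
    refine ⟨⟨w, hw⟩, Subtype.ext (Lp.ext ?_)⟩
    filter_upwards [hae ⟨w, hw⟩, hwφ] with x hx hx'
    exact WithLp.ofLp_injective 2 (hx.trans hx'.symm)
  rw [← (LinearEquiv.ofBijective G ⟨hinj, hsurj⟩).rank_eq, Module.finrank_eq_rank]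

end Eigenspaces

section Lifting

/-- Unimodular functions on `[0, ∞] × [a, b]` have continuous logarithms. -/
theorem exists_continuousOn_arg {a b : ℝ} (hab : a ≤ b) {u : ENNReal × ℝ → ℂ}
    (hu : ContinuousOn u (Set.univ ×ˢ Set.Icc a b))
    (hn : ∀ q ∈ (Set.univ ×ˢ Set.Icc a b : Set (ENNReal × ℝ)), ‖u q‖ = 1) :
    ∃ α : ENNReal × ℝ → ℝ, ContinuousOn α (Set.univ ×ˢ Set.Icc a b) ∧
      ∀ q ∈ (Set.univ ×ˢ Set.Icc a b : Set (ENNReal × ℝ)), Complex.exp (α q * Complex.I) = u q := by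
  set e := ENNReal.orderIsoUnitIntervalBirational with he
  have h01 : (0 : ℝ) ≤ 1 := zero_le_one
  set π : ℝ × ℝ → ENNReal × ℝ := fun r =>
    (e.symm (Set.projIcc 0 1 h01 r.1), (Set.projIcc a b hab r.2 : ℝ)) with hπ
  have hπc : Continuous π :=
    (e.symm.toHomeomorph.continuous.comp (continuous_projIcc.comp continuous_fst)).prodMk
      (continuous_subtype_val.comp (continuous_projIcc.comp continuous_snd))
  have hπm : ∀ r, π r ∈ (Set.univ ×ˢ Set.Icc a b : Set (ENNReal × ℝ)) := fun r =>
    ⟨trivial, (Set.projIcc a b hab r.2).2⟩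
  have hg : Continuous fun r => u (π r) := hu.comp_continuous hπc hπm
  let f : C(ℝ × ℝ, Circle) := ⟨fun r => ⟨u (π r), mem_sphere_zero_iff_norm.2 (hn _ (hπm r))⟩,
    Continuous.subtype_mk hg _⟩
  obtain ⟨e₀, he₀⟩ := Circle.exp_surjective (f 0)
  obtain ⟨F, ⟨-, hF⟩, -⟩ := Circle.isCoveringMap_exp.existsUnique_continuousMap_lifts f 0 e₀ he₀
  have hF' : ∀ r, Complex.exp (F r * Complex.I) = u (π r) := fun r => by
    have := congrArg Subtype.val (congrFun hF r)
    exact this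
  refine ⟨fun q => F (e q.1, q.2), ?_, fun q hq => ?_⟩
  · refine Continuous.continuousOn (F.continuous.comp ?_)
    exact (continuous_subtype_val.comp (e.toHomeomorph.continuous.comp continuous_fst)).prodMk
      continuous_snd
  · rw [hF']
    congr 1
    refine Prod.ext ?_ ?_
    · simp only [hπ]
      rw [Set.projIcc_of_mem h01 (e q.1).2]
      exact e.symm_apply_apply q.1
    · simp only [hπ]
      rw [Set.projIcc_of_mem hab hq.2]

end Lifting

section SpectralCounting

variable {n : ℕ}

/-- A phase that only drops at isolated crossings drops by `2π` times the number of crossings. -/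
theorem sub_eq_sum_of_crossings {f : ℝ → ℝ} {z : ℝ → ℕ} {a b : ℝ} (hab : a ≤ b)
    (h : ∀ t₀ ∈ Set.Icc a b, ∀ᶠ t in 𝓝[Set.Icc a b] t₀,
      f t = f t₀ - (if t₀ < t then 2 * Real.pi * z t₀ else 0) ∧ (t ≠ t₀ → z t = 0)) :
    ∃ Z : Finset ℝ, (∀ t, t ∈ Z ↔ t ∈ Set.Ico a b ∧ z t ≠ 0) ∧
      f b - f a = -(2 * Real.pi * ∑ t ∈ Z, z t) := by
  have hfin : ({t | t ∈ Set.Icc a b ∧ z t ≠ 0}).Finite := by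
    have := isCompact_Icc.induction_on (s := Set.Icc a b)
      (p := fun s => (s ∩ {t | t ∈ Set.Icc a b ∧ z t ≠ 0}).Finite) (by simp)
      (fun s t hst ht => ht.subset (Set.inter_subset_inter_left _ hst))
      (fun s t hs ht => by rw [Set.union_inter_distrib_right]; exact hs.union ht)
      (fun t₀ ht₀ => ⟨_, h t₀ ht₀, (Set.finite_singleton t₀).subset (by
        rintro t ⟨ht, -, hz⟩
        by_contra hne
        exact hz (ht.2 hne))⟩)
    refine this.subset fun t ht => ⟨ht.1, ht⟩
  set Y := hfin.toFinset with hY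
  have hYm : ∀ t, t ∈ Y ↔ t ∈ Set.Icc a b ∧ z t ≠ 0 := fun t => hfin.mem_toFinset
  set g : ℝ → ℝ := fun t => f t + 2 * Real.pi * ∑ s ∈ Y, if s < t then (z s : ℝ) else 0 with hg
  have hconst : g b = g a := by
    refine isPreconnected_Icc.eq_of_eventually_eq (s := Set.Icc a b) (fun t₀ ht₀ => ?_)
      (Set.right_mem_Icc.2 hab) (Set.left_mem_Icc.2 hab)
    have h1 : ∀ᶠ t in 𝓝 t₀, ∀ s ∈ Y, s ≠ t₀ → (s < t ↔ s < t₀) := by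
      refine (Filter.eventually_all_finset Y).2 fun s _ => ?_
      by_cases hs : s = t₀
      · exact Eventually.of_forall fun t hne => absurd hs hne
      rcases lt_or_gt_of_ne hs with hlt | hlt
      · filter_upwards [lt_mem_nhds hlt] with t ht _
        exact iff_of_true ht hlt
      · filter_upwards [gt_mem_nhds hlt] with t ht _
        exact iff_of_false ht.not_gt hlt.not_gt
    filter_upwards [h t₀ ht₀, mem_nhdsWithin_of_mem_nhds h1] with t ht ht1
    have h2 : (∑ s ∈ Y, if s < t then (z s : ℝ) else 0) - ∑ s ∈ Y, (if s < t₀ then (z s : ℝ) else 0) =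
        if t₀ < t then (z t₀ : ℝ) else 0 := by
      rw [← Finset.sum_sub_distrib]
      rw [Finset.sum_eq_single t₀]
      · simp
      · intro s hs hne
        simp only [ht1 s hs hne, sub_self]
      · intro hs
        have h3 : z t₀ = 0 := by
          by_contra h0
          exact hs ((hYm t₀).2 ⟨ht₀, h0⟩)
        simp [h3]
    simp only [hg]
    rw [ht.1]
    have h3 := congrArg (fun r => 2 * Real.pi * r) h2
    simp only [mul_sub, mul_ite, mul_zero] at h3
    linarith
  refine ⟨Y.filter (· < b), fun t => ?_, ?_⟩
  · rw [Finset.mem_filter, hYm]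
    constructor
    · rintro ⟨⟨h1, h2⟩, h3⟩
      exact ⟨⟨h1.1, h3⟩, h2⟩
    · rintro ⟨h1, h2⟩
      exact ⟨⟨⟨h1.1, h1.2.le⟩, h2⟩, h1.2⟩
  · have ha : (∑ s ∈ Y, if s < a then (z s : ℝ) else 0) = 0 := by
      refine Finset.sum_eq_zero fun s hs => if_neg ?_
      exact not_lt.2 ((hYm s).1 hs).1.1
    simp only [hg, ha] at hconst
    rw [← Finset.sum_filter] at hconst
    push_cast
    linarith

/-- The Maslov indices on two sides of the rectangle `[0, ∞] × [a, b]` count the crossings on a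
third side. -/
theorem maslovIndex_add_maslovIndex {a b : ℝ} (hab : a ≤ b)
    {C : Submodule ℂ (Fin n ⊕ Fin n → ℂ)} {L : ENNReal → Submodule ℂ (Fin n ⊕ Fin n → ℂ)}
    {D : ENNReal → ℝ → Submodule ℂ (Fin n ⊕ Fin n → ℂ)} (hL : IsLagrangianPath L Set.univ)
    (hL0 : L 0 = C)
    (hD : IsLagrangianPath (fun q : ENNReal × ℝ => D q.1 q.2) (Set.univ ×ˢ Set.Icc a b)) {d : ℕ}
    (hA : ∀ p, p ≠ ⊤ → Module.finrank ℂ (L p ⊓ D p b : Submodule ℂ _) = d)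
    (hA' : Module.finrank ℂ (L ⊤ ⊓ D ⊤ b : Submodule ℂ _) ≤ d)
    (hB : ∀ p, C ⊓ D p a = ⊥)
    (hcr : ∀ t₀ ∈ Set.Icc a b, ∃ ε > 0, ∀ᶠ t in 𝓝[Set.Icc a b \ {t₀}] t₀, ∀ θ : ℝ, |θ| ≤ ε →
      0 ≤ θ * (t - t₀) → circlePoint θ ∉ spectrum ℂ (souriauMatrix C (D 0 t))) :
    ∃ Z : Finset ℝ, (∀ t, t ∈ Z ↔ t ∈ Set.Ico a b ∧
        Module.finrank ℂ (C ⊓ D 0 t : Submodule ℂ _) ≠ 0) ∧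
      maslovIndex L (fun _ => D ⊤ b) 0 ⊤ + maslovIndex (fun _ : ℝ => C) (fun t => D ⊤ t) a b =
        -∑ t ∈ Z, (Module.finrank ℂ (C ⊓ D 0 t : Submodule ℂ _) : ℤ) := by
  have ha : a ∈ Set.Icc a b := Set.left_mem_Icc.2 hab
  have hb : b ∈ Set.Icc a b := Set.right_mem_Icc.2 hab
  have hI : Set.Icc (0 : ENNReal) ⊤ = Set.univ := Set.eq_univ_of_forall fun p => ⟨zero_le, le_top⟩
  have h0T : (0 : ENNReal) ≤ ⊤ := zero_le
  have hCL : IsLagrangian C := hL0 ▸ hL.1 0 trivial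
  have hDL : ∀ p, ∀ t ∈ Set.Icc a b, IsLagrangian (D p t) := fun p t ht => hD.1 (p, t) ⟨trivial, ht⟩
  -- paths on the sides
  have hDp : ∀ t ∈ Set.Icc a b, IsLagrangianPath (fun p => D p t) (Set.Icc (0 : ENNReal) ⊤) :=
    fun t ht => ⟨fun p _ => hDL p t ht, hD.2.comp (f := fun p : ENNReal => (p, t))
      (by fun_prop) fun p _ => ⟨trivial, ht⟩⟩
  have hDt : ∀ p, IsLagrangianPath (fun t => D p t) (Set.Icc a b) :=
    fun p => ⟨fun t ht => hDL p t ht, hD.2.comp (f := fun t : ℝ => (p, t))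
      (by fun_prop) fun t ht => ⟨trivial, ht⟩⟩
  have hLp : IsLagrangianPath L (Set.Icc (0 : ENNReal) ⊤) := hI ▸ hL
  have hconst : ∀ {ι : Type} [TopologicalSpace ι] (s : Set ι) {M : Submodule ℂ (Fin n ⊕ Fin n → ℂ)},
      IsLagrangian M → IsLagrangianPath (fun _ : ι => M) s := fun s _ hM =>
    ⟨fun _ _ => hM, continuousOn_const⟩
  -- lifts
  have hnorm : ∀ {M : Submodule ℂ (Fin n ⊕ Fin n → ℂ)}, IsLagrangian M → ‖(lagUnitary M).det‖ = 1 := by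
    intro M hM
    have h1 := congrArg Matrix.det (lagUnitary_unitary hM)
    rw [Matrix.det_mul, Matrix.det_conjTranspose, Matrix.det_one, RCLike.star_def,
      Complex.conj_mul'] at h1
    have h2 : ‖(lagUnitary M).det‖ ^ 2 = 1 := by exact_mod_cast h1
    exact (pow_eq_one_iff_of_nonneg (norm_nonneg _) two_ne_zero).1 h2
  have hdet : ∀ {ι : Type} [TopologicalSpace ι] {s : Set ι}
      {M : ι → Submodule ℂ (Fin n ⊕ Fin n → ℂ)},
      IsLagrangianPath M s → ContinuousOn (fun t => (lagUnitary (M t)).det) s := fun h =>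
    (Continuous.matrix_det continuous_id).comp_continuousOn (continuousWithinAt_lagUnitary h)
  obtain ⟨α₁', hα₁c, hα₁⟩ := exists_continuousOn_arg hab
    (u := fun q => (lagUnitary (L q.1)).det)
    ((hdet hL).comp continuousOn_fst fun q _ => trivial) (fun q _ => hnorm (hL.1 _ trivial))
  obtain ⟨α₂, hα₂c, hα₂⟩ := exists_continuousOn_arg hab
    (u := fun q => (lagUnitary (D q.1 q.2)).det) (hdet hD) (fun q hq => hnorm (hD.1 q hq))
  set α₁ : ENNReal → ℝ := fun p => α₁' (p, a) with hα₁def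
  have hα₁cont : ContinuousOn α₁ (Set.Icc (0 : ENNReal) ⊤) :=
    hα₁c.comp (f := fun p : ENNReal => (p, a)) (by fun_prop) fun p _ => ⟨trivial, ha⟩
  have hα₁e : ∀ p, Complex.exp (α₁ p * Complex.I) = (lagUnitary (L p)).det := fun p =>
    hα₁ (p, a) ⟨trivial, ha⟩
  have hα₂p : ∀ t ∈ Set.Icc a b, ContinuousOn (fun p => α₂ (p, t)) (Set.Icc (0 : ENNReal) ⊤) :=
    fun t ht => hα₂c.comp (f := fun p : ENNReal => (p, t)) (by fun_prop) fun p _ => ⟨trivial, ht⟩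
  have hα₂t : ∀ p, ContinuousOn (fun t => α₂ (p, t)) (Set.Icc a b) :=
    fun p => hα₂c.comp (f := fun t : ℝ => (p, t)) (by fun_prop) fun t ht => ⟨trivial, ht⟩
  have hα : ∀ p p', ∀ t ∈ Set.Icc a b, Complex.exp ((α₁ p - α₂ (p', t) : ℝ) * Complex.I) =
      (-souriauMatrix (L p) (D p' t)).det := by
    intro p p' t ht
    rw [det_neg_souriauMatrix (hDL p' t ht), ← hα₁e, ← hα₂ (p', t) ⟨trivial, ht⟩, RCLike.star_def,
      ← Complex.exp_conj, ← Complex.exp_add]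
    congr 1
    simp only [map_mul, Complex.conj_ofReal, Complex.conj_I]
    push_cast
    ring
  have hU : ∀ p p', ∀ t ∈ Set.Icc a b, (souriauMatrix (L p) (D p' t)).conjTranspose *
      souriauMatrix (L p) (D p' t) = 1 := fun p p' t ht =>
    souriauMatrix_unitary (hL.1 p trivial) (hDL p' t ht)
  -- the four sides
  have e1 := two_pi_mul_maslovIndex (L₁ := L) (L₂ := fun _ => D ⊤ b) h0T
    (continuousOn_souriauMatrix hLp (hconst _ (hDL ⊤ b hb))) (fun p _ => hU p ⊤ b hb)
    (α := fun p => α₁ p - α₂ (⊤, b)) (hα₁cont.sub continuousOn_const) (fun p _ => hα p ⊤ b hb)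
  have e2 := two_pi_mul_maslovIndex (L₁ := fun _ : ℝ => C) (L₂ := fun t => D ⊤ t) hab
    (continuousOn_souriauMatrix (hconst _ hCL) (hDt ⊤)) (fun t ht => hL0 ▸ hU 0 ⊤ t ht)
    (α := fun t => α₁ 0 - α₂ (⊤, t)) (continuousOn_const.sub (hα₂t ⊤))
    (fun t ht => hL0 ▸ hα 0 ⊤ t ht)
  have hzc : ∀ p p', ∀ t ∈ Set.Icc a b, zeroCount (souriauMatrix (L p) (D p' t)) =
      Module.finrank ℂ (L p ⊓ D p' t : Submodule ℂ _) := fun p p' t ht =>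
    zeroCount_souriauMatrix (hL.1 p trivial) (hDL p' t ht)
  have e3 := lift_sub_angleSum_eq_of_zeroCount (W := fun p => souriauMatrix (L p) (D p b))
    (s := Set.Icc (0 : ENNReal) ⊤) isPreconnected_Icc
    (continuousOn_souriauMatrix hLp (hDp b hb)) (fun p _ => hU p p b hb)
    (α := fun p => α₁ p - α₂ (p, b)) (hα₁cont.sub (hα₂p b hb)) (fun p _ => hα p p b hb)
    (fun p _ => by
      simp only [hzc _ _ b hb]
      by_cases hp : p = ⊤
      · refine Eventually.of_forall fun u => ?_
        by_cases hu : u = ⊤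
        · rw [hp, hu]
        · rw [hA u hu, hp]
          exact hA'
      · filter_upwards [mem_nhdsWithin_of_mem_nhds (isOpen_ne.mem_nhds hp)] with u hu
        rw [hA u hu, hA p hp])
    (Set.left_mem_Icc.2 h0T) (Set.right_mem_Icc.2 h0T)
  have e4 := lift_sub_angleSum_eq_of_zeroCount (W := fun p => souriauMatrix C (D p a))
    (s := Set.Icc (0 : ENNReal) ⊤) isPreconnected_Icc
    (continuousOn_souriauMatrix (hconst _ hCL) (hDp a ha)) (fun p _ => hL0 ▸ hU 0 p a ha)
    (α := fun p => α₁ 0 - α₂ (p, a)) (continuousOn_const.sub (hα₂p a ha))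
    (fun p _ => hL0 ▸ hα 0 p a ha)
    (fun p _ => by
      refine Eventually.of_forall fun u => ?_
      rw [zeroCount_souriauMatrix hCL (hDL p a ha), hB p, finrank_bot]
      exact Nat.zero_le _)
    (Set.left_mem_Icc.2 h0T) (Set.right_mem_Icc.2 h0T)
  obtain ⟨Z, hZ, e5⟩ := sub_eq_sum_of_crossings hab
    (f := fun t => (α₁ 0 - α₂ (0, t)) - angleSum (souriauMatrix C (D 0 t)))
    (z := fun t => zeroCount (souriauMatrix C (D 0 t))) (fun t₀ ht₀ =>
      lift_sub_angleSum_crossing (W := fun t => souriauMatrix C (D 0 t)) ht₀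
        (continuousOn_souriauMatrix (hconst _ hCL) (hDt 0) t₀ ht₀) (fun t ht => hL0 ▸ hU 0 0 t ht)
        (α := fun t => α₁ 0 - α₂ (0, t)) ((continuousOn_const.sub (hα₂t 0)) t₀ ht₀)
        (fun t ht => hL0 ▸ hα 0 0 t ht) (hcr t₀ ht₀))
  have hz0 : ∀ t ∈ Set.Icc a b, zeroCount (souriauMatrix C (D 0 t)) =
      Module.finrank ℂ (C ⊓ D 0 t : Submodule ℂ _) := fun t ht =>
    zeroCount_souriauMatrix hCL (hDL 0 t ht)
  refine ⟨Z, fun t => ?_, ?_⟩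
  · rw [hZ]
    exact and_congr_right fun ht => by rw [hz0 t ⟨ht.1, ht.2.le⟩]
  · have hsum : ∑ t ∈ Z, zeroCount (souriauMatrix C (D 0 t)) =
        ∑ t ∈ Z, Module.finrank ℂ (C ⊓ D 0 t : Submodule ℂ _) :=
      Finset.sum_congr rfl fun t ht => hz0 t ⟨((hZ t).1 ht).1.1, ((hZ t).1 ht).1.2.le⟩
    have hsum' := congrArg (Nat.cast : ℕ → ℝ) hsum
    push_cast at hsum' e5
    rw [hsum'] at e5
    simp only [hL0] at e1 e2 e3 e4 e5
    have e6 : 2 * Real.pi * ((maslovIndex L (fun _ => D ⊤ b) 0 ⊤ : ℝ) +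
        maslovIndex (fun _ : ℝ => C) (fun t => D ⊤ t) a b) =
        2 * Real.pi * -∑ t ∈ Z, (Module.finrank ℂ (C ⊓ D 0 t : Submodule ℂ _) : ℝ) := by
      rw [mul_add, e1, e2]
      linarith
    have e7 := mul_left_cancel₀ (by positivity : (2 * Real.pi : ℝ) ≠ 0) e6
    exact_mod_cast e7

end SpectralCounting

section NoIntersection

variable {n : ℕ} {T : HSys n} {Rp Vp Qp : Matrix (Fin n) (Fin n) ℂ} {K θ η : ℝ}
  {C : Submodule ℂ (Fin n ⊕ Fin n → ℂ)}

/-- On an isotropic subspace `Re (φ, ψ)` is bounded below by a multiple of `|φ|²`. -/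
theorem exists_lyap_nonneg
    (hC : ∀ u ∈ C, ∀ v ∈ C, star v ⬝ᵥ Matrix.mulVec (Matrix.J (Fin n) ℂ) u = 0) :
    ∃ k : ℝ, 0 ≤ k ∧ ∀ v ∈ C, 0 ≤ lyap k v := by
  set P : (Fin n ⊕ Fin n → ℂ) →ₗ[ℂ] (Fin n → ℂ) := LinearMap.funLeft ℂ ℂ Sum.inl with hP
  set R : (Fin n ⊕ Fin n → ℂ) →ₗ[ℂ] (Fin n → ℂ) := LinearMap.funLeft ℂ ℂ Sum.inr with hR
  obtain ⟨σ, hσ⟩ := ((P.domRestrict C).rangeRestrict).exists_rightInverse_of_surjective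
    (LinearMap.range_rangeRestrict _)
  have hPσ : ∀ r, P (σ r : Fin n ⊕ Fin n → ℂ) = r := fun r => by
    have := congrArg Subtype.val (LinearMap.congr_fun hσ r)
    simpa using this
  set F := LinearMap.toContinuousLinearMap (R ∘ₗ C.subtype ∘ₗ σ) with hF
  refine ⟨n * ‖F‖, by positivity, fun v hv => ?_⟩
  set r : LinearMap.range (P.domRestrict C) := ⟨P v, ⟨⟨v, hv⟩, rfl⟩⟩ with hr
  have h1 := hC _ (sub_mem hv (σ r).2) v hv
  have hl : ∀ i, (v - (σ r : Fin n ⊕ Fin n → ℂ)) (Sum.inl i) = 0 := fun i => by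
    have := congrFun (hPσ r) i
    simp only [hP, LinearMap.funLeft_apply, hr] at this
    rw [Pi.sub_apply, this, sub_self]
  have hFr : ∀ i, F r i = (σ r : Fin n ⊕ Fin n → ℂ) (Sum.inr i) := fun i => rfl
  rw [star_dotProduct_J_mulVec] at h1
  simp only [hl, mul_zero, zero_sub, Finset.sum_neg_distrib, neg_eq_zero, Pi.sub_apply, mul_sub,
    Finset.sum_sub_distrib, sub_eq_zero] at h1
  have h2 : star (v ∘ Sum.inl) ⬝ᵥ (v ∘ Sum.inr) = ∑ i, star (v (Sum.inl i)) * F r i := h1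
  have h3 : ‖star (v ∘ Sum.inl) ⬝ᵥ (v ∘ Sum.inr)‖ ≤ n * ‖F‖ * nsq (v ∘ Sum.inl) := by
    rw [h2]
    calc _ ≤ ∑ i : Fin n, ‖star (v (Sum.inl i)) * F r i‖ := norm_sum_le _ _
      _ ≤ ∑ _i : Fin n, ‖v ∘ Sum.inl‖ * (‖F‖ * ‖v ∘ Sum.inl‖) := Finset.sum_le_sum fun i _ => by
        rw [norm_mul, norm_star]
        exact mul_le_mul (norm_le_pi_norm (v ∘ Sum.inl) i)
          ((norm_le_pi_norm (F r) i).trans (F.le_opNorm r)) (norm_nonneg _) (norm_nonneg _)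
      _ = n * ‖F‖ * ‖v ∘ Sum.inl‖ ^ 2 := by
        rw [Finset.sum_const, Finset.card_univ, Fintype.card_fin, nsmul_eq_mul]; ring
      _ ≤ _ := mul_le_mul_of_nonneg_left (norm_sq_le_nsq _) (by positivity)
  rw [lyap_eq]
  linarith [neg_abs_le (star (v ∘ Sum.inl) ⬝ᵥ (v ∘ Sum.inr)).re,
    Complex.abs_re_le_norm (star (v ∘ Sum.inl) ⬝ᵥ (v ∘ Sum.inr))]

/-- For very negative spectral parameters, decaying solutions never meet a given isotropic
subspace. -/
theorem HSys.Bounds.exists_inf_decayFamily_eq_bot (hT : T.Bounds Rp Vp Qp K θ η)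
    (hC : ∀ u ∈ C, ∀ v ∈ C, star v ⬝ᵥ Matrix.mulVec (Matrix.J (Fin n) ℂ) u = 0) :
    ∃ Λ : ℝ, ∀ lam ≤ -Λ, ∀ p, C ⊓ T.decayFamily Rp Vp Qp p lam = ⊥ := by
  obtain ⟨k, hk, hkC⟩ := exists_lyap_nonneg hC
  have hθ := hT.θ_pos
  refine ⟨(2 * (k * (n * n * K)) ^ 2 / θ + θ / 2 + n * n * K) / θ, fun lam hlam p => ?_⟩
  have h1 : 2 * (k * (n * n * K)) ^ 2 / θ + θ / 2 + n * n * K ≤ -lam * θ := by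
    rw [← div_le_iff₀ hθ]; linarith
  have h2 := (hT.shift p).coercive_of_le hk h1
  refine (Submodule.eq_bot_iff _).2 fun w hw => ?_
  by_contra hw0
  have h3 := (hT.shift p).lyap_neg (half_pos hθ) h2 le_rfl le_rfl hw.2 hw0
  rw [((hT.shift p).Φ_spec lam).2.1] at h3
  exact absurd (hkC w hw.1) (not_le.2 h3)

end NoIntersection

section Paths

variable {n : ℕ} {S : SturmLiouville n} {Rp Vp Qp : Matrix (Fin n) (Fin n) ℂ} {K θ η c lam : ℝ}

theorem SturmLiouville.isLagrangianLimit_ell₁ (hA : S.SelfAdjointBoundary)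
    (hT : S.toHSys.Bounds Rp Vp Qp K θ η) (hc : 0 < c) (hg : GapBound Vp Qp c lam) :
    IsLagrangianLimit (fun x => S.ell₁ x lam) (limitSpace (S.toHSys.Φ lam)
      (LinearMap.range (Matrix.J (Fin n) ℂ * S.α.conjTranspose).mulVecLin)) := by
  have h := (hT.exists_isLagrangianLimit hc hg hA.isLagrangian).1
  refine ⟨h.1, h.2.congr' ((eventually_ge_atTop 0).mono fun x hx => ?_)⟩
  simp only
  rw [S.ell₁_eq hT hx]

theorem SturmLiouville.isLagrangianPath_ell₁ (hA : S.SelfAdjointBoundary)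
    (hT : S.toHSys.Bounds Rp Vp Qp K θ η) (hc : 0 < c) (hg : GapBound Vp Qp c lam) :
    IsLagrangianPath (compactifiedPath (fun x => S.ell₁ x lam)) Set.univ := by
  have hlim := SturmLiouville.isLagrangianLimit_ell₁ hA hT hc hg
  have htop : compactifiedPath (fun x => S.ell₁ x lam) ⊤ = _ := (if_pos rfl).trans hlim.eq
  have hfin : ∀ {p : ENNReal}, p ≠ ⊤ → compactifiedPath (fun x => S.ell₁ x lam) p =
      S.ell₁ p.toReal lam := fun hp => if_neg hp
  refine ⟨fun p _ => ?_, continuousOn_univ.2 (continuous_iff_continuousAt.2 fun p => ?_)⟩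
  · rcases eq_or_ne p ⊤ with rfl | hp
    · rw [htop]
      exact hlim.1
    · rw [hfin hp, S.ell₁_eq hT ENNReal.toReal_nonneg]
      exact hT.isLagrangian_map lam hA.isLagrangian ENNReal.toReal_nonneg
  · rcases eq_or_ne p ⊤ with rfl | hp
    · rw [continuousAt_iff_punctured_nhds, htop]
      have h1 : Tendsto ENNReal.toReal (𝓝[≠] ⊤) atTop := by
        refine tendsto_atTop.2 fun b => ?_
        filter_upwards [self_mem_nhdsWithin,
          mem_nhdsWithin_of_mem_nhds (Ioi_mem_nhds (ENNReal.ofReal_lt_top (r := b)))] with q hq hb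
        exact (ENNReal.ofReal_le_iff_le_toReal hq).1 (le_of_lt hb)
      refine (hlim.2.comp h1).congr' ?_
      filter_upwards [self_mem_nhdsWithin] with q hq
      rw [hfin hq, Function.comp_apply]
    · have h1 := tendsto_projMatrix_map hA.isLagrangian.1
        (((hT.Φ_spec lam).1.tendsto _).comp (ENNReal.tendsto_toReal hp))
        (hT.isUnit_Φ lam (ENNReal.toReal_nonneg (a := p)))
      rw [ContinuousAt, hfin hp, S.ell₁_eq hT ENNReal.toReal_nonneg]
      refine h1.congr' ((isOpen_ne.eventually_mem hp).mono fun q hq => ?_)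
      exact congrArg projMatrix ((hfin hq).trans (S.ell₁_eq hT ENNReal.toReal_nonneg lam)).symm

theorem SturmLiouville.isLagrangianPath_ell₂plus (hT : S.toHSys.Bounds Rp Vp Qp K θ η) :
    IsLagrangianPath S.ell₂plus (Set.Iio (kappa Vp Qp)) := by
  have hpos : ∀ {lam}, lam < kappa Vp Qp → 0 < (kappa Vp Qp - lam) * θ := fun h =>
    mul_pos (sub_pos.2 h) hT.θ_pos
  have heq : ∀ lam < kappa Vp Qp, S.ell₂plus lam = S.toHSys.decayFamily Rp Vp Qp ⊤ lam :=
    fun lam h => S.ell₂plus_eq hT (hpos h) (hT.gapBound h.le)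
  refine ⟨fun lam h => ?_, fun lam h => ?_⟩
  · rw [heq lam h]
    exact hT.isLagrangian_decayFamily (hpos h) (hT.gapBound (le_of_lt h)) ⊤
  · have h : lam < kappa Vp Qp := h
    have hmid : lam < (lam + kappa Vp Qp) / 2 := by linarith
    have hmid' : (lam + kappa Vp Qp) / 2 < kappa Vp Qp := by linarith
    have hg : ∀ t ≤ (lam + kappa Vp Qp) / 2,
        GapBound Vp Qp ((kappa Vp Qp - (lam + kappa Vp Qp) / 2) * θ) t := fun t ht =>
      (hT.gapBound (ht.trans hmid'.le)).mono
        (mul_le_mul_of_nonneg_right (by linarith) hT.θ_pos.le)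
    have h2 : Tendsto (fun t : ℝ => ((⊤ : ENNReal), t)) (𝓝 lam) (𝓝 (⊤, lam)) :=
      tendsto_const_nhds.prodMk_nhds tendsto_id
    have h1 := hT.tendsto_projMatrix_decayFamily (q₀ := (⊤, lam))
      (l := map (fun t : ℝ => ((⊤ : ENNReal), t)) (𝓝 lam)) h2 (hpos hmid')
      (eventually_map.2 ((eventually_le_nhds hmid).mono fun t ht => hg t ht)) (hg lam hmid.le)
    rw [tendsto_map'_iff] at h1
    refine ContinuousAt.continuousWithinAt ?_
    rw [ContinuousAt, heq lam h]
    refine h1.congr' ((eventually_lt_nhds h).mono fun t ht => ?_)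
    exact congrArg projMatrix (heq t ht).symm

theorem HSys.Bounds.isLagrangianPath_decayFamily {T : HSys n} (hT : T.Bounds Rp Vp Qp K θ η) (hc : 0 < c)
    {s : Set ℝ} (hg : ∀ t ∈ s, GapBound Vp Qp c t) :
    IsLagrangianPath (fun q : ENNReal × ℝ => T.decayFamily Rp Vp Qp q.1 q.2) (Set.univ ×ˢ s) :=
  ⟨fun q hq => hT.isLagrangian_decayFamily hc (hg _ hq.2) q.1, fun _ hq =>
    hT.tendsto_projMatrix_decayFamily inf_le_left hc
      (eventually_mem_nhdsWithin.mono fun _ hq => hg _ hq.2) (hg _ hq.2)⟩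

theorem HSys.Bounds.souriauMatrix_decaySpace_crossing {T : HSys n} (hT : T.Bounds Rp Vp Qp K θ η)
    (hc : 0 < c) {s : Set ℝ} (hg : ∀ t ∈ s, GapBound Vp Qp c t)
    {C : Submodule ℂ (Fin n ⊕ Fin n → ℂ)} (hC : IsLagrangian C) {t₀ : ℝ} (ht₀ : t₀ ∈ s) :
    ∃ ε > 0, ∀ᶠ t in 𝓝[s \ {t₀}] t₀, ∀ θ : ℝ, |θ| ≤ ε → 0 ≤ θ * (t - t₀) →
      circlePoint θ ∉ spectrum ℂ (souriauMatrix C (T.decayFamily Rp Vp Qp 0 t)) := by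
  have h0 : ∀ t, T.decayFamily Rp Vp Qp 0 t = decaySpace (T.Φ t) := fun t => by
    rw [hT.decayFamily_eq_map t ENNReal.zero_ne_top, ENNReal.toReal_zero, (hT.Φ_spec t).2.1]
    exact Submodule.map_id _
  have hpath : IsLagrangianPath (fun t => T.decayFamily Rp Vp Qp 0 t) s :=
    ⟨fun t ht => hT.isLagrangian_decayFamily hc (hg t ht) 0,
      (hT.isLagrangianPath_decayFamily hc hg).2.comp (f := fun t : ℝ => ((0 : ENNReal), t))
        (by fun_prop) fun t ht => ⟨trivial, ht⟩⟩
  refine souriauMatrix_crossing hC hpath ht₀ fun z hz hz0 t z' hk ht hz' => ?_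
  rw [h0] at hz
  exact hT.tendsto_crossing hc (hg t₀ ht₀) hz hz0 (fun k => (hk k).2.1)
    (Eventually.of_forall fun k => hg _ (hk k).1) (fun k => h0 (t k) ▸ (hk k).2.2) ht hz'

theorem iSup_sum_eq_sum {b : ℝ} {f : Set.Iio b → ℕ∞} {g : ℝ → ℕ} {Z : Finset ℝ}
    (hf : ∀ t, f t = g t) (hZ : ∀ t, t ∈ Z → t < b) (hg : ∀ t < b, g t ≠ 0 → t ∈ Z) :
    ⨆ F : Finset (Set.Iio b), ∑ t ∈ F, f t = ((∑ t ∈ Z, g t : ℕ) : ℕ∞) := by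
  classical
  simp only [hf, ← Nat.cast_sum]
  refine le_antisymm (iSup_le fun F => ?_) (le_iSup_of_le (Z.subtype (· ∈ Set.Iio b)) ?_)
  · refine Nat.cast_le.2 ?_
    refine (Finset.sum_map F (Function.Embedding.subtype (· ∈ Set.Iio b)) g).symm.trans_le ?_
    refine Finset.sum_le_sum_of_ne_zero fun t ht h => ?_
    obtain ⟨u, -, rfl⟩ := Finset.mem_map.1 ht
    exact hg _ u.2 h
  · exact Nat.cast_le.2 (Finset.sum_subtype_of_mem g (p := (· ∈ Set.Iio b)) hZ).ge

end Paths

theorem theorem1p3 {n : ℕ} (S : SturmLiouville n) (Pp Vp Qp : Matrix (Fin n) (Fin n) ℂ)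
    (hA1 : S.RegularCoefficients) (hA2 : S.HasEndstates Pp Vp Qp) (hA3 : S.SelfAdjointBoundary)
    (lam0 : ℝ) (hlam0 : lam0 < kappa Vp Qp) :
    -- the two Lagrangian paths are well defined and continuous, so the indices below make sense
    IsLagrangianPath (compactifiedPath (fun x => S.ell₁ x lam0)) Set.univ ∧
    IsLagrangianPath S.ell₂plus (Set.Iio (kappa Vp Qp)) ∧
    ∃ LamInf : ℝ, ∀ lamInf > LamInf, S.BoundaryInconjugate lamInf →
      ∃ m : ℕ, S.morseIndex lam0 = (m : ℕ∞) ∧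
        (m : ℤ) =
          - maslovIndexHalfLine (fun x => S.ell₁ x lam0) (fun _ => S.ell₂plus lam0)
          - maslovIndex (fun lam => S.ell₁ 0 lam) (fun lam => S.ell₂plus lam) (-lamInf) lam0 := by
  obtain ⟨K, θ, η, hT⟩ := SturmLiouville.exists_bounds hA1 hA2
  have hC := hA3.isLagrangian
  set C := LinearMap.range (Matrix.J (Fin n) ℂ * S.α.conjTranspose).mulVecLin with hCdef
  set T := S.toHSys with hTdef
  set c := (kappa Vp Qp - lam0) * θ with hcdef
  have hc : 0 < c := mul_pos (sub_pos.2 hlam0) hT.θ_pos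
  have hg : ∀ t ≤ lam0, GapBound Vp Qp c t := fun t ht => (hT.gapBound (ht.trans hlam0.le)).mono
    (mul_le_mul_of_nonneg_right (by linarith) hT.θ_pos.le)
  have hpath := SturmLiouville.isLagrangianPath_ell₁ hA3 hT hc (hg lam0 le_rfl)
  refine ⟨hpath, SturmLiouville.isLagrangianPath_ell₂plus hT, ?_⟩
  obtain ⟨Λ, hΛ⟩ := hT.exists_inf_decayFamily_eq_bot hC.2
  refine ⟨max Λ (-lam0), fun lamInf hlamInf _ => ?_⟩
  have hab : -lamInf ≤ lam0 := by linarith [(le_max_right Λ (-lam0)).trans_lt hlamInf]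
  have hbot : ∀ t ≤ -lamInf, ∀ p, C ⊓ T.decayFamily Pp⁻¹ Vp Qp p t = ⊥ := fun t ht =>
    hΛ t (by linarith [(le_max_left Λ (-lam0)).trans_lt hlamInf])
  have hΦ0 : ∀ t, T.Φ t 0 = 1 := fun t => (hT.Φ_spec t).2.1
  have hD0 : ∀ t, T.decayFamily Pp⁻¹ Vp Qp 0 t = decaySpace (T.Φ t) := fun t => by
    rw [hT.decayFamily_eq_map t ENNReal.zero_ne_top, ENNReal.toReal_zero, hΦ0]
    exact Submodule.map_id _
  have hell₁ : ∀ t, S.ell₁ 0 t = C := fun t => S.ell₁_zero hT t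
  have hell₂ : ∀ t ≤ lam0, S.ell₂plus t = T.decayFamily Pp⁻¹ Vp Qp ⊤ t := fun t ht =>
    S.ell₂plus_eq hT hc (hg t ht)
  set L := compactifiedPath (fun x => S.ell₁ x lam0) with hL
  have hLfin : ∀ {p : ENNReal}, p ≠ ⊤ → L p =
      C.map (T.Φ lam0 p.toReal : (Fin n ⊕ Fin n → ℂ) →ₗ[ℂ] (Fin n ⊕ Fin n → ℂ)) := fun hp =>
    (if_neg hp).trans (S.ell₁_eq hT ENNReal.toReal_nonneg lam0)
  have hLtop : L ⊤ = limitSpace (T.Φ lam0) C :=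
    (if_pos rfl).trans (SturmLiouville.isLagrangianLimit_ell₁ hA3 hT hc (hg lam0 le_rfl)).eq
  -- the decaying solutions, with the literal limit at infinity
  set D : ENNReal → ℝ → Submodule ℂ (Fin n ⊕ Fin n → ℂ) :=
    Function.update (fun p t => T.decayFamily Pp⁻¹ Vp Qp p t) ⊤ S.ell₂plus with hD
  have hDtop : D ⊤ = S.ell₂plus := Function.update_self ..
  have hDeq : ∀ p, ∀ t ≤ lam0, D p t = T.decayFamily Pp⁻¹ Vp Qp p t := fun p t ht => by
    rcases eq_or_ne p ⊤ with rfl | hp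
    · rw [hDtop, hell₂ t ht]
    · rw [hD, Function.update_of_ne hp]
  have hDpath := hT.isLagrangianPath_decayFamily hc (s := Set.Icc (-lamInf) lam0)
    fun t ht => hg t ht.2
  obtain ⟨Z, hZ, hmas⟩ := maslovIndex_add_maslovIndex (C := C) (L := L) (D := D)
    (d := Module.finrank ℂ (C ⊓ decaySpace (T.Φ lam0) : Submodule ℂ _)) hab hpath
    ((hLfin ENNReal.zero_ne_top).trans (by
      rw [ENNReal.toReal_zero, hΦ0]; exact Submodule.map_id _))
    ⟨fun q hq => by simpa only [hDeq q.1 q.2 hq.2.2] using hDpath.1 q hq,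
      hDpath.2.congr fun q hq => congrArg projMatrix (hDeq q.1 q.2 hq.2.2)⟩
    (fun p hp => by
      rw [hLfin hp, hDeq p lam0 le_rfl, hT.decayFamily_eq_map lam0 hp,
        ← Submodule.map_inf _ (hT.Φ_injective lam0 ENNReal.toReal_nonneg)]
      exact (Submodule.equivMapOfInjective _ (hT.Φ_injective lam0 ENNReal.toReal_nonneg) _).finrank_eq.symm)
    (by
      rw [hLtop, hDeq ⊤ lam0 le_rfl]
      exact (hT.exists_isLagrangianLimit hc (hg lam0 le_rfl) hC).2)
    (fun p => by rw [hDeq p _ hab]; exact hbot _ le_rfl p)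
    (fun t₀ ht₀ => by
      obtain ⟨ε, hε, h⟩ := hT.souriauMatrix_decaySpace_crossing hc
        (s := Set.Icc (-lamInf) lam0) (fun t ht => hg t ht.2) hC ht₀
      refine ⟨ε, hε, ?_⟩
      filter_upwards [h, self_mem_nhdsWithin] with t h ht
      rwa [hDeq 0 t ht.1.2])
  have hZ' : ∀ t, t ∈ Z ↔ t ∈ Set.Ico (-lamInf) lam0 ∧
      Module.finrank ℂ (C ⊓ decaySpace (T.Φ t) : Submodule ℂ _) ≠ 0 := fun t => by
    rw [hZ]
    refine and_congr_right fun ht => ?_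
    rw [hDeq 0 t ht.2.le, hD0]
  have hsum : ∑ t ∈ Z, (Module.finrank ℂ (C ⊓ D 0 t : Submodule ℂ _) : ℤ) =
      ((∑ t ∈ Z, Module.finrank ℂ (C ⊓ decaySpace (T.Φ t) : Submodule ℂ _) : ℕ) : ℤ) := by
    rw [Nat.cast_sum]
    refine Finset.sum_congr rfl fun t ht => ?_
    rw [hDeq 0 t ((hZ t).1 ht).1.2.le, hD0]
  refine ⟨∑ t ∈ Z, Module.finrank ℂ (C ⊓ decaySpace (T.Φ t) : Submodule ℂ _), ?_, ?_⟩
  · refine iSup_sum_eq_sum (fun t => ?_) (fun t ht => ((hZ' t).1 ht).1.2) fun t ht h => ?_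
    · rw [S.rank_eigenspace hA1 hA3 hT hc (hg t.1 (le_of_lt t.2))]
      exact Cardinal.toENat_nat _
    · refine (hZ' t).2 ⟨⟨?_, ht⟩, h⟩
      by_contra hlt
      refine h ?_
      rw [← hD0, hbot t (not_le.1 hlt).le 0]
      exact finrank_bot ℂ _
  · rw [hsum, hDtop] at hmas
    rw [maslovIndexHalfLine, (show IsLagrangian (S.ell₂plus lam0) by
      rw [hell₂ lam0 le_rfl]
      exact hT.isLagrangian_decayFamily hc (hg lam0 le_rfl) ⊤).compactifiedPath_const]
    simp only [hell₁]
    linarith
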